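/- We work with oriented piecewise linear links in $\mathbb R^3$ with $n$ components, up to (piecewise linear ambient) isotopy, and with rigid-vertex embeddings in $\mathbb R^3$ of 4-valent graphs: families of $n$ closed oriented polygons that are disjoint and free of self-intersections, except that at finitely many points, the \emph{nodes}, two straight pieces of strand cross each other. Let $|G|$ denote the number of nodes of $G$. If $K_*$ is such a graph with a chosen node, $K_+$ and $K_-$ denote the graphs obtained from $K_*$ by replacing the node by a positive, respectively negative, crossing (pushing one of the two strands off the other). Let $R$ be a commutative ring. A \emph{Vassiliev invariant} $v$ with values in $R$ is an isotopy invariant of oriented links with $n$ components, extended to embedded 4-valent graphs by the exchange identity $$v(K_*) = v(K_+) - v(K_-).$$ It is \emph{of finite type $k$} if $v(G)=0$ whenever $|G|>k$. The abstract graph underlying an embedded 4-valent graph $G$ is its chord diagram: $n$ oriented circles with pairs of points, any two paired points being those welded to a node, considered up to orientation-preserving homeomorphisms of the circles, permutation of the circles, and renaming of the nodes. \textbf{Lemma.} Let $v_k$ be a Vassiliev invariant of finite type $k$. If an abstract graph $\Gamma$ has exactly $k$ nodes, then $v_k(G)$ does not depend on the embedding $G$ of $\Gamma$: if $G$ and $G'$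 are rigid-vertex embeddings of $\Gamma$ in $\mathbb R^3$, then $v_k(G)=v_k(G')$. -/

import Mathlib

/-- A vertex of a closed polygon in `ℝ³`. It is an ordinary vertex (label `none`) or a passage
through the node named `a` (label `some a`). -/
abbrev MarkedPoint : Type := (Fin 3 → ℝ) × Option ℕ

/-- The directed edges of the closed polygon with the given cyclic list of vertices. -/
def polygonEdges (l : List MarkedPoint) : List (MarkedPoint × MarkedPoint) :=
  l.zip (l.rotate 1)

/-- The edge from `e.1` to `e.2` with its initial point and without its end point. -/
def halfOpenEdge (e : MarkedPoint × MarkedPoint) : Set (Fin 3 → ℝ) :=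
  (fun t : ℝ => AffineMap.lineMap e.1.1 e.2.1 t) '' Set.Ico (0 : ℝ) 1

/-- `p`, `c`, `q` are three cyclically consecutive vertices of the closed polygon `l`. -/
def IsConsecutive (l : List MarkedPoint) (p c q : MarkedPoint) : Prop :=
  ∃ t : List MarkedPoint, l ~r (p :: c :: q :: t)

/-- Turn the passages through the node named `a` into ordinary vertices. -/
def unmark (a : ℕ) (x : MarkedPoint) : MarkedPoint :=
  if x.2 = some a then (x.1, none) else x

/-- All directed edges of a family of `n` closed polygons. -/
def allEdges {n : ℕ} (comp : Fin n → List MarkedPoint) : List (MarkedPoint × MarkedPoint) :=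
  (List.finRange n).flatMap fun i => polygonEdges (comp i)

/-- The names of all node passages of a family of `n` closed polygons, with multiplicity. -/
def allLabels {n : ℕ} (comp : Fin n → List MarkedPoint) : List ℕ :=
  (List.finRange n).flatMap fun i => (comp i).filterMap Prod.snd

/-- A (piecewise linear) rigid-vertex embedding in `ℝ³` of an oriented 4-valent graph made of `n`
closed strands: `n` closed oriented polygons that are disjoint and without self-intersections,
except that at each node two straight pieces of strand cross each other. -/
@[ext]
structure EmbeddedGraph (n : ℕ) where
  /-- The cyclic list of vertices of each closed strand. -/
  comp : Fin n → List MarkedPoint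
  comp_ne_nil : ∀ i, comp i ≠ []
  edge_nondegenerate : ∀ e ∈ allEdges comp, e.1.1 ≠ e.2.1
  /-- Two different edges have no point in common (the end point of an edge being counted with the
  next edge), except that the two edges leaving a node have that node in common. -/
  edges_disjoint : (allEdges comp).Pairwise fun e f =>
    ∀ x ∈ halfOpenEdge e ∩ halfOpenEdge f,
      x = e.1.1 ∧ x = f.1.1 ∧ e.1.2 = f.1.2 ∧ e.1.2 ≠ none
  /-- Every node is passed exactly twice. -/
  node_twice : ∀ a ∈ allLabels comp, (allLabels comp).count a = 2
  /-- Both passages are at the same point of space. -/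
  node_position : ∀ i j, ∀ x ∈ comp i, ∀ y ∈ comp j, x.2 = y.2 → x.2 ≠ none → x.1 = y.1
  /-- Strands pass straight through a node. By `edges_disjoint` the directions of the two passages
  are then linearly independent, so that they span the rigid disk of the node. -/
  node_straight : ∀ i p c q, IsConsecutive (comp i) p c q → c.2 ≠ none →
    c.1 ∈ openSegment ℝ p.1 q.1

namespace EmbeddedGraph

variable {n : ℕ}

/-- The set of (names of) nodes. -/
def nodes (G : EmbeddedGraph n) : Finset ℕ := (allLabels G.comp).toFinset

/-- The subset of `ℝ³` occupied by the graph. -/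
def support (G : EmbeddedGraph n) : Set (Fin 3 → ℝ) :=
  ⋃ e ∈ allEdges G.comp, segment ℝ e.1.1 e.2.1

/-- An oriented polygonal link is an embedded graph without nodes. -/
def IsLink (G : EmbeddedGraph n) : Prop := G.nodes = ∅

/-- The elementary move on polygonal links: an edge `A B` is replaced by `A C`, `C B`, where the
(possibly degenerate) triangle `A C B` meets the link only in the edge `A B`. Neither the starting
vertices of the polygons nor the numbering of the components matters. -/
def DeltaMove (L L' : EmbeddedGraph n) : Prop :=
  L.IsLink ∧ L'.IsLink ∧
  ∃ (π : Equiv.Perm (Fin n)) (i : Fin n) (A B C : MarkedPoint) (t : List MarkedPoint),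
    (L.comp i) ~r (A :: B :: t) ∧
    (L'.comp (π i)) ~r (A :: C :: B :: t) ∧
    (∀ j, j ≠ i → (L'.comp (π j)) ~r (L.comp j)) ∧
    convexHull ℝ {A.1, C.1, B.1} ∩ L.support ⊆ segment ℝ A.1 B.1

/-- Combinatorial (that is, piecewise linear ambient) isotopy of oriented polygonal links. -/
def LinkIsotopic (L L' : EmbeddedGraph n) : Prop := Relation.EqvGen DeltaMove L L'

/-- `H` is obtained from `G` by replacing the node `a` by a crossing of sign `s` (`1` positive,
`-1` negative): on one of the two strands through the node, the short straight piece from `x`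
through the node `c` to `y` is replaced by the two segments `x z`, `z y`, where the triangle
`x z y` meets `G` only in the segment `x y`. The vector from the other strand to the moved one is
`z - c`, so that the sign of the crossing is that of the determinant of (direction of the moved
strand, direction of the other strand, `z - c`). A nonzero sign forces the corner `p'`, `c'`, `q'`
to be the other passage through `a`, since the determinant vanishes for the corner `p`, `c`, `q`
itself. -/
def IsResolution (G : EmbeddedGraph n) (a : ℕ) (s : SignType) (H : EmbeddedGraph n) : Prop :=
  ∃ (i : Fin n) (p c q : MarkedPoint) (t : List MarkedPoint) (x z y : Fin 3 → ℝ),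
    (G.comp i) ~r (p :: c :: q :: t) ∧ c.2 = some a ∧
    x ∈ openSegment ℝ p.1 c.1 ∧ y ∈ openSegment ℝ c.1 q.1 ∧
    convexHull ℝ {x, z, y} ∩ G.support ⊆ segment ℝ x y ∧
    (∃ (j : Fin n) (p' c' q' : MarkedPoint), IsConsecutive (G.comp j) p' c' q' ∧ c'.2 = some a ∧
      SignType.sign (Matrix.det (Matrix.of ![q.1 - p.1, q'.1 - p'.1, z - c.1])) = s) ∧
    (H.comp i) ~r
      ((p :: (x, none) :: (z, none) :: (y, none) :: q :: t).map (unmark a)) ∧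
    ∀ j, j ≠ i → (H.comp j) ~r ((G.comp j).map (unmark a))

end EmbeddedGraph

/-- A Vassiliev invariant: an isotopy invariant of oriented links with `n` components, together
with its extension to embedded 4-valent graphs by the exchange identity
`v(K_*) = v(K_+) - v(K_-)`. (Resolving all nodes, one sees that the values on links determine the
values on graphs.) -/
structure IsVassilievInvariant {n : ℕ} {R : Type*} [CommRing R] (v : EmbeddedGraph n → R) :
    Prop where
  isotopy_invariant : ∀ L L' : EmbeddedGraph n, L.IsLink → L'.IsLink → L.LinkIsotopic L' →
    v L = v L'
  exchange : ∀ (G P N : EmbeddedGraph n) (a : ℕ),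
    G.IsResolution a 1 P → G.IsResolution a (-1) N → v G = v P - v N

/-- `v` vanishes on all embedded graphs with more than `k` nodes. -/
def IsOfFiniteType {n : ℕ} {R : Type*} [CommRing R] (k : ℕ) (v : EmbeddedGraph n → R) : Prop :=
  ∀ G : EmbeddedGraph n, k < G.nodes.card → v G = 0

/-- An abstract oriented 4-valent graph with a pairing of opposite edges at each node, that is, a
chord diagram on `n` circles: for each of the `n` closed strands, the cyclic sequence of nodes that
it passes; each node is passed twice. (The edges are the pieces of strand between consecutive
passages; a strand with empty sequence is a free loop.) -/
structure AbstractGraph (n : ℕ) where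
  word : Fin n → List ℕ
  node_twice : ∀ a ∈ (List.finRange n).flatMap word, ((List.finRange n).flatMap word).count a = 2

/-- The set of nodes of an abstract graph. -/
def AbstractGraph.nodes {n : ℕ} (Γ : AbstractGraph n) : Finset ℕ :=
  ((List.finRange n).flatMap Γ.word).toFinset

/-- `G` is an embedding of `Γ`: up to an isomorphism of graphs (a bijection `σ` of nodes and a
bijection `π` of strands) the strands of `G` pass the nodes in the cyclic order given by `Γ`. -/
def EmbeddedGraph.IsEmbeddingOf {n : ℕ} (G : EmbeddedGraph n) (Γ : AbstractGraph n) : Prop :=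
  ∃ (σ : Equiv.Perm ℕ) (π : Equiv.Perm (Fin n)), ∀ i,
    (((G.comp (π i)).filterMap Prod.snd).map σ) ~r (Γ.word i)

/-!
Embedded graphs are encoded as *diagrams*: cyclic lists `T` of vertex names, with a labelling `lab`
of the names that marks the passages through nodes, and with positions `pos` in space. The
combinatorial conditions (`Shape`) and the geometric conditions (`Good`) are thus separated, so that
vertices can be moved with the combinatorial type fixed. `valueOf` is the value of an invariant on a
diagram.

A Vassiliev invariant is an isotopy invariant on links by assumption, and this extends to graphs by
induction on the number of nodes. If a node is resolved within a small triangle, a move of the graph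
becomes a move of its two resolutions, which have fewer nodes. In this way the value is seen to be
invariant under elementary moves (`valueOf_insertion_aux`) and under all sufficiently small movements
of the vertices that keep the strands straight at the nodes (`Good.eventually_valueOf`).

Let now `v` be of finite type `k` and consider diagrams with exactly `k` nodes. If one strand is
pushed through another one, the value changes by the value of the graph in which the crossing is
welded to a node. This graph has `k + 1` nodes, so the value does not change at all
(`IsVassilievInvariant.crossing_plane`, `IsVassilievInvariant.push`). Hence a vertex that is not an
end of an edge at a node may be moved to any generic point of space, whatever its edges run into on
the way (`IsVassilievInvariant.valueOf_update`). As any two embeddings can be moved to common generic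
points, the value does not depend on the positions of these free vertices at all
(`IsVassilievInvariant.valueOf_eq_of_agree`): for a given combinatorial type it is a function of the
positions of the nodes, the directions of the two strands at each node, and the lengths of the
straight pieces (arms) there.

The arms may be shortened, because for any lengths of the arms, as long as different arms stay apart,
the free vertices can be placed suitably; small arms stay apart automatically. So there is a
well-defined and locally constant function on the configurations of distinct node positions and
linearly independent directions at each node (`ShortArmValue`). These configurations form a connected
space: a node can be moved in the complement of the finitely many others, and the direction of a
strand can be turned in the complement of the line of the other strand, which has codimension two.
Hence the function is constant (`ShortArmValue.of_isAdmissible`), and the value depends only on the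
combinatorial type (`IsVassilievInvariant.valueOf_eq_of_spread`).

Finally, two embeddings of the same abstract graph have the same combinatorial type up to the choice
of starting points, the order of the strands, the names of the nodes, and the numbers of vertices
between nodes. The first three do not matter, and the last ones become equal by subdividing edges
(`HasLabels.standardize`), which also provides the free vertices between nodes needed above.
-/

open Filter Topology

/-! ### Cyclic lists -/

/-- Names of the vertices of a diagram. -/
abbrev VertexName : Type := ℕ × ℕ

/-- The pairs of cyclically consecutive entries of a list. -/
def cyclicPairs {α : Type*} (l : List α) : List (α × α) := l.zip (l.rotate 1)

section Cyclic

variable {α β : Type*}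

lemma cyclicPairs_cons (a : α) (l : List α) :
    cyclicPairs (a :: l) = (a :: l).zip (l ++ [a]) := by
  simp [cyclicPairs]

lemma cyclicPairs_map (f : α → β) (l : List α) :
    cyclicPairs (l.map f) = (cyclicPairs l).map (Prod.map f f) := by
  simp [cyclicPairs, List.zip_map, ← List.map_rotate]

lemma cyclicPairs_rotate (l : List α) (k : ℕ) :
    cyclicPairs (l.rotate k) = (cyclicPairs l).rotate k := by
  have hz : ∀ x y : List α, x.zip y = List.zipWith Prod.mk x y := fun _ _ => by
    rw [List.zip_eq_zipWith]
  rw [cyclicPairs, cyclicPairs, hz, hz, List.zipWith_rotate_distrib _ _ _ _ (by simp),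
    List.rotate_rotate, List.rotate_rotate, add_comm]

lemma List.IsRotated.cyclicPairs {l l' : List α} (h : l ~r l') :
    cyclicPairs l ~r cyclicPairs l' := by
  obtain ⟨k, rfl⟩ := h
  exact ⟨k, (cyclicPairs_rotate l k).symm⟩

lemma List.IsRotated.mem_cyclicPairs {l l' : List α} (h : l ~r l') {e : α × α} :
    e ∈ _root_.cyclicPairs l ↔ e ∈ _root_.cyclicPairs l' := h.cyclicPairs.mem_iff

lemma fst_mem_of_mem_cyclicPairs {l : List α} {e : α × α} (h : e ∈ cyclicPairs l) : e.1 ∈ l :=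
  (List.of_mem_zip (show (e.1, e.2) ∈ l.zip (l.rotate 1) from h)).1

lemma snd_mem_of_mem_cyclicPairs {l : List α} {e : α × α} (h : e ∈ cyclicPairs l) : e.2 ∈ l := by
  have := (List.of_mem_zip (show (e.1, e.2) ∈ l.zip (l.rotate 1) from h)).2
  simpa using this

lemma map_fst_cyclicPairs (l : List α) : (cyclicPairs l).map Prod.fst = l := by
  simp [cyclicPairs, List.map_fst_zip]

lemma map_snd_cyclicPairs (l : List α) : (cyclicPairs l).map Prod.snd = l.rotate 1 := by
  simp [cyclicPairs, List.map_snd_zip]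

lemma exists_next {l : List α} {u : α} (h : u ∈ l) : ∃ w, (u, w) ∈ cyclicPairs l := by
  rw [← map_fst_cyclicPairs l, List.mem_map] at h
  obtain ⟨e, he, rfl⟩ := h
  exact ⟨e.2, he⟩

lemma exists_prev {l : List α} {u : α} (h : u ∈ l) : ∃ w, (w, u) ∈ cyclicPairs l := by
  have h' : u ∈ l.rotate 1 := by simpa using h
  rw [← map_snd_cyclicPairs l, List.mem_map] at h'
  obtain ⟨e, he, rfl⟩ := h'
  exact ⟨e.1, he⟩

lemma nodup_cyclicPairs {l : List α} (h : l.Nodup) : (cyclicPairs l).Nodup := by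
  apply List.Nodup.of_map Prod.fst
  rwa [map_fst_cyclicPairs]

lemma next_unique {l : List α} (h : l.Nodup) {u w w' : α} (h1 : (u, w) ∈ cyclicPairs l)
    (h2 : (u, w') ∈ cyclicPairs l) : w = w' := by
  have := List.inj_on_of_nodup_map (f := Prod.fst) (by rwa [map_fst_cyclicPairs]) h1 h2 rfl
  exact congrArg Prod.snd this

lemma prev_unique {l : List α} (h : l.Nodup) {u w w' : α} (h1 : (w, u) ∈ cyclicPairs l)
    (h2 : (w', u) ∈ cyclicPairs l) : w = w' := by
  have := List.inj_on_of_nodup_map (f := Prod.snd)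
    (by rw [map_snd_cyclicPairs]; exact List.nodup_rotate.2 h) h1 h2 rfl
  exact congrArg Prod.fst this

lemma exists_isRotated_cons {l : List α} {a : α} (h : a ∈ l) : ∃ m, l ~r a :: m := by
  obtain ⟨s, t, rfl⟩ := List.append_of_mem h
  exact ⟨t ++ s, by simpa using List.isRotated_append (l := s) (l' := a :: t)⟩

lemma exists_isRotated_cons_cons {l : List α} (hl : l.Nodup) {a b : α} (hab : a ≠ b)
    (h : (a, b) ∈ cyclicPairs l) : ∃ t, l ~r a :: b :: t := by
  obtain ⟨m, hm⟩ := exists_isRotated_cons (fst_mem_of_mem_cyclicPairs h)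
  have h' := hm.mem_cyclicPairs.1 h
  have hn : (a :: m).Nodup := hm.nodup_iff.1 hl
  cases m with
  | nil => simp [cyclicPairs] at h'; exact absurd h'.symm hab
  | cons b' t =>
    have : (a, b') ∈ cyclicPairs (a :: b' :: t) := by simp [cyclicPairs_cons]
    obtain rfl := next_unique hn h' this
    exact ⟨t, hm⟩

lemma exists_isRotated_cons_cons_cons {l : List α} (hl : l.Nodup) {a b c : α} (hab : a ≠ b)
    (hac : a ≠ c) (h : (a, b) ∈ cyclicPairs l) (h2 : (b, c) ∈ cyclicPairs l) :
    ∃ t, l ~r a :: b :: c :: t := by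
  obtain ⟨t, ht⟩ := exists_isRotated_cons_cons hl hab h
  have h' := ht.mem_cyclicPairs.1 h2
  have hn : (a :: b :: t).Nodup := ht.nodup_iff.1 hl
  cases t with
  | nil =>
    have : (b, a) ∈ cyclicPairs [a, b] := by simp [cyclicPairs_cons]
    exact absurd (next_unique hn this h') hac
  | cons c' t =>
    have : (b, c') ∈ cyclicPairs (a :: b :: c' :: t) := by simp [cyclicPairs_cons]
    obtain rfl := next_unique hn h' this
    exact ⟨t, ht⟩

/-- Inserting `c` between the cyclically consecutive entries `a` and `b` replaces the pair
`(a, b)` by `(a, c)` and `(c, b)`. -/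
lemma mem_cyclicPairs_insert {a b c : α} {t : List α} (h : (a :: b :: t).Nodup) {e : α × α} :
    e ∈ cyclicPairs (a :: c :: b :: t) ↔
      (e ∈ cyclicPairs (a :: b :: t) ∧ e ≠ (a, b)) ∨ e = (a, c) ∨ e = (c, b) := by
  have h1 : (a, b) ∉ (b :: t).zip (t ++ [a]) := fun hm => by
    have := (List.of_mem_zip hm).1
    rw [List.nodup_cons] at h
    exact h.1 this
  simp only [cyclicPairs_cons, List.cons_append, List.zip_cons_cons, List.mem_cons]
  constructor
  · rintro (h2 | h2 | h2)
    · tauto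
    · tauto
    · refine Or.inl ⟨Or.inr h2, ?_⟩
      rintro rfl
      exact h1 h2
  · tauto

end Cyclic

/-! ### Combinatorial types of diagrams -/

section Shape

variable {n : ℕ}

/-- The directed edges of a family of cyclic lists of vertex names. -/
def edgeSet (T : Fin n → List VertexName) : Set (VertexName × VertexName) :=
  {e | ∃ i, e ∈ cyclicPairs (T i)}

/-- The combinatorial type of an embedded graph: cyclic lists `T` of pairwise distinct vertex
names, together with a labelling `lab` of names by nodes, every node having two passages. -/
structure Shape (T : Fin n → List VertexName) (lab : VertexName → Option ℕ) : Prop where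
  ne_nil : ∀ i, T i ≠ []
  nodup : ∀ i, (T i).Nodup
  disj : ∀ i j u, u ∈ T i → u ∈ T j → i = j
  supp : ∀ u, lab u ≠ none → ∃ i, u ∈ T i
  two : ∀ u, lab u ≠ none → ∃ u', u' ≠ u ∧ lab u' = lab u ∧ ∀ w, lab w = lab u → w = u ∨ w = u'

lemma edgeSet_finite (T : Fin n → List VertexName) : (edgeSet T).Finite := by
  have : edgeSet T = ⋃ i, {e | e ∈ cyclicPairs (T i)} := by
    ext e; simp [edgeSet]
  rw [this]
  exact Set.finite_iUnion fun i => List.finite_toSet _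

lemma fst_mem_of_mem_edgeSet {T : Fin n → List VertexName} {e : VertexName × VertexName}
    (h : e ∈ edgeSet T) : ∃ i, e.1 ∈ T i :=
  h.imp fun _ => fst_mem_of_mem_cyclicPairs

lemma snd_mem_of_mem_edgeSet {T : Fin n → List VertexName} {e : VertexName × VertexName}
    (h : e ∈ edgeSet T) : ∃ i, e.2 ∈ T i :=
  h.imp fun _ => snd_mem_of_mem_cyclicPairs

lemma exists_next_edge {T : Fin n → List VertexName} {u : VertexName} (h : ∃ i, u ∈ T i) :
    ∃ w, (u, w) ∈ edgeSet T := by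
  obtain ⟨i, hi⟩ := h
  exact (exists_next hi).imp fun w hw => ⟨i, hw⟩

lemma exists_prev_edge {T : Fin n → List VertexName} {u : VertexName} (h : ∃ i, u ∈ T i) :
    ∃ w, (w, u) ∈ edgeSet T := by
  obtain ⟨i, hi⟩ := h
  exact (exists_prev hi).imp fun w hw => ⟨i, hw⟩

namespace Shape

variable {T : Fin n → List VertexName} {lab : VertexName → Option ℕ}

lemma next_eq (h : Shape T lab) {u w w' : VertexName} (h1 : (u, w) ∈ edgeSet T)
    (h2 : (u, w') ∈ edgeSet T) : w = w' := by
  obtain ⟨i, hi⟩ := h1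
  obtain ⟨j, hj⟩ := h2
  obtain rfl := h.disj i j u (fst_mem_of_mem_cyclicPairs hi) (fst_mem_of_mem_cyclicPairs hj)
  exact next_unique (h.nodup i) hi hj

lemma prev_eq (h : Shape T lab) {u w w' : VertexName} (h1 : (w, u) ∈ edgeSet T)
    (h2 : (w', u) ∈ edgeSet T) : w = w' := by
  obtain ⟨i, hi⟩ := h1
  obtain ⟨j, hj⟩ := h2
  obtain rfl := h.disj i j u (snd_mem_of_mem_cyclicPairs hi) (snd_mem_of_mem_cyclicPairs hj)
  exact prev_unique (h.nodup i) hi hj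

end Shape

/-- `T'` is obtained from `T` by inserting the name `c` between the consecutive names `a` and `b`;
the cyclic lists may be rotated, and they are permuted by `π`. -/
def IsInsertion (π : Equiv.Perm (Fin n)) (T T' : Fin n → List VertexName)
    (a c b : VertexName) : Prop :=
  ∃ i t, T i ~r (a :: b :: t) ∧ T' (π i) ~r (a :: c :: b :: t) ∧ ∀ j, j ≠ i → T' (π j) ~r T j

namespace IsInsertion

variable {π : Equiv.Perm (Fin n)} {T T' : Fin n → List VertexName} {a b c : VertexName}
  {lab : VertexName → Option ℕ}

lemma mem_edgeSet (h : IsInsertion π T T' a c b) (hT : Shape T lab) {e : VertexName × VertexName} :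
    e ∈ edgeSet T' ↔ (e ∈ edgeSet T ∧ e ≠ (a, b)) ∨ e = (a, c) ∨ e = (c, b) := by
  obtain ⟨i, t, hi, hi', hj⟩ := h
  have hn : (a :: b :: t).Nodup := hi.nodup_iff.1 (hT.nodup i)
  have h1 : e ∈ edgeSet T' ↔ ∃ j, e ∈ cyclicPairs (T' (π j)) :=
    (Equiv.exists_congr_left π.symm).trans (by simp)
  rw [h1]
  constructor
  · rintro ⟨j, hje⟩
    by_cases hji : j = i
    · subst hji
      rw [hi'.mem_cyclicPairs, mem_cyclicPairs_insert hn, ← hi.mem_cyclicPairs] at hje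
      exact hje.imp_left fun h => ⟨⟨j, h.1⟩, h.2⟩
    · rw [(hj j hji).mem_cyclicPairs] at hje
      refine Or.inl ⟨⟨j, hje⟩, ?_⟩
      rintro rfl
      exact hji (hT.disj j i a (fst_mem_of_mem_cyclicPairs hje) (hi.mem_iff.2 (by simp)))
  · rintro (⟨⟨j, hje⟩, hne⟩ | he)
    · by_cases hji : j = i
      · subst hji
        refine ⟨j, ?_⟩
        rw [hi'.mem_cyclicPairs, mem_cyclicPairs_insert hn, ← hi.mem_cyclicPairs]
        exact Or.inl ⟨hje, hne⟩
      · exact ⟨j, (hj j hji).mem_cyclicPairs.2 hje⟩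
    · refine ⟨i, ?_⟩
      rw [hi'.mem_cyclicPairs, mem_cyclicPairs_insert hn]
      exact Or.inr he

lemma mem_names (h : IsInsertion π T T' a c b) {u : VertexName} :
    (∃ i, u ∈ T' i) ↔ (∃ i, u ∈ T i) ∨ u = c := by
  obtain ⟨i, t, hi, hi', hj⟩ := h
  have h1 : (∃ i, u ∈ T' i) ↔ ∃ j, u ∈ T' (π j) :=
    (Equiv.exists_congr_left π.symm).trans (by simp)
  rw [h1]
  constructor
  · rintro ⟨j, hju⟩
    by_cases hji : j = i
    · subst hji
      rw [hi'.mem_iff] at hju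
      by_cases huc : u = c
      · exact Or.inr huc
      · refine Or.inl ⟨j, hi.mem_iff.2 ?_⟩
        simp only [List.mem_cons] at hju ⊢
        tauto
    · exact Or.inl ⟨j, (hj j hji).mem_iff.1 hju⟩
  · rintro (⟨j, hju⟩ | rfl)
    · by_cases hji : j = i
      · subst hji
        rw [hi.mem_iff] at hju
        refine ⟨j, hi'.mem_iff.2 ?_⟩
        simp only [List.mem_cons] at hju ⊢
        tauto
      · exact ⟨j, (hj j hji).mem_iff.2 hju⟩
    · exact ⟨i, hi'.mem_iff.2 (by simp)⟩

lemma shape (h : IsInsertion π T T' a c b) (hT : Shape T lab) (hc : ∀ i, c ∉ T i) :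
    Shape T' lab := by
  have hnames := fun u => h.mem_names (u := u)
  obtain ⟨i, t, hi, hi', hj⟩ := h
  have key : ∀ j u, u ∈ T' (π j) ↔ u ∈ T j ∨ (j = i ∧ u = c) := by
    intro j u
    by_cases hji : j = i
    · subst hji
      rw [hi'.mem_iff, hi.mem_iff]
      simp only [List.mem_cons]
      tauto
    · rw [(hj j hji).mem_iff]
      tauto
  have hc' := hc i
  rw [hi.mem_iff] at hc'
  have hn : (a :: b :: t).Nodup := hi.nodup_iff.1 (hT.nodup i)
  refine ⟨?_, ?_, ?_, ?_, hT.two⟩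
  · intro j hj0
    obtain ⟨j, rfl⟩ := π.surjective j
    obtain ⟨u, hu⟩ := List.exists_mem_of_ne_nil _ (hT.ne_nil j)
    have := (key j u).2 (Or.inl hu)
    rw [hj0] at this
    simp at this
  · intro j
    obtain ⟨j, rfl⟩ := π.surjective j
    by_cases hji : j = i
    · subst hji
      rw [hi'.nodup_iff]
      simp only [List.nodup_cons, List.mem_cons] at hn hc' ⊢
      tauto
    · exact (hj j hji).nodup_iff.2 (hT.nodup j)
  · intro j k u hju hku
    obtain ⟨j, rfl⟩ := π.surjective j
    obtain ⟨k, rfl⟩ := π.surjective k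
    rw [key] at hju hku
    congr 1
    rcases hju with hju | ⟨rfl, rfl⟩ <;> rcases hku with hku | ⟨rfl, hku⟩
    · exact hT.disj j k u hju hku
    · subst hku; exact absurd hju (hc j)
    · exact absurd hku (hc k)
    · rfl
  · intro u hu
    exact (hnames u).2 (Or.inl (hT.supp u hu))

end IsInsertion

lemma exists_isInsertion {T : Fin n → List VertexName} {lab : VertexName → Option ℕ}
    (hT : Shape T lab) {a b : VertexName} (hab : a ≠ b) (h : (a, b) ∈ edgeSet T)
    (c : VertexName) : ∃ T', IsInsertion 1 T T' a c b := by
  obtain ⟨i, hi⟩ := h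
  obtain ⟨t, ht⟩ := exists_isRotated_cons_cons (hT.nodup i) hab hi
  refine ⟨Function.update T i (a :: c :: b :: t), i, t, ht, by simp [List.IsRotated.refl], fun j hj => ?_⟩
  simp [hj, List.IsRotated.refl]

lemma exists_fresh (T : Fin n → List VertexName) (S : Finset VertexName) :
    ∃ c, (∀ i, c ∉ T i) ∧ c ∉ S := by
  obtain ⟨c, hc⟩ := Infinite.exists_notMem_finset
    (S ∪ Finset.univ.biUnion fun i => (T i).toFinset)
  simp at hc
  exact ⟨c, fun i => by simpa using hc.2 i, by simpa using hc.1⟩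

end Shape

/-! ### Diagrams with named vertices -/

section Diagram

variable {n : ℕ}

/-- The family of closed polygons given by cyclic lists of names, labels and positions. -/
def diagram (T : Fin n → List VertexName) (lab : VertexName → Option ℕ)
    (pos : VertexName → Fin 3 → ℝ) : Fin n → List MarkedPoint :=
  fun i => (T i).map fun u => (pos u, lab u)

/-- The segment between the positions of the two ends of an edge. -/
abbrev edgeSegment (pos : VertexName → Fin 3 → ℝ) (e : VertexName × VertexName) :
    Set (Fin 3 → ℝ) := segment ℝ (pos e.1) (pos e.2)

/-- Two edges meet properly if every common point of their (closed) segments is the position of an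
end of either edge, and these two ends are the same vertex or passages through the same node. -/
def MeetProperly (lab : VertexName → Option ℕ) (pos : VertexName → Fin 3 → ℝ)
    (e f : VertexName × VertexName) : Prop :=
  ∀ x ∈ edgeSegment pos e, x ∈ edgeSegment pos f → ∃ u w, (u = e.1 ∨ u = e.2) ∧
    (w = f.1 ∨ w = f.2) ∧ x = pos u ∧ x = pos w ∧ (u = w ∨ (lab u = lab w ∧ lab u ≠ none))

lemma MeetProperly.symm {lab : VertexName → Option ℕ} {pos : VertexName → Fin 3 → ℝ}
    {e f : VertexName × VertexName} (h : MeetProperly lab pos e f) : MeetProperly lab pos f e := by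
  intro x hx hx'
  obtain ⟨u, w, hu, hw, h1, h2, h3⟩ := h x hx' hx
  refine ⟨w, u, hw, hu, h2, h1, ?_⟩
  rcases h3 with h | ⟨h, h'⟩
  · exact Or.inl h.symm
  · exact Or.inr ⟨h.symm, h ▸ h'⟩

/-- The geometric conditions on an embedded graph, for an arbitrary set `E` of directed edges. -/
structure Good (E : Set (VertexName × VertexName)) (lab : VertexName → Option ℕ)
    (pos : VertexName → Fin 3 → ℝ) : Prop where
  nondeg : ∀ e ∈ E, pos e.1 ≠ pos e.2
  inter : ∀ e ∈ E, ∀ f ∈ E, e ≠ f → MeetProperly lab pos e f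
  straight : ∀ u b w, (u, b) ∈ E → (b, w) ∈ E → lab b ≠ none → pos b ∈ openSegment ℝ (pos u) (pos w)
  nodepos : ∀ u w, lab u ≠ none → lab u = lab w → pos u = pos w

lemma Good.mono {E E' : Set (VertexName × VertexName)} {lab : VertexName → Option ℕ}
    {pos : VertexName → Fin 3 → ℝ} (h : Good E lab pos) (hE : E' ⊆ E) : Good E' lab pos :=
  ⟨fun e he => h.nondeg e (hE he), fun e he f hf => h.inter e (hE he) f (hE hf),
    fun u b w h1 h2 => h.straight u b w (hE h1) (hE h2), h.nodepos⟩

/-- All edges of a family of cyclic lists of names, as a list. -/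
def edgeList (T : Fin n → List VertexName) : List (VertexName × VertexName) :=
  (List.finRange n).flatMap fun i => cyclicPairs (T i)

/-- All names of a family of cyclic lists of names, as a list. -/
def nameList (T : Fin n → List VertexName) : List VertexName :=
  (List.finRange n).flatMap T

lemma mem_edgeList {T : Fin n → List VertexName} {e : VertexName × VertexName} :
    e ∈ edgeList T ↔ e ∈ edgeSet T := by
  simp [edgeList, edgeSet]

lemma mem_nameList {T : Fin n → List VertexName} {u : VertexName} :
    u ∈ nameList T ↔ ∃ i, u ∈ T i := by
  simp [nameList]

lemma nodup_nameList {T : Fin n → List VertexName} (h1 : ∀ i, (T i).Nodup)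
    (h2 : ∀ i j u, u ∈ T i → u ∈ T j → i = j) : (nameList T).Nodup := by
  refine List.nodup_flatMap.2 ⟨fun i _ => h1 i, ?_⟩
  refine (List.nodup_finRange n).pairwise_of_forall_ne fun i _ j _ hij => ?_
  exact fun u hu hu' => hij (h2 i j u hu hu')

lemma nodup_edgeList {T : Fin n → List VertexName} {lab : VertexName → Option ℕ}
    (h : Shape T lab) : (edgeList T).Nodup := by
  refine List.nodup_flatMap.2 ⟨fun i _ => nodup_cyclicPairs (h.nodup i), ?_⟩
  refine (List.nodup_finRange n).pairwise_of_forall_ne fun i _ j _ hij => ?_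
  exact fun e he he' => hij
    (h.disj i j e.1 (fst_mem_of_mem_cyclicPairs he) (fst_mem_of_mem_cyclicPairs he'))

lemma allEdges_diagram (T : Fin n → List VertexName) (lab : VertexName → Option ℕ)
    (pos : VertexName → Fin 3 → ℝ) :
    allEdges (diagram T lab pos) = (edgeList T).map fun e =>
      ((pos e.1, lab e.1), (pos e.2, lab e.2)) := by
  have : ∀ l : List MarkedPoint, polygonEdges l = cyclicPairs l := fun _ => rfl
  simp only [allEdges, diagram, this, cyclicPairs_map, edgeList, List.map_flatMap]
  rfl

lemma allLabels_diagram (T : Fin n → List VertexName) (lab : VertexName → Option ℕ)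
    (pos : VertexName → Fin 3 → ℝ) :
    allLabels (diagram T lab pos) = (nameList T).filterMap lab := by
  simp only [allLabels, diagram, nameList, List.filterMap_map, List.filterMap_flatMap]
  rfl

lemma mem_segment_iff_halfOpenEdge (e : MarkedPoint × MarkedPoint) (x : Fin 3 → ℝ) :
    x ∈ segment ℝ e.1.1 e.2.1 ↔ x ∈ halfOpenEdge e ∨ x = e.2.1 := by
  rw [segment_eq_image_lineMap, halfOpenEdge]
  constructor
  · rintro ⟨t, ⟨h0, h1⟩, rfl⟩
    rcases h1.lt_or_eq with h1 | rfl
    · exact Or.inl ⟨t, ⟨h0, h1⟩, rfl⟩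
    · simp
  · rintro (⟨t, ht, rfl⟩ | rfl)
    · exact ⟨t, ⟨ht.1, ht.2.le⟩, rfl⟩
    · exact ⟨1, by simp, by simp⟩

lemma end_notMem_halfOpenEdge {e : MarkedPoint × MarkedPoint} (he : e.1.1 ≠ e.2.1) :
    e.2.1 ∉ halfOpenEdge e := by
  rintro ⟨t, ht, h⟩
  have h' : AffineMap.lineMap e.1.1 e.2.1 t = AffineMap.lineMap e.1.1 e.2.1 (1 : ℝ) := by
    simpa using h
  have := (AffineMap.lineMap_injective ℝ he) h'
  exact ht.2.ne this

lemma start_mem_halfOpenEdge (e : MarkedPoint × MarkedPoint) : e.1.1 ∈ halfOpenEdge e :=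
  ⟨0, by simp, by simp⟩

lemma exists_names_of_isConsecutive {T : Fin n → List VertexName} {lab : VertexName → Option ℕ}
    {pos : VertexName → Fin 3 → ℝ} {i : Fin n} {p c q : MarkedPoint}
    (h : IsConsecutive (diagram T lab pos i) p c q) :
    ∃ u b w, (u, b) ∈ edgeSet T ∧ (b, w) ∈ edgeSet T ∧ p = (pos u, lab u) ∧ c = (pos b, lab b) ∧
      q = (pos w, lab w) := by
  obtain ⟨t, k, hk⟩ := h
  rw [diagram, ← List.map_rotate] at hk
  obtain ⟨u, l1, h1, rfl, hk2⟩ := List.map_eq_cons_iff.1 hk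
  obtain ⟨b, l2, rfl, rfl, hk3⟩ := List.map_eq_cons_iff.1 hk2
  obtain ⟨w, l3, rfl, rfl, -⟩ := List.map_eq_cons_iff.1 hk3
  have hr : T i ~r u :: b :: w :: l3 := ⟨k, h1⟩
  refine ⟨u, b, w, ⟨i, ?_⟩, ⟨i, ?_⟩, rfl, rfl, rfl⟩ <;> rw [hr.mem_cyclicPairs] <;>
    simp [cyclicPairs_cons]

lemma count_filterMap_eq_two {T : Fin n → List VertexName} {lab : VertexName → Option ℕ}
    (h : Shape T lab) {u : VertexName} {a : ℕ} (hu : lab u = some a) :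
    ((nameList T).filterMap lab).count a = 2 := by
  obtain ⟨u', hne, hl, hall⟩ := h.two u (by simp [hu])
  rw [List.count_filterMap, List.countP_eq_length_filter]
  have : ((nameList T).filter fun w => lab w == some a).Perm [u, u'] := by
    rw [List.perm_ext_iff_of_nodup ((nodup_nameList h.nodup h.disj).filter _)
      (by simpa using hne.symm)]
    intro w
    simp only [List.mem_filter, mem_nameList, beq_iff_eq, List.mem_cons, List.not_mem_nil, or_false]
    constructor
    · rintro ⟨-, hw⟩
      exact hall w (by rw [hw, hu])
    · rintro (rfl | rfl)
      · exact ⟨h.supp _ (by simp [hu]), hu⟩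
      · exact ⟨h.supp _ (by simp [hl, hu]), by rw [hl, hu]⟩
  simpa using this.length_eq

/-- The half-open edge condition of embedded graphs in terms of closed edges. -/
lemma edges_disjoint_of_good {T : Fin n → List VertexName} {lab : VertexName → Option ℕ}
    {pos : VertexName → Fin 3 → ℝ} (hT : Shape T lab) (hG : Good (edgeSet T) lab pos)
    {e f : VertexName × VertexName} (he : e ∈ edgeSet T) (hf : f ∈ edgeSet T) (hef : e ≠ f)
    {x : Fin 3 → ℝ} (hxe : x ∈ halfOpenEdge ((pos e.1, lab e.1), (pos e.2, lab e.2)))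
    (hxf : x ∈ halfOpenEdge ((pos f.1, lab f.1), (pos f.2, lab f.2))) :
    x = pos e.1 ∧ x = pos f.1 ∧ lab e.1 = lab f.1 ∧ lab e.1 ≠ none := by
  obtain ⟨u, w, hu, hw, hxu, hxw, huw⟩ := hG.inter e he f hf hef x
    ((mem_segment_iff_halfOpenEdge ((pos e.1, lab e.1), (pos e.2, lab e.2)) x).2 (Or.inl hxe))
    ((mem_segment_iff_halfOpenEdge ((pos f.1, lab f.1), (pos f.2, lab f.2)) x).2 (Or.inl hxf))
  rcases hu with rfl | rfl
  · rcases hw with rfl | rfl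
    · refine ⟨hxu, hxw, ?_⟩
      rcases huw with huw | huw
      · refine absurd (Prod.ext huw ?_) hef
        refine hT.next_eq (u := e.1) he ?_
        rw [huw]; exact hf
      · exact huw
    · exact absurd (hxw ▸ hxf) (end_notMem_halfOpenEdge (hG.nondeg f hf))
  · exact absurd (hxu ▸ hxe) (end_notMem_halfOpenEdge (hG.nondeg e he))

/-- A good diagram is an embedded graph. -/
lemma exists_embeddedGraph {T : Fin n → List VertexName} {lab : VertexName → Option ℕ}
    {pos : VertexName → Fin 3 → ℝ} (hT : Shape T lab) (hG : Good (edgeSet T) lab pos) :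
    ∃ G : EmbeddedGraph n, G.comp = diagram T lab pos := by
  refine ⟨⟨diagram T lab pos, ?_, ?_, ?_, ?_, ?_, ?_⟩, rfl⟩
  · intro i
    simpa [diagram] using hT.ne_nil i
  · rw [allEdges_diagram]
    simp only [List.mem_map, mem_edgeList]
    rintro _ ⟨e, he, rfl⟩
    exact hG.nondeg e he
  · rw [allEdges_diagram, List.pairwise_map]
    refine (nodup_edgeList hT).pairwise_of_forall_ne fun e he f hf hef x hx => ?_
    exact edges_disjoint_of_good hT hG (mem_edgeList.1 he) (mem_edgeList.1 hf) hef hx.1 hx.2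
  · rw [allLabels_diagram]
    intro a ha
    obtain ⟨u, -, hu⟩ := List.mem_filterMap.1 ha
    exact count_filterMap_eq_two hT hu
  · intro i j x hx y hy hxy hne
    simp only [diagram, List.mem_map] at hx hy
    obtain ⟨u, -, rfl⟩ := hx
    obtain ⟨w, -, rfl⟩ := hy
    exact hG.nodepos u w hne hxy
  · intro i p c q h hc
    obtain ⟨u, b, w, h1, h2, rfl, rfl, rfl⟩ := exists_names_of_isConsecutive h
    exact hG.straight u b w h1 h2 hc

/-- The vertex name at which a half-open edge containing a given point of a closed edge starts. -/
lemma exists_halfOpenEdge {T : Fin n → List VertexName} {lab : VertexName → Option ℕ}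
    {pos : VertexName → Fin 3 → ℝ} {e : VertexName × VertexName} (he : e ∈ edgeSet T)
    {x : Fin 3 → ℝ} (hx : x ∈ edgeSegment pos e) :
    ∃ e' ∈ edgeSet T, x ∈ halfOpenEdge ((pos e'.1, lab e'.1), (pos e'.2, lab e'.2)) ∧
      (e' = e ∨ (e'.1 = e.2 ∧ x = pos e.2)) := by
  rcases (mem_segment_iff_halfOpenEdge ((pos e.1, lab e.1), (pos e.2, lab e.2)) x).1 hx with h | h
  · exact ⟨e, he, h, Or.inl rfl⟩
  · obtain ⟨w, hw⟩ := exists_next_edge (snd_mem_of_mem_edgeSet he)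
    exact ⟨(e.2, w), hw, h ▸ start_mem_halfOpenEdge ((pos e.2, lab e.2), (pos w, lab w)),
      Or.inr ⟨rfl, h⟩⟩

/-- An embedded graph is a good diagram. Its definition speaks of half-open edges, and proper
meeting of closed edges: a common end point of two closed edges is the initial point of the next
edges. -/
lemma good_of_embeddedGraph {T : Fin n → List VertexName} {lab : VertexName → Option ℕ}
    {pos : VertexName → Fin 3 → ℝ} (hT : Shape T lab) (G : EmbeddedGraph n)
    (hG : G.comp = diagram T lab pos) : Good (edgeSet T) lab pos := by
  have hnd : ∀ e ∈ edgeSet T, pos e.1 ≠ pos e.2 := by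
    intro e he
    have := G.edge_nondegenerate ((pos e.1, lab e.1), (pos e.2, lab e.2))
    rw [hG, allEdges_diagram] at this
    exact this (List.mem_map.2 ⟨e, mem_edgeList.2 he, rfl⟩)
  have hp := G.edges_disjoint
  rw [hG, allEdges_diagram, List.pairwise_map] at hp
  let Rel : VertexName × VertexName → VertexName × VertexName → Prop := fun e f =>
    ∀ x ∈ halfOpenEdge ((pos e.1, lab e.1), (pos e.2, lab e.2)) ∩
      halfOpenEdge ((pos f.1, lab f.1), (pos f.2, lab f.2)),
      x = pos e.1 ∧ x = pos f.1 ∧ lab e.1 = lab f.1 ∧ lab e.1 ≠ none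
  have hsymm : Std.Symm Rel := ⟨fun e f h x hx => by
    obtain ⟨h1, h2, h3, h4⟩ := h x ⟨hx.2, hx.1⟩
    exact ⟨h2, h1, h3.symm, h3 ▸ h4⟩⟩
  have hp' : ∀ e ∈ edgeSet T, ∀ f ∈ edgeSet T, e ≠ f → Rel e f := fun e he f hf hef =>
    List.Pairwise.forall (R := Rel) hp (mem_edgeList.2 he) (mem_edgeList.2 hf) hef
  refine ⟨hnd, ?_, ?_, ?_⟩
  · intro e he f hf hef x hxe hxf
    obtain ⟨e', he', hxe', h1⟩ := exists_halfOpenEdge (lab := lab) he hxe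
    obtain ⟨f', hf', hxf', h2⟩ := exists_halfOpenEdge (lab := lab) hf hxf
    by_cases h : e' = f'
    · subst h
      have hx' : ∀ g : VertexName × VertexName, (e' = g ∨ (e'.1 = g.2 ∧ x = pos g.2)) →
          e'.1 = g.1 ∨ e'.1 = g.2 := by
        rintro g (rfl | h) <;> tauto
      refine ⟨e'.1, e'.1, hx' e h1, hx' f h2, ?_, ?_, Or.inl rfl⟩ <;>
      · rcases h1 with rfl | ⟨h1, h1'⟩
        · rcases h2 with rfl | ⟨h2, h2'⟩
          · exact absurd rfl hef
          · rw [h2, h2']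
        · rw [h1, h1']
    · obtain ⟨h3, h4, h5, h6⟩ := hp' e' he' f' hf' h x ⟨hxe', hxf'⟩
      refine ⟨e'.1, f'.1, ?_, ?_, h3, h4, Or.inr ⟨h5, h6⟩⟩
      · rcases h1 with rfl | h1 <;> tauto
      · rcases h2 with rfl | h2 <;> tauto
  · rintro u b w hub hbw hb
    have hub' : u ≠ b := fun h => hnd _ hub (by simp [h])
    have hbw' : b ≠ w := fun h => hnd _ hbw (by simp [h])
    have huw' : u ≠ w := by
      rintro rfl
      have hm : midpoint ℝ (pos u) (pos b) ∈ halfOpenEdge ((pos u, lab u), (pos b, lab b)) := by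
        refine ⟨1 / 2, by norm_num, ?_⟩
        simp [AffineMap.lineMap_apply, midpoint_eq_smul_add]
        module
      have hm' : midpoint ℝ (pos u) (pos b) ∈ halfOpenEdge ((pos b, lab b), (pos u, lab u)) := by
        refine ⟨1 / 2, by norm_num, ?_⟩
        simp [AffineMap.lineMap_apply, midpoint_eq_smul_add]
        module
      obtain ⟨h1, h2, -⟩ := hp' (u, b) hub (b, u) hbw (by simp [hub']) _ ⟨hm, hm'⟩
      exact hnd _ hub (h1.symm.trans h2)
    obtain ⟨i, hi⟩ := hub
    obtain ⟨j, hj⟩ := hbw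
    obtain rfl := hT.disj i j b (snd_mem_of_mem_cyclicPairs hi) (fst_mem_of_mem_cyclicPairs hj)
    obtain ⟨t, ht⟩ := exists_isRotated_cons_cons_cons (hT.nodup i) hub' huw' hi hj
    refine G.node_straight i (pos u, lab u) (pos b, lab b) (pos w, lab w)
      ⟨t.map fun u => (pos u, lab u), ?_⟩ hb
    rw [hG]
    exact ht.map _
  · intro u w hu huw
    obtain ⟨i, hi⟩ := hT.supp u hu
    obtain ⟨j, hj⟩ := hT.supp w (huw ▸ hu)
    refine G.node_position i j (pos u, lab u) ?_ (pos w, lab w) ?_ huw hu <;>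
    · rw [hG, diagram, List.mem_map]
      exact ⟨_, by assumption, rfl⟩

/-- In a good diagram the two neighbours of a vertex are different. -/
lemma Good.prev_ne_next {E : Set (VertexName × VertexName)} {lab : VertexName → Option ℕ}
    {pos : VertexName → Fin 3 → ℝ} (h : Good E lab pos) {u b w : VertexName} (hu : (u, b) ∈ E)
    (hw : (b, w) ∈ E) : u ≠ w := by
  rintro rfl
  have hne := h.nondeg _ hu
  have hne' : (u, b) ≠ (b, u) := fun h' => hne (by simp only [Prod.mk.injEq] at h'; rw [h'.1])
  have hm1 : midpoint ℝ (pos u) (pos b) ∈ segment ℝ (pos u) (pos b) := midpoint_mem_segment _ _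
  have hm2 := hm1
  rw [segment_symm] at hm2
  obtain ⟨v, -, hv, -, hv', -⟩ := h.inter _ hu _ hw hne' _ hm1 hm2
  rcases hv with rfl | rfl
  · rw [midpoint_eq_left_iff] at hv'; exact hne hv'
  · rw [midpoint_eq_right_iff] at hv'; exact hne hv'

lemma EmbeddedGraph.mem_nodes_iff {T : Fin n → List VertexName} {lab : VertexName → Option ℕ}
    {pos : VertexName → Fin 3 → ℝ} (hT : Shape T lab) {G : EmbeddedGraph n}
    (hG : G.comp = diagram T lab pos) {a : ℕ} : a ∈ G.nodes ↔ ∃ u, lab u = some a := by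
  rw [EmbeddedGraph.nodes, hG, allLabels_diagram, List.mem_toFinset, List.mem_filterMap]
  constructor
  · rintro ⟨u, -, hu⟩; exact ⟨u, hu⟩
  · rintro ⟨u, hu⟩
    exact ⟨u, mem_nameList.2 (hT.supp u (by simp [hu])), hu⟩

lemma EmbeddedGraph.mem_support_iff {T : Fin n → List VertexName} {lab : VertexName → Option ℕ}
    {pos : VertexName → Fin 3 → ℝ} {G : EmbeddedGraph n}
    (hG : G.comp = diagram T lab pos) {x : Fin 3 → ℝ} :
    x ∈ G.support ↔ ∃ e ∈ edgeSet T, x ∈ edgeSegment pos e := by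
  rw [EmbeddedGraph.support, hG, allEdges_diagram]
  simp [mem_edgeList]

lemma EmbeddedGraph.nodes_card {T : Fin n → List VertexName} {lab : VertexName → Option ℕ}
    {pos : VertexName → Fin 3 → ℝ} (hT : Shape T lab) {G : EmbeddedGraph n}
    (hG : G.comp = diagram T lab pos) : G.nodes.card = {a | ∃ u, lab u = some a}.ncard := by
  rw [← Set.ncard_coe_finset]
  congr 1
  ext a
  simp [EmbeddedGraph.mem_nodes_iff hT hG]

open Classical in
/-- The value of `v` at a family of polygons, `0` unless this family is an embedded graph. -/
noncomputable def valueOf {R : Type*} [CommRing R] (v : EmbeddedGraph n → R)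
    (comp : Fin n → List MarkedPoint) : R :=
  if h : ∃ G : EmbeddedGraph n, G.comp = comp then v h.choose else 0

lemma valueOf_eq {R : Type*} [CommRing R] (v : EmbeddedGraph n → R) (G : EmbeddedGraph n)
    {comp : Fin n → List MarkedPoint} (hG : G.comp = comp) : valueOf v comp = v G := by
  have h : ∃ G : EmbeddedGraph n, G.comp = comp := ⟨G, hG⟩
  rw [valueOf, dif_pos h]
  congr 1
  ext1
  rw [h.choose_spec, hG]

end Diagram

/-! ### Segments and triangles -/

section Triangles

variable {V : Type*} [AddCommGroup V] [Module ℝ V]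

lemma mem_segment_iff_exists {a b x : V} :
    x ∈ segment ℝ a b ↔ ∃ t : ℝ, 0 ≤ t ∧ t ≤ 1 ∧ x = a + t • (b - a) := by
  rw [segment_eq_image']
  constructor
  · rintro ⟨t, ht, rfl⟩; exact ⟨t, ht.1, ht.2, rfl⟩
  · rintro ⟨t, h0, h1, rfl⟩; exact ⟨t, ⟨h0, h1⟩, rfl⟩

lemma mem_openSegment_iff_exists {a b x : V} :
    x ∈ openSegment ℝ a b ↔ ∃ t : ℝ, 0 < t ∧ t < 1 ∧ x = a + t • (b - a) := by
  rw [openSegment_eq_image']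
  constructor
  · rintro ⟨t, ht, rfl⟩; exact ⟨t, ht.1, ht.2, rfl⟩
  · rintro ⟨t, h0, h1, rfl⟩; exact ⟨t, ⟨h0, h1⟩, rfl⟩

/-- The closed triangle with vertices `a`, `b`, `c`. -/
def triangle (a b c : V) : Set V :=
  {x | ∃ s t : ℝ, 0 ≤ s ∧ 0 ≤ t ∧ s + t ≤ 1 ∧ x = a + s • (b - a) + t • (c - a)}

lemma convexHull_triple (a b c : V) : convexHull ℝ {a, b, c} = triangle a b c := by
  ext x
  rw [convexHull_insert (by simp), convexHull_pair]
  simp only [convexJoin_singleton_left, Set.mem_iUnion, exists_prop, triangle, Set.mem_ofPred_eq,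
    mem_segment_iff_exists]
  constructor
  · rintro ⟨y, ⟨t, h0, h1, rfl⟩, r, hr0, hr1, rfl⟩
    refine ⟨r * (1 - t), r * t, by nlinarith, by nlinarith, by nlinarith, by module⟩
  · rintro ⟨s, t, hs, ht, hst, rfl⟩
    rcases eq_or_lt_of_le (add_nonneg hs ht) with h | h
    · have hs' : s = 0 := by linarith
      have ht' : t = 0 := by linarith
      subst hs' ht'
      exact ⟨b, ⟨0, le_rfl, zero_le_one, by simp⟩, 0, le_rfl, zero_le_one, by simp⟩
    · refine ⟨b + (t / (s + t)) • (c - b), ⟨t / (s + t), by positivity, ?_, rfl⟩, s + t, h.le, hst,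
        ?_⟩
      · rw [div_le_one h]; linarith
      · have h2 : (s + t) * (t / (s + t)) = t := by field_simp
        calc a + s • (b - a) + t • (c - a)
            = a + (s + t) • (b - a) + t • (c - b) := by module
          _ = a + (s + t) • (b - a) + ((s + t) * (t / (s + t))) • (c - b) := by rw [h2]
          _ = _ := by module

lemma LinearIndependent.coeff_eq {u w : V} (h : LinearIndependent ℝ ![u, w]) {s t s' t' : ℝ}
    (h' : s • u + t • w = s' • u + t' • w) : s = s' ∧ t = t' := by
  rw [LinearIndependent.pair_iff] at h
  have := h (s - s') (t - t') (by
    have : (s - s') • u + (t - t') • w = (s • u + t • w) - (s' • u + t' • w) := by module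
    rw [this, h', sub_self])
  constructor <;> linarith

lemma left_mem_triangle (a b c : V) : a ∈ triangle a b c :=
  ⟨0, 0, le_rfl, le_rfl, by norm_num, by simp⟩

lemma segment_subset_triangle_left (a b c : V) : segment ℝ a c ⊆ triangle a b c := by
  intro x hx
  obtain ⟨t, h0, h1, rfl⟩ := mem_segment_iff_exists.1 hx
  exact ⟨0, t, le_rfl, h0, by linarith, by simp⟩

lemma segment_subset_triangle_base (a b c : V) : segment ℝ a b ⊆ triangle a b c := by
  intro x hx
  obtain ⟨t, h0, h1, rfl⟩ := mem_segment_iff_exists.1 hx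
  exact ⟨t, 0, h0, le_rfl, by linarith, by simp⟩

lemma segment_subset_triangle_right (a b c : V) : segment ℝ c b ⊆ triangle a b c := by
  intro x hx
  obtain ⟨t, h0, h1, rfl⟩ := mem_segment_iff_exists.1 hx
  exact ⟨t, 1 - t, h0, by linarith, by linarith, by module⟩

lemma triangle_swap (a b c : V) : triangle a b c = triangle b a c := by
  rw [← convexHull_triple, ← convexHull_triple, Set.insert_comm]

lemma triangle_comm (a b c : V) : triangle a b c = triangle a c b := by
  rw [← convexHull_triple, ← convexHull_triple, Set.pair_comm]

lemma LinearIndependent.swap_base {a b c : V} (h : LinearIndependent ℝ ![b - a, c - a]) :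
    LinearIndependent ℝ ![a - b, c - b] := by
  rw [LinearIndependent.pair_iff] at h ⊢
  intro s t hst
  have := h (-s - t) t (by rw [← hst]; module)
  constructor <;> linarith

/-- Two sides of a nondegenerate triangle meet only in their common vertex. -/
lemma eq_of_mem_sides {a b c x : V} (h : LinearIndependent ℝ ![b - a, c - a])
    (h1 : x ∈ segment ℝ a b) (h2 : x ∈ segment ℝ a c) : x = a := by
  obtain ⟨s, -, -, rfl⟩ := mem_segment_iff_exists.1 h1
  obtain ⟨t, -, -, h3⟩ := mem_segment_iff_exists.1 h2
  have := h.coeff_eq (s := s) (t := 0) (s' := 0) (t' := t) (by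
    simpa using h3)
  simp [this.1]

lemma eq_of_mem_sides_right {a b c x : V} (h : LinearIndependent ℝ ![b - a, c - a])
    (h1 : x ∈ segment ℝ a b) (h2 : x ∈ segment ℝ c b) : x = b := by
  rw [segment_symm] at h1 h2
  exact eq_of_mem_sides h.swap_base h1 h2

lemma eq_of_mem_sides_apex {a b c x : V} (h : LinearIndependent ℝ ![b - a, c - a])
    (h1 : x ∈ segment ℝ a c) (h2 : x ∈ segment ℝ c b) : x = c := by
  have h' : LinearIndependent ℝ ![a - c, b - c] := by
    rw [LinearIndependent.pair_iff] at h ⊢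
    intro s t hst
    have := h t (-s - t) (by rw [← hst]; module)
    constructor <;> linarith
  rw [segment_symm] at h1
  exact eq_of_mem_sides h' h1 h2

lemma LinearIndependent.triangle_ne {a b c : V} (h : LinearIndependent ℝ ![b - a, c - a]) :
    a ≠ b ∧ a ≠ c ∧ c ≠ b := by
  rw [LinearIndependent.pair_iff] at h
  refine ⟨?_, ?_, ?_⟩
  · rintro rfl
    exact one_ne_zero (h 1 0 (by simp)).1
  · rintro rfl
    exact one_ne_zero (h 0 1 (by simp)).2
  · rintro rfl
    exact one_ne_zero (h 1 (-1) (by simp)).1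

end Triangles

/-! ### Inserting a vertex into a good diagram -/

section Insertion

variable {E : Set (VertexName × VertexName)} {lab : VertexName → Option ℕ}
  {pos : VertexName → Fin 3 → ℝ} {a b c : VertexName}

/-- Adding an edge to a good set of edges. -/
lemma Good.insert (h : Good E lab pos) {e : VertexName × VertexName} (hnd : pos e.1 ≠ pos e.2)
    (hm : ∀ f ∈ E, f ≠ e → MeetProperly lab pos e f)
    (h1 : ∀ u, (u, e.1) ∈ E → lab e.1 ≠ none → pos e.1 ∈ openSegment ℝ (pos u) (pos e.2))
    (h2 : ∀ w, (e.2, w) ∈ E → lab e.2 ≠ none → pos e.2 ∈ openSegment ℝ (pos e.1) (pos w)) :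
    Good (insert e E) lab pos := by
  refine ⟨?_, ?_, ?_, h.nodepos⟩
  · rintro f (rfl | hf)
    · exact hnd
    · exact h.nondeg f hf
  · rintro f (rfl | hf) g (rfl | hg) hfg
    · exact absurd rfl hfg
    · exact hm g hg hfg.symm
    · exact (hm f hf hfg).symm
    · exact h.inter f hf g hg hfg
  · rintro u x w (rfl | hu) (hw | hw) hx
    · simp only [Prod.mk.injEq] at hw
      exact absurd (by simp [hw.1]) hnd
    · exact h2 w hw hx
    · subst hw
      exact h1 u hu hx
    · exact h.straight u x w hu hw hx

/-- The conditions under which an edge `a b` may be replaced by `a c`, `c b`. If `a` or `b` is a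
passage through a node, the strand has to remain straight there. -/
lemma Good.insertion_of_meet (h : Good E lab pos) (hab : (a, b) ∈ E)
    (hc : ∀ e ∈ E, e.1 ≠ c ∧ e.2 ≠ c)
    (hlc : lab c = none) (hac : pos a ≠ pos c) (hcb : pos c ≠ pos b)
    (h1 : ∀ f ∈ E, f ≠ (a, b) → MeetProperly lab pos (a, c) f)
    (h2 : ∀ f ∈ E, f ≠ (a, b) → MeetProperly lab pos (c, b) f)
    (h3 : ∀ x ∈ segment ℝ (pos a) (pos c), x ∈ segment ℝ (pos c) (pos b) → x = pos c)
    (h4 : ∀ u, (u, a) ∈ E → lab a ≠ none → pos a ∈ openSegment ℝ (pos u) (pos c))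
    (h5 : ∀ w, (b, w) ∈ E → lab b ≠ none → pos b ∈ openSegment ℝ (pos c) (pos w)) :
    Good (Insert.insert (a, c) (Insert.insert (c, b) (E \ {(a, b)}))) lab pos := by
  have hb : Good (Insert.insert (c, b) (E \ {(a, b)})) lab pos := by
    refine (h.mono Set.sdiff_subset).insert hcb (fun f hf _ => h2 f hf.1 hf.2) ?_ ?_
    · intro u hu
      exact absurd rfl (hc _ hu.1).2
    · intro w hw
      exact h5 w hw.1
  refine hb.insert hac ?_ ?_ ?_
  · rintro f (rfl | hf) -
    · intro x hx hx'
      exact ⟨c, c, by simp, by simp, h3 x hx hx', h3 x hx hx', Or.inl rfl⟩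
    · exact h1 f hf.1 hf.2
  · rintro u (hu | hu)
    · simp only [Prod.mk.injEq] at hu
      exact absurd (congrArg pos hu.2) (h.nondeg _ hab)
    · exact h4 u hu.1
  · intro w _ hlc'
    exact absurd hlc hlc'

/-- An edge may be subdivided, even if it ends at a node: strands remain straight there. -/
lemma Good.subdivide (h : Good E lab pos) (hab : (a, b) ∈ E) (hc : ∀ e ∈ E, e.1 ≠ c ∧ e.2 ≠ c)
    (hlc : lab c = none) (hC : pos c ∈ openSegment ℝ (pos a) (pos b)) :
    Good (Insert.insert (a, c) (Insert.insert (c, b) (E \ {(a, b)}))) lab pos := by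
  have hne : pos a ≠ pos b := h.nondeg _ hab
  obtain ⟨t, ht0, ht1, hC⟩ := mem_openSegment_iff_exists.1 hC
  have hd : pos b - pos a ≠ 0 := sub_ne_zero.2 hne.symm
  have hac : ∀ x ∈ segment ℝ (pos a) (pos c), x ∈ segment ℝ (pos a) (pos b) ∧ x ≠ pos b := by
    intro x hx
    obtain ⟨s, hs0, hs1, rfl⟩ := mem_segment_iff_exists.1 hx
    refine ⟨mem_segment_iff_exists.2 ⟨s * t, by positivity, by nlinarith, by rw [hC]; module⟩, ?_⟩
    intro h'
    have : (1 - s * t) • (pos b - pos a) = 0 := by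
      rw [hC] at h'
      calc (1 - s * t) • (pos b - pos a)
          = pos b - (pos a + s • (pos a + t • (pos b - pos a) - pos a)) := by module
        _ = 0 := by rw [h']; simp
    rcases smul_eq_zero.1 this with h'' | h''
    · nlinarith
    · exact hd h''
  have hcb : ∀ x ∈ segment ℝ (pos c) (pos b), x ∈ segment ℝ (pos a) (pos b) ∧ x ≠ pos a := by
    intro x hx
    obtain ⟨s, hs0, hs1, rfl⟩ := mem_segment_iff_exists.1 hx
    refine ⟨mem_segment_iff_exists.2 ⟨t + s * (1 - t), by nlinarith, by nlinarith,
      by rw [hC]; module⟩, ?_⟩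
    intro h'
    have : (t + s * (1 - t)) • (pos b - pos a) = 0 := by
      rw [hC] at h'
      calc (t + s * (1 - t)) • (pos b - pos a)
          = (pos a + t • (pos b - pos a) + s • (pos b - (pos a + t • (pos b - pos a))))
            - pos a := by module
        _ = 0 := by rw [h']; simp
    rcases smul_eq_zero.1 this with h'' | h''
    · nlinarith
    · exact hd h''
  refine h.insertion_of_meet hab hc hlc ?_ ?_ ?_ ?_ ?_ ?_ ?_
  · intro h'
    exact (hcb (pos c) (left_mem_segment _ _ _)).2 h'.symm
  · exact (hac (pos c) (right_mem_segment _ _ _)).2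
  · intro f hf hfe x hx hxf
    obtain ⟨u, w, hu, hw, hxu, hxw, huw⟩ := h.inter (a, b) hab f hf hfe.symm x (hac x hx).1 hxf
    rcases hu with hu | hu
    · exact ⟨u, w, Or.inl hu, hw, hxu, hxw, huw⟩
    · exact absurd (hxu.trans (congrArg pos hu)) (hac x hx).2
  · intro f hf hfe x hx hxf
    obtain ⟨u, w, hu, hw, hxu, hxw, huw⟩ := h.inter (a, b) hab f hf hfe.symm x (hcb x hx).1 hxf
    rcases hu with hu | hu
    · exact absurd (hxu.trans (congrArg pos hu)) (hcb x hx).2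
    · exact ⟨u, w, Or.inr hu, hw, hxu, hxw, huw⟩
  · intro x hx hx'
    obtain ⟨s, hs0, hs1, rfl⟩ := mem_segment_iff_exists.1 hx
    obtain ⟨r, hr0, hr1, h'⟩ := mem_segment_iff_exists.1 hx'
    have : (s * t - (t + r * (1 - t))) • (pos b - pos a) = 0 := by
      rw [hC] at h'
      calc (s * t - (t + r * (1 - t))) • (pos b - pos a)
          = (pos a + s • (pos a + t • (pos b - pos a) - pos a)) -
            (pos a + t • (pos b - pos a) + r • (pos b - (pos a + t • (pos b - pos a)))) := by module
        _ = 0 := by rw [h']; simp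
    rcases smul_eq_zero.1 this with h'' | h''
    · have : s = 1 := by nlinarith
      simp [this]
    · exact absurd h'' hd
  · intro u hu hla
    obtain ⟨r, hr0, hr1, hA⟩ := mem_openSegment_iff_exists.1 (h.straight u a b hu hab hla)
    rw [mem_openSegment_iff_div]
    refine ⟨t * (1 - r), r, mul_pos ht0 (by linarith), hr0, ?_⟩
    have hpos : 0 < t * (1 - r) + r := add_pos (mul_pos ht0 (by linarith)) hr0
    have hA' : (1 - r) • (pos a - pos u) = r • (pos b - pos a) := by
      have h3 : pos a - pos u = r • (pos b - pos u) := by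
        conv_lhs => rw [hA]
        simp
      have h4 : r • (pos b - pos a) = r • (pos b - pos u) - r • (pos a - pos u) := by module
      rw [h4, ← h3]; module
    have h5 : pos u = pos a - (r / (1 - r)) • (pos b - pos a) := by
      have : pos a - pos u = (r / (1 - r)) • (pos b - pos a) := by
        rw [div_eq_inv_mul, mul_smul, ← hA', smul_smul, inv_mul_cancel₀ (by linarith), one_smul]
      rw [← this]; simp
    rw [hC, h5]
    have h6 : (1 - r) ≠ 0 := by linarith
    match_scalars <;> field_simp <;> ring
  · intro w hw hlb
    obtain ⟨r, hr0, hr1, hB⟩ := mem_openSegment_iff_exists.1 (h.straight a b w hab hw hlb)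
    rw [mem_openSegment_iff_div]
    refine ⟨(1 - r), r * (1 - t), by linarith, mul_pos hr0 (by linarith), ?_⟩
    have hpos : 0 < 1 - r + r * (1 - t) := add_pos (by linarith) (mul_pos hr0 (by linarith))
    have h5 : pos w = pos a + (1 / r) • (pos b - pos a) := by
      have : pos b - pos a = r • (pos w - pos a) := by
        conv_lhs => rw [hB]
        simp
      rw [this, smul_smul, one_div, inv_mul_cancel₀ hr0.ne', one_smul]; simp
    rw [hC, h5]
    match_scalars <;> field_simp <;> ring

/-- Inserting the apex of a triangle two of whose sides do not meet the rest of the diagram. -/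
lemma Good.insert_apex (h : Good E lab pos) (hab : (a, b) ∈ E)
    (hc : ∀ e ∈ E, e.1 ≠ c ∧ e.2 ≠ c) (hlc : lab c = none) (hla : lab a = none)
    (hlb : lab b = none) (hli : LinearIndependent ℝ ![pos b - pos a, pos c - pos a])
    (hd : ∀ f ∈ E, f ≠ (a, b) → ∀ x ∈ edgeSegment pos f,
      x ∈ segment ℝ (pos a) (pos c) ∨ x ∈ segment ℝ (pos c) (pos b) → x = pos a ∨ x = pos b) :
    Good (Insert.insert (a, c) (Insert.insert (c, b) (E \ {(a, b)}))) lab pos := by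
  obtain ⟨hne1, hne2, hne3⟩ := hli.triangle_ne
  refine h.insertion_of_meet hab hc hlc hne2 hne3 ?_ ?_ (fun x => eq_of_mem_sides_apex hli)
    (fun _ _ h => absurd hla h) (fun _ _ h => absurd hlb h)
  · intro f hf hfe x hx hxf
    have hxA : x = pos a := by
      rcases hd f hf hfe x hxf (Or.inl hx) with h' | h'
      · exact h'
      · exact eq_of_mem_sides hli (h' ▸ right_mem_segment ℝ (pos a) (pos b)) hx
    obtain ⟨u, w, hu, hw, hxu, hxw, huw⟩ := h.inter (a, b) hab f hf hfe.symm x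
      (hxA ▸ left_mem_segment ℝ (pos a) (pos b)) hxf
    rcases hu with hu | hu
    · exact ⟨u, w, Or.inl hu, hw, hxu, hxw, huw⟩
    · exact absurd (hxA.symm.trans (hxu.trans (congrArg pos hu))) hne1
  · intro f hf hfe x hx hxf
    have hxB : x = pos b := by
      rcases hd f hf hfe x hxf (Or.inr hx) with h' | h'
      · exact eq_of_mem_sides_right hli (h' ▸ left_mem_segment ℝ (pos a) (pos b)) hx
      · exact h'
    obtain ⟨u, w, hu, hw, hxu, hxw, huw⟩ := h.inter (a, b) hab f hf hfe.symm x
      (hxB ▸ right_mem_segment ℝ (pos a) (pos b)) hxf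
    rcases hu with hu | hu
    · exact absurd ((hxu.trans (congrArg pos hu)).symm.trans hxB) hne1
    · exact ⟨u, w, Or.inr hu, hw, hxu, hxw, huw⟩

/-- Inserting the apex of a triangle that meets the rest of the diagram only in its base. -/
lemma Good.insert_apex_of_triangle (h : Good E lab pos) (hab : (a, b) ∈ E)
    (hc : ∀ e ∈ E, e.1 ≠ c ∧ e.2 ≠ c) (hlc : lab c = none) (hla : lab a = none)
    (hlb : lab b = none) (hli : LinearIndependent ℝ ![pos b - pos a, pos c - pos a])
    (hd : ∀ f ∈ E, f ≠ (a, b) → ∀ x ∈ edgeSegment pos f,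
      x ∈ triangle (pos a) (pos b) (pos c) → x ∈ segment ℝ (pos a) (pos b)) :
    Good (Insert.insert (a, c) (Insert.insert (c, b) (E \ {(a, b)}))) lab pos := by
  refine h.insert_apex hab hc hlc hla hlb hli fun f hf hfe x hxf hx => ?_
  rcases hx with hx | hx
  · exact Or.inl (eq_of_mem_sides hli
      (hd f hf hfe x hxf (segment_subset_triangle_left _ _ _ hx)) hx)
  · exact Or.inr (eq_of_mem_sides_right hli
      (hd f hf hfe x hxf (segment_subset_triangle_right _ _ _ hx)) hx)

lemma IsInsertion.edgeSet_eq {n : ℕ} {π : Equiv.Perm (Fin n)} {T T' : Fin n → List VertexName}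
    (h : IsInsertion π T T' a c b) (hT : Shape T lab) :
    edgeSet T' = Insert.insert (a, c) (Insert.insert (c, b) (edgeSet T \ {(a, b)})) := by
  ext e
  rw [h.mem_edgeSet hT]
  simp only [Set.mem_insert_iff, Set.mem_sdiff, Set.mem_singleton_iff]
  tauto

lemma notMem_edge_of_fresh {n : ℕ} {T : Fin n → List VertexName} (hc : ∀ i, c ∉ T i) :
    ∀ e ∈ edgeSet T, e.1 ≠ c ∧ e.2 ≠ c := by
  intro e he
  obtain ⟨i, hi⟩ := fst_mem_of_mem_edgeSet he
  obtain ⟨j, hj⟩ := snd_mem_of_mem_edgeSet he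
  exact ⟨fun h => hc i (h ▸ hi), fun h => hc j (h ▸ hj)⟩

lemma Shape.lab_fresh {n : ℕ} {T : Fin n → List VertexName} (hT : Shape T lab)
    (hc : ∀ i, c ∉ T i) : lab c = none := by
  by_contra h
  obtain ⟨i, hi⟩ := hT.supp c h
  exact hc i hi

lemma IsInsertion.mem_edge {n : ℕ} {π : Equiv.Perm (Fin n)} {T T' : Fin n → List VertexName}
    (h : IsInsertion π T T' a c b) : (a, b) ∈ edgeSet T := by
  obtain ⟨i, t, ht, -, -⟩ := h
  exact ⟨i, ht.mem_cyclicPairs.2 (by simp [cyclicPairs_cons])⟩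

/-- The position of a vertex not occurring in the diagram is irrelevant. -/
lemma Good.congr {pos' : VertexName → Fin 3 → ℝ} (h : Good E lab pos)
    (h1 : ∀ e ∈ E, pos' e.1 = pos e.1 ∧ pos' e.2 = pos e.2)
    (h2 : ∀ u, lab u ≠ none → pos' u = pos u) : Good E lab pos' := by
  refine ⟨?_, ?_, ?_, ?_⟩
  · intro e he
    rw [(h1 e he).1, (h1 e he).2]
    exact h.nondeg e he
  · intro e he f hf hef x hx hx'
    rw [edgeSegment, (h1 e he).1, (h1 e he).2] at hx
    rw [edgeSegment, (h1 f hf).1, (h1 f hf).2] at hx'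
    obtain ⟨u, w, hu, hw, hxu, hxw, huw⟩ := h.inter e he f hf hef x hx hx'
    refine ⟨u, w, hu, hw, ?_, ?_, huw⟩
    · rcases hu with rfl | rfl
      · rw [(h1 e he).1, hxu]
      · rw [(h1 e he).2, hxu]
    · rcases hw with rfl | rfl
      · rw [(h1 f hf).1, hxw]
      · rw [(h1 f hf).2, hxw]
  · intro u b w hu hw hb
    rw [(h1 _ hu).1, (h1 _ hu).2, (h1 _ hw).2]
    exact h.straight u b w hu hw hb
  · intro u w hu huw
    rw [h2 u hu, h2 w (huw ▸ hu)]
    exact h.nodepos u w hu huw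

end Insertion

/-! ### Resolving a node -/

section Resolution

variable {n : ℕ}

lemma isRotated_of_eq {α : Type*} {l l' : List α} (h : l = l') : l ~r l' := h ▸ List.IsRotated.refl l

lemma List.IsRotated.tail_eq {α : Type*} {b : α} {m m' : List α} (h : (b :: m) ~r (b :: m'))
    (hn : (b :: m).Nodup) : m = m' := by
  obtain ⟨k, hk⟩ := h
  have hlen : 0 < (b :: m).length := by simp
  rw [← List.rotate_mod] at hk
  have hlt : k % (b :: m).length < (b :: m).length := Nat.mod_lt _ hlen
  generalize k % (b :: m).length = r at hk hlt
  have h0 : (b :: m)[r] = b := by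
    have := congrArg List.head? hk
    rw [List.head?_rotate hlt] at this
    simpa [List.getElem?_eq_getElem hlt] using this
  have h1 : (b :: m)[r] = (b :: m)[0] := by rw [h0]; rfl
  have : r = 0 := (List.Nodup.getElem_inj_iff hn).1 h1
  subst this
  simpa using hk

/-- `T'` is obtained from `T` by inserting names `x` and `y` just before and just after `b`. -/
def IsBypass (T T' : Fin n → List VertexName) (x b y : VertexName) : Prop :=
  ∃ i m, T i ~r (b :: m) ∧ T' i ~r (x :: b :: y :: m) ∧ ∀ j, j ≠ i → T' j ~r T j

lemma exists_isBypass {T : Fin n → List VertexName} {b : VertexName} (hb : ∃ i, b ∈ T i)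
    (x y : VertexName) : ∃ T', IsBypass T T' x b y := by
  obtain ⟨i, hi⟩ := hb
  obtain ⟨m, hm⟩ := exists_isRotated_cons hi
  refine ⟨Function.update T i (x :: b :: y :: m), i, m, hm, by simp [List.IsRotated.refl],
    fun j hj => ?_⟩
  simp [hj, List.IsRotated.refl]

variable {T T' T₂ : Fin n → List VertexName} {lab : VertexName → Option ℕ}
  {pos : VertexName → Fin 3 → ℝ} {p q x b y a c : VertexName} {π : Equiv.Perm (Fin n)}

lemma IsBypass.exists_list (h : IsBypass T T₂ x b y) (hT : Shape T lab) (hpb : p ≠ b) (hpq : p ≠ q)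
    (hp : (p, b) ∈ edgeSet T) (hq : (b, q) ∈ edgeSet T) :
    ∃ i t, T i ~r (p :: b :: q :: t) ∧ T₂ i ~r (p :: x :: b :: y :: q :: t) ∧
      ∀ j, j ≠ i → T₂ j ~r T j := by
  obtain ⟨i, m, hi, hi', hj⟩ := h
  have hbi : b ∈ T i := hi.mem_iff.2 (by simp)
  obtain ⟨j, hpj⟩ := hp
  obtain rfl := hT.disj i j b hbi (snd_mem_of_mem_cyclicPairs hpj)
  obtain ⟨k, hqk⟩ := hq
  obtain rfl := hT.disj i k b hbi (fst_mem_of_mem_cyclicPairs hqk)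
  obtain ⟨t, ht⟩ := exists_isRotated_cons_cons_cons (hT.nodup i) hpb hpq hpj hqk
  refine ⟨i, t, ht, ?_, hj⟩
  have h1 : (b :: m) ~r (b :: (q :: t ++ [p])) :=
    hi.symm.trans (ht.trans (List.isRotated_append (l := [p]) (l' := b :: q :: t)))
  obtain rfl := h1.tail_eq (hi.nodup_iff.1 (hT.nodup i))
  exact hi'.trans (List.isRotated_append (l := [p]) (l' := x :: b :: y :: q :: t)).symm

lemma IsBypass.exists_isInsertion (h : IsBypass T T₂ x b y) (hT : Shape T lab) (hpb : p ≠ b)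
    (hpq : p ≠ q) (hp : (p, b) ∈ edgeSet T) (hq : (b, q) ∈ edgeSet T) :
    ∃ T₁, IsInsertion 1 T T₁ p x b ∧ IsInsertion 1 T₁ T₂ b y q := by
  obtain ⟨i, t, hi, hi', hj⟩ := h.exists_list hT hpb hpq hp hq
  refine ⟨Function.update T i (p :: x :: b :: q :: t),
    ⟨i, q :: t, hi, by simp [List.IsRotated.refl], fun j hji => by simp [hji, List.IsRotated.refl]⟩,
    ⟨i, t ++ [p, x], ?_, ?_, fun j hji => ?_⟩⟩
  · simpa using List.isRotated_append (l := [p, x]) (l' := b :: q :: t)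
  · exact hi'.trans (by simpa using List.isRotated_append (l := [p, x]) (l' := b :: y :: q :: t))
  · simpa [hji] using hj j hji

/-- Bypassing a vertex commutes with an insertion elsewhere. -/
lemma IsInsertion.exists_bypass {b₀ : VertexName} (h : IsInsertion π T T' a c b) (hT : Shape T lab)
    (hba : b₀ ≠ a) (hbb : b₀ ≠ b) (h₂ : IsBypass T T₂ x b₀ y) :
    ∃ T₂', IsBypass T' T₂' x b₀ y ∧ IsInsertion π T₂ T₂' a c b := by
  obtain ⟨i, t, hi, hi', hj⟩ := h
  obtain ⟨k, m, hk, hk', hl⟩ := h₂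
  by_cases hki : k = i
  · subst hki
    have hbt : b₀ ∈ t := by
      have : b₀ ∈ a :: b :: t := hi.mem_iff.1 (hk.mem_iff.2 (by simp))
      simp only [List.mem_cons] at this
      tauto
    obtain ⟨t₁, t₂, rfl⟩ := List.append_of_mem hbt
    have h1 : (b₀ :: m) ~r (b₀ :: (t₂ ++ a :: b :: t₁)) := hk.symm.trans (hi.trans (by
      simpa using List.isRotated_append (l := a :: b :: t₁) (l' := b₀ :: t₂)))
    obtain rfl := h1.tail_eq (hk.nodup_iff.1 (hT.nodup k))
    refine ⟨Function.update T' (π k) (x :: b₀ :: y :: (t₂ ++ a :: c :: b :: t₁)),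
      ⟨π k, t₂ ++ a :: c :: b :: t₁, hi'.trans ?_, by simp [List.IsRotated.refl],
        fun j hjk => by simp [hjk, List.IsRotated.refl]⟩,
      ⟨k, t₁ ++ x :: b₀ :: y :: t₂, hk'.trans ?_, ?_, fun j hjk => ?_⟩⟩
    · simpa using List.isRotated_append (l := a :: c :: b :: t₁) (l' := b₀ :: t₂)
    · simpa using List.isRotated_append (l := x :: b₀ :: y :: t₂) (l' := a :: b :: t₁)
    · simpa using List.isRotated_append (l := x :: b₀ :: y :: t₂) (l' := a :: c :: b :: t₁)
    · simpa [hjk] using (hj j hjk).trans (hl j hjk).symm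
  · refine ⟨Function.update T' (π k) (x :: b₀ :: y :: m),
      ⟨π k, m, (hj k hki).trans hk, by simp [List.IsRotated.refl],
        fun j hjk => by simp [hjk, List.IsRotated.refl]⟩,
      ⟨i, t, (hl i (Ne.symm hki)).trans hi, ?_, fun j hji => ?_⟩⟩
    · have : π i ≠ π k := fun h => hki (π.injective h).symm
      simpa [this] using hi'
    · by_cases hjk : j = k
      · subst hjk
        simpa using hk'.symm
      · have : π j ≠ π k := fun h => hjk (π.injective h)
        simpa [hjk] using (hj j hji).trans (hl j hjk).symm

/-- The labelling after the node `a` has been removed. -/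
def eraseLabel (a : ℕ) (lab : VertexName → Option ℕ) : VertexName → Option ℕ :=
  fun u => if lab u = some a then none else lab u

lemma eraseLabel_eq {a : ℕ} {lab : VertexName → Option ℕ} {u : VertexName}
    (h : eraseLabel a lab u ≠ none) : eraseLabel a lab u = lab u ∧ lab u ≠ some a := by
  unfold eraseLabel at *
  split_ifs at * <;> simp_all

lemma eraseLabel_of_ne {a : ℕ} {lab : VertexName → Option ℕ} {u : VertexName}
    (h : lab u ≠ some a) : eraseLabel a lab u = lab u := by
  simp [eraseLabel, h]

lemma eraseLabel_of_none {a : ℕ} {lab : VertexName → Option ℕ} {u : VertexName}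
    (h : lab u = none) : eraseLabel a lab u = none := by
  simp [eraseLabel, h]

lemma Shape.eraseLabel (h : Shape T lab) (a : ℕ) : Shape T (eraseLabel a lab) := by
  refine ⟨h.ne_nil, h.nodup, h.disj, fun u hu => h.supp u ?_, fun u hu => ?_⟩
  · exact fun h0 => hu (eraseLabel_of_none h0)
  · obtain ⟨h1, h2⟩ := eraseLabel_eq hu
    obtain ⟨u', hne, hl, hall⟩ := h.two u (h1 ▸ hu)
    refine ⟨u', hne, ?_, fun w hw => hall w ?_⟩
    · rw [eraseLabel_of_ne (hl ▸ h2), h1, hl]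
    · have hw' : _root_.eraseLabel a lab w ≠ none := by rw [hw]; exact hu
      exact (eraseLabel_eq hw').1.symm.trans (hw.trans h1)

lemma setOf_eraseLabel (a : ℕ) (lab : VertexName → Option ℕ) :
    {k | ∃ u, eraseLabel a lab u = some k} = {k | ∃ u, lab u = some k} \ {a} := by
  ext k
  simp only [Set.mem_ofPred_eq, Set.mem_sdiff, Set.mem_singleton_iff]
  constructor
  · rintro ⟨u, hu⟩
    obtain ⟨h1, h2⟩ := eraseLabel_eq (a := a) (lab := lab) (u := u) (by simp [hu])
    refine ⟨⟨u, h1 ▸ hu⟩, ?_⟩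
    rintro rfl
    exact h2 (h1 ▸ hu)
  · rintro ⟨⟨u, hu⟩, hk⟩
    exact ⟨u, by rw [eraseLabel_of_ne (by simp [hu, hk]), hu]⟩

set_option maxHeartbeats 1000000 in
/-- Pushing one strand off a node, within a triangle that meets the diagram only in its base, gives
a good diagram. -/
lemma Good.resolve {a : ℕ} {ζ : Fin 3 → ℝ} (hG : Good (edgeSet T) lab pos) (hT : Shape T lab)
    (hb : lab b = some a) (hp : (p, b) ∈ edgeSet T) (hq : (b, q) ∈ edgeSet T)
    (h₂ : IsBypass T T₂ x b y) (hx : ∀ i, x ∉ T i) (hy : ∀ i, y ∉ T i) (hxy : x ≠ y)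
    (hX : pos x ∈ openSegment ℝ (pos p) (pos b)) (hY : pos y ∈ openSegment ℝ (pos b) (pos q))
    (hli : LinearIndependent ℝ ![pos y - pos x, ζ - pos x])
    (hd : ∀ f ∈ edgeSet T, ∀ z ∈ edgeSegment pos f, z ∈ triangle (pos x) (pos y) ζ →
      z ∈ segment ℝ (pos x) (pos y)) :
    Shape T₂ (eraseLabel a lab) ∧
      Good (edgeSet T₂) (eraseLabel a lab) (Function.update pos b ζ) := by
  have hpb : p ≠ b := fun h => hG.nondeg _ hp (by simp [h])
  have hbq : b ≠ q := fun h => hG.nondeg _ hq (by simp [h])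
  obtain ⟨T₁, hins1, hins2⟩ := h₂.exists_isInsertion hT hpb (hG.prev_ne_next hp hq) hp hq
  have hlx := hT.lab_fresh hx
  have hly := hT.lab_fresh hy
  have hT₁ := hins1.shape hT hx
  have hy₁ : ∀ i, y ∉ T₁ i := by
    intro i hi
    rcases hins1.mem_names.1 ⟨i, hi⟩ with ⟨j, hj⟩ | h
    · exact hy j hj
    · exact hxy h.symm
  have hT₂ := hins2.shape hT₁ hy₁
  have hG₁ : Good (edgeSet T₁) lab pos := by
    rw [hins1.edgeSet_eq hT]
    exact hG.subdivide hp (notMem_edge_of_fresh hx) hlx hX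
  have hG₂ : Good (edgeSet T₂) lab pos := by
    rw [hins2.edgeSet_eq hT₁]
    exact hG₁.subdivide hins2.mem_edge (notMem_edge_of_fresh hy₁) hly hY
  have hbx : b ≠ x := fun h => by obtain ⟨i, hi⟩ := hT.supp b (by simp [hb]); exact hx i (h ▸ hi)
  have hby : b ≠ y := fun h => by obtain ⟨i, hi⟩ := hT.supp b (by simp [hb]); exact hy i (h ▸ hi)
  have hE : ∀ e, e ∈ edgeSet T₂ ↔ e = (b, y) ∨ e = (y, q) ∨ e = (p, x) ∨ e = (x, b) ∨
      (e ∈ edgeSet T ∧ e ≠ (p, b) ∧ e ≠ (b, q)) := by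
    intro e
    rw [hins2.mem_edgeSet hT₁, hins1.mem_edgeSet hT]
    have h1 : e = (p, x) → e ≠ (b, q) := by rintro rfl h; exact hpb (congrArg Prod.fst h)
    have h2 : e = (x, b) → e ≠ (b, q) := by rintro rfl h; exact hbx (congrArg Prod.fst h).symm
    tauto
  set E₀ : Set (VertexName × VertexName) := edgeSet T₂ \ {(x, b), (b, y)} with hE₀
  have hE₂ : edgeSet T₂ = Insert.insert (x, b) (Insert.insert (b, y) E₀) := by
    ext e
    simp only [hE₀, Set.mem_insert_iff, Set.mem_sdiff, Set.mem_singleton_iff, hE]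
    tauto
  have hbE₀ : ∀ e ∈ E₀, e.1 ≠ b ∧ e.2 ≠ b := by
    rintro ⟨u, w⟩ ⟨he, hne⟩
    simp only [Set.mem_insert_iff, Set.mem_singleton_iff, Prod.mk.injEq, not_or, not_and] at hne
    constructor
    · rintro rfl
      exact hne.2 rfl (hT₂.next_eq he ((hE _).2 (Or.inl rfl)))
    · rintro rfl
      exact hne.1 (hT₂.prev_eq he ((hE _).2 (Or.inr (Or.inr (Or.inr (Or.inl rfl)))))) rfl
  obtain ⟨b', hb'ne, hb'l, hb'all⟩ := hT.two b (by simp [hb])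
  have hG₀ : Good E₀ (_root_.eraseLabel a lab) pos := by
    have h0 : Good E₀ lab pos := hG₂.mono Set.sdiff_subset
    refine ⟨h0.nondeg, ?_, ?_, ?_⟩
    · intro e he f hf hef z hz hz'
      obtain ⟨u, w, hu, hw, hzu, hzw, huw⟩ := h0.inter e he f hf hef z hz hz'
      refine ⟨u, w, hu, hw, hzu, hzw, ?_⟩
      rcases huw with huw | ⟨huw, hun⟩
      · exact Or.inl huw
      · by_cases hua : lab u = some a
        · left
          have hub : u ≠ b := by rcases hu with rfl | rfl; exacts [(hbE₀ e he).1, (hbE₀ e he).2]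
          have hwb : w ≠ b := by rcases hw with rfl | rfl; exacts [(hbE₀ f hf).1, (hbE₀ f hf).2]
          have h1 := (hb'all u (hua.trans hb.symm)).resolve_left hub
          have h2 := (hb'all w ((huw.symm.trans hua).trans hb.symm)).resolve_left hwb
          rw [h1, h2]
        · right
          rw [eraseLabel_of_ne hua, eraseLabel_of_ne (huw ▸ hua)]
          exact ⟨huw, hun⟩
    · intro u c w hu hw hc
      refine h0.straight u c w hu hw ?_
      rw [← (eraseLabel_eq hc).1]; exact hc
    · intro u w hu huw
      have h1 := eraseLabel_eq hu
      have h2 := eraseLabel_eq (huw ▸ hu)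
      exact hG.nodepos u w (h1.1 ▸ hu) (by rw [← h1.1, huw, h2.1])
  have hlb : _root_.eraseLabel a lab b = none := by simp [_root_.eraseLabel, hb]
  have hG₀' : Good E₀ (_root_.eraseLabel a lab) (Function.update pos b ζ) := by
    refine hG₀.congr (fun e he => ?_) fun u hu => ?_
    · have := hbE₀ e he
      simp [this.1, this.2]
    · rw [Function.update_of_ne]
      rintro rfl
      exact hu hlb
  refine ⟨hT₂.eraseLabel a, ?_⟩
  obtain ⟨hne1, hne2, hne3⟩ := hli.triangle_ne
  -- every edge other than those at `b` lies on an edge of the original diagram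
  have hold : ∀ f ∈ E₀, ∀ z ∈ edgeSegment (Function.update pos b ζ) f, ∃ g ∈ edgeSet T,
      z ∈ edgeSegment pos g ∧ (f ≠ (p, x) → g ≠ (p, b)) ∧ (f ≠ (y, q) → g ≠ (b, q)) := by
    intro f hf z hz
    have hfb := hbE₀ f hf
    rw [edgeSegment, Function.update_of_ne hfb.1, Function.update_of_ne hfb.2] at hz
    rcases (hE f).1 hf.1 with rfl | rfl | rfl | rfl | ⟨h1, h2, h3⟩
    · exact absurd rfl hfb.1
    · refine ⟨(b, q), hq, ?_, fun _ h => hpb (congrArg Prod.fst h).symm,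
        fun h => absurd rfl h⟩
      exact (convex_segment (𝕜 := ℝ) _ _).segment_subset (openSegment_subset_segment _ _ _ hY)
        (right_mem_segment _ _ _) hz
    · refine ⟨(p, b), hp, ?_, fun h => absurd rfl h,
        fun _ h => hpb (congrArg Prod.fst h)⟩
      exact (convex_segment (𝕜 := ℝ) _ _).segment_subset (left_mem_segment _ _ _)
        (openSegment_subset_segment _ _ _ hX) hz
    · exact absurd rfl hfb.2
    · exact ⟨f, h1, hz, fun _ => h2, fun _ => h3⟩
  have hXne : ∀ g ∈ edgeSet T, g ≠ (p, b) → pos x ∉ edgeSegment pos g := by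
    intro g hg hne hmem
    obtain ⟨u, -, hu, -, hxu, -⟩ := hG.inter (p, b) hp g hg hne.symm _
      (openSegment_subset_segment _ _ _ hX) hmem
    have hnd := hG₁.nondeg (p, x) ((hins1.mem_edgeSet hT).2 (Or.inr (Or.inl rfl)))
    have hnd' := hG₁.nondeg (x, b) ((hins1.mem_edgeSet hT).2 (Or.inr (Or.inr rfl)))
    rcases hu with rfl | rfl
    · exact hnd hxu.symm
    · exact hnd' hxu
  have hYne : ∀ g ∈ edgeSet T, g ≠ (b, q) → pos y ∉ edgeSegment pos g := by
    intro g hg hne hmem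
    obtain ⟨u, -, hu, -, hxu, -⟩ := hG.inter (b, q) hq g hg hne.symm _
      (openSegment_subset_segment _ _ _ hY) hmem
    have hnd := hG₂.nondeg (b, y) ((hE _).2 (by simp))
    have hnd' := hG₂.nondeg (y, q) ((hE _).2 (by simp))
    rcases hu with rfl | rfl
    · exact hnd hxu.symm
    · exact hnd' hxu
  have hx' : Function.update pos b ζ x = pos x := Function.update_of_ne hbx.symm _ _
  have hy' : Function.update pos b ζ y = pos y := Function.update_of_ne hby.symm _ _
  have hb0 : Function.update pos b ζ b = ζ := Function.update_self _ _ _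
  have hside : ∀ z ∈ segment ℝ (pos x) ζ, ∀ g ∈ edgeSet T, z ∈ edgeSegment pos g → z = pos x := by
    intro z hz g hg hzg
    exact eq_of_mem_sides hli (hd g hg z hzg (segment_subset_triangle_left _ _ _ hz)) hz
  have hside' : ∀ z ∈ segment ℝ ζ (pos y), ∀ g ∈ edgeSet T, z ∈ edgeSegment pos g → z = pos y := by
    intro z hz g hg hzg
    exact eq_of_mem_sides_right hli (hd g hg z hzg (segment_subset_triangle_right _ _ _ hz)) hz
  rw [hE₂]
  have hlx' := eraseLabel_of_none (a := a) hlx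
  have hly' := eraseLabel_of_none (a := a) hly
  refine (hG₀'.insert (e := (b, y)) ?_ ?_ ?_ ?_).insert (e := (x, b)) ?_ ?_ ?_ ?_
  · simpa only [hb0, hy'] using hne3
  · intro f hf _ z hz hzf
    simp only [edgeSegment, hb0, hy'] at hz
    obtain ⟨g, hg, hzg, -, h2⟩ := hold f hf z hzf
    have hzy := hside' z hz g hg hzg
    by_cases hfy : f = (y, q)
    · subst hfy
      exact ⟨y, y, by simp, by simp, hzy.trans hy'.symm, hzy.trans hy'.symm, Or.inl rfl⟩
    · exact absurd (hzy ▸ hzg) (hYne g hg (h2 hfy))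
  · exact fun _ _ h => absurd hlb h
  · exact fun _ _ h => absurd hly' h
  · simpa only [hb0, hx'] using hne2
  · rintro f (rfl | hf) _ z hz hzf
    · simp only [edgeSegment, hb0, hy', hx'] at hz hzf
      have := eq_of_mem_sides_apex hli hz hzf
      exact ⟨b, b, by simp, by simp, this.trans hb0.symm, this.trans hb0.symm, Or.inl rfl⟩
    · simp only [edgeSegment, hb0, hx'] at hz
      obtain ⟨g, hg, hzg, h1, -⟩ := hold f hf z hzf
      have hzx := hside z hz g hg hzg
      by_cases hfx : f = (p, x)
      · subst hfx
        exact ⟨x, x, by simp, by simp, hzx.trans hx'.symm, hzx.trans hx'.symm, Or.inl rfl⟩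
      · exact absurd (hzx ▸ hzg) (hXne g hg (h1 hfx))
  · exact fun _ _ h => absurd hlx' h
  · exact fun _ _ h => absurd hlb h

/-- Replacing `p b q` by `p x b y q` and moving `b` to `ζ`, off the other strand, is a resolution of
the node, whose sign is that of the determinant. -/
lemma isResolution_of_bypass {a : ℕ} {ζ : Fin 3 → ℝ} {s : SignType} {p' b' q' : VertexName}
    {G H : EmbeddedGraph n} (hGc : G.comp = diagram T lab pos)
    (hHc : H.comp = diagram T₂ (eraseLabel a lab) (Function.update pos b ζ))
    (hG : Good (edgeSet T) lab pos) (hT : Shape T lab)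
    (hb : lab b = some a) (hp : (p, b) ∈ edgeSet T) (hq : (b, q) ∈ edgeSet T)
    (hb' : lab b' = some a) (hp' : (p', b') ∈ edgeSet T) (hq' : (b', q') ∈ edgeSet T)
    (h₂ : IsBypass T T₂ x b y) (hx : ∀ i, x ∉ T i) (hy : ∀ i, y ∉ T i)
    (hX : pos x ∈ openSegment ℝ (pos p) (pos b)) (hY : pos y ∈ openSegment ℝ (pos b) (pos q))
    (hd : ∀ f ∈ edgeSet T, ∀ z ∈ edgeSegment pos f, z ∈ triangle (pos x) (pos y) ζ →
      z ∈ segment ℝ (pos x) (pos y))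
    (hs : SignType.sign (Matrix.det (Matrix.of
      ![pos q - pos p, pos q' - pos p', ζ - pos b])) = s) :
    G.IsResolution a s H := by
  have hpb : p ≠ b := fun h => hG.nondeg _ hp (by simp [h])
  have hbq : b ≠ q := fun h => hG.nondeg _ hq (by simp [h])
  have hpq := hG.prev_ne_next hp hq
  have hpb' : p' ≠ b' := fun h => hG.nondeg _ hp' (by simp [h])
  obtain ⟨i, t, hi, hi', hj⟩ := h₂.exists_list hT hpb hpq hp hq
  have hn : (p :: b :: q :: t).Nodup := hi.nodup_iff.1 (hT.nodup i)
  have hbi : b ∈ T i := hi.mem_iff.2 (by simp)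
  have hxb : x ≠ b := fun h => hx i (h ▸ hbi)
  have hyb : y ≠ b := fun h => hy i (h ▸ hbi)
  have hlx := eraseLabel_of_none (a := a) (hT.lab_fresh hx)
  have hly := eraseLabel_of_none (a := a) (hT.lab_fresh hy)
  have hlb : eraseLabel a lab b = none := by simp [eraseLabel, hb]
  have hmap : ∀ u, u ≠ b → ((Function.update pos b ζ u, eraseLabel a lab u) : MarkedPoint) =
      unmark a (pos u, lab u) := by
    intro u hu
    simp only [Function.update_of_ne hu, eraseLabel, unmark]
    split_ifs <;> rfl
  refine ⟨i, (pos p, lab p), (pos b, lab b), (pos q, lab q), t.map fun u => (pos u, lab u),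
    pos x, ζ, pos y, ?_, hb, hX, hY, ?_, ?_, ?_, ?_⟩
  · rw [hGc]
    exact hi.map _
  · rw [convexHull_triple, triangle_comm]
    rintro z ⟨hz, hzG⟩
    obtain ⟨f, hf, hzf⟩ := (EmbeddedGraph.mem_support_iff hGc).1 hzG
    exact hd f hf z hzf hz
  · obtain ⟨j, hpj⟩ := hp'
    obtain ⟨k, hqk⟩ := hq'
    obtain rfl := hT.disj j k b' (snd_mem_of_mem_cyclicPairs hpj) (fst_mem_of_mem_cyclicPairs hqk)
    obtain ⟨t', ht'⟩ := exists_isRotated_cons_cons_cons (hT.nodup j) hpb'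
      (hG.prev_ne_next ⟨j, hpj⟩ ⟨j, hqk⟩) hpj hqk
    refine ⟨j, (pos p', lab p'), (pos b', lab b'), (pos q', lab q'),
      ⟨t'.map fun u => (pos u, lab u), ?_⟩, hb', hs⟩
    rw [hGc]
    exact ht'.map _
  · have h1 := hi'.map fun u => ((Function.update pos b ζ u, eraseLabel a lab u) : MarkedPoint)
    rw [hHc]
    refine h1.trans (isRotated_of_eq ?_)
    simp only [List.nodup_cons, List.mem_cons, not_or] at hn
    have hu0 : ∀ z : Fin 3 → ℝ, unmark a (z, none) = (z, none) := fun z => by simp [unmark]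
    simp only [List.map_cons, List.map_map, Function.update_self, hlx, hly, hlb,
      Function.update_of_ne hxb, Function.update_of_ne hyb, hmap p hpb, hmap q (Ne.symm hbq), hu0]
    congr 5
    refine List.map_congr_left fun u hu => hmap u ?_
    rintro rfl
    exact hn.2.1.2 hu
  · intro j hji
    have h1 := (hj j hji).map fun u =>
      ((Function.update pos b ζ u, eraseLabel a lab u) : MarkedPoint)
    rw [hHc, hGc]
    refine h1.trans (isRotated_of_eq ?_)
    simp only [diagram, List.map_map]
    refine List.map_congr_left fun u hu => hmap u ?_
    rintro rfl
    exact hji (hT.disj j i u hu hbi)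

/-- The exchange identity in terms of named diagrams. -/
lemma IsVassilievInvariant.exchange_diagram {R : Type*} [CommRing R] {v : EmbeddedGraph n → R}
    (hv : IsVassilievInvariant v) {a : ℕ} {ζ ζ' : Fin 3 → ℝ} {p' b' q' : VertexName}
    (hG : Good (edgeSet T) lab pos) (hT : Shape T lab)
    (hb : lab b = some a) (hp : (p, b) ∈ edgeSet T) (hq : (b, q) ∈ edgeSet T)
    (hb' : lab b' = some a) (hp' : (p', b') ∈ edgeSet T) (hq' : (b', q') ∈ edgeSet T)
    (h₂ : IsBypass T T₂ x b y) (hx : ∀ i, x ∉ T i) (hy : ∀ i, y ∉ T i)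
    (hX : pos x ∈ openSegment ℝ (pos p) (pos b)) (hY : pos y ∈ openSegment ℝ (pos b) (pos q))
    (hT₂ : Shape T₂ (eraseLabel a lab))
    (hG₂ : Good (edgeSet T₂) (eraseLabel a lab) (Function.update pos b ζ))
    (hG₂' : Good (edgeSet T₂) (eraseLabel a lab) (Function.update pos b ζ'))
    (hd : ∀ f ∈ edgeSet T, ∀ z ∈ edgeSegment pos f, z ∈ triangle (pos x) (pos y) ζ →
      z ∈ segment ℝ (pos x) (pos y))
    (hd' : ∀ f ∈ edgeSet T, ∀ z ∈ edgeSegment pos f, z ∈ triangle (pos x) (pos y) ζ' →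
      z ∈ segment ℝ (pos x) (pos y))
    (hs : 0 < Matrix.det (Matrix.of ![pos q - pos p, pos q' - pos p', ζ - pos b]))
    (hs' : Matrix.det (Matrix.of ![pos q - pos p, pos q' - pos p', ζ' - pos b]) < 0) :
    valueOf v (diagram T lab pos) =
      valueOf v (diagram T₂ (eraseLabel a lab) (Function.update pos b ζ)) -
      valueOf v (diagram T₂ (eraseLabel a lab) (Function.update pos b ζ')) := by
  obtain ⟨G, hGc⟩ := exists_embeddedGraph hT hG
  obtain ⟨P, hPc⟩ := exists_embeddedGraph hT₂ hG₂
  obtain ⟨N, hNc⟩ := exists_embeddedGraph hT₂ hG₂'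
  rw [valueOf_eq v G hGc, valueOf_eq v P hPc, valueOf_eq v N hNc]
  refine hv.exchange G P N a ?_ ?_
  · exact isResolution_of_bypass hGc hPc hG hT hb hp hq hb' hp' hq' h₂ hx hy hX hY hd (sign_pos hs)
  · exact isResolution_of_bypass hGc hNc hG hT hb hp hq hb' hp' hq' h₂ hx hy hX hY hd' (sign_neg hs')

end Resolution

/-! ### The neighbourhood of a node -/

section Node

variable {n : ℕ} {T T' T₂ : Fin n → List VertexName} {lab : VertexName → Option ℕ}
  {pos : VertexName → Fin 3 → ℝ} {p q x b y a c p' b' q' : VertexName}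
  {E : Set (VertexName × VertexName)}

/-- The determinant of three vectors, as a function of its last argument, vanishes on the span of
the first two. -/
lemma mul_det_eq_zero {d d' e : Fin 3 → ℝ} {t r s : ℝ} (h : t • e = r • d + s • d') :
    t * Matrix.det (Matrix.of ![d, d', e]) = 0 := by
  have h0 := congrFun h 0
  have h1 := congrFun h 1
  have h2 := congrFun h 2
  simp only [Pi.smul_apply, Pi.add_apply, smul_eq_mul] at h0 h1 h2
  simp only [Matrix.det_fin_three, Matrix.of_apply, Matrix.cons_val_zero, Matrix.cons_val_one,
    Matrix.cons_val]
  linear_combination (d 1 * d' 2 - d 2 * d' 1) * h0 - (d 0 * d' 2 - d 2 * d' 0) * h1 +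
    (d 0 * d' 1 - d 1 * d' 0) * h2

lemma det_smul_smul {d d' e : Fin 3 → ℝ} {r s t : ℝ} :
    Matrix.det (Matrix.of ![r • d, s • d', t • e]) =
      r * s * t * Matrix.det (Matrix.of ![d, d', e]) := by
  simp only [Matrix.det_fin_three, Matrix.of_apply, Matrix.cons_val_zero, Matrix.cons_val_one,
    Matrix.cons_val, Pi.smul_apply, smul_eq_mul]
  ring

/-- The cross product completes two independent vectors to a positive basis. -/
lemma exists_det_pos {d d' : Fin 3 → ℝ} (h : LinearIndependent ℝ ![d, d']) :
    ∃ e : Fin 3 → ℝ, 0 < Matrix.det (Matrix.of ![d, d', e]) := by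
  have hne := crossProduct_ne_zero_iff_linearIndependent.2 h
  refine ⟨crossProduct d d', ?_⟩
  have h1 : Matrix.det (Matrix.of ![d, d', crossProduct d d']) =
      (crossProduct d d' 0) ^ 2 + (crossProduct d d' 1) ^ 2 + (crossProduct d d' 2) ^ 2 := by
    simp only [Matrix.det_fin_three, Matrix.of_apply, Matrix.cons_val_zero, Matrix.cons_val_one,
      Matrix.cons_val, cross_apply]
    ring
  rw [h1]
  by_contra hle
  apply hne
  have h0 : crossProduct d d' 0 = 0 := by nlinarith [sq_nonneg (crossProduct d d' 0), sq_nonneg (crossProduct d d' 1), sq_nonneg (crossProduct d d' 2)]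
  have h1 : crossProduct d d' 1 = 0 := by nlinarith [sq_nonneg (crossProduct d d' 0), sq_nonneg (crossProduct d d' 1), sq_nonneg (crossProduct d d' 2)]
  have h2 : crossProduct d d' 2 = 0 := by nlinarith [sq_nonneg (crossProduct d d' 0), sq_nonneg (crossProduct d d' 1), sq_nonneg (crossProduct d d' 2)]
  ext i
  fin_cases i <;> assumption

/-- `e` has one end at `C` and the other end at `X`. -/
def HasEnds (pos : VertexName → Fin 3 → ℝ) (e : VertexName × VertexName) (C X : Fin 3 → ℝ) :
    Prop := (pos e.1 = C ∧ pos e.2 = X) ∨ (pos e.1 = X ∧ pos e.2 = C)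

lemma HasEnds.edgeSegment_eq {e : VertexName × VertexName} {C X : Fin 3 → ℝ}
    (h : HasEnds pos e C X) : edgeSegment pos e = segment ℝ C X := by
  rcases h with ⟨h1, h2⟩ | ⟨h1, h2⟩
  · rw [edgeSegment, h1, h2]
  · rw [edgeSegment, h1, h2, segment_symm]

/-- Two edges with a common end do not leave it in the same direction. -/
lemma Good.not_same_direction (hG : Good E lab pos) {e f : VertexName × VertexName} (he : e ∈ E)
    (hf : f ∈ E) (hef : e ≠ f) {C X Y : Fin 3 → ℝ} (h1 : HasEnds pos e C X)
    (h2 : HasEnds pos f C Y) {r : ℝ} (hr : 0 < r) : X - C ≠ r • (Y - C) := by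
  intro h
  have hX : X = C + r • (Y - C) := by rw [← h]; simp
  have hCX : X ≠ C := by
    have := hG.nondeg e he
    rcases h1 with ⟨rfl, rfl⟩ | ⟨rfl, rfl⟩
    · exact this.symm
    · exact this
  have hs0 : 0 < min 1 r / 2 := by positivity
  have hs1 : min 1 r / 2 < 1 := by linarith [min_le_left 1 r]
  have hsr : min 1 r / 2 < r := by linarith [min_le_right 1 r]
  have hz1 : C + (min 1 r / 2) • (Y - C) ∈ edgeSegment pos f := by
    rw [h2.edgeSegment_eq]
    exact mem_segment_iff_exists.2 ⟨_, hs0.le, hs1.le, rfl⟩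
  have hz2 : C + (min 1 r / 2) • (Y - C) = C + (min 1 r / 2 / r) • (X - C) := by
    rw [h, smul_smul, div_mul_cancel₀ _ hr.ne']
  have hlt : min 1 r / 2 / r < 1 := by rw [div_lt_one hr]; exact hsr
  have hz3 : C + (min 1 r / 2) • (Y - C) ∈ edgeSegment pos e := by
    rw [h1.edgeSegment_eq, hz2]
    exact mem_segment_iff_exists.2 ⟨_, by positivity, hlt.le, rfl⟩
  obtain ⟨u, -, hu, -, hzu, -⟩ := hG.inter e he f hf hef _ hz3 hz1
  have hCX' : X - C ≠ 0 := sub_ne_zero.2 hCX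
  have key : ∀ s : ℝ, s ≠ 0 → s ≠ 1 → C + s • (X - C) ≠ C ∧ C + s • (X - C) ≠ X := by
    intro s hs hs'
    constructor
    · intro h'
      have : s • (X - C) = 0 := by simpa using h'
      exact (smul_ne_zero hs hCX') this
    · intro h'
      have : (1 - s) • (X - C) = 0 := by
        calc (1 - s) • (X - C) = X - (C + s • (X - C)) := by module
          _ = 0 := by rw [h', sub_self]
      exact (smul_ne_zero (sub_ne_zero.2 hs'.symm) hCX') this
  obtain ⟨k1, k2⟩ := key (min 1 r / 2 / r) (by positivity) hlt.ne
  rw [hz2] at hzu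
  rcases h1 with ⟨h1, h1'⟩ | ⟨h1, h1'⟩ <;> rcases hu with rfl | rfl
  · exact k1 (hzu.trans h1)
  · exact k2 (hzu.trans h1')
  · exact k2 (hzu.trans h1)
  · exact k1 (hzu.trans h1')

/-- The two strands through a node have independent directions. -/
lemma Good.linearIndependent_strands (hG : Good E lab pos) (hb : lab b ≠ none)
    (hbb : lab b = lab b') (hne : b ≠ b') (hp : (p, b) ∈ E) (hq : (b, q) ∈ E) (hp' : (p', b') ∈ E)
    (hq' : (b', q') ∈ E) : LinearIndependent ℝ ![pos q - pos p, pos q' - pos p'] := by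
  obtain ⟨r, hr0, hr1, hr⟩ := mem_openSegment_iff_exists.1 (hG.straight p b q hp hq hb)
  obtain ⟨r', hr0', hr1', hr'⟩ := mem_openSegment_iff_exists.1
    (hG.straight p' b' q' hp' hq' (hbb ▸ hb))
  have hpos := hG.nodepos b b' hb hbb
  rw [LinearIndependent.pair_iff]
  intro s t hst
  have hPb : pos q - pos b = (1 - r) • (pos q - pos p) := by rw [hr]; module
  have hQ' : pos q' - pos b = (1 - r') • (pos q' - pos p') := by rw [hpos, hr']; module
  have hP' : pos p' - pos b = (-r') • (pos q' - pos p') := by rw [hpos, hr']; module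
  have hd : pos q - pos p ≠ 0 := by
    intro h0
    rw [h0, smul_zero, sub_eq_zero] at hPb
    exact hG.nondeg _ hq hPb.symm
  have hd' : pos q' - pos p' ≠ 0 := by
    intro h0
    rw [h0, smul_zero, sub_eq_zero, hpos] at hQ'
    exact hG.nondeg _ hq' hQ'.symm
  by_cases hs : s = 0
  · subst hs
    simp only [zero_smul, zero_add, smul_eq_zero] at hst
    exact ⟨rfl, hst.resolve_right hd'⟩
  exfalso
  have hdd : pos q - pos p = (-(t / s)) • (pos q' - pos p') := by
    have : s • (pos q - pos p) = (-t) • (pos q' - pos p') := by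
      rw [neg_smul, eq_neg_iff_add_eq_zero]; exact hst
    calc pos q - pos p = s⁻¹ • (s • (pos q - pos p)) := by
          rw [smul_smul, inv_mul_cancel₀ hs, one_smul]
      _ = _ := by rw [this, smul_smul]; congr 1; ring
  rcases lt_trichotomy (-(t / s)) 0 with h | h | h
  · refine hG.not_same_direction (e := (b, q)) (f := (p', b')) hq hp' ?_ (C := pos b) (X := pos q)
      (Y := pos p') (Or.inl ⟨rfl, rfl⟩) (Or.inr ⟨rfl, hpos.symm⟩)
      (r := (1 - r) * (-(t / s)) / (-r')) ?_ ?_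
    · intro h'
      simp only [Prod.mk.injEq] at h'
      exact hG.nondeg _ hp' ((congrArg pos h'.1).symm.trans hpos)
    · exact div_pos_of_neg_of_neg (by nlinarith) (by linarith)
    · rw [hPb, hdd, hP', smul_smul, smul_smul]
      congr 1
      field_simp
  · rw [h, zero_smul] at hdd
    exact hd hdd
  · refine hG.not_same_direction (e := (b, q)) (f := (b', q')) hq hq' ?_ (C := pos b) (X := pos q)
      (Y := pos q') (Or.inl ⟨rfl, rfl⟩) (Or.inl ⟨hpos.symm, rfl⟩)
      (r := (1 - r) * (-(t / s)) / (1 - r')) ?_ ?_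
    · intro h'
      exact hne (congrArg Prod.fst h')
    · exact div_pos (mul_pos (by linarith) h) (by linarith)
    · rw [hPb, hdd, hQ', smul_smul, smul_smul]
      congr 1
      have : 1 - r' ≠ 0 := by linarith
      field_simp

/-- A triangle with base on the line through `C` in direction `d` and apex outside of the plane
through `C` in directions `d`, `d'` meets this plane only in its base. -/
lemma mem_base_of_mem_plane {C d d' X Y Z z : Fin 3 → ℝ} {r s l m : ℝ} (hX : X = C + r • d)
    (hY : Y = C + s • d) (hdet : Matrix.det (Matrix.of ![d, d', Z - C]) ≠ 0)
    (hz : z ∈ triangle X Y Z) (hz' : z = C + l • d + m • d') : z ∈ segment ℝ X Y := by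
  obtain ⟨α, β, hα, hβ, hαβ, h⟩ := hz
  have hβ0 : β = 0 := by
    have : β • (Z - C) = (l - (1 - α - β) * r - α * s) • d + m • d' := by
      have h' : C + l • d + m • d' = X + α • (Y - X) + β • (Z - X) := hz'.symm.trans h
      rw [hX, hY] at h'
      have h2 : β • (Z - C) = (C + r • d + α • (C + s • d - (C + r • d)) +
        β • (Z - (C + r • d))) - (C + ((1 - α - β) * r + α * s) • d) := by module
      rw [h2, ← h']
      module
    exact (mul_eq_zero.1 (mul_det_eq_zero this)).resolve_right hdet
  subst hβ0
  exact mem_segment_iff_exists.2 ⟨α, hα, by linarith, by rw [h]; simp⟩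

lemma linearIndependent_base_apex {C d d' X Y Z : Fin 3 → ℝ} {r s : ℝ} (hX : X = C + r • d)
    (hY : Y = C + s • d) (hrs : r ≠ s) (hdet : Matrix.det (Matrix.of ![d, d', Z - C]) ≠ 0) :
    LinearIndependent ℝ ![Y - X, Z - X] := by
  rw [LinearIndependent.pair_iff]
  intro α β h
  have h1 : β • (Z - C) = (β * r - α * (s - r)) • d + (0 : ℝ) • d' := by
    have : β • (Z - C) = (α • (Y - X) + β • (Z - X)) - α • (Y - X) + β • (X - C) := by module
    rw [this, h, hX, hY]; module
  have hβ : β = 0 := (mul_eq_zero.1 (mul_det_eq_zero h1)).resolve_right hdet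
  subst hβ
  refine ⟨?_, rfl⟩
  have hd : d ≠ 0 := by
    rintro rfl
    simp [Matrix.det_fin_three] at hdet
  have h2 : (α * (s - r)) • d = 0 := by
    rw [← h, hX, hY]; module
  exact (mul_eq_zero.1 ((smul_eq_zero.1 h2).resolve_right hd)).resolve_right
    (sub_ne_zero.2 hrs.symm)

/-- The edges meeting the point of a node are the four edges at this node. -/
lemma Good.edge_of_node_mem (hG : Good (edgeSet T) lab pos) (hT : Shape T lab) (hb : lab b ≠ none)
    (hbb : lab b = lab b') (hne : b ≠ b') (hp : (p, b) ∈ edgeSet T) (hq : (b, q) ∈ edgeSet T)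
    (hp' : (p', b') ∈ edgeSet T) (hq' : (b', q') ∈ edgeSet T) {f : VertexName × VertexName}
    (hf : f ∈ edgeSet T) (hbf : pos b ∈ edgeSegment pos f) :
    f = (p, b) ∨ f = (b, q) ∨ f = (p', b') ∨ f = (b', q') := by
  by_cases hfp : f = (p, b)
  · exact Or.inl hfp
  obtain ⟨u, w, hu, hw, hbu, hbw, huw⟩ := hG.inter (p, b) hp f hf (Ne.symm hfp) _
    (right_mem_segment _ _ _) hbf
  have hub : u = b := by
    rcases hu with hu | hu
    · exact absurd (hbu.trans (congrArg pos hu)).symm (hG.nondeg _ hp)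
    · exact hu
  subst hub
  have hw' : w = u ∨ w = b' := by
    rcases huw with h | ⟨h, -⟩
    · exact Or.inl h.symm
    · obtain ⟨v, -, -, hall⟩ := hT.two u hb
      rcases hall w h.symm with h1 | h1
      · exact Or.inl h1
      · rcases hall b' hbb.symm with h2 | h2
        · exact absurd h2.symm hne
        · exact Or.inr (h1.trans h2.symm)
  obtain ⟨f1, f2⟩ := f
  rcases hw' with rfl | rfl <;> rcases hw with rfl | rfl
  · right; left; rw [hT.next_eq hf hq]
  · left; rw [hT.prev_eq hf hp]
  · right; right; right; rw [hT.next_eq hf hq']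
  · right; right; left; rw [hT.prev_eq hf hp']

/-- The condition on a triangle used to resolve a node, reduced to the edges away from the node. -/
lemma Good.triangle_inter_subset (hG : Good (edgeSet T) lab pos) (hT : Shape T lab)
    (hb : lab b ≠ none) (hbb : lab b = lab b') (hne : b ≠ b') (hp : (p, b) ∈ edgeSet T)
    (hq : (b, q) ∈ edgeSet T) (hp' : (p', b') ∈ edgeSet T) (hq' : (b', q') ∈ edgeSet T)
    {X Y Z : Fin 3 → ℝ} {r s : ℝ} (hX : X = pos b + r • (pos q - pos p))
    (hY : Y = pos b + s • (pos q - pos p))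
    (hdet : Matrix.det (Matrix.of ![pos q - pos p, pos q' - pos p', Z - pos b]) ≠ 0)
    (hd : ∀ f ∈ edgeSet T, pos b ∉ edgeSegment pos f → ∀ z ∈ edgeSegment pos f,
      z ∉ triangle X Y Z) :
    ∀ f ∈ edgeSet T, ∀ z ∈ edgeSegment pos f, z ∈ triangle X Y Z → z ∈ segment ℝ X Y := by
  intro f hf z hzf hz
  by_cases hbf : pos b ∈ edgeSegment pos f
  swap
  · exact absurd hz (hd f hf hbf z hzf)
  obtain ⟨r₁, -, -, hr⟩ := mem_openSegment_iff_exists.1 (hG.straight p b q hp hq hb)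
  obtain ⟨r₁', -, -, hr'⟩ := mem_openSegment_iff_exists.1
    (hG.straight p' b' q' hp' hq' (hbb ▸ hb))
  have hpos := hG.nodepos b b' hb hbb
  have hP : pos p = pos b - r₁ • (pos q - pos p) := by rw [hr]; simp
  have hP' : pos p' = pos b - r₁' • (pos q' - pos p') := by rw [hpos, hr']; simp
  rcases hG.edge_of_node_mem hT hb hbb hne hp hq hp' hq' hf hbf with rfl | rfl | rfl | rfl
  · obtain ⟨t, -, -, rfl⟩ := mem_segment_iff_exists.1 hzf
    refine mem_base_of_mem_plane hX hY hdet hz (l := -(1 - t) * r₁) (m := 0) ?_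
    calc pos p + t • (pos b - pos p) = pos b - (1 - t) • (pos b - pos p) := by module
      _ = pos b - (1 - t) • (r₁ • (pos q - pos p)) := by
        congr 2
        conv_lhs => rw [hP]
        simp
      _ = _ := by module
  · obtain ⟨t, -, -, rfl⟩ := mem_segment_iff_exists.1 hzf
    refine mem_base_of_mem_plane hX hY hdet hz (l := t * (1 - r₁)) (m := 0) ?_
    have : pos q - pos b = (1 - r₁) • (pos q - pos p) := by rw [hr]; module
    simp only [this]; module
  · obtain ⟨t, -, -, rfl⟩ := mem_segment_iff_exists.1 hzf
    refine mem_base_of_mem_plane hX hY hdet hz (l := 0) (m := -(1 - t) * r₁') ?_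
    calc pos p' + t • (pos b' - pos p') = pos b' - (1 - t) • (pos b' - pos p') := by module
      _ = pos b - (1 - t) • (r₁' • (pos q' - pos p')) := by
        rw [← hpos]
        congr 2
        conv_lhs => rw [hP']
        simp
      _ = _ := by module
  · obtain ⟨t, -, -, rfl⟩ := mem_segment_iff_exists.1 hzf
    refine mem_base_of_mem_plane hX hY hdet hz (l := 0) (m := t * (1 - r₁')) ?_
    have : pos q' - pos b' = (1 - r₁') • (pos q' - pos p') := by rw [hr']; module
    change pos b' + t • (pos q' - pos b') = _
    rw [this, ← hpos]; module

lemma isCompact_segment (u w : Fin 3 → ℝ) : IsCompact (segment ℝ u w) := by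
  rw [segment_eq_image']
  exact isCompact_Icc.image (by fun_prop)

lemma isCompact_triangle (u w z : Fin 3 → ℝ) : IsCompact (triangle u w z) := by
  rw [← convexHull_triple]
  exact Set.Finite.isCompact_convexHull (𝕜 := ℝ) (Set.toFinite _)

lemma triangle_subset_of_convex {V : Type*} [AddCommGroup V] [Module ℝ V] {s : Set V}
    (hs : Convex ℝ s) {u w z : V} (hu : u ∈ s) (hw : w ∈ s) (hz : z ∈ s) : triangle u w z ⊆ s := by
  rw [← convexHull_triple]
  exact convexHull_min (by simp [Set.insert_subset_iff, hu, hw, hz]) hs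

/-- A triangle shrinking to a point outside of a closed set eventually leaves this set. -/
lemma eventually_triangle_disjoint {ι : Type*} {l : Filter ι} {X Y Z : ι → Fin 3 → ℝ}
    {C : Fin 3 → ℝ} (hX : Tendsto X l (𝓝 C)) (hY : Tendsto Y l (𝓝 C)) (hZ : Tendsto Z l (𝓝 C))
    {K : Set (Fin 3 → ℝ)} (hK : IsClosed K) (hC : C ∉ K) :
    ∀ᶠ i in l, ∀ z ∈ K, z ∉ triangle (X i) (Y i) (Z i) := by
  obtain ⟨ε, hε, hball⟩ := Metric.mem_nhds_iff.1 (hK.isOpen_compl.mem_nhds hC)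
  filter_upwards [hX (Metric.ball_mem_nhds C hε), hY (Metric.ball_mem_nhds C hε),
    hZ (Metric.ball_mem_nhds C hε)] with i h1 h2 h3 z hz hz'
  exact hball (triangle_subset_of_convex (convex_ball C ε) h1 h2 h3 hz') hz

lemma tendsto_add_smul (C d : Fin 3 → ℝ) :
    Tendsto (fun τ : ℝ => C + τ • d) (𝓝[>] 0) (𝓝 C) := by
  have : Continuous fun τ : ℝ => C + τ • d := by fun_prop
  simpa using (this.tendsto 0).mono_left nhdsWithin_le_nhds

/-- Small triangles at a node can be used to resolve it. -/
lemma Good.eventually_triangle (hG : Good (edgeSet T) lab pos) (hT : Shape T lab)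
    (hb : lab b ≠ none) (hbb : lab b = lab b') (hne : b ≠ b') (hp : (p, b) ∈ edgeSet T)
    (hq : (b, q) ∈ edgeSet T) (hp' : (p', b') ∈ edgeSet T) (hq' : (b', q') ∈ edgeSet T)
    {e : Fin 3 → ℝ} (hdet : Matrix.det (Matrix.of ![pos q - pos p, pos q' - pos p', e]) ≠ 0) :
    ∀ᶠ τ in 𝓝[>] (0 : ℝ), ∀ f ∈ edgeSet T, ∀ z ∈ edgeSegment pos f,
      z ∈ triangle (pos b + τ • (pos p - pos b)) (pos b + τ • (pos q - pos b)) (pos b + τ • e) →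
      z ∈ segment ℝ (pos b + τ • (pos p - pos b)) (pos b + τ • (pos q - pos b)) := by
  obtain ⟨r₁, -, -, hr⟩ := mem_openSegment_iff_exists.1 (hG.straight p b q hp hq hb)
  have hP : pos p - pos b = (-r₁) • (pos q - pos p) := by rw [hr]; module
  have hQ : pos q - pos b = (1 - r₁) • (pos q - pos p) := by rw [hr]; module
  have h1 : ∀ᶠ τ in 𝓝[>] (0 : ℝ), ∀ f ∈ edgeSet T, pos b ∉ edgeSegment pos f →
      ∀ z ∈ edgeSegment pos f, z ∉ triangle (pos b + τ • (pos p - pos b))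
        (pos b + τ • (pos q - pos b)) (pos b + τ • e) := by
    refine (eventually_all_finite (edgeSet_finite T)).2 fun f hf => ?_
    by_cases hbf : pos b ∈ edgeSegment pos f
    · exact Eventually.of_forall fun τ h => absurd hbf h
    · filter_upwards [eventually_triangle_disjoint (tendsto_add_smul (pos b) (pos p - pos b))
        (tendsto_add_smul (pos b) (pos q - pos b)) (tendsto_add_smul (pos b) e)
        (isCompact_segment (pos f.1) (pos f.2)).isClosed hbf] with τ hτ _ using hτ
  filter_upwards [h1, self_mem_nhdsWithin] with τ hτ hτ0
  refine hG.triangle_inter_subset hT hb hbb hne hp hq hp' hq' (r := τ * (-r₁))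
    (s := τ * (1 - r₁)) ?_ ?_ ?_ hτ
  · rw [hP, smul_smul]
  · rw [hQ, smul_smul]
  · have h2 : pos b + τ • e - pos b = τ • e := by simp
    have h3 := det_smul_smul (d := pos q - pos p) (d' := pos q' - pos p') (e := e) (r := 1) (s := 1)
      (t := τ)
    rw [one_smul, one_smul] at h3
    rw [h2, h3]
    have : τ ≠ 0 := ne_of_gt hτ0
    simp [this, hdet]

end Node

/-! ### Invariance under elementary moves -/

section Insertion

variable {n : ℕ} {T T' T₂ : Fin n → List VertexName} {lab : VertexName → Option ℕ}
  {pos : VertexName → Fin 3 → ℝ} {p q x b y a c p' b' q' : VertexName}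

lemma diagram_congr {pos' : VertexName → Fin 3 → ℝ} (h : ∀ u, (∃ i, u ∈ T i) → pos u = pos' u) :
    diagram T lab pos = diagram T lab pos' := by
  funext i
  refine List.map_congr_left fun u hu => ?_
  rw [h u ⟨i, hu⟩]

/-- Resolving a node within a small triangle. -/
lemma IsVassilievInvariant.exchange_of_triangle {R : Type*} [CommRing R] {v : EmbeddedGraph n → R}
    (hv : IsVassilievInvariant v) {a : ℕ} (hG : Good (edgeSet T) lab pos) (hT : Shape T lab)
    (hb : lab b = some a) (hb' : lab b' = some a) (hp : (p, b) ∈ edgeSet T)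
    (hq : (b, q) ∈ edgeSet T) (hp' : (p', b') ∈ edgeSet T) (hq' : (b', q') ∈ edgeSet T)
    (h₂ : IsBypass T T₂ x b y) (hx : ∀ i, x ∉ T i) (hy : ∀ i, y ∉ T i) (hxy : x ≠ y)
    {τ : ℝ} (hτ0 : 0 < τ) (hτ1 : τ < 1) (hX : pos x = pos b + τ • (pos p - pos b))
    (hY : pos y = pos b + τ • (pos q - pos b)) {e : Fin 3 → ℝ}
    (hdet : 0 < Matrix.det (Matrix.of ![pos q - pos p, pos q' - pos p', e]))
    (hd : ∀ f ∈ edgeSet T, ∀ z ∈ edgeSegment pos f, z ∈ triangle (pos x) (pos y) (pos b + τ • e) →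
      z ∈ segment ℝ (pos x) (pos y))
    (hd' : ∀ f ∈ edgeSet T, ∀ z ∈ edgeSegment pos f,
      z ∈ triangle (pos x) (pos y) (pos b + τ • (-e)) → z ∈ segment ℝ (pos x) (pos y)) :
    Shape T₂ (eraseLabel a lab) ∧
      Good (edgeSet T₂) (eraseLabel a lab) (Function.update pos b (pos b + τ • e)) ∧
      Good (edgeSet T₂) (eraseLabel a lab) (Function.update pos b (pos b + τ • (-e))) ∧
      valueOf v (diagram T lab pos) =
        valueOf v (diagram T₂ (eraseLabel a lab) (Function.update pos b (pos b + τ • e))) -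
        valueOf v (diagram T₂ (eraseLabel a lab) (Function.update pos b (pos b + τ • (-e)))) := by
  obtain ⟨r, hr0, hr1, hr⟩ := mem_openSegment_iff_exists.1 (hG.straight p b q hp hq (by simp [hb]))
  have hP : pos p - pos b = (-r) • (pos q - pos p) := by rw [hr]; module
  have hQ : pos q - pos b = (1 - r) • (pos q - pos p) := by rw [hr]; module
  have hX' : pos x ∈ openSegment ℝ (pos p) (pos b) := by
    rw [openSegment_symm]
    exact mem_openSegment_iff_exists.2 ⟨τ, hτ0, hτ1, hX⟩
  have hY' : pos y ∈ openSegment ℝ (pos b) (pos q) :=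
    mem_openSegment_iff_exists.2 ⟨τ, hτ0, hτ1, hY⟩
  have hdet1 : ∀ s : ℝ, Matrix.det (Matrix.of ![pos q - pos p, pos q' - pos p', s • e]) =
      s * Matrix.det (Matrix.of ![pos q - pos p, pos q' - pos p', e]) := by
    intro s
    have := det_smul_smul (d := pos q - pos p) (d' := pos q' - pos p') (e := e) (r := 1) (s := 1)
      (t := s)
    simpa using this
  have hpos : 0 < Matrix.det (Matrix.of
      ![pos q - pos p, pos q' - pos p', pos b + τ • e - pos b]) := by
    rw [add_sub_cancel_left, hdet1]
    exact mul_pos hτ0 hdet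
  have hneg : Matrix.det (Matrix.of
      ![pos q - pos p, pos q' - pos p', pos b + τ • (-e) - pos b]) < 0 := by
    rw [add_sub_cancel_left, smul_neg, ← neg_smul, hdet1]
    nlinarith [mul_pos hτ0 hdet]
  have hli : ∀ Z, Matrix.det (Matrix.of ![pos q - pos p, pos q' - pos p', Z - pos b]) ≠ 0 →
      LinearIndependent ℝ ![pos y - pos x, Z - pos x] := fun Z hZ =>
    linearIndependent_base_apex (C := pos b) (d := pos q - pos p) (d' := pos q' - pos p')
      (r := τ * (-r)) (s := τ * (1 - r)) (by rw [hX, hP, smul_smul]) (by rw [hY, hQ, smul_smul])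
      (by nlinarith) hZ
  obtain ⟨hS, hG1⟩ := hG.resolve hT hb hp hq h₂ hx hy hxy hX' hY' (hli _ hpos.ne') hd
  obtain ⟨-, hG2⟩ := hG.resolve hT hb hp hq h₂ hx hy hxy hX' hY' (hli _ hneg.ne) hd'
  exact ⟨hS, hG1, hG2, hv.exchange_diagram hG hT hb hp hq hb' hp' hq' h₂ hx hy hX' hY' hS hG1 hG2
    hd hd' hpos hneg⟩

/-- Up to the triangle used, a resolution is contained in the original diagram. -/
lemma IsBypass.edgeSegment_cases {ζ : Fin 3 → ℝ} (h₂ : IsBypass T T₂ x b y) (hT : Shape T lab)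
    (hG : Good (edgeSet T) lab pos) (hp : (p, b) ∈ edgeSet T) (hq : (b, q) ∈ edgeSet T)
    (hx : ∀ i, x ∉ T i) (hy : ∀ i, y ∉ T i) (hxy : x ≠ y)
    (hX : pos x ∈ openSegment ℝ (pos p) (pos b)) (hY : pos y ∈ openSegment ℝ (pos b) (pos q))
    {f : VertexName × VertexName} (hf : f ∈ edgeSet T₂) {z : Fin 3 → ℝ}
    (hz : z ∈ edgeSegment (Function.update pos b ζ) f) :
    (∃ g ∈ edgeSet T, z ∈ edgeSegment pos g) ∨ z ∈ triangle (pos x) (pos y) ζ := by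
  have hpb : p ≠ b := fun h => hG.nondeg _ hp (by simp [h])
  have hbq : b ≠ q := fun h => hG.nondeg _ hq (by simp [h])
  obtain ⟨T₁, hins1, hins2⟩ := h₂.exists_isInsertion hT hpb (hG.prev_ne_next hp hq) hp hq
  have hT₁ := hins1.shape hT hx
  obtain ⟨i, hbi⟩ := fst_mem_of_mem_edgeSet hq
  have hbx : x ≠ b := fun h => hx i (h ▸ hbi)
  have hby : y ≠ b := fun h => hy i (h ▸ hbi)
  have hy₁ : ∀ i, y ∉ T₁ i := by
    intro i hi
    rcases hins1.mem_names.1 ⟨i, hi⟩ with ⟨j, hj⟩ | h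
    · exact hy j hj
    · exact hxy h.symm
  rw [edgeSegment] at hz
  by_cases h1 : f = (x, b)
  · subst h1
    simp only [Function.update_self, Function.update_of_ne hbx] at hz
    exact Or.inr (segment_subset_triangle_left _ _ _ hz)
  by_cases h2 : f = (b, y)
  · subst h2
    simp only [Function.update_self, Function.update_of_ne hby] at hz
    exact Or.inr (segment_subset_triangle_right _ _ _ hz)
  left
  have hT₂ := hins2.shape hT₁ hy₁
  have hf1 : f.1 ≠ b := by
    intro h
    apply h2
    have : (b, y) ∈ edgeSet T₂ := (hins2.mem_edgeSet hT₁).2 (by simp)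
    exact Prod.ext h (hT₂.next_eq (u := b) (h ▸ hf) this)
  have hf2 : f.2 ≠ b := by
    intro h
    apply h1
    have : (x, b) ∈ edgeSet T₂ := (hins2.mem_edgeSet hT₁).2 (Or.inl
      ⟨(hins1.mem_edgeSet hT).2 (by simp), fun h => hbx (congrArg Prod.fst h)⟩)
    exact Prod.ext (hT₂.prev_eq (u := b) (h ▸ hf) this) h
  rw [Function.update_of_ne hf1, Function.update_of_ne hf2] at hz
  rcases (hins2.mem_edgeSet hT₁).1 hf with ⟨h3, -⟩ | h3 | h3
  · rcases (hins1.mem_edgeSet hT).1 h3 with ⟨h4, -⟩ | h4 | h4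
    · exact ⟨f, h4, hz⟩
    · subst h4
      exact ⟨(p, b), hp, (convex_segment (𝕜 := ℝ) _ _).segment_subset (left_mem_segment _ _ _)
        (openSegment_subset_segment _ _ _ hX) hz⟩
    · exact absurd h4 h1
  · exact absurd h3 h2
  · subst h3
    exact ⟨(b, q), hq, (convex_segment (𝕜 := ℝ) _ _).segment_subset
      (openSegment_subset_segment _ _ _ hY) (right_mem_segment _ _ _) hz⟩

/-- Renaming the nodes of a labelling. -/
def relabel (σ : Equiv.Perm ℕ) (lab : VertexName → Option ℕ) : VertexName → Option ℕ :=
  fun u => (lab u).map σ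

lemma relabel_eq_none {σ : Equiv.Perm ℕ} {u : VertexName} : relabel σ lab u = none ↔ lab u = none :=
  Option.map_eq_none_iff

lemma relabel_inj {σ : Equiv.Perm ℕ} {u w : VertexName} :
    relabel σ lab u = relabel σ lab w ↔ lab u = lab w :=
  (Option.map_injective σ.injective).eq_iff

lemma Shape.relabel (h : Shape T lab) (σ : Equiv.Perm ℕ) : Shape T (relabel σ lab) := by
  refine ⟨h.ne_nil, h.nodup, h.disj, fun u hu => h.supp u fun h0 => hu (relabel_eq_none.2 h0),
    fun u hu => ?_⟩
  obtain ⟨u', h1, h2, h3⟩ := h.two u fun h0 => hu (relabel_eq_none.2 h0)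
  exact ⟨u', h1, relabel_inj.2 h2, fun w hw => h3 w (relabel_inj.1 hw)⟩

lemma Good.relabel {E : Set (VertexName × VertexName)} (h : Good E lab pos) (σ : Equiv.Perm ℕ) :
    Good E (relabel σ lab) pos := by
  refine ⟨h.nondeg, ?_, ?_, ?_⟩
  · intro e he f hf hef x hx hx'
    obtain ⟨u, w, h1, h2, h3, h4, h5⟩ := h.inter e he f hf hef x hx hx'
    refine ⟨u, w, h1, h2, h3, h4, h5.imp_right fun h6 => ⟨relabel_inj.2 h6.1, fun h0 => ?_⟩⟩
    exact h6.2 (relabel_eq_none.1 h0)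
  · intro u b w hu hw hb
    exact h.straight u b w hu hw fun h0 => hb (relabel_eq_none.2 h0)
  · intro u w hu huw
    exact h.nodepos u w (fun h0 => hu (relabel_eq_none.2 h0)) (relabel_inj.1 huw)

lemma eraseLabel_relabel (σ : Equiv.Perm ℕ) (a : ℕ) :
    eraseLabel (σ a) (relabel σ lab) = relabel σ (eraseLabel a lab) := by
  funext u
  have : (lab u).map σ = some (σ a) ↔ lab u = some a := by
    rw [← Option.map_some, (Option.map_injective σ.injective).eq_iff]
  by_cases h : lab u = some a
  · simp [eraseLabel, relabel, h]
  · simp [eraseLabel, relabel, h]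

lemma labels_finite (hT : Shape T lab) : {k | ∃ u, lab u = some k}.Finite := by
  refine ((nameList T).filterMap lab).toFinset.finite_toSet.subset ?_
  rintro k ⟨u, hu⟩
  simp only [List.coe_toFinset, Set.mem_ofPred_eq, List.mem_filterMap]
  exact ⟨u, mem_nameList.2 (hT.supp u (by simp [hu])), hu⟩

/-- For links, the insertion of a vertex is an elementary isotopy, under which `v` is invariant by
assumption. -/
lemma valueOf_insertion_of_link {R : Type*} [CommRing R] {v : EmbeddedGraph n → R}
    (hv : IsVassilievInvariant v) {π : Equiv.Perm (Fin n)} (hT : Shape T lab)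
    (hlab : ∀ u, lab u = none) (h : IsInsertion π T T' a c b) (hc : ∀ i, c ∉ T i)
    (hG : Good (edgeSet T) lab pos) (hG' : Good (edgeSet T') lab pos)
    (htri : ∀ f ∈ edgeSet T, ∀ z ∈ edgeSegment pos f, z ∈ triangle (pos a) (pos b) (pos c) →
      z ∈ segment ℝ (pos a) (pos b)) :
    valueOf v (diagram T lab pos) = valueOf v (diagram T' lab pos) := by
  have hT' := h.shape hT hc
  obtain ⟨G, hGc⟩ := exists_embeddedGraph hT hG
  obtain ⟨G', hGc'⟩ := exists_embeddedGraph hT' hG'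
  rw [valueOf_eq v G hGc, valueOf_eq v G' hGc']
  have hL : ∀ {S : Fin n → List VertexName} {H : EmbeddedGraph n}, Shape S lab →
      H.comp = diagram S lab pos → H.IsLink := by
    intro S H hS hH
    ext k
    simp [EmbeddedGraph.mem_nodes_iff hS hH, hlab]
  refine hv.isotopy_invariant G G' (hL hT hGc) (hL hT' hGc') (Relation.EqvGen.rel _ _ ?_)
  obtain ⟨i, t, hi, hi', hj⟩ := h
  refine ⟨hL hT hGc, hL hT' hGc', π, i, (pos a, lab a), (pos b, lab b), (pos c, lab c),
    t.map fun u => (pos u, lab u), ?_, ?_, ?_, ?_⟩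
  · rw [hGc]; exact hi.map _
  · rw [hGc']; exact hi'.map _
  · intro j hji
    rw [hGc, hGc']
    exact (hj j hji).map _
  · rw [convexHull_triple, triangle_comm]
    rintro z ⟨hz, hzG⟩
    obtain ⟨f, hf, hzf⟩ := (EmbeddedGraph.mem_support_iff hGc).1 hzG
    exact htri f hf z hzf hz

lemma triangle_subset_segment_of_mem {A B C : Fin 3 → ℝ} (h : C ∈ segment ℝ A B) :
    triangle A B C ⊆ segment ℝ A B :=
  triangle_subset_of_convex (convex_segment _ _) (left_mem_segment _ _ _) (right_mem_segment _ _ _) h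

/-- The direction of a strand at a node is not affected by an insertion, up to a positive factor. -/
lemma exists_direction_factor {π : Equiv.Perm (Fin n)} (hT : Shape T lab)
    (h : IsInsertion π T T' a c b) (hc : ∀ i, c ∉ T i) (hG : Good (edgeSet T) lab pos)
    (hG' : Good (edgeSet T') lab pos) (hb' : lab b' ≠ none) {p'' q'' : VertexName}
    (hp' : (p', b') ∈ edgeSet T) (hq' : (b', q') ∈ edgeSet T)
    (hp'' : (p'', b') ∈ edgeSet T') (hq'' : (b', q'') ∈ edgeSet T') :
    ∃ r : ℝ, 0 < r ∧ pos q'' - pos p'' = r • (pos q' - pos p') := by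
  have hT' := h.shape hT hc
  obtain ⟨r, hr0, hr1, hr⟩ := mem_openSegment_iff_exists.1 (hG.straight p' b' q' hp' hq' hb')
  obtain ⟨s, hs0, hs1, hs⟩ := mem_openSegment_iff_exists.1 (hG'.straight p'' b' q'' hp'' hq'' hb')
  by_cases hab : (b', q') = (a, b)
  · have : (p', b') ≠ (a, b) := by
      intro h'
      have h1 := congrArg Prod.snd h'
      have h2 := congrArg Prod.fst hab
      simp only at h1 h2
      exact hG.nondeg _ h.mem_edge (by simp only; rw [← h1, ← h2])
    have h3 : (p', b') ∈ edgeSet T' := (h.mem_edgeSet hT).2 (Or.inl ⟨hp', this⟩)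
    obtain rfl := hT'.prev_eq hp'' h3
    refine ⟨r / s, by positivity, ?_⟩
    have : s • (pos q'' - pos p'') = r • (pos q' - pos p'') := by
      have h4 := hr.symm.trans hs
      simpa using h4.symm
    rw [div_eq_inv_mul, mul_smul, ← this, smul_smul, inv_mul_cancel₀ hs0.ne', one_smul]
  · have h3 : (b', q') ∈ edgeSet T' := (h.mem_edgeSet hT).2 (Or.inl ⟨hq', hab⟩)
    obtain rfl := hT'.next_eq hq'' h3
    refine ⟨(1 - r) / (1 - s), div_pos (by linarith) (by linarith), ?_⟩
    have : (1 - s) • (pos q'' - pos p'') = (1 - r) • (pos q'' - pos p') := by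
      have h4 := hs.symm.trans hr
      calc (1 - s) • (pos q'' - pos p'')
          = pos q'' - (pos p'' + s • (pos q'' - pos p'')) := by module
        _ = _ := by rw [h4]; module
    rw [div_eq_inv_mul, mul_smul, ← this, smul_smul, inv_mul_cancel₀ (by linarith), one_smul]

/-- At every node there is a passage away from a given edge. -/
lemma exists_passage_away {u : VertexName} (hT : Shape T lab)
    (hG : Good (edgeSet T) lab pos) (hab : (a, b) ∈ edgeSet T) (hu : lab u ≠ none) :
    ∃ b₀ b₁, lab b₀ = lab u ∧ lab b₁ = lab u ∧ b₀ ≠ b₁ ∧ b₀ ≠ a ∧ b₀ ≠ b := by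
  obtain ⟨w, hwu, hw, -⟩ := hT.two u hu
  have hpos := hG.nodepos u w hu hw.symm
  have hne : pos a ≠ pos b := hG.nondeg _ hab
  by_cases h : u = a ∨ u = b
  · refine ⟨w, u, hw, rfl, hwu, ?_, ?_⟩
    · rintro rfl
      rcases h with rfl | rfl
      · exact hwu rfl
      · exact hne hpos.symm
    · rintro rfl
      rcases h with rfl | rfl
      · exact hne hpos
      · exact hwu rfl
  · push Not at h
    exact ⟨u, w, rfl, hw, hwu.symm, h.1, h.2⟩

set_option maxHeartbeats 1000000 in
/-- Invariance of the extension of a Vassiliev invariant under elementary moves of embedded graphs,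
by induction on the number of nodes: a node is resolved within a small triangle at a passage away
from the edge that is moved. -/
theorem valueOf_insertion_aux {R : Type*} [CommRing R] {v : EmbeddedGraph n → R}
    (hv : IsVassilievInvariant v) (π : Equiv.Perm (Fin n)) (σ : Equiv.Perm ℕ)
    (a c b : VertexName) (m : ℕ) :
    ∀ {T T' : Fin n → List VertexName} {lab : VertexName → Option ℕ}
      {pos : VertexName → Fin 3 → ℝ}, {k | ∃ u, lab u = some k}.ncard = m → Shape T lab →
      IsInsertion π T T' a c b → (∀ i, c ∉ T i) → Good (edgeSet T) lab pos →
      Good (edgeSet T') lab pos →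
      (∀ f ∈ edgeSet T, ∀ z ∈ edgeSegment pos f, z ∈ triangle (pos a) (pos b) (pos c) →
        z ∈ segment ℝ (pos a) (pos b)) →
      ((lab a = none ∧ lab b = none) ∨ pos c ∈ segment ℝ (pos a) (pos b)) →
      valueOf v (diagram T lab pos) = valueOf v (diagram T' (relabel σ lab) pos) := by
  induction m with
  | zero =>
    intro T T' lab pos hm hT h hc hG hG' htri _
    have hempty : {k | ∃ u, lab u = some k} = ∅ := (Set.ncard_eq_zero (labels_finite hT)).1 hm
    have hlab : ∀ u, lab u = none := by
      intro u
      by_contra hu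
      obtain ⟨k, hk⟩ := Option.ne_none_iff_exists'.1 hu
      have : k ∈ {k | ∃ u, lab u = some k} := ⟨u, hk⟩
      rw [hempty] at this
      exact this
    have hrel : relabel σ lab = lab := by
      funext u
      simp [relabel, hlab]
    rw [hrel]
    exact valueOf_insertion_of_link hv hT hlab h hc hG hG' htri
  | succ m ih =>
    intro T T' lab pos hm hT h hc hG hG' htri hor
    have hT' := h.shape hT hc
    have hab := h.mem_edge
    obtain ⟨k, u, hu⟩ : {k | ∃ u, lab u = some k}.Nonempty := by
      rw [← Set.ncard_pos (labels_finite hT)]; omega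
    obtain ⟨b₀, b₁, hb₀, hb₁, hne, hb₀a, hb₀b⟩ := exists_passage_away hT hG hab
      (u := u) (by simp [hu])
    -- `b₀` is a passage through the node `k` that is not an end of the edge `a b`; the strand through
    -- it is pushed to both sides, before and after the move, by the same vectors `τ • e`, `τ • -e`.
    rw [hu] at hb₀ hb₁
    have hbb : lab b₀ = lab b₁ := hb₀.trans hb₁.symm
    have hb₀n : lab b₀ ≠ none := by simp [hb₀]
    have hb₁n : lab b₁ ≠ none := by simp [hb₁]
    obtain ⟨p, hp⟩ := exists_prev_edge (hT.supp b₀ hb₀n)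
    obtain ⟨q, hq⟩ := exists_next_edge (hT.supp b₀ hb₀n)
    obtain ⟨p', hp'⟩ := exists_prev_edge (hT.supp b₁ hb₁n)
    obtain ⟨q', hq'⟩ := exists_next_edge (hT.supp b₁ hb₁n)
    obtain ⟨p'', hp''⟩ := exists_prev_edge (hT'.supp b₁ hb₁n)
    obtain ⟨q'', hq''⟩ := exists_next_edge (hT'.supp b₁ hb₁n)
    have hpT' : (p, b₀) ∈ edgeSet T' :=
      (h.mem_edgeSet hT).2 (Or.inl ⟨hp, fun h => hb₀b (congrArg Prod.snd h)⟩)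
    have hqT' : (b₀, q) ∈ edgeSet T' :=
      (h.mem_edgeSet hT).2 (Or.inl ⟨hq, fun h => hb₀a (congrArg Prod.fst h)⟩)
    obtain ⟨e, he⟩ := exists_det_pos (hG.linearIndependent_strands hb₀n hbb hne hp hq hp' hq')
    obtain ⟨r, hr0, hr⟩ := exists_direction_factor hT h hc hG hG' hb₁n hp' hq' hp'' hq''
    have he'' : 0 < Matrix.det (Matrix.of ![pos q - pos p, pos q'' - pos p'', e]) := by
      have := det_smul_smul (d := pos q - pos p) (d' := pos q' - pos p') (e := e) (r := 1) (s := r)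
        (t := 1)
      rw [one_smul, one_smul, ← hr] at this
      rw [this]
      positivity
    have hneg : ∀ {d d' : Fin 3 → ℝ}, 0 < Matrix.det (Matrix.of ![d, d', e]) →
        Matrix.det (Matrix.of ![d, d', -e]) ≠ 0 := by
      intro d d' hdd
      have := det_smul_smul (d := d) (d' := d') (e := e) (r := 1) (s := 1) (t := -1)
      rw [one_smul, one_smul, neg_smul, one_smul] at this
      rw [this]
      nlinarith
    -- near the node, the resolving triangles do not meet the triangle of the move
    have hfar : ∀ e' : Fin 3 → ℝ, ∀ᶠ τ in 𝓝[>] (0 : ℝ),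
        ∀ z ∈ triangle (pos a) (pos b) (pos c), z ∈ triangle (pos b₀ + τ • (pos p - pos b₀))
          (pos b₀ + τ • (pos q - pos b₀)) (pos b₀ + τ • e') → z ∈ segment ℝ (pos a) (pos b) := by
      intro e'
      rcases hor with ⟨hla, hlb⟩ | hC
      · have hnot : pos b₀ ∉ triangle (pos a) (pos b) (pos c) := by
          intro hmem
          have h1 : pos b₀ ∈ edgeSegment pos (p, b₀) := right_mem_segment _ _ _
          have h2 := htri _ hp _ h1 hmem
          obtain ⟨u, w, hu, hw, -, hbw, huw⟩ := hG.inter (a, b) hab (p, b₀) hp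
            (fun h => hb₀b (congrArg Prod.snd h).symm) _ h2 h1
          have hlu : lab u = none := by rcases hu with rfl | rfl <;> assumption
          rcases huw with rfl | ⟨-, h4⟩
          · rcases hw with hw | hw
            · exact hG.nondeg _ hp (hbw.trans (congrArg pos hw)).symm
            · exact hb₀n ((congrArg lab hw).symm.trans hlu)
          · exact h4 hlu
        filter_upwards [eventually_triangle_disjoint (tendsto_add_smul (pos b₀) (pos p - pos b₀))
          (tendsto_add_smul (pos b₀) (pos q - pos b₀)) (tendsto_add_smul (pos b₀) e')
          (isCompact_triangle (pos a) (pos b) (pos c)).isClosed hnot] with τ hτ z hz hz'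
        exact absurd hz' (hτ z hz)
      · exact Eventually.of_forall fun τ z hz _ => triangle_subset_segment_of_mem hC hz
    have hev1 := hG.eventually_triangle hT hb₀n hbb hne hp hq hp' hq' he.ne'
    have hev2 := hG.eventually_triangle hT hb₀n hbb hne hp hq hp' hq' (hneg he)
    have hev3 := hG'.eventually_triangle hT' hb₀n hbb hne hpT' hqT' hp'' hq'' he''.ne'
    have hev4 := hG'.eventually_triangle hT' hb₀n hbb hne hpT' hqT' hp'' hq'' (hneg he'')
    have hlt : ∀ᶠ τ in 𝓝[>] (0 : ℝ), τ < 1 :=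
      nhdsWithin_le_nhds (eventually_lt_nhds (zero_lt_one' ℝ))
    obtain ⟨τ, h1, h2, h3, h4, h5, h6, hτ1, hτ0⟩ := (hev1.and (hev2.and (hev3.and (hev4.and
      ((hfar e).and ((hfar (-e)).and (hlt.and self_mem_nhdsWithin))))))).exists
    replace hτ0 : 0 < τ := hτ0
    obtain ⟨x, hx, hxS⟩ := exists_fresh T {c}
    obtain ⟨y, hy, hyS⟩ := exists_fresh T {c, x}
    simp only [Finset.mem_singleton, Finset.mem_insert, not_or] at hxS hyS
    obtain ⟨i₀, hi₀⟩ := hT.supp b₀ hb₀n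
    have hb₀x : x ≠ b₀ := fun h => hx i₀ (h ▸ hi₀)
    have hb₀y : y ≠ b₀ := fun h => hy i₀ (h ▸ hi₀)
    have hcb₀ : c ≠ b₀ := fun h => hc i₀ (h ▸ hi₀)
    obtain ⟨T₂, h₂⟩ := exists_isBypass (hT.supp b₀ hb₀n) x y
    obtain ⟨T₂', h₂', hins⟩ := h.exists_bypass hT hb₀a hb₀b h₂
    have hx' : ∀ i, x ∉ T' i := fun i hi =>
      (h.mem_names.1 ⟨i, hi⟩).elim (fun ⟨j, hj⟩ => hx j hj) hxS
    have hy' : ∀ i, y ∉ T' i := fun i hi =>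
      (h.mem_names.1 ⟨i, hi⟩).elim (fun ⟨j, hj⟩ => hy j hj) hyS.1
    -- the positions including those of the new vertices
    obtain ⟨ps, hps⟩ : ∃ ps : VertexName → Fin 3 → ℝ, ps = Function.update (Function.update pos x
      (pos b₀ + τ • (pos p - pos b₀))) y (pos b₀ + τ • (pos q - pos b₀)) := ⟨_, rfl⟩
    have hps0 : ∀ u, u ≠ x → u ≠ y → ps u = pos u := by
      intro u hux huy
      rw [hps, Function.update_of_ne huy, Function.update_of_ne hux]
    have hpsx : ps x = pos b₀ + τ • (pos p - pos b₀) := by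
      rw [hps, Function.update_of_ne (Ne.symm hyS.2), Function.update_self]
    have hpsy : ps y = pos b₀ + τ • (pos q - pos b₀) := by
      rw [hps, Function.update_self]
    have hpsT : ∀ u, (∃ i, u ∈ T i) → ps u = pos u := fun u ⟨i, hi⟩ =>
      hps0 u (fun h => hx i (h ▸ hi)) (fun h => hy i (h ▸ hi))
    have hpsT' : ∀ u, (∃ i, u ∈ T' i) → ps u = pos u := fun u ⟨i, hi⟩ =>
      hps0 u (fun h => hx' i (h ▸ hi)) (fun h => hy' i (h ▸ hi))
    have hsegT : ∀ f ∈ edgeSet T, edgeSegment ps f = edgeSegment pos f := fun f hf => by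
      rw [edgeSegment, edgeSegment, hpsT _ (fst_mem_of_mem_edgeSet hf),
        hpsT _ (snd_mem_of_mem_edgeSet hf)]
    have hsegT' : ∀ f ∈ edgeSet T', edgeSegment ps f = edgeSegment pos f := fun f hf => by
      rw [edgeSegment, edgeSegment, hpsT' _ (fst_mem_of_mem_edgeSet hf),
        hpsT' _ (snd_mem_of_mem_edgeSet hf)]
    have hGs : Good (edgeSet T) lab ps := hG.congr (fun f hf =>
      ⟨hpsT _ (fst_mem_of_mem_edgeSet hf), hpsT _ (snd_mem_of_mem_edgeSet hf)⟩)
      fun u hu => hpsT u (hT.supp u hu)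
    have hGs' : Good (edgeSet T') lab ps := hG'.congr (fun f hf =>
      ⟨hpsT' _ (fst_mem_of_mem_edgeSet hf), hpsT' _ (snd_mem_of_mem_edgeSet hf)⟩)
      fun u hu => hpsT u (hT.supp u hu)
    have hpb₀ := hpsT b₀ ⟨i₀, hi₀⟩
    have hpp := hpsT p (fst_mem_of_mem_edgeSet hp)
    have hpq := hpsT q (snd_mem_of_mem_edgeSet hq)
    have hpp' := hpsT p' (fst_mem_of_mem_edgeSet hp')
    have hpq' := hpsT q' (snd_mem_of_mem_edgeSet hq')
    have hpp'' := hpsT' p'' (fst_mem_of_mem_edgeSet hp'')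
    have hpq'' := hpsT' q'' (snd_mem_of_mem_edgeSet hq'')
    have hpa := hpsT a (fst_mem_of_mem_edgeSet hab)
    have hpb := hpsT b (snd_mem_of_mem_edgeSet hab)
    have hpc := hps0 c (Ne.symm hxS) (Ne.symm hyS.1)
    obtain ⟨hS, hGP, hGN, hval⟩ := hv.exchange_of_triangle hGs hT hb₀ hb₁ hp hq hp' hq' h₂ hx hy
      (Ne.symm hyS.2) hτ0 hτ1 (by rw [hpsx, hpb₀, hpp]) (by rw [hpsy, hpb₀, hpq]) (e := e)
      (by rw [hpp, hpq, hpp', hpq']; exact he)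
      (fun f hf z hz => by rw [hpsx, hpsy, hpb₀]; rw [hsegT f hf] at hz; exact h1 f hf z hz)
      (fun f hf z hz => by rw [hpsx, hpsy, hpb₀]; rw [hsegT f hf] at hz; exact h2 f hf z hz)
    have hσb : ∀ {u}, lab u = some k → relabel σ lab u = some (σ k) := by
      intro u hu; simp [relabel, hu]
    obtain ⟨-, hGP', hGN', -⟩ := hv.exchange_of_triangle hGs' hT' hb₀ hb₁ hpT' hqT' hp'' hq''
      h₂' hx' hy' (Ne.symm hyS.2) hτ0 hτ1 (by rw [hpsx, hpb₀, hpp]) (by rw [hpsy, hpb₀, hpq])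
      (e := e) (by rw [hpp, hpq, hpp'', hpq'']; exact he'')
      (fun f hf z hz => by rw [hpsx, hpsy, hpb₀]; rw [hsegT' f hf] at hz; exact h3 f hf z hz)
      (fun f hf z hz => by rw [hpsx, hpsy, hpb₀]; rw [hsegT' f hf] at hz; exact h4 f hf z hz)
    obtain ⟨-, -, -, hval'⟩ := hv.exchange_of_triangle (hGs'.relabel σ) (hT'.relabel σ)
      (hσb hb₀) (hσb hb₁) hpT' hqT' hp'' hq''
      h₂' hx' hy' (Ne.symm hyS.2) hτ0 hτ1 (by rw [hpsx, hpb₀, hpp]) (by rw [hpsy, hpb₀, hpq])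
      (e := e) (by rw [hpp, hpq, hpp'', hpq'']; exact he'')
      (fun f hf z hz => by rw [hpsx, hpsy, hpb₀]; rw [hsegT' f hf] at hz; exact h3 f hf z hz)
      (fun f hf z hz => by rw [hpsx, hpsy, hpb₀]; rw [hsegT' f hf] at hz; exact h4 f hf z hz)
    rw [eraseLabel_relabel] at hval'
    rw [← diagram_congr hpsT, ← diagram_congr hpsT', hval, hval']
    have hm' : {j | ∃ u, eraseLabel k lab u = some j}.ncard = m := by
      rw [setOf_eraseLabel, Set.ncard_sdiff_singleton_of_mem
        (show k ∈ {j | ∃ u, lab u = some j} from ⟨u, hu⟩), hm]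
      rfl
    have hc₂ : ∀ i, c ∉ T₂ i := by
      obtain ⟨j, mm, hj, hj', hl⟩ := h₂
      intro i hi
      by_cases hij : i = j
      · subst hij
        have h7 := hc i
        rw [hj.mem_iff] at h7
        rw [hj'.mem_iff] at hi
        simp only [List.mem_cons] at hi h7
        rcases hi with hi | hi | hi | hi
        · exact hxS hi.symm
        · exact hcb₀ hi
        · exact hyS.1 hi.symm
        · exact h7 (Or.inr hi)
      · exact hc i ((hl i hij).mem_iff.1 hi)
    have hXo : ps x ∈ openSegment ℝ (ps p) (ps b₀) := by
      rw [hpsx, hpp, hpb₀, openSegment_symm]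
      exact mem_openSegment_iff_exists.2 ⟨τ, hτ0, hτ1, rfl⟩
    have hYo : ps y ∈ openSegment ℝ (ps b₀) (ps q) := by
      rw [hpsy, hpq, hpb₀]
      exact mem_openSegment_iff_exists.2 ⟨τ, hτ0, hτ1, rfl⟩
    have hor' : (eraseLabel k lab a = none ∧ eraseLabel k lab b = none) ∨
        pos c ∈ segment ℝ (pos a) (pos b) :=
      hor.imp_left fun h => ⟨eraseLabel_of_none h.1, eraseLabel_of_none h.2⟩
    -- the two moves of the resolved graphs, which have fewer nodes
    have main : ∀ e' : Fin 3 → ℝ,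
        (∀ z ∈ triangle (pos a) (pos b) (pos c), z ∈ triangle (pos b₀ + τ • (pos p - pos b₀))
          (pos b₀ + τ • (pos q - pos b₀)) (pos b₀ + τ • e') → z ∈ segment ℝ (pos a) (pos b)) →
        Good (edgeSet T₂) (eraseLabel k lab) (Function.update ps b₀ (ps b₀ + τ • e')) →
        Good (edgeSet T₂') (eraseLabel k lab) (Function.update ps b₀ (ps b₀ + τ • e')) →
        valueOf v (diagram T₂ (eraseLabel k lab) (Function.update ps b₀ (ps b₀ + τ • e'))) =
        valueOf v (diagram T₂' (relabel σ (eraseLabel k lab))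
          (Function.update ps b₀ (ps b₀ + τ • e'))) := by
      intro e' he' hg hg'
      refine ih hm' hS hins hc₂ hg hg' ?_ ?_
      · intro f hf z hz
        rw [Function.update_of_ne (Ne.symm hb₀a), Function.update_of_ne (Ne.symm hb₀b),
          Function.update_of_ne hcb₀, hpa, hpb, hpc]
        intro hzt
        rcases h₂.edgeSegment_cases hT hGs hp hq hx hy (Ne.symm hyS.2) hXo hYo hf hz with
          ⟨g, hg, hzg⟩ | hzt'
        · rw [hsegT g hg] at hzg
          exact htri g hg z hzg hzt
        · rw [hpsx, hpsy, hpb₀] at hzt'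
          exact he' z hzt hzt'
      · rw [Function.update_of_ne (Ne.symm hb₀a), Function.update_of_ne (Ne.symm hb₀b),
          Function.update_of_ne hcb₀, hpa, hpb, hpc]
        exact hor'
    rw [main e h5 hGP hGP', main (-e) h6 hGN hGN']

end Insertion

section Corollaries

variable {n : ℕ} {T T' : Fin n → List VertexName} {lab : VertexName → Option ℕ}
  {pos : VertexName → Fin 3 → ℝ} {a b c : VertexName} {R : Type*} [CommRing R]
  {v : EmbeddedGraph n → R}

lemma relabel_one : relabel 1 lab = lab := by
  funext u
  simp [relabel]

/-- Subdividing an edge does not change the value of a Vassiliev invariant. -/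
lemma IsVassilievInvariant.subdivide (hv : IsVassilievInvariant v) (hT : Shape T lab)
    (h : IsInsertion 1 T T' a c b) (hc : ∀ i, c ∉ T i) (hG : Good (edgeSet T) lab pos)
    (hC : pos c ∈ openSegment ℝ (pos a) (pos b)) :
    Shape T' lab ∧ Good (edgeSet T') lab pos ∧
      valueOf v (diagram T lab pos) = valueOf v (diagram T' lab pos) := by
  have hG' : Good (edgeSet T') lab pos := by
    rw [h.edgeSet_eq hT]
    exact hG.subdivide h.mem_edge (notMem_edge_of_fresh hc) (hT.lab_fresh hc) hC
  have hC' := openSegment_subset_segment _ _ _ hC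
  refine ⟨h.shape hT hc, hG', ?_⟩
  have := valueOf_insertion_aux hv 1 1 a c b _ rfl hT h hc hG hG'
    (fun f _ z _ hz => triangle_subset_segment_of_mem hC' hz) (Or.inr hC')
  rwa [relabel_one] at this

/-- Pushing an edge across a triangle that meets the rest of the graph only in this edge does not
change the value of a Vassiliev invariant. -/
lemma IsVassilievInvariant.insert_apex (hv : IsVassilievInvariant v) (hT : Shape T lab)
    (h : IsInsertion 1 T T' a c b) (hc : ∀ i, c ∉ T i) (hG : Good (edgeSet T) lab pos)
    (hla : lab a = none) (hlb : lab b = none)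
    (hli : LinearIndependent ℝ ![pos b - pos a, pos c - pos a])
    (hd : ∀ f ∈ edgeSet T, f ≠ (a, b) → ∀ x ∈ edgeSegment pos f,
      x ∈ triangle (pos a) (pos b) (pos c) → x ∈ segment ℝ (pos a) (pos b)) :
    Shape T' lab ∧ Good (edgeSet T') lab pos ∧
      valueOf v (diagram T lab pos) = valueOf v (diagram T' lab pos) := by
  have hG' : Good (edgeSet T') lab pos := by
    rw [h.edgeSet_eq hT]
    exact hG.insert_apex_of_triangle h.mem_edge (notMem_edge_of_fresh hc) (hT.lab_fresh hc)
      hla hlb hli hd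
  refine ⟨h.shape hT hc, hG', ?_⟩
  have := valueOf_insertion_aux hv 1 1 a c b _ rfl hT h hc hG hG' (fun f hf z hz hzt => by
    by_cases hfe : f = (a, b)
    · subst hfe; exact hz
    · exact hd f hf hfe z hz hzt) (Or.inl ⟨hla, hlb⟩)
  rwa [relabel_one] at this

lemma edgeSet_eq_of_isRotated {π : Equiv.Perm (Fin n)} (h : ∀ j, T' (π j) ~r T j) :
    edgeSet T' = edgeSet T := by
  ext e
  have h1 : e ∈ edgeSet T' ↔ ∃ j, e ∈ cyclicPairs (T' (π j)) :=
    (Equiv.exists_congr_left π.symm).trans (by simp)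
  rw [h1]
  exact exists_congr fun j => (h j).mem_cyclicPairs

lemma Shape.of_isRotated {π : Equiv.Perm (Fin n)} (hT : Shape T lab) (h : ∀ j, T' (π j) ~r T j) :
    Shape T' lab := by
  refine ⟨fun j => ?_, fun j => ?_, fun i j u hi hj => ?_, fun u hu => ?_, hT.two⟩
  · obtain ⟨j, rfl⟩ := π.surjective j
    exact fun h0 => hT.ne_nil j (by simpa [h0] using (h j).symm)
  · obtain ⟨j, rfl⟩ := π.surjective j
    exact (h j).nodup_iff.2 (hT.nodup j)
  · obtain ⟨i, rfl⟩ := π.surjective i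
    obtain ⟨j, rfl⟩ := π.surjective j
    rw [hT.disj i j u ((h i).mem_iff.1 hi) ((h j).mem_iff.1 hj)]
  · obtain ⟨i, hi⟩ := hT.supp u hu
    exact ⟨π i, (h i).mem_iff.2 hi⟩

/-- The starting points of the strands, their numbering and the names of the nodes are irrelevant
for the value of a Vassiliev invariant. -/
theorem IsVassilievInvariant.valueOf_isRotated (hv : IsVassilievInvariant v)
    (π : Equiv.Perm (Fin n)) (σ : Equiv.Perm ℕ) (hT : Shape T lab) (h : ∀ j, T' (π j) ~r T j)
    (hG : Good (edgeSet T) lab pos) :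
    valueOf v (diagram T lab pos) = valueOf v (diagram T' (relabel σ lab) pos) := by
  rcases isEmpty_or_nonempty (Fin n) with hn | ⟨⟨i⟩⟩
  · congr 1
    funext i
    exact isEmptyElim i
  obtain ⟨a, ha⟩ := List.exists_mem_of_ne_nil _ (hT.ne_nil i)
  obtain ⟨b, hb⟩ := exists_next ha
  have hab : (a, b) ∈ edgeSet T := ⟨i, hb⟩
  have hne : a ≠ b := fun h0 => hG.nondeg _ hab (by simp [h0])
  obtain ⟨c, hc, -⟩ := exists_fresh T ∅
  have hT' := hT.of_isRotated h
  have hE := edgeSet_eq_of_isRotated h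
  have hc' : ∀ i, c ∉ T' i := by
    intro i hi
    obtain ⟨i, rfl⟩ := π.surjective i
    exact hc i ((h i).mem_iff.1 hi)
  set ps := Function.update pos c (midpoint ℝ (pos a) (pos b)) with hps
  have hpsT : ∀ u, (∃ i, u ∈ T i) → pos u = ps u := fun u ⟨i, hi⟩ => by
    have h0 : u ≠ c := fun h0 => hc i (h0 ▸ hi)
    rw [hps, Function.update_of_ne h0]
  have hpsT' : ∀ u, (∃ i, u ∈ T' i) → pos u = ps u := fun u ⟨i, hi⟩ => by
    have h0 : u ≠ c := fun h0 => hc' i (h0 ▸ hi)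
    rw [hps, Function.update_of_ne h0]
  have hGs : Good (edgeSet T) lab ps := hG.congr (fun f hf =>
      ⟨(hpsT _ (fst_mem_of_mem_edgeSet hf)).symm, (hpsT _ (snd_mem_of_mem_edgeSet hf)).symm⟩)
      fun u hu => (hpsT u (hT.supp u hu)).symm
  have hC : ps c ∈ openSegment ℝ (ps a) (ps b) := by
    rw [← hpsT a ⟨i, ha⟩, ← hpsT b (snd_mem_of_mem_edgeSet hab), hps, Function.update_self]
    exact mem_openSegment_iff_exists.2 ⟨1 / 2, by norm_num, by norm_num, by
      rw [midpoint_eq_smul_add, invOf_eq_inv]; module⟩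
  rw [diagram_congr hpsT, diagram_congr hpsT']
  have hab' : (a, b) ∈ edgeSet T' := hE ▸ hab
  obtain ⟨T'', hins'⟩ := exists_isInsertion hT' hne hab' c
  have hins : IsInsertion π T T'' a c b := by
    obtain ⟨j, t, hj, hj', hl⟩ := hins'
    obtain ⟨j, rfl⟩ := π.surjective j
    refine ⟨j, t, (h j).symm.trans hj, hj', fun k hk => (hl _ ?_).trans (h k)⟩
    exact fun h0 => hk (π.injective h0)
  have hGs' : Good (edgeSet T') lab ps := hE ▸ hGs
  have hG'' : Good (edgeSet T'') lab ps := by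
    rw [hins.edgeSet_eq hT]
    exact hGs.subdivide hab (notMem_edge_of_fresh hc) (hT.lab_fresh hc) hC
  have hC' := openSegment_subset_segment _ _ _ hC
  have hlc' : ∀ u, relabel σ lab u ≠ none → lab u ≠ none := fun u hu h0 => hu (relabel_eq_none.2 h0)
  rw [valueOf_insertion_aux hv π σ a c b _ rfl hT hins hc hGs hG''
    (fun f _ z _ hz => triangle_subset_segment_of_mem hC' hz) (Or.inr hC')]
  have := valueOf_insertion_aux hv 1 1 a c b _ rfl (hT'.relabel σ) hins' hc' (hGs'.relabel σ)
    (hG''.relabel σ)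
    (fun f _ z _ hz => triangle_subset_segment_of_mem hC' hz) (Or.inr hC')
  rw [relabel_one] at this
  exact this.symm

/-- Insert `o` behind every occurrence of `u` in a list. -/
def insertBehind (u o : VertexName) (l : List VertexName) : List VertexName :=
  l.flatMap fun w => if w = u then [w, o] else [w]

lemma insertBehind_cons_of_ne {u o w : VertexName} (h : w ≠ u) (l : List VertexName) :
    insertBehind u o (w :: l) = w :: insertBehind u o l := by
  simp [insertBehind, h]

lemma insertBehind_cons_self (u o : VertexName) (l : List VertexName) :
    insertBehind u o (u :: l) = u :: o :: insertBehind u o l := by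
  simp [insertBehind]

lemma insertBehind_of_notMem {u o : VertexName} {l : List VertexName} (h : u ∉ l) :
    insertBehind u o l = l := by
  induction l with
  | nil => rfl
  | cons w l ih =>
    simp only [List.mem_cons, not_or] at h
    rw [insertBehind_cons_of_ne (Ne.symm h.1), ih h.2]

lemma insertBehind_isRotated {u o : VertexName} {l l' : List VertexName} (h : l ~r l') :
    insertBehind u o l ~r insertBehind u o l' := by
  obtain ⟨k, rfl⟩ := h
  rw [List.rotate_eq_drop_append_take_mod]
  conv_lhs => rw [← List.take_append_drop (k % l.length) l]
  simp only [insertBehind, List.flatMap_append]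
  exact List.isRotated_append

/-- Insertions at different edges commute. -/
lemma IsInsertion.exists_commute {π : Equiv.Perm (Fin n)} {f₁ f₂ : VertexName}
    (h : IsInsertion π T T' a c b) (hT : Shape T lab) (hc : ∀ i, c ∉ T i)
    (hf : (f₁, f₂) ∈ edgeSet T) (hne : f₁ ≠ f₂) (hfe : (f₁, f₂) ≠ (a, b)) (o : VertexName) :
    ∃ S S', IsInsertion 1 T S f₁ o f₂ ∧ IsInsertion 1 T' S' f₁ o f₂ ∧ IsInsertion π S S' a c b := by
  have hT' := h.shape hT hc
  have hf' : (f₁, f₂) ∈ edgeSet T' := (h.mem_edgeSet hT).2 (Or.inl ⟨hf, hfe⟩)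
  have hcf : c ≠ f₁ := by
    rintro rfl
    obtain ⟨i, hi⟩ := fst_mem_of_mem_edgeSet hf
    exact hc i hi
  have key : ∀ {S : Fin n → List VertexName}, Shape S lab → (f₁, f₂) ∈ edgeSet S →
      IsInsertion 1 S (fun i => insertBehind f₁ o (S i)) f₁ o f₂ := by
    intro S hS hfS
    obtain ⟨i, hi⟩ := hfS
    obtain ⟨t, ht⟩ := exists_isRotated_cons_cons (hS.nodup i) hne hi
    have hn : (f₁ :: f₂ :: t).Nodup := ht.nodup_iff.1 (hS.nodup i)
    rw [List.nodup_cons] at hn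
    refine ⟨i, t, ht, ?_, fun j hj => ?_⟩
    · have := insertBehind_isRotated (u := f₁) (o := o) ht
      rwa [insertBehind_cons_self, insertBehind_of_notMem hn.1] at this
    · have : f₁ ∉ S j := fun h0 => hj (hS.disj j i f₁ h0 (fst_mem_of_mem_cyclicPairs hi))
      simp [insertBehind_of_notMem this, List.IsRotated.refl]
  refine ⟨_, _, key hT hf, key hT' hf', ?_⟩
  obtain ⟨i, t, hi, hi', hj⟩ := h
  have hfa : a ≠ f₁ := by
    rintro rfl
    refine hfe ?_
    have hab' : (a, b) ∈ edgeSet T := ⟨i, hi.mem_cyclicPairs.2 (by simp [cyclicPairs_cons])⟩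
    rw [hT.next_eq hf hab']
  have h1 := insertBehind_isRotated (u := f₁) (o := o) hi
  have h2 := insertBehind_isRotated (u := f₁) (o := o) hi'
  rw [insertBehind_cons_of_ne hfa] at h1 h2
  rw [insertBehind_cons_of_ne hcf] at h2
  obtain ⟨s, hs⟩ : ∃ s, insertBehind f₁ o (b :: t) = b :: s := by
    by_cases hb : b = f₁
    · subst hb; exact ⟨_, insertBehind_cons_self _ _ _⟩
    · exact ⟨_, insertBehind_cons_of_ne hb _⟩
  rw [hs] at h1 h2
  exact ⟨i, s, h1, h2, fun j hji => insertBehind_isRotated (hj j hji)⟩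

end Corollaries

/-! ### Coordinates in the plane of a triangle -/

section Plane

variable {V : Type*} [AddCommGroup V] [Module ℝ V]

/-- The point with coordinates `s`, `t` in the plane through `O` in directions `u`, `w`. -/
def planePoint (O u w : V) (s t : ℝ) : V := O + s • u + t • w

variable {O u w : V}

lemma planePoint_inj (h : LinearIndependent ℝ ![u, w]) {s t s' t' : ℝ}
    (h' : planePoint O u w s t = planePoint O u w s' t') : s = s' ∧ t = t' := by
  refine h.coeff_eq ?_
  unfold planePoint at h'
  rw [add_assoc, add_assoc] at h'
  exact add_left_cancel h'

lemma mem_segment_planePoint {s t s' t' : ℝ} {x : V} :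
    x ∈ segment ℝ (planePoint O u w s t) (planePoint O u w s' t') ↔
      ∃ r : ℝ, 0 ≤ r ∧ r ≤ 1 ∧ x = planePoint O u w (s + r * (s' - s)) (t + r * (t' - t)) := by
  rw [mem_segment_iff_exists]
  refine exists_congr fun r => and_congr_right fun _ => and_congr_right fun _ => ?_
  have : planePoint O u w s t + r • (planePoint O u w s' t' - planePoint O u w s t) =
      planePoint O u w (s + r * (s' - s)) (t + r * (t' - t)) := by
    unfold planePoint; module
  rw [this]

lemma mem_openSegment_planePoint {s t s' t' : ℝ} {x : V} :
    x ∈ openSegment ℝ (planePoint O u w s t) (planePoint O u w s' t') ↔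
      ∃ r : ℝ, 0 < r ∧ r < 1 ∧ x = planePoint O u w (s + r * (s' - s)) (t + r * (t' - t)) := by
  rw [mem_openSegment_iff_exists]
  refine exists_congr fun r => and_congr_right fun _ => and_congr_right fun _ => ?_
  have : planePoint O u w s t + r • (planePoint O u w s' t' - planePoint O u w s t) =
      planePoint O u w (s + r * (s' - s)) (t + r * (t' - t)) := by
    unfold planePoint; module
  rw [this]

lemma mem_triangle_planePoint {s t s' t' s'' t'' : ℝ} {x : V} :
    x ∈ triangle (planePoint O u w s t) (planePoint O u w s' t') (planePoint O u w s'' t'') ↔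
      ∃ r q : ℝ, 0 ≤ r ∧ 0 ≤ q ∧ r + q ≤ 1 ∧
        x = planePoint O u w (s + r * (s' - s) + q * (s'' - s)) (t + r * (t' - t) + q * (t'' - t)) := by
  refine exists_congr fun r => exists_congr fun q => and_congr_right fun _ => and_congr_right fun _ =>
    and_congr_right fun _ => ?_
  have : planePoint O u w s t + r • (planePoint O u w s' t' - planePoint O u w s t) +
      q • (planePoint O u w s'' t'' - planePoint O u w s t) =
      planePoint O u w (s + r * (s' - s) + q * (s'' - s)) (t + r * (t' - t) + q * (t'' - t)) := by
    unfold planePoint; module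
  rw [this]

lemma linearIndependent_planePoint (h : LinearIndependent ℝ ![u, w]) {s t s' t' s'' t'' : ℝ}
    (hdet : (s' - s) * (t'' - t) - (t' - t) * (s'' - s) ≠ 0) :
    LinearIndependent ℝ ![planePoint O u w s' t' - planePoint O u w s t,
      planePoint O u w s'' t'' - planePoint O u w s t] := by
  rw [LinearIndependent.pair_iff] at h ⊢
  intro α β hαβ
  obtain ⟨h1, h2⟩ := h (α * (s' - s) + β * (s'' - s)) (α * (t' - t) + β * (t'' - t)) (by
    rw [← hαβ]; unfold planePoint; module)
  constructor
  · have : α * ((s' - s) * (t'' - t) - (t' - t) * (s'' - s)) = 0 := by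
      linear_combination (t'' - t) * h1 - (s'' - s) * h2
    exact (mul_eq_zero.1 this).resolve_right hdet
  · have : β * ((s' - s) * (t'' - t) - (t' - t) * (s'' - s)) = 0 := by
      linear_combination (s' - s) * h2 - (t' - t) * h1
    exact (mul_eq_zero.1 this).resolve_right hdet

end Plane

/-! ### Passing a strand through another one -/

section Crossing

variable {n : ℕ} {S S₂ : Fin n → List VertexName} {lab : VertexName → Option ℕ}
  {pos : VertexName → Fin 3 → ℝ} {a b c q x y : VertexName} {R : Type*} [CommRing R]
  {v : EmbeddedGraph n → R}

/-- In the plane coordinates of the crossing, the moved strand `a c q b` may be replaced by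
`a x c y q b`: the triangles `a c x` and `c q y` avoid the rest of the graph. The strand runs through
`a = (0, 0)`, `c = (z₁, z₂)`, `q = (1, 0)`, `b = (1, 1)`; the crossing is at `(ξ, 0)`, between `x` and
`y`, and `c` may lie on either side of the line `a q`. -/
lemma IsVassilievInvariant.bypass_plane (hv : IsVassilievInvariant v) (hS : Shape S lab)
    (hG : Good (edgeSet S) lab pos) (h₂ : IsBypass S S₂ x c y) (hac : (a, c) ∈ edgeSet S)
    (hcq : (c, q) ∈ edgeSet S) (hx : ∀ i, x ∉ S i) (hy : ∀ i, y ∉ S i) (hxy : x ≠ y)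
    (hla : lab a = none) (hlc : lab c = none) (hlq : lab q = none) {O u w : Fin 3 → ℝ}
    (hli : LinearIndependent ℝ ![u, w]) {ξ z₁ z₂ : ℝ} (hξ0 : 0 < ξ) (hξ1 : ξ < 1)
    (hz₁ : z₁ ≤ 1) (hz₂ : z₂ ≠ 0) (hz₂' : z₂ < 1) (hz : z₁ < 1 ∨ z₂ < 0)
    (pA : pos a = planePoint O u w 0 0) (pZ : pos c = planePoint O u w z₁ z₂)
    (pQ : pos q = planePoint O u w 1 0) (pB : pos b = planePoint O u w 1 1)
    (px : pos x = planePoint O u w (ξ / 2) 0) (py : pos y = planePoint O u w ((1 + ξ) / 2) 0)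
    (hrest : ∀ f ∈ edgeSet S, f ≠ (a, c) → f ≠ (c, q) → f ≠ (q, b) → ∀ z ∈ edgeSegment pos f,
      z ∈ triangle (pos a) (pos c) (pos x) ∨ z ∈ triangle (pos c) (pos q) (pos y) →
      z = pos a ∨ z = pos b ∨ z = planePoint O u w ξ 0) :
    Shape S₂ lab ∧ Good (edgeSet S₂) lab pos ∧
      valueOf v (diagram S lab pos) = valueOf v (diagram S₂ lab pos) := by
  have hnac : a ≠ c := fun h => hG.nondeg _ hac (by simp [h])
  have hnaq : a ≠ q := hG.prev_ne_next hac hcq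
  obtain ⟨S₁, h1, h2⟩ := h₂.exists_isInsertion hS hnac hnaq hac hcq
  have htri1 : ∀ f ∈ edgeSet S, f ≠ (a, c) → ∀ z ∈ edgeSegment pos f,
      z ∈ triangle (pos a) (pos c) (pos x) → z ∈ segment ℝ (pos a) (pos c) := by
    intro f hf hfa z hzf hzt
    by_cases hf1 : f = (c, q)
    · subst hf1
      simp only [edgeSegment, pA, pZ, pQ, px] at hzf hzt ⊢
      obtain ⟨r, s, hr, hs, hrs, rfl⟩ := mem_triangle_planePoint.1 hzt
      obtain ⟨l, hl0, hl1, h⟩ := mem_segment_planePoint.1 hzf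
      obtain ⟨e1, e2⟩ := planePoint_inj hli h
      refine mem_segment_planePoint.2 ⟨r, hr, by linarith, ?_⟩
      have hr' : r = 1 - l := by
        apply mul_left_cancel₀ hz₂; linarith
      subst hr'
      have : s = 0 := by nlinarith
      simp [this]
    by_cases hf2 : f = (q, b)
    · subst hf2
      exfalso
      simp only [edgeSegment, pA, pZ, pQ, px, pB] at hzf hzt
      obtain ⟨r, s, hr, hs, hrs, rfl⟩ := mem_triangle_planePoint.1 hzt
      obtain ⟨l, hl0, hl1, h⟩ := mem_segment_planePoint.1 hzf
      obtain ⟨e1, e2⟩ := planePoint_inj hli h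
      have hs0 : s = 0 := by nlinarith
      subst hs0
      have hr1 : r = 1 := by nlinarith
      subst hr1
      rcases hz with h | h <;> linarith
    rcases hrest f hf hfa hf1 hf2 z hzf (Or.inl hzt) with h | h | h
    · rw [h]; exact left_mem_segment _ _ _
    · exfalso
      rw [h, pA, pZ, px, pB] at hzt
      obtain ⟨r, s, hr, hs, hrs, h⟩ := mem_triangle_planePoint.1 hzt
      obtain ⟨e1, e2⟩ := planePoint_inj hli h
      have hr1 : r = 1 := by nlinarith
      subst hr1
      linarith
    · exfalso
      rw [h, pA, pZ, px] at hzt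
      obtain ⟨r, s, hr, hs, hrs, h⟩ := mem_triangle_planePoint.1 hzt
      obtain ⟨e1, e2⟩ := planePoint_inj hli h
      have hr0 : r = 0 := by
        apply mul_right_cancel₀ hz₂; linarith
      subst hr0
      nlinarith
  have hli1 : LinearIndependent ℝ ![pos c - pos a, pos x - pos a] := by
    rw [pA, pZ, px]
    refine linearIndependent_planePoint hli ?_
    have := mul_ne_zero hz₂ hξ0.ne'
    intro h0; apply this; linarith
  obtain ⟨hS₁, hG₁, hval₁⟩ := hv.insert_apex hS h1 hx hG hla hlc hli1 htri1
  have hyS₁ : ∀ i, y ∉ S₁ i := fun i hi => by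
    rcases h1.mem_names.1 ⟨i, hi⟩ with ⟨j, hj⟩ | h
    · exact hy j hj
    · exact hxy h.symm
  have hli2 : LinearIndependent ℝ ![pos q - pos c, pos y - pos c] := by
    rw [pQ, pZ, py]
    refine linearIndependent_planePoint hli ?_
    have := mul_ne_zero hz₂ (sub_pos.2 hξ1).ne'
    intro h0; apply this; linarith
  have htri2 : ∀ f ∈ edgeSet S₁, f ≠ (c, q) → ∀ z ∈ edgeSegment pos f,
      z ∈ triangle (pos c) (pos q) (pos y) → z ∈ segment ℝ (pos c) (pos q) := by
    intro f hf hfc z hzf hzt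
    have hp0 : ∀ {r s : ℝ}, z₂ + r * (0 - z₂) + s * (0 - z₂) = 0 → r + s = 1 := fun {r s} h => by
      apply mul_right_cancel₀ hz₂; linarith
    rcases (h1.mem_edgeSet hS).1 hf with ⟨hf, hfa⟩ | rfl | rfl
    · by_cases hf2 : f = (q, b)
      · subst hf2
        simp only [edgeSegment, pZ, pQ, py, pB] at hzf hzt ⊢
        obtain ⟨r, s, hr, hs, hrs, rfl⟩ := mem_triangle_planePoint.1 hzt
        obtain ⟨l, hl0, hl1, h⟩ := mem_segment_planePoint.1 hzf
        obtain ⟨e1, e2⟩ := planePoint_inj hli h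
        have hs0 : s = 0 := by nlinarith
        subst hs0
        exact mem_segment_planePoint.2 ⟨r, hr, by linarith, by simp⟩
      rcases hrest f hf hfa hfc hf2 z hzf (Or.inr hzt) with h | h | h
      · exfalso
        rw [h, pA, pZ, py, pQ] at hzt
        obtain ⟨r, s, hr, hs, hrs, h⟩ := mem_triangle_planePoint.1 hzt
        obtain ⟨e1, e2⟩ := planePoint_inj hli h
        have := hp0 e2.symm
        nlinarith
      · exfalso
        rw [h, pB, pZ, py, pQ] at hzt
        obtain ⟨r, s, hr, hs, hrs, h⟩ := mem_triangle_planePoint.1 hzt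
        obtain ⟨e1, e2⟩ := planePoint_inj hli h
        have hp : 1 - r - s = 1 := by nlinarith
        have hz : z₂ = 1 := by
          have : (1 - r - s) * z₂ = 1 := by linarith
          rwa [hp, one_mul] at this
        linarith
      · exfalso
        rw [h, pZ, py, pQ] at hzt
        obtain ⟨r, s, hr, hs, hrs, h⟩ := mem_triangle_planePoint.1 hzt
        obtain ⟨e1, e2⟩ := planePoint_inj hli h
        have := hp0 e2.symm
        obtain rfl : r = 1 - s := by linarith
        nlinarith
    · exfalso
      simp only [edgeSegment, pA, pZ, pQ, px, py] at hzf hzt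
      obtain ⟨r, s, hr, hs, hrs, rfl⟩ := mem_triangle_planePoint.1 hzt
      obtain ⟨l, hl0, hl1, h⟩ := mem_segment_planePoint.1 hzf
      obtain ⟨e1, e2⟩ := planePoint_inj hli h
      have := hp0 (e2.trans (by ring))
      obtain rfl : r = 1 - s := by linarith
      nlinarith
    · simp only [edgeSegment, pZ, pQ, px, py] at hzf hzt ⊢
      obtain ⟨r, s, hr, hs, hrs, rfl⟩ := mem_triangle_planePoint.1 hzt
      obtain ⟨l, hl0, hl1, h⟩ := mem_segment_planePoint.1 hzf
      obtain ⟨e1, e2⟩ := planePoint_inj hli h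
      have hl : l = 1 - r - s := by
        apply mul_right_cancel₀ hz₂; linarith
      subst hl
      have hs0 : s = 0 := by nlinarith
      have hr0 : r = 0 := by nlinarith
      subst hs0 hr0
      exact mem_segment_planePoint.2 ⟨0, le_rfl, zero_le_one, by simp⟩
  obtain ⟨hS₂, hG₂, hval₂⟩ := hv.insert_apex hS₁ h2 hyS₁ hG₁ hlc hlq hli2 htri2
  exact ⟨hS₂, hG₂, hval₁.trans hval₂⟩

end Crossing

section CrossingNode

variable {n : ℕ} {T T' S₁ S₂ : Fin n → List VertexName} {lab : VertexName → Option ℕ}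
  {pos : VertexName → Fin 3 → ℝ} {a b c o q x y f₁ f₂ : VertexName} {L : ℕ}
  {R : Type*} [CommRing R] {v : EmbeddedGraph n → R}

/-- Turn `c` and `o` into the two passages of a node `L`. -/
def markPair (c o : VertexName) (L : ℕ) (lab : VertexName → Option ℕ) : VertexName → Option ℕ :=
  fun u => if u = c ∨ u = o then some L else lab u

lemma markPair_left : markPair c o L lab c = some L := by simp [markPair]

lemma markPair_right : markPair c o L lab o = some L := by simp [markPair]

lemma markPair_of_ne {u : VertexName} (h : u ≠ c) (h' : u ≠ o) :
    markPair c o L lab u = lab u := by simp [markPair, h, h']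

lemma eraseLabel_markPair (hc : lab c = none) (ho : lab o = none) (hL : ∀ u, lab u ≠ some L) :
    eraseLabel L (markPair c o L lab) = lab := by
  funext u
  by_cases h : u = c ∨ u = o
  · have : lab u = none := by rcases h with rfl | rfl <;> assumption
    simp [eraseLabel, markPair, h, this]
  · simp [eraseLabel, markPair, h, hL]

lemma Shape.markPair (hT : Shape T lab) (hc : ∃ i, c ∈ T i) (ho : ∃ i, o ∈ T i) (hco : c ≠ o)
    (hlc : lab c = none) (hlo : lab o = none) (hL : ∀ u, lab u ≠ some L) :
    Shape T (_root_.markPair c o L lab) := by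
  refine ⟨hT.ne_nil, hT.nodup, hT.disj, fun u hu => ?_, fun u hu => ?_⟩
  · by_cases h1 : u = c
    · exact h1 ▸ hc
    by_cases h2 : u = o
    · exact h2 ▸ ho
    exact hT.supp u (by rwa [markPair_of_ne h1 h2] at hu)
  · have hiff : ∀ w, _root_.markPair c o L lab w = some L ↔ w = c ∨ w = o := fun w => by
      by_cases h : w = c ∨ w = o <;> simp [_root_.markPair, h, hL]
    by_cases h1 : u = c
    · subst h1
      refine ⟨o, hco.symm, by rw [markPair_left, markPair_right], fun w hw => ?_⟩
      rwa [markPair_left, hiff] at hw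
    by_cases h2 : u = o
    · subst h2
      refine ⟨c, hco, by rw [markPair_left, markPair_right], fun w hw => ?_⟩
      rw [markPair_right, hiff] at hw
      exact hw.symm
    rw [markPair_of_ne h1 h2] at hu
    obtain ⟨u', hne, hl, hall⟩ := hT.two u hu
    have hc' : u' ≠ c := by rintro rfl; exact hu (hl ▸ hlc)
    have ho' : u' ≠ o := by rintro rfl; exact hu (hl ▸ hlo)
    refine ⟨u', hne, by rw [markPair_of_ne h1 h2, markPair_of_ne hc' ho', hl], fun w hw => ?_⟩
    rw [markPair_of_ne h1 h2] at hw
    by_cases h : w = c ∨ w = o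
    · rw [(hiff w).2 h] at hw
      exact absurd hw.symm (hL u)
    · push Not at h
      rw [markPair_of_ne h.1 h.2] at hw
      exact hall w hw

/-- An edge of an embedded graph through an unlabelled end of another edge ends there. -/
lemma Good.end_of_mem {E : Set (VertexName × VertexName)} (hG : Good E lab pos)
    {e f : VertexName × VertexName} (he : e ∈ E) (hf : f ∈ E) {s : VertexName}
    (hs : s = e.1 ∨ s = e.2) (hls : lab s = none) (h : pos s ∈ edgeSegment pos f) :
    s = f.1 ∨ s = f.2 := by
  by_cases hef : e = f
  · exact hef ▸ hs
  have hse : pos s ∈ edgeSegment pos e := by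
    rcases hs with rfl | rfl
    · exact left_mem_segment _ _ _
    · exact right_mem_segment _ _ _
  obtain ⟨u, w, hu, hw, h1, h2, h3⟩ := hG.inter e he f hf hef _ hse h
  have hus : u = s := by
    have hnd := hG.nondeg e he
    rcases hs with rfl | rfl <;> rcases hu with rfl | rfl
    · rfl
    · exact absurd h1 hnd
    · exact absurd h1.symm hnd
    · rfl
  rcases h3 with rfl | ⟨-, h3⟩
  · exact hus ▸ hw
  · exact absurd (hus ▸ hls) h3

/-- The strand `a c q b` through the point of the edge `f₁ o f₂` at which this edge pierces the
triangle, with the passages `c` and `o` welded to a node. -/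
lemma Good.node_crossing (hT : Shape T lab) (hG : Good (edgeSet T) lab pos)
    (h₁ : IsInsertion 1 T S₁ a c b) (h₂ : IsInsertion 1 S₁ S₂ c q b) (hc : ∀ i, c ∉ T i)
    (hq : ∀ i, q ∉ T i) (hqc : q ≠ c) (hla : lab a = none) (hlb : lab b = none)
    (hf₁ : (f₁, o) ∈ edgeSet T) (hf₂ : (o, f₂) ∈ edgeSet T) (hfa : (f₁, o) ≠ (a, b))
    (ho : lab o = none) (hL : ∀ u, lab u ≠ some L)
    (hX : pos o ∈ openSegment ℝ (pos f₁) (pos f₂)) {O u w : Fin 3 → ℝ}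
    (hli : LinearIndependent ℝ ![u, w]) {ξ : ℝ} (hξ0 : 0 < ξ) (hξ1 : ξ < 1)
    (pA : pos a = planePoint O u w 0 0) (pX : pos o = planePoint O u w ξ 0)
    (pQ : pos q = planePoint O u w 1 0) (pB : pos b = planePoint O u w 1 1)
    (hrest : ∀ f ∈ edgeSet T, f ≠ (a, b) → ∀ z ∈ edgeSegment pos f,
      z ∈ segment ℝ (pos a) (pos q) ∨ z ∈ segment ℝ (pos q) (pos b) →
      z = pos a ∨ z = pos b ∨ z = pos o) :
    Good (edgeSet S₂) (markPair c o L lab) (Function.update pos c (pos o)) := by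
  have hab := h₁.mem_edge
  set ps := Function.update pos c (pos o) with hps
  have hp : ∀ u, u ≠ c → ps u = pos u := fun u hu => by rw [hps, Function.update_of_ne hu]
  have hpc : ps c = pos o := by rw [hps, Function.update_self]
  have hTc : ∀ u, (∃ i, u ∈ T i) → u ≠ c := fun u ⟨i, hi⟩ h => hc i (h ▸ hi)
  have hTq : ∀ u, (∃ i, u ∈ T i) → u ≠ q := fun u ⟨i, hi⟩ h => hq i (h ▸ hi)
  have haT := fst_mem_of_mem_edgeSet hab
  have hbT := snd_mem_of_mem_edgeSet hab
  have hoT := snd_mem_of_mem_edgeSet hf₁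
  have hlc := hT.lab_fresh hc
  have hlq := hT.lab_fresh hq
  have hpa := hp a (hTc a haT)
  have hpb := hp b (hTc b hbT)
  have hpo := hp o (hTc o hoT)
  have hpq := hp q hqc
  have hseg : ∀ f ∈ edgeSet T, edgeSegment ps f = edgeSegment pos f := fun f hf => by
    rw [edgeSegment, hp _ (hTc _ (fst_mem_of_mem_edgeSet hf)),
      hp _ (hTc _ (snd_mem_of_mem_edgeSet hf))]
  have hoa : o ≠ a := by
    rintro rfl
    have := (planePoint_inj hli (pA.symm.trans pX)).1
    linarith
  have hob : o ≠ b := by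
    rintro rfl
    have := (planePoint_inj hli (pB.symm.trans pX)).1
    linarith
  have hlk : ∀ u, u ≠ c → u ≠ o → markPair c o L lab u = lab u := fun u h h' => markPair_of_ne h h'
  have hlkn : ∀ u, lab u ≠ none → u ≠ c ∧ u ≠ o := fun u hu =>
    ⟨fun h => hu (h ▸ hlc), fun h => hu (h ▸ ho)⟩
  have hlka : markPair c o L lab a = none := by rw [hlk a (hTc a haT) hoa.symm, hla]
  have hlkb : markPair c o L lab b = none := by rw [hlk b (hTc b hbT) hob.symm, hlb]
  have hlkq : markPair c o L lab q = none := by rw [hlk q hqc (hTq o hoT).symm, hlq]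
  -- the rest of the diagram
  have hR : Good (edgeSet T \ {(a, b)}) (markPair c o L lab) ps := by
    refine ⟨fun e he => ?_, fun e he f hf hef z hze hzf => ?_, fun r s t hr ht hs => ?_,
      fun r s hr hrs => ?_⟩
    · rw [hp _ (hTc _ (fst_mem_of_mem_edgeSet he.1)), hp _ (hTc _ (snd_mem_of_mem_edgeSet he.1))]
      exact hG.nondeg e he.1
    · rw [hseg _ he.1] at hze
      rw [hseg _ hf.1] at hzf
      obtain ⟨r, s, hr, hs, h1, h2, h3⟩ := hG.inter e he.1 f hf.1 hef z hze hzf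
      have hr' : r ≠ c := hTc r (by
        rcases hr with rfl | rfl
        exacts [fst_mem_of_mem_edgeSet he.1, snd_mem_of_mem_edgeSet he.1])
      have hs' : s ≠ c := hTc s (by
        rcases hs with rfl | rfl
        exacts [fst_mem_of_mem_edgeSet hf.1, snd_mem_of_mem_edgeSet hf.1])
      refine ⟨r, s, hr, hs, by rw [hp r hr', h1], by rw [hp s hs', h2], h3.imp id fun ⟨h3, h4⟩ => ?_⟩
      have e1 := hlkn r h4
      have e2 := hlkn s (h3 ▸ h4)
      rw [hlk r e1.1 e1.2, hlk s e2.1 e2.2]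
      exact ⟨h3, h4⟩
    · have hs' := hTc s (snd_mem_of_mem_edgeSet hr.1)
      rw [hp _ (hTc r (fst_mem_of_mem_edgeSet hr.1)), hp _ hs',
        hp _ (hTc t (snd_mem_of_mem_edgeSet ht.1))]
      by_cases hso : s = o
      · subst hso
        rw [hT.prev_eq hr.1 hf₁, hT.next_eq ht.1 hf₂]
        exact hX
      · rw [hlk s hs' hso] at hs
        exact hG.straight r s t hr.1 ht.1 hs
    · have hcase : ∀ s, ((s = c ∨ s = o) ∧ markPair c o L lab s = some L ∧ ps s = pos o) ∨
          (markPair c o L lab s = lab s ∧ (lab s ≠ none → ps s = pos s)) := by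
        intro s
        by_cases h : s = c ∨ s = o
        · refine Or.inl ⟨h, by simp [markPair, h], ?_⟩
          rcases h with rfl | rfl
          exacts [hpc, hpo]
        · push Not at h
          exact Or.inr ⟨hlk s h.1 h.2, fun _ => hp s h.1⟩
      rcases hcase r with ⟨-, h1, h2⟩ | ⟨h1, h2⟩ <;> rcases hcase s with ⟨-, h3, h4⟩ | ⟨h3, h4⟩
      · rw [h2, h4]
      · exact absurd (h3.symm.trans (hrs.symm.trans h1)) (hL s)
      · exact absurd (h1.symm.trans (hrs.trans h3)) (hL r)
      · rw [h1] at hr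
        rw [h1, h3] at hrs
        rw [h2 hr, h4 (hrs ▸ hr)]
        exact hG.nodepos r s hr hrs
  have hsegR : ∀ f ∈ edgeSet T \ {(a, b)}, edgeSegment ps f = edgeSegment pos f := fun f hf =>
    hseg f hf.1
  have hmo : ∀ f ∈ edgeSet T \ {(a, b)}, pos o ∈ edgeSegment pos f → o = f.1 ∨ o = f.2 :=
    fun f hf h => hG.end_of_mem hf₁ hf.1 (Or.inr rfl) ho h
  have hma : ∀ f ∈ edgeSet T \ {(a, b)}, pos a ∈ edgeSegment pos f → a = f.1 ∨ a = f.2 :=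
    fun f hf h => hG.end_of_mem hab hf.1 (Or.inl rfl) hla h
  have hmb : ∀ f ∈ edgeSet T \ {(a, b)}, pos b ∈ edgeSegment pos f → b = f.1 ∨ b = f.2 :=
    fun f hf h => hG.end_of_mem hab hf.1 (Or.inr rfl) hlb h
  have hne : ∀ {s t s' t' : ℝ}, s ≠ s' ∨ t ≠ t' → planePoint O u w s t ≠ planePoint O u w s' t' :=
    fun h h' => by
      obtain ⟨h1, h2⟩ := planePoint_inj hli h'
      exact h.elim (fun h => h h1) (fun h => h h2)
  have hQB : Good (Insert.insert (q, b) (edgeSet T \ {(a, b)})) (markPair c o L lab) ps := by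
    refine hR.insert ?_ (fun f hf _ z hz hzf => ?_) (fun _ _ h => absurd hlkq h)
      (fun _ _ h => absurd hlkb h)
    · simp only [hpq, hpb, pQ, pB]
      exact hne (Or.inr zero_ne_one)
    · rw [hsegR f hf] at hzf
      simp only [edgeSegment, hpq, hpb] at hz
      rcases hrest f hf.1 hf.2 z hzf (Or.inr hz) with rfl | rfl | rfl
      · rw [pA, pQ, pB] at hz
        obtain ⟨l, h0, h1, h⟩ := mem_segment_planePoint.1 hz
        have := (planePoint_inj hli h).1
        linarith
      · exact ⟨b, b, Or.inr rfl, hmb f hf hzf, hpb.symm, hpb.symm, Or.inl rfl⟩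
      · rw [pX, pQ, pB] at hz
        obtain ⟨l, h0, h1, h⟩ := mem_segment_planePoint.1 hz
        have := (planePoint_inj hli h).1
        linarith
  have hXQ : ∀ z ∈ segment ℝ (pos o) (pos q), z ∈ segment ℝ (pos a) (pos q) := by
    intro z hz
    rw [pX, pQ] at hz
    rw [pA, pQ]
    obtain ⟨l, h0, h1, rfl⟩ := mem_segment_planePoint.1 hz
    exact mem_segment_planePoint.2 ⟨ξ + l * (1 - ξ), by nlinarith, by nlinarith, by ring_nf⟩
  have hAX : ∀ z ∈ segment ℝ (pos a) (pos o), z ∈ segment ℝ (pos a) (pos q) := by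
    intro z hz
    rw [pX, pA] at hz
    rw [pA, pQ]
    obtain ⟨l, h0, h1, rfl⟩ := mem_segment_planePoint.1 hz
    exact mem_segment_planePoint.2 ⟨l * ξ, by nlinarith, by nlinarith, by ring_nf⟩
  have hlco : markPair c o L lab c = markPair c o L lab o ∧ markPair c o L lab c ≠ none := by
    simp [markPair]
  have hCQ : Good (Insert.insert (c, q) (Insert.insert (q, b) (edgeSet T \ {(a, b)})))
      (markPair c o L lab) ps := by
    refine hQB.insert ?_ (fun f hf _ z hz hzf => ?_) (fun r hr _ => ?_)
      (fun _ _ h => absurd hlkq h)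
    · simp only [hpq, hpc, pQ, pX]
      exact hne (Or.inl hξ1.ne)
    · simp only [edgeSegment, hpq, hpc] at hz
      rcases hf with rfl | hf
      · simp only [edgeSegment, hpq, hpb] at hzf
        rw [pQ, pB] at hzf
        rw [pX, pQ] at hz
        obtain ⟨l, h0, h1, rfl⟩ := mem_segment_planePoint.1 hz
        obtain ⟨m, h0', h1', h⟩ := mem_segment_planePoint.1 hzf
        obtain ⟨e1, e2⟩ := planePoint_inj hli h
        have : planePoint O u w (ξ + l * (1 - ξ)) (0 + l * (0 - 0)) = ps q := by
          rw [hpq, pQ, e1]; simp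
        exact ⟨q, q, Or.inr rfl, Or.inl rfl, this, this, Or.inl rfl⟩
      · rw [hsegR f hf] at hzf
        rcases hrest f hf.1 hf.2 z hzf (Or.inl (hXQ z hz)) with rfl | rfl | rfl
        · rw [pA, pX, pQ] at hz
          obtain ⟨l, h0, h1, h⟩ := mem_segment_planePoint.1 hz
          have := (planePoint_inj hli h).1
          nlinarith
        · rw [pB, pX, pQ] at hz
          obtain ⟨l, h0, h1, h⟩ := mem_segment_planePoint.1 hz
          have := (planePoint_inj hli h).2
          linarith
        · exact ⟨c, o, Or.inl rfl, hmo f hf hzf, hpc.symm, hpo.symm, Or.inr hlco⟩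
    · exfalso
      rcases hr with hr | hr
      · simp only [Prod.mk.injEq] at hr
        exact hTc b hbT hr.2.symm
      · exact hTc c (snd_mem_of_mem_edgeSet hr.1) rfl
  have hAC : Good (Insert.insert (a, c) (Insert.insert (c, q)
      (Insert.insert (q, b) (edgeSet T \ {(a, b)})))) (markPair c o L lab) ps := by
    refine hCQ.insert ?_ (fun f hf _ z hz hzf => ?_) (fun _ _ h => absurd hlka h)
      (fun r hr _ => ?_)
    · simp only [hpa, hpc, pA, pX]
      exact hne (Or.inl hξ0.ne)
    · simp only [edgeSegment, hpa, hpc] at hz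
      rcases hf with rfl | rfl | hf
      · simp only [edgeSegment, hpq, hpc] at hzf
        rw [pX, pQ] at hzf
        rw [pA, pX] at hz
        obtain ⟨l, h0, h1, rfl⟩ := mem_segment_planePoint.1 hz
        obtain ⟨m, h0', h1', h⟩ := mem_segment_planePoint.1 hzf
        obtain ⟨e1, e2⟩ := planePoint_inj hli h
        have hl : l = 1 := by nlinarith
        have : planePoint O u w (0 + l * (ξ - 0)) (0 + l * (0 - 0)) = ps c := by
          rw [hpc, pX, hl]; simp
        exact ⟨c, c, Or.inr rfl, Or.inl rfl, this, this, Or.inl rfl⟩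
      · exfalso
        simp only [edgeSegment, hpq, hpb] at hzf
        rw [pQ, pB] at hzf
        rw [pA, pX] at hz
        obtain ⟨l, h0, h1, rfl⟩ := mem_segment_planePoint.1 hz
        obtain ⟨m, h0', h1', h⟩ := mem_segment_planePoint.1 hzf
        obtain ⟨e1, e2⟩ := planePoint_inj hli h
        nlinarith
      · rw [hsegR f hf] at hzf
        rcases hrest f hf.1 hf.2 z hzf (Or.inl (hAX z hz)) with rfl | rfl | rfl
        · exact ⟨a, a, Or.inl rfl, hma f hf hzf, hpa.symm, hpa.symm, Or.inl rfl⟩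
        · rw [pB, pA, pX] at hz
          obtain ⟨l, h0, h1, h⟩ := mem_segment_planePoint.1 hz
          have := (planePoint_inj hli h).2
          linarith
        · exact ⟨c, o, Or.inr rfl, hmo f hf hzf, hpc.symm, hpo.symm, Or.inr hlco⟩
    · have hrq : r = q := by
        rcases hr with hr | hr | hr
        · simpa using hr
        · simp only [Prod.mk.injEq] at hr
          exact absurd hr.1.symm hqc
        · exact absurd rfl (hTc c (fst_mem_of_mem_edgeSet hr.1))
      subst hrq
      simp only [hpc, hpa, hpq]
      rw [pX, pA, pQ]
      exact mem_openSegment_planePoint.2 ⟨ξ, hξ0, hξ1, by simp⟩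
  refine hAC.mono fun e he => ?_
  rcases (h₂.mem_edgeSet (h₁.shape hT hc)).1 he with ⟨he, hne⟩ | rfl | rfl
  · rcases (h₁.mem_edgeSet hT).1 he with he | rfl | rfl
    · exact Or.inr (Or.inr (Or.inr he))
    · exact Or.inl rfl
    · exact absurd rfl hne
  · exact Or.inr (Or.inl rfl)
  · exact Or.inr (Or.inr (Or.inl rfl))

lemma det_combination {u w f : Fin 3 → ℝ} {α β γ δ : ℝ} :
    Matrix.det (Matrix.of ![α • u + β • w, γ • u + δ • w, f]) =
      (α * δ - β * γ) * Matrix.det (Matrix.of ![u, w, f]) := by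
  simp [Matrix.det_fin_three]
  ring

/-- `v` vanishes on diagrams with too many nodes. -/
lemma IsOfFiniteType.valueOf_eq_zero {k : ℕ} (hk : IsOfFiniteType k v) (hT : Shape T lab)
    (hG : Good (edgeSet T) lab pos) (h : k < {l | ∃ u, lab u = some l}.ncard) :
    valueOf v (diagram T lab pos) = 0 := by
  obtain ⟨G, hGc⟩ := exists_embeddedGraph hT hG
  rw [valueOf_eq v G hGc]
  exact hk G (by rwa [G.nodes_card hT hGc])

end CrossingNode

section CrossingCore

variable {n : ℕ} {T T' S₁ S₂ : Fin n → List VertexName} {lab : VertexName → Option ℕ}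
  {pos : VertexName → Fin 3 → ℝ} {a b c o q x y f₁ f₂ : VertexName}
  {R : Type*} [CommRing R] {v : EmbeddedGraph n → R}

lemma det_third {u w f : Fin 3 → ℝ} {r s : ℝ} :
    Matrix.det (Matrix.of ![u, f, r • u + s • w]) = -s * Matrix.det (Matrix.of ![u, w, f]) := by
  simp [Matrix.det_fin_three]
  ring

lemma convex_triangle {V : Type*} [AddCommGroup V] [Module ℝ V] (a b c : V) :
    Convex ℝ (triangle a b c) := by
  rw [← convexHull_triple]; exact convex_convexHull ℝ _

/-- A strand may be moved through an edge, in the coordinates of its plane: the two sides differ by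
the value at a graph with one more node, which vanishes. The triangle with the corners `a = (0, 0)`,
`b = (1, 1)`, `c = (1, -κ)` is pierced by the edge `f₁ f₂` at the vertex `o = (ξ, 0)`. The side `c b`
is subdivided at `q = (1, 0)`; then `c` is moved from `(1, -κ)` across the line `a q` to `(1/2, 1/2)`
on `a b`, and finally `c` and `q` are removed. -/
lemma IsVassilievInvariant.crossing_plane {k : ℕ} (hv : IsVassilievInvariant v)
    (hk : IsOfFiniteType k v) (hcard : {l | ∃ u, lab u = some l}.ncard = k) (hT : Shape T lab)
    (hG : Good (edgeSet T) lab pos) (h : IsInsertion 1 T T' a c b) (hc : ∀ i, c ∉ T i)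
    (hG' : Good (edgeSet T') lab pos) (hla : lab a = none) (hlb : lab b = none)
    (hf₁ : (f₁, o) ∈ edgeSet T) (hf₂ : (o, f₂) ∈ edgeSet T) (hfa : (f₁, o) ≠ (a, b))
    (ho : lab o = none) (hX : pos o ∈ openSegment ℝ (pos f₁) (pos f₂)) {O u w : Fin 3 → ℝ}
    (hli : LinearIndependent ℝ ![u, w]) {ξ κ : ℝ} (hξ0 : 0 < ξ) (hξ1 : ξ < 1) (hκ : 0 < κ)
    (hdet : Matrix.det (Matrix.of ![u, w, pos f₂ - pos f₁]) ≠ 0)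
    (hq : ∀ i, q ∉ T i) (hx : ∀ i, x ∉ T i) (hy : ∀ i, y ∉ T i) (hqc : q ≠ c) (hxc : x ≠ c)
    (hyc : y ≠ c) (hxq : x ≠ q) (hyq : y ≠ q) (hxy : x ≠ y)
    (pA : pos a = planePoint O u w 0 0) (pX : pos o = planePoint O u w ξ 0)
    (pQ : pos q = planePoint O u w 1 0) (pB : pos b = planePoint O u w 1 1)
    (pC : pos c = planePoint O u w 1 (-κ))
    (px : pos x = planePoint O u w (ξ / 2) 0) (py : pos y = planePoint O u w ((1 + ξ) / 2) 0)
    (hrest : ∀ f ∈ edgeSet T, f ≠ (a, b) → ∀ z ∈ edgeSegment pos f,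
      z ∈ triangle (pos a) (pos b) (pos c) → z = pos a ∨ z = pos b ∨ z = pos o) :
    valueOf v (diagram T lab pos) = valueOf v (diagram T' lab pos) := by
  have hab := h.mem_edge
  have hT' := h.shape hT hc
  have hlc := hT.lab_fresh hc
  have hlq := hT.lab_fresh hq
  have hTc : ∀ u, (∃ i, u ∈ T i) → u ≠ c := fun u ⟨i, hi⟩ h => hc i (h ▸ hi)
  have haT := fst_mem_of_mem_edgeSet hab
  have hbT := snd_mem_of_mem_edgeSet hab
  have hoT := snd_mem_of_mem_edgeSet hf₁
  have hca : a ≠ c := hTc a haT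
  have hcb : b ≠ c := hTc b hbT
  have hoc : o ≠ c := hTc o hoT
  have hfresh' : ∀ {s}, s ≠ c → (∀ i, s ∉ T i) → ∀ i, s ∉ T' i := fun {s} hsc hs i hi => by
    rcases h.mem_names.1 ⟨i, hi⟩ with ⟨j, hj⟩ | h
    exacts [hs j hj, hsc h]
  have hqT' := hfresh' hqc hq
  have hcb' : (c, b) ∈ edgeSet T' := (h.mem_edgeSet hT).2 (Or.inr (Or.inr rfl))
  obtain ⟨S, hS⟩ := exists_isInsertion hT' hcb.symm hcb' q
  have hSS := hS.shape hT' hqT'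
  have hfreshS : ∀ {s}, s ≠ c → s ≠ q → (∀ i, s ∉ T i) → ∀ i, s ∉ S i :=
    fun {s} hsc hsq hs i hi => by
      rcases hS.mem_names.1 ⟨i, hi⟩ with ⟨j, hj⟩ | h
      exacts [hfresh' hsc hs j hj, hsq h]
  have hxS := hfreshS hxc hxq hx
  have hyS := hfreshS hyc hyq hy
  have hcS : ∃ i, c ∈ S i := hS.mem_names.2 (Or.inl (h.mem_names.2 (Or.inr rfl)))
  have hoS : ∃ i, o ∈ S i := hS.mem_names.2 (Or.inl (h.mem_names.2 (Or.inl hoT)))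
  obtain ⟨S₂, hS₂⟩ := exists_isBypass hcS x y
  have hacS : (a, c) ∈ edgeSet S := (hS.mem_edgeSet hT').2 (Or.inl
    ⟨(h.mem_edgeSet hT).2 (Or.inr (Or.inl rfl)), fun h => hca (by simp at h; exact h.1)⟩)
  have hcqS : (c, q) ∈ edgeSet S := (hS.mem_edgeSet hT').2 (Or.inr (Or.inl rfl))
  have hkeep : ∀ f ∈ edgeSet T, f ≠ (a, b) → f ∈ edgeSet S := fun f hf hfab =>
    (hS.mem_edgeSet hT').2 (Or.inl ⟨(h.mem_edgeSet hT).2 (Or.inl ⟨hf, hfab⟩), by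
      rintro rfl; exact hTc c (fst_mem_of_mem_edgeSet hf) rfl⟩)
  have hedge : ∀ f ∈ edgeSet S, f ≠ (a, c) → f ≠ (c, q) → f ≠ (q, b) →
      f ∈ edgeSet T ∧ f ≠ (a, b) := by
    intro f hf h1 h2 h3
    rcases (hS.mem_edgeSet hT').1 hf with ⟨hf, h4⟩ | h | h
    · rcases (h.mem_edgeSet hT).1 hf with h | h | h
      exacts [h, absurd h h1, absurd h h4]
    · exact absurd h h2
    · exact absurd h h3
  -- points of the big triangle
  have hmem : ∀ {s : ℝ}, 0 ≤ s → s ≤ 1 → planePoint O u w s 0 ∈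
      triangle (pos a) (pos b) (pos c) := by
    intro s h0 h1
    rw [pA, pB, pC]
    refine mem_triangle_planePoint.2 ⟨κ * (s / (1 + κ)), s / (1 + κ), by positivity, by positivity,
      ?_, ?_⟩
    · have : κ * (s / (1 + κ)) + s / (1 + κ) = s := by field_simp; ring
      linarith
    · congr 1 <;> (field_simp; ring)
  have hcv := convex_triangle (pos a) (pos b) (pos c)
  have hWm : planePoint O u w (1 / 2) (1 / 2) ∈ triangle (pos a) (pos b) (pos c) := by
    rw [pA, pB, pC]
    exact mem_triangle_planePoint.2 ⟨1 / 2, 0, by norm_num, by norm_num, by norm_num, by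
      congr 1 <;> norm_num⟩
  have hCm : pos c ∈ triangle (pos a) (pos b) (pos c) :=
    segment_subset_triangle_left _ _ _ (right_mem_segment ℝ _ _)
  have hAm : pos a ∈ triangle (pos a) (pos b) (pos c) := left_mem_triangle _ _ _
  have hBm : pos b ∈ triangle (pos a) (pos b) (pos c) :=
    segment_subset_triangle_base _ _ _ (right_mem_segment ℝ _ _)
  have hQm : pos q ∈ triangle (pos a) (pos b) (pos c) := pQ ▸ hmem zero_le_one le_rfl
  have hxm : pos x ∈ triangle (pos a) (pos b) (pos c) := px ▸ hmem (by linarith) (by linarith)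
  have hym : pos y ∈ triangle (pos a) (pos b) (pos c) := py ▸ hmem (by linarith) (by linarith)
  -- positions with the vertex `c` moved to `Z`
  have hup : ∀ (Z : Fin 3 → ℝ) s, s ≠ c → Function.update pos c Z s = pos s := fun Z s hs => by
    rw [Function.update_of_ne hs]
  have hGup : ∀ Z, Good (edgeSet T) lab (Function.update pos c Z) := fun Z => hG.congr
    (fun e he => ⟨hup Z _ (hTc _ (fst_mem_of_mem_edgeSet he)),
      hup Z _ (hTc _ (snd_mem_of_mem_edgeSet he))⟩)
    (fun s hs => hup Z s (hTc s (hT.supp s hs)))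
  have hsegup : ∀ Z, ∀ f ∈ edgeSet T, edgeSegment (Function.update pos c Z) f = edgeSegment pos f :=
    fun Z f hf => by
      rw [edgeSegment, hup Z _ (hTc _ (fst_mem_of_mem_edgeSet hf)),
        hup Z _ (hTc _ (snd_mem_of_mem_edgeSet hf))]
  -- the last two pushes, for both positions of `c`
  have hpush : ∀ z₁ z₂ : ℝ, z₁ ≤ 1 → z₂ ≠ 0 → z₂ < 1 → (z₁ < 1 ∨ z₂ < 0) →
      planePoint O u w z₁ z₂ ∈ triangle (pos a) (pos b) (pos c) →
      Good (edgeSet S) lab (Function.update pos c (planePoint O u w z₁ z₂)) →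
      Shape S₂ lab ∧ Good (edgeSet S₂) lab (Function.update pos c (planePoint O u w z₁ z₂)) ∧
      valueOf v (diagram S lab (Function.update pos c (planePoint O u w z₁ z₂))) =
        valueOf v (diagram S₂ lab (Function.update pos c (planePoint O u w z₁ z₂))) := by
    intro z₁ z₂ h1 h2 h3 h4 hZ hGS
    refine hv.bypass_plane hSS hGS hS₂ hacS hcqS hxS hyS hxy hla hlc hlq hli hξ0 hξ1 h1 h2 h3 h4
      (b := b) (by rw [hup _ a hca, pA]) (by rw [Function.update_self]) (by rw [hup _ q hqc, pQ])
      (by rw [hup _ b hcb, pB]) (by rw [hup _ x hxc, px]) (by rw [hup _ y hyc, py]) ?_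
    intro f hf e1 e2 e3 z hz hzt
    obtain ⟨hfT, hfab⟩ := hedge f hf e1 e2 e3
    rw [hsegup _ f hfT] at hz
    rw [hup _ a hca, hup _ b hcb]
    rw [hup _ a hca, hup _ x hxc, hup _ q hqc, hup _ y hyc, Function.update_self] at hzt
    rw [← pX]
    refine hrest f hfT hfab z hz ?_
    rcases hzt with hzt | hzt
    · exact triangle_subset_of_convex hcv hAm hZ hxm hzt
    · exact triangle_subset_of_convex hcv hZ hQm hym hzt
  -- the strand on the side of `c`
  have hCC : Function.update pos c (planePoint O u w 1 (-κ)) = pos := by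
    rw [← pC, Function.update_eq_self]
  obtain ⟨-, hGS, hv1⟩ := hv.subdivide hT' hS hqT' hG' (by
    rw [pC, pB, pQ]
    refine mem_openSegment_planePoint.2 ⟨κ / (1 + κ), by positivity, by
      rw [div_lt_one (by positivity)]; linarith, ?_⟩
    congr 1 <;> (field_simp; ring))
  obtain ⟨hSh₂, hGC, hv2⟩ := hpush 1 (-κ) le_rfl (by linarith) (by linarith)
    (Or.inr (by linarith)) (pC ▸ hCm) (by rwa [hCC])
  rw [hCC] at hv2
  -- the strand on the side of `a b`
  set W := planePoint O u w (1 / 2) (1 / 2) with hW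
  have hWs : Function.update pos c W c = W := Function.update_self ..
  obtain ⟨-, hGW', hv3⟩ := hv.subdivide hT h hc (hGup W) (by
    rw [hWs, hup _ a hca, hup _ b hcb, pA, pB]
    exact mem_openSegment_planePoint.2 ⟨1 / 2, by norm_num, by norm_num, by
      rw [hW]; congr 1 <;> norm_num⟩)
  obtain ⟨-, hGSW, hv4⟩ := hv.insert_apex hT' hS hqT' hGW' hlc hlb (by
    rw [hWs, hup _ b hcb, hup _ q hqc, pB, pQ]
    exact linearIndependent_planePoint hli (by norm_num)) (by
    intro f hf hfc z hz hzt
    rw [hWs, hup _ b hcb, hup _ q hqc] at hzt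
    rw [hWs, hup _ b hcb]
    rcases (h.mem_edgeSet hT).1 hf with ⟨hf, hfab⟩ | rfl | rfl
    · rw [hsegup _ f hf] at hz
      have hz' := hrest f hf hfab z hz (triangle_subset_of_convex hcv hWm hBm hQm hzt)
      rw [pB, pQ] at hzt
      rcases hz' with rfl | rfl | rfl
      · exfalso
        rw [pA] at hzt
        obtain ⟨r, s, hr, hs, hrs, hh⟩ := mem_triangle_planePoint.1 hzt
        obtain ⟨e1, e2⟩ := planePoint_inj hli hh
        linarith
      · exact right_mem_segment _ _ _
      · exfalso
        rw [pX] at hzt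
        obtain ⟨r, s, hr, hs, hrs, hh⟩ := mem_triangle_planePoint.1 hzt
        obtain ⟨e1, e2⟩ := planePoint_inj hli hh
        linarith
    · simp only [edgeSegment, hWs, hup _ a hca] at hz
      rw [pB, pQ] at hzt
      rw [pA] at hz
      obtain ⟨r, s, hr, hs, hrs, rfl⟩ := mem_triangle_planePoint.1 hzt
      obtain ⟨l, hl0, hl1, hh⟩ := mem_segment_planePoint.1 hz
      obtain ⟨e1, e2⟩ := planePoint_inj hli hh
      obtain rfl : r = 0 := by linarith
      obtain rfl : s = 0 := by linarith
      simpa [hW] using left_mem_segment ℝ _ _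
    · exact absurd rfl hfc)
  obtain ⟨-, hGW, hv5⟩ := hpush (1 / 2) (1 / 2) (by norm_num) (by norm_num) (by norm_num)
    (Or.inl (by norm_num)) hWm hGSW
  -- the graph with the additional node `L`
  obtain ⟨L, hL⟩ := (labels_finite hT).exists_notMem
  have hL' : ∀ u, lab u ≠ some L := fun u hu => hL ⟨u, hu⟩
  have hXQ : ∀ z, z ∈ segment ℝ (pos a) (pos q) ∨ z ∈ segment ℝ (pos q) (pos b) →
      z ∈ triangle (pos a) (pos b) (pos c) := fun z hz =>
    hz.elim (fun h => hcv.segment_subset hAm hQm h) (fun h => hcv.segment_subset hQm hBm h)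
  have hK := hG.node_crossing hT h hS hc hq hqc hla hlb hf₁ hf₂ hfa ho hL' hX hli hξ0 hξ1
    pA pX pQ pB (fun f hf hfab z hz hz' => hrest f hf hfab z hz (hXQ z hz'))
  have hKS : Shape S (markPair c o L lab) := hSS.markPair hcS hoS hoc.symm hlc ho hL'
  have hK0 : valueOf v (diagram S (markPair c o L lab) (Function.update pos c (pos o))) = 0 := by
    refine hk.valueOf_eq_zero hKS hK ?_
    have : {l | ∃ u, markPair c o L lab u = some l} = insert L {l | ∃ u, lab u = some l} := by
      ext l
      constructor
      · rintro ⟨u, hu⟩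
        by_cases h : u = c ∨ u = o
        · simp only [markPair, h, if_true, Option.some.injEq] at hu
          exact Or.inl hu.symm
        · simp only [markPair, h, if_false] at hu
          exact Or.inr ⟨u, hu⟩
      · rintro (rfl | ⟨u, hu⟩)
        · exact ⟨c, markPair_left⟩
        · refine ⟨u, ?_⟩
          rwa [markPair_of_ne]
          · rintro rfl; simp [hlc] at hu
          · rintro rfl; simp [ho] at hu
    rw [this, Set.ncard_insert_of_notMem hL (labels_finite hT), hcard]
    exact Nat.lt_succ_self k
  have her : eraseLabel L (markPair c o L lab) = lab := eraseLabel_markPair hlc ho hL'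
  have hfc₁ : f₁ ≠ c := hTc _ (fst_mem_of_mem_edgeSet hf₁)
  have hfc₂ : f₂ ≠ c := hTc _ (snd_mem_of_mem_edgeSet hf₂)
  have hfa₂ : (o, f₂) ≠ (a, b) := by
    intro h0
    simp only [Prod.mk.injEq] at h0
    obtain ⟨rfl, -⟩ := h0
    have := (planePoint_inj hli (pA.symm.trans pX)).1
    linarith
  -- The exchange identity at a node between `c` and `o`: the graph with this node has `k + 1` nodes
  -- and hence value `0`, so that the positions of `c` on both sides have the same value.
  have hex : ∀ z₁ z₂ z₁' z₂' : ℝ,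
      (∀ s t : ℝ, (s = z₁ ∧ t = z₂ ∨ s = z₁' ∧ t = z₂') →
        s ≤ 1 ∧ t ≠ 0 ∧ t < 1 ∧ (s < 1 ∨ t < 0) ∧
        planePoint O u w s t ∈ triangle (pos a) (pos b) (pos c) ∧
        Good (edgeSet S₂) lab (Function.update pos c (planePoint O u w s t))) →
      0 < -z₂ * Matrix.det (Matrix.of ![u, w, pos f₂ - pos f₁]) →
      -z₂' * Matrix.det (Matrix.of ![u, w, pos f₂ - pos f₁]) < 0 →
      valueOf v (diagram S₂ lab (Function.update pos c (planePoint O u w z₁ z₂))) =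
        valueOf v (diagram S₂ lab (Function.update pos c (planePoint O u w z₁' z₂'))) := by
    intro z₁ z₂ z₁' z₂' hz hs hs'
    set pk := Function.update pos c (pos o) with hpk
    have huk : ∀ s, s ≠ c → pk s = pos s := hup _
    have hkc : pk c = pos o := Function.update_self ..
    have hdd : ∀ s t : ℝ, Matrix.det (Matrix.of ![pk q - pk a, pk f₂ - pk f₁,
        planePoint O u w s t - pk c]) = -t * Matrix.det (Matrix.of ![u, w, pos f₂ - pos f₁]) := by
      intro s t
      rw [huk q hqc, huk a hca, huk _ hfc₁, huk _ hfc₂, hkc, ← det_third (r := s - ξ), pQ, pA, pX]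
      congr 3
      · simp [planePoint]
      · congr 2
        unfold planePoint; module
    have hd : ∀ s t : ℝ, (s = z₁ ∧ t = z₂ ∨ s = z₁' ∧ t = z₂') → ∀ f ∈ edgeSet S,
        ∀ z ∈ edgeSegment pk f, z ∈ triangle (pk x) (pk y) (planePoint O u w s t) →
        z ∈ segment ℝ (pk x) (pk y) := by
      intro s t hst f hf z hzf hzt
      obtain ⟨h1, h2, h3, h4, hZ, -⟩ := hz s t hst
      rw [huk x hxc, huk y hyc] at hzt ⊢
      have hon : ∀ r q' : ℝ, 0 ≤ r → 0 ≤ q' → r + q' ≤ 1 → 0 + r * (0 - 0) + q' * (t - 0) = 0 →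
          planePoint O u w (ξ / 2 + r * ((1 + ξ) / 2 - ξ / 2) + q' * (s - ξ / 2))
            (0 + r * (0 - 0) + q' * (t - 0)) ∈ segment ℝ (pos x) (pos y) := by
        intro r q' hr hq' hrq h0
        obtain rfl : q' = 0 := by
          apply mul_right_cancel₀ h2; linarith
        rw [px, py]
        exact mem_segment_planePoint.2 ⟨r, hr, by linarith, by simp⟩
      by_cases e1 : f = (a, c)
      · subst e1
        simp only [edgeSegment, huk a hca, hkc, pA, pX] at hzf
        rw [px, py] at hzt
        obtain ⟨r, q', hr, hq', hrq, rfl⟩ := mem_triangle_planePoint.1 hzt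
        obtain ⟨l, hl0, hl1, hh⟩ := mem_segment_planePoint.1 hzf
        obtain ⟨e1, e2⟩ := planePoint_inj hli hh
        exact hon r q' hr hq' hrq (e2.trans (by ring))
      by_cases e2 : f = (c, q)
      · subst e2
        simp only [edgeSegment, huk q hqc, hkc, pQ, pX] at hzf
        rw [px, py] at hzt
        obtain ⟨r, q', hr, hq', hrq, rfl⟩ := mem_triangle_planePoint.1 hzt
        obtain ⟨l, hl0, hl1, hh⟩ := mem_segment_planePoint.1 hzf
        obtain ⟨e1, e2⟩ := planePoint_inj hli hh
        exact hon r q' hr hq' hrq (e2.trans (by ring))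
      by_cases e3 : f = (q, b)
      · exfalso
        subst e3
        simp only [edgeSegment, huk q hqc, huk b hcb, pQ, pB] at hzf
        rw [px, py] at hzt
        obtain ⟨r, q', hr, hq', hrq, rfl⟩ := mem_triangle_planePoint.1 hzt
        obtain ⟨l, hl0, hl1, hh⟩ := mem_segment_planePoint.1 hzf
        obtain ⟨e1, e2⟩ := planePoint_inj hli hh
        have hq1 : q' = 1 := by nlinarith
        subst hq1
        have hr0 : r = 0 := by linarith
        subst hr0
        rcases h4 with h4 | h4 <;> linarith
      obtain ⟨hfT, hfab⟩ := hedge f hf e1 e2 e3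
      rw [hpk, hsegup _ f hfT] at hzf
      rcases hrest f hfT hfab z hzf (triangle_subset_of_convex hcv hxm hym hZ hzt) with h | h | h
      · exfalso
        rw [h, pA, px, py] at hzt
        obtain ⟨r, q', hr, hq', hrq, hh⟩ := mem_triangle_planePoint.1 hzt
        obtain ⟨e1, e2⟩ := planePoint_inj hli hh
        have : q' = 0 := by
          apply mul_right_cancel₀ h2; linarith
        subst this
        nlinarith
      · exfalso
        rw [h, pB, px, py] at hzt
        obtain ⟨r, q', hr, hq', hrq, hh⟩ := mem_triangle_planePoint.1 hzt
        obtain ⟨e1, e2⟩ := planePoint_inj hli hh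
        have hq1 : q' = 1 := by nlinarith
        subst hq1
        linarith
      · rw [h, pX, px, py]
        exact mem_segment_planePoint.2 ⟨ξ, hξ0.le, hξ1.le, by congr 1 <;> ring⟩
    have := hv.exchange_diagram (ζ := planePoint O u w z₁ z₂) (ζ' := planePoint O u w z₁' z₂')
      (p' := f₁) (b' := o) (q' := f₂) hK hKS markPair_left hacS hcqS markPair_right
      (hkeep _ hf₁ hfa) (hkeep _ hf₂ hfa₂) hS₂ hxS hyS ?_ ?_ (by rwa [her]) ?_ ?_
      (hd _ _ (Or.inl ⟨rfl, rfl⟩)) (hd _ _ (Or.inr ⟨rfl, rfl⟩)) (by rw [hdd]; exact hs)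
      (by rw [hdd]; exact hs')
    · rw [hK0, her, Function.update_idem, Function.update_idem] at this
      exact (sub_eq_zero.1 this.symm)
    · rw [hkc, huk x hxc, huk a hca, px, pA, pX]
      exact mem_openSegment_planePoint.2 ⟨1 / 2, by norm_num, by norm_num, by congr 1 <;> ring⟩
    · rw [hkc, huk y hyc, huk q hqc, py, pQ, pX]
      exact mem_openSegment_planePoint.2 ⟨1 / 2, by norm_num, by norm_num, by congr 1 <;> ring⟩
    · rw [her, Function.update_idem]
      exact (hz z₁ z₂ (Or.inl ⟨rfl, rfl⟩)).2.2.2.2.2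
    · rw [her, Function.update_idem]
      exact (hz z₁' z₂' (Or.inr ⟨rfl, rfl⟩)).2.2.2.2.2
  have hdC : (1 : ℝ) ≤ 1 ∧ (-κ) ≠ 0 ∧ (-κ) < 1 ∧ ((1 : ℝ) < 1 ∨ (-κ) < 0) ∧
        planePoint O u w 1 (-κ) ∈ triangle (pos a) (pos b) (pos c) ∧
        Good (edgeSet S₂) lab (Function.update pos c (planePoint O u w 1 (-κ))) :=
    ⟨le_rfl, by linarith, by linarith, Or.inr (by linarith), pC ▸ hCm, hGC⟩
  have hdW : (1 / 2 : ℝ) ≤ 1 ∧ (1 / 2 : ℝ) ≠ 0 ∧ (1 / 2 : ℝ) < 1 ∧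
        ((1 / 2 : ℝ) < 1 ∨ (1 / 2 : ℝ) < 0) ∧
        planePoint O u w (1 / 2) (1 / 2) ∈ triangle (pos a) (pos b) (pos c) ∧
        Good (edgeSet S₂) lab (Function.update pos c (planePoint O u w (1 / 2) (1 / 2))) :=
    ⟨by norm_num, by norm_num, by norm_num, Or.inl (by norm_num), hWm, hGW⟩
  have hfin : valueOf v (diagram S₂ lab (Function.update pos c (planePoint O u w 1 (-κ)))) =
      valueOf v (diagram S₂ lab (Function.update pos c (planePoint O u w (1 / 2) (1 / 2)))) := by
    rcases lt_or_gt_of_ne hdet with hneg | hpos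
    · refine (hex (1 / 2) (1 / 2) 1 (-κ) ?_ (by nlinarith) (by nlinarith)).symm
      rintro s t (⟨rfl, rfl⟩ | ⟨rfl, rfl⟩)
      exacts [hdW, hdC]
    · refine hex 1 (-κ) (1 / 2) (1 / 2) ?_ (by nlinarith) (by nlinarith)
      rintro s t (⟨rfl, rfl⟩ | ⟨rfl, rfl⟩)
      exacts [hdC, hdW]
  have hTW : diagram T lab pos = diagram T lab (Function.update pos c W) :=
    diagram_congr fun s hs => (hup W s (hTc s hs)).symm
  rw [hTW, hv3, hv4, hv5, ← hfin, hCC, ← hv2, ← hv1]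

end CrossingCore

/-! ### Pushing an edge across a triangle -/

section Density

/-- Finitely many proper hyperplanes do not exhaust any open set. -/
lemma exists_mem_nhds_avoiding {V : Type*} [NormedAddCommGroup V] [NormedSpace ℝ V]
    {F : Set ((V →L[ℝ] ℝ) × ℝ)} (hF : F.Finite) (h0 : ∀ p ∈ F, p.1 ≠ 0) {x₀ : V} {U : Set V}
    (hU : U ∈ 𝓝 x₀) : ∃ x ∈ U, ∀ p ∈ F, p.1 x ≠ p.2 := by
  have hdense : ∀ p ∈ F, IsOpen {x | p.1 x ≠ p.2} ∧ Dense {x | p.1 x ≠ p.2} := by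
    intro p hp
    refine ⟨isOpen_ne_fun p.1.continuous continuous_const, fun x => ?_⟩
    obtain ⟨e, he⟩ : ∃ e, p.1 e ≠ 0 := by
      by_contra! h
      exact h0 p hp (ContinuousLinearMap.ext h)
    by_cases hx : p.1 x = p.2
    · have ht : Tendsto (fun t : ℝ => x + t • e) (𝓝[≠] 0) (𝓝 x) := by
        have : Continuous fun t : ℝ => x + t • e := by fun_prop
        simpa using (this.tendsto 0).mono_left nhdsWithin_le_nhds
      refine mem_closure_of_tendsto ht ?_
      filter_upwards [self_mem_nhdsWithin] with t ht
      simp only [map_add, map_smul, smul_eq_mul, hx]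
      intro h
      exact mul_ne_zero ht he (by linarith)
    · exact subset_closure hx
  have key : ∀ s : Finset ((V →L[ℝ] ℝ) × ℝ), (∀ p ∈ s, p ∈ F) →
      IsOpen {x : V | ∀ p ∈ s, p.1 x ≠ p.2} ∧ Dense {x : V | ∀ p ∈ s, p.1 x ≠ p.2} := by
    classical
    intro s
    induction s using Finset.induction_on with
    | empty => intro _; simp
    | insert p s _ ih =>
      intro hs
      have h1 := hdense p (hs p (Finset.mem_insert_self p s))
      have h2 := ih fun q hq => hs q (Finset.mem_insert_of_mem hq)
      have : {x : V | ∀ q ∈ insert p s, q.1 x ≠ q.2} =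
          {x | p.1 x ≠ p.2} ∩ {x | ∀ q ∈ s, q.1 x ≠ q.2} := by
        ext x; simp
      rw [this]
      exact ⟨h1.1.inter h2.1, h1.2.inter_of_isOpen_left h2.2 h1.1⟩
  obtain ⟨x, hx, hxU⟩ := mem_closure_iff_nhds.1 ((key hF.toFinset (by simp)).2 x₀) U hU
  exact ⟨x, hx, fun p hp => hxU p (by simpa using hp)⟩

lemma eventually_notMem_triangle {P Q M x : Fin 3 → ℝ} (h : x ∉ triangle P Q M) :
    ∀ᶠ D in 𝓝 M, x ∉ triangle P Q D := by
  have hK := (isCompact_triangle P Q M).isClosed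
  have hne : (triangle P Q M).Nonempty := ⟨P, left_mem_triangle _ _ _⟩
  have hd : 0 < Metric.infDist x (triangle P Q M) := (hK.notMem_iff_infDist_pos hne).1 h
  set δ := Metric.infDist x (triangle P Q M) with hδ
  have hsub : triangle P Q M ⊆ Metric.thickening δ (triangle P Q M) :=
    Metric.self_subset_thickening hd _
  have hM : M ∈ triangle P Q M := segment_subset_triangle_left _ _ _ (right_mem_segment ℝ _ _)
  have hQ : Q ∈ triangle P Q M := segment_subset_triangle_base _ _ _ (right_mem_segment ℝ _ _)
  filter_upwards [Metric.isOpen_thickening.mem_nhds (hsub hM)] with D hD hx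
  have := triangle_subset_of_convex ((convex_triangle P Q M).thickening δ)
    (hsub (left_mem_triangle _ _ _)) (hsub hQ) hD hx
  rw [Metric.mem_thickening_iff_infDist_lt hne] at this
  exact this.ne rfl

end Density

section Push

variable {n : ℕ} {T T' : Fin n → List VertexName} {lab : VertexName → Option ℕ}
  {pos : VertexName → Fin 3 → ℝ} {a b c f₁ f₂ : VertexName}
  {R : Type*} [CommRing R] {v : EmbeddedGraph n → R}

/-- The edge `f` meets the triangle `A B C`, apart from its corners `A` and `B`, only transversally
in its interior. -/
def GenericTo (pos : VertexName → Fin 3 → ℝ) (A B C : Fin 3 → ℝ) (f : VertexName × VertexName) :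
    Prop :=
  ∀ x ∈ edgeSegment pos f, x ∈ triangle A B C → x = A ∨ x = B ∨
    (x ∉ segment ℝ A B ∧ x ∉ segment ℝ A C ∧ x ∉ segment ℝ C B ∧
      x ∈ openSegment ℝ (pos f.1) (pos f.2) ∧
      Matrix.det (Matrix.of ![B - A, C - A, pos f.2 - pos f.1]) ≠ 0)

/-- The edge `f` meets the triangle `A B C` outside its corners `A` and `B`. -/
def Pierces (pos : VertexName → Fin 3 → ℝ) (A B C : Fin 3 → ℝ) (f : VertexName × VertexName) :
    Prop := ∃ x ∈ edgeSegment pos f, x ∈ triangle A B C ∧ x ≠ A ∧ x ≠ B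

lemma exists_interior_coordinates {A B C x : Fin 3 → ℝ} (hx : x ∈ triangle A B C)
    (h1 : x ∉ segment ℝ A B) (h2 : x ∉ segment ℝ A C) (h3 : x ∉ segment ℝ C B) :
    ∃ σ ρ : ℝ, 0 < σ ∧ 0 < ρ ∧ σ + ρ < 1 ∧ x = planePoint A (B - A) (C - A) σ ρ := by
  obtain ⟨σ, ρ, hσ, hρ, hs, rfl⟩ := hx
  refine ⟨σ, ρ, hσ.lt_of_ne' ?_, hρ.lt_of_ne' ?_, hs.lt_of_ne ?_, rfl⟩
  · rintro rfl
    exact h2 (mem_segment_iff_exists.2 ⟨ρ, hρ, by linarith, by simp⟩)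
  · rintro rfl
    exact h1 (mem_segment_iff_exists.2 ⟨σ, hσ, by linarith, by simp⟩)
  · intro h
    refine h3 (mem_segment_iff_exists.2 ⟨σ, hσ, by linarith, ?_⟩)
    obtain rfl : ρ = 1 - σ := by linarith
    module

/-- A segment that is not parallel to the plane of a triangle meets it in at most one point. -/
lemma eq_of_transversal {A B C F G x x' : Fin 3 → ℝ} (hx : x ∈ segment ℝ F G)
    (hx' : x' ∈ segment ℝ F G) (ht : x ∈ triangle A B C) (ht' : x' ∈ triangle A B C)
    (hdet : Matrix.det (Matrix.of ![B - A, C - A, G - F]) ≠ 0) : x = x' := by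
  obtain ⟨l, -, -, rfl⟩ := mem_segment_iff_exists.1 hx
  obtain ⟨m, -, -, rfl⟩ := mem_segment_iff_exists.1 hx'
  obtain ⟨s, t, -, -, -, h⟩ := ht
  obtain ⟨s', t', -, -, -, h'⟩ := ht'
  have := mul_det_eq_zero (t := l - m) (r := s - s') (s := t - t') (d := B - A) (d' := C - A)
    (e := G - F) (by
      calc (l - m) • (G - F) = (F + l • (G - F)) - (F + m • (G - F)) := by module
        _ = _ := by rw [h, h']; module)
  rw [sub_eq_zero.1 ((mul_eq_zero.1 this).resolve_right hdet)]

/-- Pushing an edge across a triangle that is pierced by exactly one other edge. -/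
lemma IsVassilievInvariant.push_of_one {k : ℕ} (hv : IsVassilievInvariant v)
    (hk : IsOfFiniteType k v) (hcard : {l | ∃ u, lab u = some l}.ncard = k) (hT : Shape T lab)
    (hG : Good (edgeSet T) lab pos) (h : IsInsertion 1 T T' a c b) (hc : ∀ i, c ∉ T i)
    (hG' : Good (edgeSet T') lab pos) (hla : lab a = none) (hlb : lab b = none)
    (hli : LinearIndependent ℝ ![pos b - pos a, pos c - pos a])
    (hf : (f₁, f₂) ∈ edgeSet T) (hfa : (f₁, f₂) ≠ (a, b)) {X : Fin 3 → ℝ}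
    (hX : X ∈ openSegment ℝ (pos f₁) (pos f₂)) {σ ρ : ℝ} (hσ : 0 < σ) (hρ : 0 < ρ)
    (hσρ : σ + ρ < 1) (hXc : X = planePoint (pos a) (pos b - pos a) (pos c - pos a) σ ρ)
    (hdet : Matrix.det (Matrix.of ![pos b - pos a, pos c - pos a, pos f₂ - pos f₁]) ≠ 0)
    (hrest : ∀ f ∈ edgeSet T, f ≠ (a, b) → ∀ z ∈ edgeSegment pos f,
      z ∈ triangle (pos a) (pos b) (pos c) → z = pos a ∨ z = pos b ∨ z = X) :
    valueOf v (diagram T lab pos) = valueOf v (diagram T' lab pos) := by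
  have hT' := h.shape hT hc
  obtain ⟨o, hoT, hoc⟩ := exists_fresh T {c}
  obtain ⟨q, hqT, hqc⟩ := exists_fresh T {c, o}
  obtain ⟨x, hxT, hxc⟩ := exists_fresh T {c, o, q}
  obtain ⟨y, hyT, hyc⟩ := exists_fresh T {c, o, q, x}
  simp only [Finset.mem_singleton, Finset.mem_insert, not_or] at hoc hqc hxc hyc
  have hne : f₁ ≠ f₂ := fun h0 => hG.nondeg _ hf (by simp [h0])
  obtain ⟨S, S', hS, hS', hSS⟩ := h.exists_commute hT hc hf hne hfa o
  set A := pos a with hA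
  set u := (σ / (σ + ρ)) • (pos b - A) + (ρ / (σ + ρ)) • (pos c - A) with hu
  set w := pos b - A - u with hw
  have hsum : 0 < σ + ρ := by positivity
  -- new positions
  set ps := Function.update (Function.update (Function.update (Function.update pos o X)
    q (planePoint A u w 1 0)) x (planePoint A u w ((σ + ρ) / 2) 0))
    y (planePoint A u w ((1 + (σ + ρ)) / 2) 0) with hps
  have hkeep : ∀ s, s ≠ o → s ≠ q → s ≠ x → s ≠ y → ps s = pos s := fun s h1 h2 h3 h4 => by
    rw [hps, Function.update_of_ne h4, Function.update_of_ne h3, Function.update_of_ne h2,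
      Function.update_of_ne h1]
  have hTk : ∀ s, (∃ i, s ∈ T i) → ps s = pos s := fun s ⟨i, hi⟩ =>
    hkeep s (fun h => hoT i (h ▸ hi)) (fun h => hqT i (h ▸ hi)) (fun h => hxT i (h ▸ hi))
      (fun h => hyT i (h ▸ hi))
  have hck : ps c = pos c := hkeep c (Ne.symm hoc) (Ne.symm hqc.1) (Ne.symm hxc.1) (Ne.symm hyc.1)
  have hT'k : ∀ s, (∃ i, s ∈ T' i) → ps s = pos s := fun s hs => by
    rcases h.mem_names.1 hs with hs | rfl
    exacts [hTk s hs, hck]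
  have hok : ps o = X := by
    rw [hps, Function.update_of_ne (Ne.symm hyc.2.1), Function.update_of_ne (Ne.symm hxc.2.1),
      Function.update_of_ne (Ne.symm hqc.2), Function.update_self]
  have hqk : ps q = planePoint A u w 1 0 := by
    rw [hps, Function.update_of_ne (Ne.symm hyc.2.2.1), Function.update_of_ne (Ne.symm hxc.2.2),
      Function.update_self]
  have hxk : ps x = planePoint A u w ((σ + ρ) / 2) 0 := by
    rw [hps, Function.update_of_ne (Ne.symm hyc.2.2.2), Function.update_self]
  have hyk : ps y = planePoint A u w ((1 + (σ + ρ)) / 2) 0 := by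
    rw [hps, Function.update_self]
  have hseg : ∀ f ∈ edgeSet T, edgeSegment ps f = edgeSegment pos f := fun f hf => by
    rw [edgeSegment, hTk _ (fst_mem_of_mem_edgeSet hf), hTk _ (snd_mem_of_mem_edgeSet hf)]
  have hGs : Good (edgeSet T) lab ps := hG.congr
    (fun e he => ⟨hTk _ (fst_mem_of_mem_edgeSet he), hTk _ (snd_mem_of_mem_edgeSet he)⟩)
    (fun s hs => hTk s (hT.supp s hs))
  have hGs' : Good (edgeSet T') lab ps := hG'.congr
    (fun e he => ⟨hT'k _ (fst_mem_of_mem_edgeSet he), hT'k _ (snd_mem_of_mem_edgeSet he)⟩)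
    (fun s hs => hTk s (hT.supp s hs))
  have hak : ps a = A := hTk a (fst_mem_of_mem_edgeSet h.mem_edge)
  have hbk : ps b = pos b := hTk b (snd_mem_of_mem_edgeSet h.mem_edge)
  have hf₁k : ps f₁ = pos f₁ := hTk _ (fst_mem_of_mem_edgeSet hf)
  have hf₂k : ps f₂ = pos f₂ := hTk _ (snd_mem_of_mem_edgeSet hf)
  rw [diagram_congr (fun s hs => (hTk s hs).symm), diagram_congr (fun s hs => (hT'k s hs).symm)]
  have hoT' : ∀ i, o ∉ T' i := fun i hi => by
    rcases h.mem_names.1 ⟨i, hi⟩ with ⟨j, hj⟩ | h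
    exacts [hoT j hj, hoc h]
  have hXs : ps o ∈ openSegment ℝ (ps f₁) (ps f₂) := by rwa [hok, hf₁k, hf₂k]
  obtain ⟨hSh, hGS, hv1⟩ := hv.subdivide hT hS hoT hGs hXs
  obtain ⟨hSh', hGS', hv2⟩ := hv.subdivide hT' hS' hoT' hGs' hXs
  rw [hv1, hv2]
  have hfreshS : ∀ {s}, s ≠ o → (∀ i, s ∉ T i) → ∀ i, s ∉ S i := fun {s} hso hs i hi => by
    rcases hS.mem_names.1 ⟨i, hi⟩ with ⟨j, hj⟩ | h
    exacts [hs j hj, hso h]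
  have hb : pos b = planePoint A u w 1 1 := by rw [hw]; unfold planePoint; module
  have hcc : pos c = planePoint A u w 1 (-(σ / ρ)) := by
    rw [hw, hu]; unfold planePoint
    match_scalars <;> field_simp <;> ring
  have hXX : X = planePoint A u w (σ + ρ) 0 := by
    rw [hXc, hu]; unfold planePoint
    match_scalars <;> field_simp <;> ring
  have hwc : w = (ρ / (σ + ρ)) • (pos b - A) + (-(ρ / (σ + ρ))) • (pos c - A) := by
    rw [hw, hu]
    match_scalars <;> field_simp <;> ring
  refine hv.crossing_plane hk hcard hSh hGS hSS (hfreshS (Ne.symm hoc) hc) hGS' hla hlb (o := o)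
    (f₁ := f₁) (f₂ := f₂) (q := q) (x := x) (y := y) (O := A) (u := u) (w := w) (ξ := σ + ρ)
    (κ := σ / ρ) ((hS.mem_edgeSet hT).2 (Or.inr (Or.inl rfl)))
    ((hS.mem_edgeSet hT).2 (Or.inr (Or.inr rfl))) ?_ (hT.lab_fresh hoT) hXs ?_ hsum hσρ
    (by positivity) ?_ (hfreshS hqc.2 hqT) (hfreshS hxc.2.1 hxT) (hfreshS hyc.2.1 hyT) hqc.1 hxc.1
    hyc.1 hxc.2.2 hyc.2.2.1 (Ne.symm hyc.2.2.2) ?_ (hok.trans hXX) hqk (hbk.trans hb)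
    (hck.trans hcc) hxk hyk ?_
  · intro h0
    simp only [Prod.mk.injEq] at h0
    obtain ⟨i, hi⟩ := snd_mem_of_mem_edgeSet h.mem_edge
    exact hoT i (h0.2 ▸ hi)
  · rw [LinearIndependent.pair_iff] at hli ⊢
    intro s t hst
    obtain ⟨e1, e2⟩ := hli (s * (σ / (σ + ρ)) + t * (ρ / (σ + ρ)))
      (s * (ρ / (σ + ρ)) - t * (ρ / (σ + ρ))) (by rw [← hst, hwc, hu]; module)
    field_simp at e1 e2
    have hs : s = 0 := by
      have : s * (σ + ρ) = 0 := by linarith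
      exact (mul_eq_zero.1 this).resolve_right hsum.ne'
    subst hs
    exact ⟨rfl, by simpa [hρ.ne'] using e1⟩
  · rw [hf₁k, hf₂k, hwc, hu, det_combination]
    refine mul_ne_zero ?_ hdet
    have : σ / (σ + ρ) * -(ρ / (σ + ρ)) - ρ / (σ + ρ) * (ρ / (σ + ρ)) = -(ρ / (σ + ρ)) := by
      field_simp; ring
    rw [this]
    exact neg_ne_zero.2 (by positivity)
  · rw [hak]; simp [planePoint]
  · intro f hfS hfab z hz hzt
    rw [hak, hbk, hok]
    rw [hak, hbk, hck] at hzt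
    have hXs' := openSegment_subset_segment _ _ _ hXs
    rcases (hS.mem_edgeSet hT).1 hfS with ⟨hfT, -⟩ | rfl | rfl
    · rw [hseg f hfT] at hz
      exact hrest f hfT hfab z hz hzt
    · refine hrest _ hf hfa z ?_ hzt
      rw [← hseg _ hf]
      exact (convex_segment _ _).segment_subset (left_mem_segment ℝ _ _) hXs' hz
    · refine hrest _ hf hfa z ?_ hzt
      rw [← hseg _ hf]
      exact (convex_segment _ _).segment_subset hXs' (right_mem_segment ℝ _ _) hz

end Push

section PushMany

variable {n : ℕ} {lab : VertexName → Option ℕ} {R : Type*} [CommRing R] {v : EmbeddedGraph n → R}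

lemma eq_of_midpoint_mem_triangle {P Q M x₁ x₂ : Fin 3 → ℝ}
    (hli : LinearIndependent ℝ ![Q - P, M - P]) (h1 : x₁ ∈ triangle P Q M)
    (h2 : x₂ ∈ triangle P Q M) (hM : (2 : ℝ) • M = x₁ + x₂) : x₁ = x₂ := by
  obtain ⟨r, s, hr, hs, hrs, rfl⟩ := h1
  obtain ⟨r', s', hr', hs', hrs', rfl⟩ := h2
  obtain ⟨e1, e2⟩ := hli.coeff_eq (s := 0) (t := 2) (s' := r + r') (t' := s + s') (by
    have : (2 : ℝ) • M - (2 : ℝ) • P = (r + r') • (Q - P) + (s + s') • (M - P) := by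
      rw [hM]; module
    rw [← this]; module)
  obtain rfl : r = 0 := by linarith
  obtain rfl : r' = 0 := by linarith
  obtain rfl : s = 1 := by linarith
  obtain rfl : s' = 1 := by linarith
  rfl

lemma linearIndependent_inside {A B C : Fin 3 → ℝ} (hli : LinearIndependent ℝ ![B - A, C - A])
    {β γ : ℝ} (hβ : 0 < β) (hγ : 0 < γ) (hβγ : β + γ < 1) :
    LinearIndependent ℝ ![B - A, planePoint A (B - A) (C - A) β γ - A] ∧
    LinearIndependent ℝ ![planePoint A (B - A) (C - A) β γ - A, C - A] ∧
    LinearIndependent ℝ ![B - C, planePoint A (B - A) (C - A) β γ - C] := by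
  have hA : planePoint A (B - A) (C - A) 0 0 = A := by simp [planePoint]
  have hB : planePoint A (B - A) (C - A) 1 0 = B := by simp [planePoint]
  have hC : planePoint A (B - A) (C - A) 0 1 = C := by simp [planePoint]
  have h1 := linearIndependent_planePoint hli (O := A) (s := 0) (t := 0) (s' := 1) (t' := 0)
    (s'' := β) (t'' := γ) (by ring_nf; exact hγ.ne')
  have h2 := linearIndependent_planePoint hli (O := A) (s := 0) (t := 0) (s' := β) (t' := γ)
    (s'' := 0) (t'' := 1) (by ring_nf; exact hβ.ne')
  have h3 := linearIndependent_planePoint hli (O := A) (s := 0) (t := 1) (s' := 1) (t' := 0)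
    (s'' := β) (t'' := γ) (by intro h; linarith)
  rw [hA, hB] at h1
  rw [hA, hC] at h2
  rw [hB, hC] at h3
  exact ⟨h1, h2, h3⟩

/-- Coordinates `β`, `γ` of a point inside the triangle `A B C` such that no point of a given finite
set lies on a line through it and a corner, and such that none of the three triangles cut off by it
contains both points with the coordinates `p₁` and `p₂`. -/
lemma exists_splitting_point {A B C : Fin 3 → ℝ} (hli : LinearIndependent ℝ ![B - A, C - A])
    {P : Set (ℝ × ℝ)} (hP : P.Finite) (hP0 : ∀ p ∈ P, 0 < p.1 ∧ 0 < p.2 ∧ p.1 + p.2 < 1)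
    {p₁ p₂ : ℝ × ℝ} (h1 : p₁ ∈ P) (h2 : p₂ ∈ P) (hne : p₁ ≠ p₂) :
    ∃ β γ : ℝ, 0 < β ∧ 0 < γ ∧ β + γ < 1 ∧
      (∀ p ∈ P, ∀ t : ℝ, (p.1 ≠ t * β ∨ p.2 ≠ t * γ) ∧
        (p.1 ≠ 1 + t * (β - 1) ∨ p.2 ≠ t * γ) ∧ (p.1 ≠ t * β ∨ p.2 ≠ 1 + t * (γ - 1))) ∧
      ∀ X Y Z, (X = A ∧ Y = B ∨ X = A ∧ Y = C ∨ X = C ∧ Y = B) →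
        Z = planePoint A (B - A) (C - A) β γ →
        ¬ (planePoint A (B - A) (C - A) p₁.1 p₁.2 ∈ triangle X Y Z ∧
          planePoint A (B - A) (C - A) p₂.1 p₂.2 ∈ triangle X Y Z) := by
  obtain ⟨a1, b1, c1⟩ := hP0 _ h1
  obtain ⟨a2, b2, c2⟩ := hP0 _ h2
  set Φ : ℝ × ℝ → Fin 3 → ℝ := fun p => planePoint A (B - A) (C - A) p.1 p.2 with hΦ
  have hcont : Continuous Φ := by unfold Φ planePoint; fun_prop
  set m : ℝ × ℝ := ((p₁.1 + p₂.1) / 2, (p₁.2 + p₂.2) / 2) with hm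
  have hxne : Φ p₁ ≠ Φ p₂ := fun h => by
    obtain ⟨e1, e2⟩ := planePoint_inj hli h
    exact hne (Prod.ext e1 e2)
  have hmid : (2 : ℝ) • Φ m = Φ p₁ + Φ p₂ := by
    simp only [hΦ, hm, planePoint]; module
  have hsplit : ∀ X Y, LinearIndependent ℝ ![Y - X, Φ m - X] →
      ∀ᶠ p in 𝓝 m, ¬ (Φ p₁ ∈ triangle X Y (Φ p) ∧ Φ p₂ ∈ triangle X Y (Φ p)) := by
    intro X Y hXY
    by_cases hx : Φ p₁ ∈ triangle X Y (Φ m)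
    · have hx' : Φ p₂ ∉ triangle X Y (Φ m) := fun h =>
        hxne (eq_of_midpoint_mem_triangle hXY hx h hmid)
      filter_upwards [hcont.continuousAt.eventually (eventually_notMem_triangle hx')] with p hp h
      exact hp h.2
    · filter_upwards [hcont.continuousAt.eventually (eventually_notMem_triangle hx)] with p hp h
      exact hp h.1
  have hm0 : 0 < m.1 ∧ 0 < m.2 ∧ m.1 + m.2 < 1 := by
    refine ⟨?_, ?_, ?_⟩ <;> simp only [hm] <;> linarith
  obtain ⟨l1, l2, l3⟩ := linearIndependent_inside hli hm0.1 hm0.2.1 hm0.2.2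
  have hs1 := hsplit A B l1
  have hs2 := hsplit A C (LinearIndependent.pair_symm_iff.1 l2)
  have hs3 := hsplit C B l3
  have hopen : ∀ᶠ p : ℝ × ℝ in 𝓝 m, 0 < p.1 ∧ 0 < p.2 ∧ p.1 + p.2 < 1 := by
    have hU : IsOpen {p : ℝ × ℝ | 0 < p.1 ∧ 0 < p.2 ∧ p.1 + p.2 < 1} :=
      (isOpen_lt continuous_const continuous_fst).inter
        ((isOpen_lt continuous_const continuous_snd).inter
          (isOpen_lt (continuous_fst.add continuous_snd) continuous_const))
    exact hU.mem_nhds hm0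
  -- the line through the corner and the point `p`
  let ℓ : ℝ → ℝ → (ℝ × ℝ →L[ℝ] ℝ) := fun s t =>
    s • ContinuousLinearMap.snd ℝ ℝ ℝ - t • ContinuousLinearMap.fst ℝ ℝ ℝ
  have hℓ : ∀ s t (p : ℝ × ℝ), ℓ s t p = s * p.2 - t * p.1 := fun s t p => by simp [ℓ]
  have hℓ0 : ∀ s t, s ≠ 0 ∨ t ≠ 0 → ℓ s t ≠ 0 := by
    intro s t hst h0
    have e1 := congrArg (fun φ : ℝ × ℝ →L[ℝ] ℝ => φ (0, 1)) h0
    have e2 := congrArg (fun φ : ℝ × ℝ →L[ℝ] ℝ => φ (1, 0)) h0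
    simp only [hℓ] at e1 e2
    simp at e1 e2
    exact hst.elim (fun h => h e1) (fun h => h e2)
  let F : Set ((ℝ × ℝ →L[ℝ] ℝ) × ℝ) :=
    (fun p : ℝ × ℝ => (ℓ p.1 p.2, 0)) '' P ∪ ((fun p : ℝ × ℝ => (ℓ (p.1 - 1) p.2, -p.2)) '' P ∪
      (fun p : ℝ × ℝ => (ℓ p.1 (p.2 - 1), p.1)) '' P)
  have hF : F.Finite := (hP.image _).union ((hP.image _).union (hP.image _))
  obtain ⟨d, hd, hdF⟩ := exists_mem_nhds_avoiding hF (by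
    rintro _ (⟨p, hp, rfl⟩ | ⟨p, hp, rfl⟩ | ⟨p, hp, rfl⟩) <;>
      obtain ⟨e1, e2, e3⟩ := hP0 p hp
    · exact hℓ0 _ _ (Or.inl e1.ne')
    · exact hℓ0 _ _ (Or.inr e2.ne')
    · exact hℓ0 _ _ (Or.inl e1.ne')) (hopen.and (hs1.and (hs2.and hs3)))
  obtain ⟨⟨d1, d2, d3⟩, e1, e2, e3⟩ := hd
  refine ⟨d.1, d.2, d1, d2, d3, fun p hp t => ⟨?_, ?_, ?_⟩, ?_⟩
  · by_contra! h
    refine hdF _ (Or.inl ⟨p, hp, rfl⟩) ?_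
    simp only [hℓ]
    rw [h.1, h.2]; ring
  · by_contra! h
    refine hdF _ (Or.inr (Or.inl ⟨p, hp, rfl⟩)) ?_
    simp only [hℓ]
    rw [h.1, h.2]; ring
  · by_contra! h
    refine hdF _ (Or.inr (Or.inr ⟨p, hp, rfl⟩)) ?_
    simp only [hℓ]
    rw [h.1, h.2]; ring
  · rintro X Y Z (⟨rfl, rfl⟩ | ⟨rfl, rfl⟩ | ⟨rfl, rfl⟩) rfl
    exacts [e1, e2, e3]

/-- The two new sides of a triangle in general position avoid all other edges. -/
lemma Good.good_of_genericTo {T T' : Fin n → List VertexName} {pos : VertexName → Fin 3 → ℝ}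
    {a b c : VertexName} (hG : Good (edgeSet T) lab pos) (hT : Shape T lab)
    (h : IsInsertion 1 T T' a c b) (hc : ∀ i, c ∉ T i) (hla : lab a = none) (hlb : lab b = none)
    (hli : LinearIndependent ℝ ![pos b - pos a, pos c - pos a])
    (hgen : ∀ f ∈ edgeSet T, f ≠ (a, b) → GenericTo pos (pos a) (pos b) (pos c) f) :
    Good (edgeSet T') lab pos := by
  rw [h.edgeSet_eq hT]
  refine hG.insert_apex h.mem_edge (notMem_edge_of_fresh hc) (hT.lab_fresh hc) hla hlb hli ?_
  intro f hf hfab x hx hxs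
  have hxt : x ∈ triangle (pos a) (pos b) (pos c) := hxs.elim
    (fun h => segment_subset_triangle_left _ _ _ h) (fun h => segment_subset_triangle_right _ _ _ h)
  rcases hgen f hf hfab x hx hxt with h | h | ⟨-, h1, h2, -⟩
  exacts [Or.inl h, Or.inr h, absurd hxs (not_or.2 ⟨h1, h2⟩)]

/-- With the maximal number of nodes, an edge may be pushed across a triangle that is pierced
transversally by other edges. -/
theorem IsVassilievInvariant.push {k : ℕ} (hv : IsVassilievInvariant v)
    (hk : IsOfFiniteType k v) (hcard : {l | ∃ u, lab u = some l}.ncard = k) (m : ℕ) :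
    ∀ {T T' : Fin n → List VertexName} {pos : VertexName → Fin 3 → ℝ} {a b c : VertexName},
    {f | f ∈ edgeSet T ∧ f ≠ (a, b) ∧ Pierces pos (pos a) (pos b) (pos c) f}.ncard = m →
    Shape T lab → Good (edgeSet T) lab pos → IsInsertion 1 T T' a c b → (∀ i, c ∉ T i) →
    lab a = none → lab b = none → LinearIndependent ℝ ![pos b - pos a, pos c - pos a] →
    (∀ f ∈ edgeSet T, f ≠ (a, b) → GenericTo pos (pos a) (pos b) (pos c) f) →
    valueOf v (diagram T lab pos) = valueOf v (diagram T' lab pos) := by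
  induction m using Nat.strong_induction_on with
  | _ m ih =>
  intro T T' pos a b c hm hT hG h hc hla hlb hli hgen
  have hT' := h.shape hT hc
  have hG' := hG.good_of_genericTo hT h hc hla hlb hli hgen
  set P := {f | f ∈ edgeSet T ∧ f ≠ (a, b) ∧ Pierces pos (pos a) (pos b) (pos c) f} with hP
  have hPfin : P.Finite := (edgeSet_finite T).subset fun f hf => hf.1
  have hdata : ∀ f ∈ P, ∃ p : ℝ × ℝ, 0 < p.1 ∧ 0 < p.2 ∧ p.1 + p.2 < 1 ∧
      planePoint (pos a) (pos b - pos a) (pos c - pos a) p.1 p.2 ∈ openSegment ℝ (pos f.1) (pos f.2)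
      ∧ Matrix.det (Matrix.of ![pos b - pos a, pos c - pos a, pos f.2 - pos f.1]) ≠ 0 ∧
      ∀ x ∈ edgeSegment pos f, x ∈ triangle (pos a) (pos b) (pos c) →
        x = planePoint (pos a) (pos b - pos a) (pos c - pos a) p.1 p.2 := by
    rintro f ⟨hf, hfab, x, hx, hxt, hxa, hxb⟩
    rcases hgen f hf hfab x hx hxt with h | h | ⟨h1, h2, h3, h4, h5⟩
    · exact absurd h hxa
    · exact absurd h hxb
    obtain ⟨σ, ρ, hσ, hρ, hs, rfl⟩ := exists_interior_coordinates hxt h1 h2 h3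
    exact ⟨(σ, ρ), hσ, hρ, hs, h4, h5, fun y hy hyt => eq_of_transversal hy hx hyt hxt h5⟩
  have hnotP : ∀ f ∈ edgeSet T, f ≠ (a, b) → f ∉ P → ∀ x ∈ edgeSegment pos f,
      x ∈ triangle (pos a) (pos b) (pos c) → x = pos a ∨ x = pos b := by
    intro f hf hfab hfP x hx hxt
    by_contra! h0
    exact hfP ⟨hf, hfab, x, hx, hxt, h0.1, h0.2⟩
  choose! crd h0 h1 hlt hop hdet huniq using hdata
  rcases P.eq_empty_or_nonempty with hE | ⟨f, hf⟩
  · refine (hv.insert_apex hT h hc hG hla hlb hli fun f hf hfab x hx hxt => ?_).2.2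
    rcases hnotP f hf hfab (by simp [hE]) x hx hxt with h | h
    · exact h ▸ left_mem_segment _ _ _
    · exact h ▸ right_mem_segment _ _ _
  by_cases hone : ∃ g ∈ P, g ≠ f
  swap
  · push Not at hone
    refine hv.push_of_one hk hcard hT hG h hc hG' hla hlb hli (f₁ := f.1) (f₂ := f.2) hf.1 hf.2.1
      (hop f hf) (h0 f hf) (h1 f hf) (hlt f hf) rfl (hdet f hf) fun g hg hgab x hx hxt => ?_
    by_cases hgP : g ∈ P
    · obtain rfl := hone g hgP
      exact Or.inr (Or.inr (huniq g hgP x hx hxt))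
    · rcases hnotP g hg hgab hgP x hx hxt with h | h
      exacts [Or.inl h, Or.inr (Or.inl h)]
  obtain ⟨g, hg, hgf⟩ := hone
  have hopen_ne : ∀ f ∈ edgeSet T, ∀ x ∈ openSegment ℝ (pos f.1) (pos f.2),
      x ≠ pos f.1 ∧ x ≠ pos f.2 := by
    intro f hf x hx
    have hnd := hG.nondeg f hf
    constructor
    · rintro rfl
      exact hnd (left_mem_openSegment_iff.1 hx)
    · rintro rfl
      exact hnd (right_mem_openSegment_iff.1 hx)
  have hcne : crd f ≠ crd g := by
    intro he
    have hx := hop f hf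
    have hx' := hop g hg
    rw [← he] at hx'
    obtain ⟨u, w, hu, -, hxu, -⟩ := hG.inter f hf.1 g hg.1 hgf.symm _
      (openSegment_subset_segment _ _ _ hx) (openSegment_subset_segment _ _ _ hx')
    have := hopen_ne f hf.1 _ hx
    rcases hu with rfl | rfl
    exacts [this.1 hxu, this.2 hxu]
  -- Two piercing points are separated by cutting the triangle into three at a point `D` inside it,
  -- so that each of the three is pierced by fewer edges.
  obtain ⟨β, γ, hβ, hγ, hβγ, hoff, hsplit⟩ := exists_splitting_point hli (hPfin.image crd)
    (by rintro _ ⟨e, he, rfl⟩; exact ⟨h0 e he, h1 e he, hlt e he⟩) ⟨f, hf, rfl⟩ ⟨g, hg, rfl⟩ hcne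
  -- the new vertex `d`
  obtain ⟨d, hdT, hdc⟩ := exists_fresh T {c}
  rw [Finset.mem_singleton] at hdc
  set A := pos a with hA
  set B := pos b with hB
  set C := pos c with hC
  set D := planePoint A (B - A) (C - A) β γ with hD
  obtain ⟨l1, l2, l3⟩ := linearIndependent_inside hli hβ hγ hβγ
  set ps := Function.update pos d D with hps
  have hpk : ∀ s, s ≠ d → ps s = pos s := fun s hs => by rw [hps, Function.update_of_ne hs]
  have hTd : ∀ s, (∃ i, s ∈ T i) → s ≠ d := fun s ⟨i, hi⟩ h => hdT i (h ▸ hi)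
  have hTk : ∀ s, (∃ i, s ∈ T i) → ps s = pos s := fun s hs => hpk s (hTd s hs)
  have hck : ps c = C := hpk c (Ne.symm hdc)
  have hdk : ps d = D := by rw [hps, Function.update_self]
  have hab := h.mem_edge
  have hak : ps a = A := hTk a (fst_mem_of_mem_edgeSet hab)
  have hbk : ps b = B := hTk b (snd_mem_of_mem_edgeSet hab)
  have hseg : ∀ f ∈ edgeSet T, edgeSegment ps f = edgeSegment pos f := fun f hf => by
    rw [edgeSegment, hTk _ (fst_mem_of_mem_edgeSet hf), hTk _ (snd_mem_of_mem_edgeSet hf)]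
  have hT'k : ∀ s, (∃ i, s ∈ T' i) → ps s = pos s := fun s hs => by
    rcases h.mem_names.1 hs with hs | rfl
    exacts [hTk s hs, hck]
  have hGs : Good (edgeSet T) lab ps := hG.congr
    (fun e he => ⟨hTk _ (fst_mem_of_mem_edgeSet he), hTk _ (snd_mem_of_mem_edgeSet he)⟩)
    (fun s hs => hTk s (hT.supp s hs))
  have hGs' : Good (edgeSet T') lab ps := hG'.congr
    (fun e he => ⟨hT'k _ (fst_mem_of_mem_edgeSet he), hT'k _ (snd_mem_of_mem_edgeSet he)⟩)
    (fun s hs => hTk s (hT.supp s hs))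
  rw [diagram_congr (fun s hs => (hTk s hs).symm), diagram_congr (fun s hs => (hT'k s hs).symm)]
  have hlc := hT.lab_fresh hc
  have hld := hT.lab_fresh hdT
  have hdT' : ∀ i, d ∉ T' i := fun i hi => by
    rcases h.mem_names.1 ⟨i, hi⟩ with ⟨j, hj⟩ | h
    exacts [hdT j hj, hdc h]
  -- the strands `a d b` and `a c d b`
  obtain ⟨T₁, T₂, hi1, hi2, hi3⟩ : ∃ T₁ T₂, IsInsertion 1 T T₁ a d b ∧ IsInsertion 1 T₁ T₂ a c d ∧
      IsInsertion 1 T' T₂ c d b := by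
    obtain ⟨i, t, hi, hi', hj⟩ := h
    refine ⟨Function.update T i (a :: d :: b :: t), Function.update T i (a :: c :: d :: b :: t),
      ⟨i, t, hi, by simp [List.IsRotated.refl], fun j hj => by simp [hj, List.IsRotated.refl]⟩,
      ⟨i, b :: t, by simp [List.IsRotated.refl], by simp [List.IsRotated.refl],
        fun j hj => by simp [hj, List.IsRotated.refl]⟩,
      ⟨i, t ++ [a], ?_, ?_, fun j hj' => ?_⟩⟩
    · exact hi'.trans (List.isRotated_append (l := [a]) (l' := c :: b :: t))
    · simpa using List.isRotated_append (l := [a]) (l' := c :: d :: b :: t)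
    · simpa [hj'] using (hj j hj').symm
  have hT₁ := hi1.shape hT hdT
  have hcT₁ : ∀ i, c ∉ T₁ i := fun i hi => by
    rcases hi1.mem_names.1 ⟨i, hi⟩ with ⟨j, hj⟩ | h
    exacts [hc j hj, hdc h.symm]
  -- the small triangles
  have hcv := convex_triangle A B C
  have hAm : A ∈ triangle A B C := left_mem_triangle _ _ _
  have hBm : B ∈ triangle A B C := segment_subset_triangle_base _ _ _ (right_mem_segment ℝ _ _)
  have hCm : C ∈ triangle A B C := segment_subset_triangle_left _ _ _ (right_mem_segment ℝ _ _)
  have hDm : D ∈ triangle A B C := ⟨β, γ, hβ.le, hγ.le, hβγ.le, rfl⟩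
  have pA : A = planePoint A (B - A) (C - A) 0 0 := by simp [planePoint]
  have pB : B = planePoint A (B - A) (C - A) 1 0 := by simp [planePoint]
  have pC : C = planePoint A (B - A) (C - A) 0 1 := by simp [planePoint]
  have hoffA : ∀ f ∈ P, planePoint A (B - A) (C - A) (crd f).1 (crd f).2 ∉ segment ℝ A D := by
    intro f hf hx
    rw [show segment ℝ A D = segment ℝ (planePoint A (B - A) (C - A) 0 0) D by rw [← pA]] at hx
    obtain ⟨t, -, -, hx⟩ := mem_segment_planePoint.1 hx
    obtain ⟨e1, e2⟩ := planePoint_inj hli hx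
    rcases (hoff _ ⟨f, hf, rfl⟩ t).1 with h | h
    · exact h (by linarith)
    · exact h (by linarith)
  have hoffB : ∀ f ∈ P, planePoint A (B - A) (C - A) (crd f).1 (crd f).2 ∉ segment ℝ B D := by
    intro f hf hx
    rw [show segment ℝ B D = segment ℝ (planePoint A (B - A) (C - A) 1 0) D by rw [← pB]] at hx
    obtain ⟨t, -, -, hx⟩ := mem_segment_planePoint.1 hx
    obtain ⟨e1, e2⟩ := planePoint_inj hli hx
    rcases (hoff _ ⟨f, hf, rfl⟩ t).2.1 with h | h
    · exact h (by linarith)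
    · exact h (by linarith)
  have hoffC : ∀ f ∈ P, planePoint A (B - A) (C - A) (crd f).1 (crd f).2 ∉ segment ℝ C D := by
    intro f hf hx
    rw [show segment ℝ C D = segment ℝ (planePoint A (B - A) (C - A) 0 1) D by rw [← pC]] at hx
    obtain ⟨t, -, -, hx⟩ := mem_segment_planePoint.1 hx
    obtain ⟨e1, e2⟩ := planePoint_inj hli hx
    rcases (hoff _ ⟨f, hf, rfl⟩ t).2.2 with h | h
    · exact h (by linarith)
    · exact h (by linarith)
  have hB' : B ∉ triangle A D C := by
    intro hx
    rw [triangle] at hx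
    obtain ⟨r, s, hr, hs, hrs, hx⟩ := hx
    have : planePoint A (B - A) (C - A) 1 0 =
        planePoint A (B - A) (C - A) (r * β) (r * γ + s) := by
      rw [← pB]
      refine hx.trans ?_
      rw [hD]; unfold planePoint; module
    obtain ⟨e1, e2⟩ := planePoint_inj hli this
    nlinarith
  have hA' : A ∉ triangle C B D := by
    intro hx
    obtain ⟨r, s, hr, hs, hrs, hx⟩ := hx
    have : planePoint A (B - A) (C - A) 0 0 =
        planePoint A (B - A) (C - A) (r + s * β) (1 - r - s + s * γ) := by
      rw [← pA]
      refine hx.trans ?_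
      rw [hD]; unfold planePoint; module
    obtain ⟨e1, e2⟩ := planePoint_inj hli this
    nlinarith
  have hCnot : ∀ f ∈ edgeSet T, f ≠ (a, b) → C ∉ edgeSegment pos f := by
    intro f hf hfab hx
    obtain ⟨hne1, hne2, hne3⟩ := hli.triangle_ne
    rcases hgen f hf hfab C hx hCm with h | h | ⟨-, h, -⟩
    exacts [hne2 h.symm, hne3 h, h (right_mem_segment ℝ _ _)]
  have htri : ∀ f ∈ edgeSet T, f ≠ (a, b) → ∀ x ∈ edgeSegment ps f, x ∈ triangle A B C →
      x = A ∨ x = B ∨ (f ∈ P ∧ x = planePoint A (B - A) (C - A) (crd f).1 (crd f).2 ∧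
        x ∉ segment ℝ A B ∧ x ∉ segment ℝ A C ∧ x ∉ segment ℝ C B ∧
        x ∈ openSegment ℝ (ps f.1) (ps f.2) ∧
        Matrix.det (Matrix.of ![B - A, C - A, ps f.2 - ps f.1]) ≠ 0) := by
    intro f hf hfab x hx hxt
    rw [hTk _ (fst_mem_of_mem_edgeSet hf), hTk _ (snd_mem_of_mem_edgeSet hf)]
    rw [hseg f hf] at hx
    by_cases hfP : f ∈ P
    · rcases hgen f hf hfab x hx hxt with h | h | ⟨i1, i2, i3, i4, i5⟩
      exacts [Or.inl h, Or.inr (Or.inl h),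
        Or.inr (Or.inr ⟨hfP, huniq f hfP x hx hxt, i1, i2, i3, i4, i5⟩)]
    · rcases hnotP f hf hfab hfP x hx hxt with h | h
      exacts [Or.inl h, Or.inr (Or.inl h)]
  have hcount : ∀ X Y Z, (X = A ∧ Y = B ∨ X = A ∧ Y = C ∨ X = C ∧ Y = B) → Z = D →
      ∀ Q : Set (VertexName × VertexName), (∀ e ∈ Q, e ∈ P ∧
        planePoint A (B - A) (C - A) (crd e).1 (crd e).2 ∈ triangle X Y Z) → Q.ncard < m := by
    intro X Y Z hXY hZ Q hQ
    rw [← hm]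
    refine Set.ncard_lt_ncard ⟨fun e he => (hQ e he).1, fun hPQ => ?_⟩ hPfin
    exact hsplit X Y Z hXY hZ ⟨(hQ f (hPQ hf)).2, (hQ g (hPQ hg)).2⟩
  have hDA : D - A = β • (B - A) + γ • (C - A) := by rw [hD]; unfold planePoint; module
  have hDC : D - C = β • (B - A) + (γ - 1) • (C - A) := by rw [hD]; unfold planePoint; module
  -- from `a b` to `a d b` across `A B D`, from `a d b` to `a c d b` across `A D C`, and from `a c b`
  -- to `a c d b` across `C B D`
  have hs1 : ∀ x, x ∈ triangle A B D → x ∈ triangle A B C :=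
    fun x hx => triangle_subset_of_convex hcv hAm hBm hDm hx
  have hs2 : ∀ x, x ∈ triangle A D C → x ∈ triangle A B C :=
    fun x hx => triangle_subset_of_convex hcv hAm hDm hCm hx
  have hs3 : ∀ x, x ∈ triangle C B D → x ∈ triangle A B C :=
    fun x hx => triangle_subset_of_convex hcv hCm hBm hDm hx
  have hgen1 : ∀ e ∈ edgeSet T, e ≠ (a, b) → GenericTo ps (ps a) (ps b) (ps d) e := by
    intro e he heab x hx hxt
    rw [hak, hbk, hdk] at *
    rcases htri e he heab x hx (hs1 x hxt) with h | h | ⟨heP, hpt, i1, i2, i3, i4, i5⟩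
    · exact Or.inl h
    · exact Or.inr (Or.inl h)
    · refine Or.inr (Or.inr ⟨i1, hpt ▸ hoffA e heP, ?_, i4, ?_⟩)
      · rw [segment_symm]; exact hpt ▸ hoffB e heP
      · rw [hDA, show B - A = (1 : ℝ) • (B - A) + (0 : ℝ) • (C - A) by module]
        nth_rw 2 [show (1 : ℝ) • (B - A) + (0 : ℝ) • (C - A) = B - A by module]
        rw [det_combination]
        refine mul_ne_zero ?_ i5
        simpa using hγ.ne'
  have hli1 : LinearIndependent ℝ ![ps b - ps a, ps d - ps a] := by rwa [hak, hbk, hdk]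
  have hv1 := ih _ (hcount A B D (Or.inl ⟨rfl, rfl⟩) rfl _ (by
    rintro e ⟨he, heab, x, hx, hxt, hxa, hxb⟩
    rw [hak, hbk, hdk] at *
    rcases htri e he heab x hx (hs1 x hxt) with h | h | ⟨heP, hpt, -⟩
    exacts [absurd h hxa, absurd h hxb, ⟨heP, hpt ▸ hxt⟩])) rfl hT hGs hi1 hdT hla hlb hli1 hgen1
  have hG₁ := hGs.good_of_genericTo hT hi1 hdT hla hlb hli1 hgen1
  have hDB : ∀ x ∈ edgeSegment ps (d, b), x ∈ triangle A D C → x = D := by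
    intro x hx hxt
    simp only [edgeSegment, hdk, hbk] at hx
    obtain ⟨l, hl0, hl1, hx⟩ := mem_segment_iff_exists.1 hx
    obtain ⟨r, s, hr, hs, hrs, hx'⟩ := hxt
    have : planePoint A (B - A) (C - A) (β + l * (1 - β)) (γ - l * γ) =
        planePoint A (B - A) (C - A) (r * β) (r * γ + s) := by
      trans x
      · rw [hx, hD]; unfold planePoint; module
      · rw [hx', hD]; unfold planePoint; module
    obtain ⟨e1, e2⟩ := planePoint_inj hli this
    have : l = 0 := by nlinarith
    rw [hx, this]; simp
  have hgen2 : ∀ e ∈ edgeSet T₁, e ≠ (a, d) → GenericTo ps (ps a) (ps d) (ps c) e := by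
    intro e he head x hx hxt
    rw [hak, hck, hdk] at *
    rcases (hi1.mem_edgeSet hT).1 he with ⟨he, heab⟩ | h | rfl
    · rcases htri e he heab x hx (hs2 x hxt) with h | h | ⟨heP, hpt, i1, i2, i3, i4, i5⟩
      · exact Or.inl h
      · exact absurd (h ▸ hxt) hB'
      · refine Or.inr (Or.inr ⟨hpt ▸ hoffA e heP, i2, hpt ▸ hoffC e heP, i4, ?_⟩)
        rw [hDA, show C - A = (0 : ℝ) • (B - A) + (1 : ℝ) • (C - A) by module]
        nth_rw 1 [show (0 : ℝ) • (B - A) + (1 : ℝ) • (C - A) = C - A by module]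
        rw [det_combination]
        refine mul_ne_zero ?_ i5
        simpa using hβ.ne'
    · exact absurd h head
    · exact Or.inr (Or.inl (hDB x hx hxt))
  have hv2 := ih _ (hcount A C D (Or.inr (Or.inl ⟨rfl, rfl⟩)) rfl _ (by
    rintro e ⟨he, head, x, hx, hxt, hxa, hxd⟩
    rw [hak, hck, hdk] at *
    rcases (hi1.mem_edgeSet hT).1 he with ⟨he, heab⟩ | h | rfl
    · rcases htri e he heab x hx (hs2 x hxt) with h | h | ⟨heP, hpt, -⟩
      · exact absurd h hxa
      · exact absurd (h ▸ hxt) hB'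
      · exact ⟨heP, hpt ▸ (triangle_comm A D C ▸ hxt)⟩
    · exact absurd h head
    · exact absurd (hDB x hx hxt) hxd)) rfl hT₁ hG₁ hi2 hcT₁ hla hld
      (by rwa [hak, hck, hdk]) hgen2
  have hAC : ∀ x ∈ edgeSegment ps (a, c), x ∈ triangle C B D → x = C := by
    intro x hx hxt
    simp only [edgeSegment, hak, hck] at hx
    obtain ⟨l, hl0, hl1, hx⟩ := mem_segment_iff_exists.1 hx
    obtain ⟨r, s, hr, hs, hrs, hx'⟩ := hxt
    have : planePoint A (B - A) (C - A) 0 l =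
        planePoint A (B - A) (C - A) (r + s * β) (1 - r - s + s * γ) := by
      trans x
      · rw [hx]; unfold planePoint; module
      · rw [hx', hD]; unfold planePoint; module
    obtain ⟨e1, e2⟩ := planePoint_inj hli this
    have hs0 : s = 0 := by nlinarith
    subst hs0
    have hr0 : r = 0 := by linarith
    rw [hx', hr0]; simp
  have hgen3 : ∀ e ∈ edgeSet T', e ≠ (c, b) → GenericTo ps (ps c) (ps b) (ps d) e := by
    intro e he hecb x hx hxt
    rw [hbk, hck, hdk] at *
    rcases (h.mem_edgeSet hT).1 he with ⟨he, heab⟩ | rfl | h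
    · rcases htri e he heab x hx (hs3 x hxt) with h | h | ⟨heP, hpt, i1, i2, i3, i4, i5⟩
      · exact absurd (h ▸ hxt) hA'
      · exact Or.inr (Or.inl h)
      · refine Or.inr (Or.inr ⟨i3, hpt ▸ hoffC e heP, ?_, i4, ?_⟩)
        · rw [segment_symm]; exact hpt ▸ hoffB e heP
        rw [hDC, show B - C = (1 : ℝ) • (B - A) + (-1 : ℝ) • (C - A) by module, det_combination]
        refine mul_ne_zero ?_ i5
        intro h0; linarith
    · exact Or.inl (hAC x hx hxt)
    · exact absurd h hecb
  have hv3 := ih _ (hcount C B D (Or.inr (Or.inr ⟨rfl, rfl⟩)) rfl _ (by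
    rintro e ⟨he, hecb, x, hx, hxt, hxc, hxb⟩
    rw [hbk, hck, hdk] at *
    rcases (h.mem_edgeSet hT).1 he with ⟨he, heab⟩ | rfl | h
    · rcases htri e he heab x hx (hs3 x hxt) with h | h | ⟨heP, hpt, -⟩
      · exact absurd (h ▸ hxt) hA'
      · exact absurd h hxb
      · exact ⟨heP, hpt ▸ hxt⟩
    · exact absurd (hAC x hx hxt) hxc
    · exact absurd h hecb)) rfl hT' hGs' hi3 hdT' hlc hlb (by rwa [hbk, hck, hdk]) hgen3
  rw [hv1, hv2, hv3]

end PushMany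

/-! ### Stability under small perturbations -/

section Openness

variable {E : Set (VertexName × VertexName)} {lab : VertexName → Option ℕ}
  {pos₀ : VertexName → Fin 3 → ℝ}

/-- Two vectors that do not point in the same direction are strictly separated by a linear form. -/
lemma exists_separating_form {g h : Fin 3 → ℝ} (hg : g ≠ 0) (hh : h ≠ 0)
    (hgh : ∀ r : ℝ, 0 < r → h ≠ r • g) :
    ∃ φ : (Fin 3 → ℝ) →L[ℝ] ℝ, 0 < φ h ∧ φ g < 0 := by
  have h0 : (0 : Fin 3 → ℝ) ∉ segment ℝ h (-g) := by
    intro hm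
    obtain ⟨t, ht0, ht1, ht⟩ := mem_segment_iff_exists.1 hm
    have ht' : (1 - t) • h = t • g := by
      rw [← sub_eq_zero, ht]; module
    rcases ht1.lt_or_eq with ht1 | rfl
    · rcases ht0.lt_or_eq with ht0 | rfl
      · refine hgh (t / (1 - t)) (div_pos ht0 (by linarith)) ?_
        rw [div_eq_inv_mul, mul_smul, ← ht', smul_smul, inv_mul_cancel₀ (by linarith), one_smul]
      · simp at ht'; exact hh ht'
    · simp at ht'; exact hg ht'.symm
  obtain ⟨φ, r, hr0, hr⟩ := geometric_hahn_banach_point_closed (convex_segment h (-g))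
    (isCompact_segment h (-g)).isClosed h0
  rw [map_zero] at hr0
  refine ⟨φ, hr0.trans (hr _ (left_mem_segment _ _ _)), ?_⟩
  have := hr _ (right_mem_segment ℝ h (-g))
  rw [map_neg] at this
  linarith

lemma eventually_triangle_segment_disjoint {ι : Type*} {l : Filter ι}
    {X Y Z F G : ι → Fin 3 → ℝ} {X₀ Y₀ Z₀ F₀ G₀ : Fin 3 → ℝ} (hX : Tendsto X l (𝓝 X₀))
    (hY : Tendsto Y l (𝓝 Y₀)) (hZ : Tendsto Z l (𝓝 Z₀)) (hF : Tendsto F l (𝓝 F₀))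
    (hG : Tendsto G l (𝓝 G₀)) (h : ∀ z ∈ segment ℝ F₀ G₀, z ∉ triangle X₀ Y₀ Z₀) :
    ∀ᶠ i in l, ∀ z ∈ segment ℝ (F i) (G i), z ∉ triangle (X i) (Y i) (Z i) := by
  have hd : Disjoint (triangle X₀ Y₀ Z₀) (segment ℝ F₀ G₀) :=
    Set.disjoint_left.2 fun z hz hz' => h z hz' hz
  obtain ⟨δ, hδ, hdis⟩ := hd.exists_thickenings (isCompact_triangle _ _ _)
    (isCompact_segment _ _).isClosed
  have h1 := Metric.self_subset_thickening hδ (triangle X₀ Y₀ Z₀)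
  have h2 := Metric.self_subset_thickening hδ (segment ℝ F₀ G₀)
  have ho1 : IsOpen (Metric.thickening δ (triangle X₀ Y₀ Z₀)) := Metric.isOpen_thickening
  have ho2 : IsOpen (Metric.thickening δ (segment ℝ F₀ G₀)) := Metric.isOpen_thickening
  filter_upwards [hX (ho1.mem_nhds (h1 (left_mem_triangle _ _ _))),
    hY (ho1.mem_nhds (h1 (segment_subset_triangle_base _ _ _ (right_mem_segment ℝ _ _)))),
    hZ (ho1.mem_nhds (h1 (segment_subset_triangle_left _ _ _ (right_mem_segment ℝ _ _)))),
    hF (ho2.mem_nhds (h2 (left_mem_segment ℝ _ _))),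
    hG (ho2.mem_nhds (h2 (right_mem_segment ℝ _ _)))] with i iX iY iZ iF iG z hz hz'
  exact Set.disjoint_left.1 hdis
    (triangle_subset_of_convex ((convex_triangle _ _ _).thickening δ) iX iY iZ hz')
    (((convex_segment _ _).thickening δ).segment_subset iF iG hz)

lemma exists_other_end {e : VertexName × VertexName} {u : VertexName} (hu : u = e.1 ∨ u = e.2) :
    ∃ w, (w = e.1 ∨ w = e.2) ∧ (e = (u, w) ∨ e = (w, u)) ∧
      ∀ pos : VertexName → Fin 3 → ℝ, HasEnds pos e (pos u) (pos w) := by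
  rcases hu with rfl | rfl
  · exact ⟨e.2, Or.inr rfl, Or.inl rfl, fun pos => Or.inl ⟨rfl, rfl⟩⟩
  · exact ⟨e.1, Or.inl rfl, Or.inr rfl, fun pos => Or.inr ⟨rfl, rfl⟩⟩

lemma HasEnds.ne {pos : VertexName → Fin 3 → ℝ} {e : VertexName × VertexName} {C X : Fin 3 → ℝ}
    (h : HasEnds pos e C X) (hnd : pos e.1 ≠ pos e.2) : X - C ≠ 0 := by
  rw [sub_ne_zero]
  rcases h with ⟨rfl, rfl⟩ | ⟨rfl, rfl⟩
  exacts [hnd.symm, hnd]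

/-- Proper meeting is stable: near a common point of the two edges both are arms of one node or
edges at one vertex, and the distance of the edges is positive elsewhere. -/
lemma Good.eventually_meetProperly (hG : Good E lab pos₀) {e f : VertexName × VertexName}
    (he : e ∈ E) (hf : f ∈ E) (hef : e ≠ f) :
    ∀ᶠ pos in 𝓝 pos₀, (∀ u w, lab u ≠ none → lab u = lab w → pos u = pos w) →
      MeetProperly lab pos e f := by
  have hc : ∀ u : VertexName, Tendsto (fun pos : VertexName → Fin 3 → ℝ => pos u) (𝓝 pos₀)
      (𝓝 (pos₀ u)) := fun u => (continuous_apply u).tendsto pos₀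
  by_cases hm : ∃ x ∈ edgeSegment pos₀ e, x ∈ edgeSegment pos₀ f
  · obtain ⟨x, hx, hx'⟩ := hm
    obtain ⟨u, w, hu, hw, rfl, hxw, huw⟩ := hG.inter e he f hf hef x hx hx'
    obtain ⟨u', -, -, hue⟩ := exists_other_end hu
    obtain ⟨w', -, -, hwe⟩ := exists_other_end hw
    have hwe0 := hwe pos₀
    rw [← hxw] at hwe0
    obtain ⟨φ, h1, h2⟩ := exists_separating_form (hwe0.ne (hG.nondeg f hf))
      ((hue pos₀).ne (hG.nondeg e he)) fun r hr => hG.not_same_direction he hf hef (hue pos₀) hwe0 hr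
    rw [hxw] at h2
    have c1 := (φ.continuous.tendsto _).comp ((hc u').sub (hc u))
    have c2 := (φ.continuous.tendsto _).comp ((hc w').sub (hc w))
    filter_upwards [c1 (lt_mem_nhds h1), c2 (gt_mem_nhds h2)] with pos p1 p2 hnp z hz hz'
    have hpuw : pos u = pos w := by
      rcases huw with rfl | ⟨h, h'⟩
      exacts [rfl, hnp u w h' h]
    rw [(hue pos).edgeSegment_eq] at hz
    rw [(hwe pos).edgeSegment_eq] at hz'
    obtain ⟨s, hs0, hs1, rfl⟩ := mem_segment_iff_exists.1 hz
    obtain ⟨t, ht0, ht1, ht⟩ := mem_segment_iff_exists.1 hz'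
    have hφ := congrArg φ ht
    rw [hpuw] at hφ
    simp only [Set.mem_preimage, Function.comp_apply, Set.mem_ofPred_eq] at p1 p2
    rw [hpuw] at p1
    simp only [map_add, map_smul, smul_eq_mul, add_right_inj] at hφ
    have hs : s = 0 := by nlinarith
    refine ⟨u, w, hu, hw, by rw [hs]; simp, by rw [hs, hpuw]; simp, huw⟩
  · push Not at hm
    have := eventually_triangle_segment_disjoint (hc e.1) (hc e.2) (hc e.2) (hc f.1) (hc f.2)
      (fun z hz hz' => hm z (triangle_subset_segment_of_mem (right_mem_segment ℝ _ _) hz') hz)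
    filter_upwards [this] with pos hp _ z hz hz'
    exact absurd (segment_subset_triangle_base _ _ _ hz) (hp z hz')

/-- Goodness is an open condition on the positions, among those for which the two passages through
each node coincide and are straight. -/
lemma Good.eventually (hG : Good E lab pos₀) (hE : E.Finite) :
    ∀ᶠ pos in 𝓝 pos₀,
      (∀ u b w, (u, b) ∈ E → (b, w) ∈ E → lab b ≠ none →
        pos b ∈ openSegment ℝ (pos u) (pos w)) →
      (∀ u w, lab u ≠ none → lab u = lab w → pos u = pos w) → Good E lab pos := by
  have h1 : ∀ᶠ pos in 𝓝 pos₀, ∀ e ∈ E, pos e.1 ≠ pos e.2 :=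
    (eventually_all_finite hE).2 fun e he =>
      (isOpen_ne_fun (continuous_apply e.1) (continuous_apply e.2)).mem_nhds (hG.nondeg e he)
  have h2 : ∀ᶠ pos in 𝓝 pos₀, ∀ e ∈ E, ∀ f ∈ E, e ≠ f →
      (∀ u w, lab u ≠ none → lab u = lab w → pos u = pos w) → MeetProperly lab pos e f := by
    refine (eventually_all_finite hE).2 fun e he => (eventually_all_finite hE).2 fun f hf => ?_
    by_cases hef : e = f
    · exact Eventually.of_forall fun _ h => absurd hef h
    · filter_upwards [hG.eventually_meetProperly he hf hef] with pos hp _ using hp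
  filter_upwards [h1, h2] with pos p1 p2 hs hn
  exact ⟨p1, fun e he f hf hef => p2 e he f hf hef hn, hs, hn⟩

/-- A thin triangle at the edge with ends `u`, `w`, with apex close to `u`, meets the edges that do
not end in `u` at most in `w`. -/
lemma Good.eventually_thin (hG : Good E lab pos₀) (hlab : ∀ u, lab u = none) (hE : E.Finite)
    {e : VertexName × VertexName} (he : e ∈ E) {u w : VertexName} (hew : e = (u, w) ∨ e = (w, u)) :
    ∀ᶠ p : (VertexName → Fin 3 → ℝ) × (Fin 3 → ℝ) in 𝓝 (pos₀, pos₀ u), ∀ f ∈ E,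
      f.1 ≠ u → f.2 ≠ u → ∀ z ∈ edgeSegment p.1 f, z ∈ triangle (p.1 u) (p.1 w) p.2 →
      z = p.1 w := by
  have hc : ∀ s : VertexName, Tendsto (fun p : (VertexName → Fin 3 → ℝ) × (Fin 3 → ℝ) => p.1 s)
      (𝓝 (pos₀, pos₀ u)) (𝓝 (pos₀ s)) := fun s =>
    ((continuous_apply s).comp continuous_fst).tendsto (pos₀, pos₀ u)
  have hc' : Tendsto (fun p : (VertexName → Fin 3 → ℝ) × (Fin 3 → ℝ) => p.2)
      (𝓝 (pos₀, pos₀ u)) (𝓝 (pos₀ u)) := continuous_snd.tendsto (pos₀, pos₀ u)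
  have hewE : ∀ pos, HasEnds pos e (pos w) (pos u) := fun pos => by
    rcases hew with rfl | rfl
    exacts [Or.inr ⟨rfl, rfl⟩, Or.inl ⟨rfl, rfl⟩]
  refine (eventually_all_finite hE).2 fun f hf => ?_
  by_cases hfu : f.1 = u ∨ f.2 = u
  · exact Eventually.of_forall fun _ h1 h2 => absurd hfu (not_or.2 ⟨h1, h2⟩)
  have hef : e ≠ f := by
    rintro rfl
    rcases hew with rfl | rfl <;> simp at hfu
  by_cases hfw : w = f.1 ∨ w = f.2
  · obtain ⟨w', -, -, hwe⟩ := exists_other_end hfw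
    obtain ⟨φ, h1, h2⟩ := exists_separating_form ((hwe pos₀).ne (hG.nondeg f hf))
      ((hewE pos₀).ne (hG.nondeg e he))
      fun r hr => hG.not_same_direction he hf hef (hewE pos₀) (hwe pos₀) hr
    have c1 := (φ.continuous.tendsto _).comp ((hc u).sub (hc w))
    have c2 := (φ.continuous.tendsto _).comp (hc'.sub (hc w))
    have c3 := (φ.continuous.tendsto _).comp ((hc w').sub (hc w))
    filter_upwards [c1 (lt_mem_nhds h1), c2 (lt_mem_nhds h1), c3 (gt_mem_nhds h2)] with p p1 p2 p3
      _ _ z hz hz'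
    rw [(hwe p.1).edgeSegment_eq] at hz
    obtain ⟨t, ht0, ht1, rfl⟩ := mem_segment_iff_exists.1 hz
    obtain ⟨r, s, hr, hs, hrs, h⟩ := hz'
    have hφ : t • (p.1 w' - p.1 w) = (1 - r - s) • (p.1 u - p.1 w) + s • (p.2 - p.1 w) := by
      calc _ = (p.1 w + t • (p.1 w' - p.1 w)) - p.1 w := by module
        _ = _ := by rw [h]; module
    have hφ' := congrArg φ hφ
    simp only [Set.mem_preimage, Function.comp_apply, Set.mem_ofPred_eq] at p1 p2 p3
    rw [map_add, map_smul, map_smul, map_smul, smul_eq_mul, smul_eq_mul, smul_eq_mul] at hφ'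
    have h3 : 0 ≤ (1 - r - s) * φ (p.1 u - p.1 w) := mul_nonneg (by linarith) p1.le
    have h4 : 0 ≤ s * φ (p.2 - p.1 w) := mul_nonneg hs p2.le
    have ht : t = 0 := by nlinarith
    rw [ht]; simp
  · have hdis : ∀ z ∈ segment ℝ (pos₀ f.1) (pos₀ f.2), z ∉ triangle (pos₀ u) (pos₀ w) (pos₀ u) := by
      intro z hz hz'
      have hz' : z ∈ edgeSegment pos₀ e := by
        rw [(hewE pos₀).edgeSegment_eq, segment_symm]
        exact triangle_subset_segment_of_mem (left_mem_segment ℝ _ _) hz'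
      obtain ⟨s, t, hs, ht, -, -, hst⟩ := hG.inter e he f hf hef z hz' hz
      rcases hst with rfl | ⟨-, h⟩
      · have : s = u ∨ s = w := by
          rcases hew with rfl | rfl
          exacts [hs, hs.symm]
        rcases this with rfl | rfl
        · exact hfu (ht.imp Eq.symm Eq.symm)
        · exact hfw ht
      · exact h (hlab s)
    filter_upwards [eventually_triangle_segment_disjoint (hc u) (hc w) hc' (hc f.1) (hc f.2) hdis]
      with p hp _ _ z hz hz'
    exact absurd hz' (hp z hz)

end Openness

section LocallyConstant

variable {n : ℕ} {T T' : Fin n → List VertexName} {lab : VertexName → Option ℕ}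
  {pos pos₀ : VertexName → Fin 3 → ℝ} {R : Type*} [CommRing R] {v : EmbeddedGraph n → R}
  {s u d w : VertexName}

/-- Rename the vertex `u` to `d`. -/
def renameVertex (T : Fin n → List VertexName) (u d : VertexName) : Fin n → List VertexName :=
  fun i => (T i).map (Equiv.swap u d)

lemma Shape.renameVertex (hT : Shape T lab) (hd : ∀ i, d ∉ T i) (hu : lab u = none) :
    Shape (renameVertex T u d) lab := by
  have hfix : ∀ x, lab x ≠ none → Equiv.swap u d x = x := fun x hx =>
    Equiv.swap_apply_of_ne_of_ne (fun h => hx (h ▸ hu)) (fun h => hx (h ▸ hT.lab_fresh hd))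
  refine ⟨fun i => by simp [_root_.renameVertex, hT.ne_nil i],
    fun i => (hT.nodup i).map (Equiv.swap u d).injective, fun i j x hi hj => ?_, fun x hx => ?_,
    hT.two⟩
  · obtain ⟨y, hy, rfl⟩ := List.mem_map.1 hi
    obtain ⟨y', hy', h⟩ := List.mem_map.1 hj
    obtain rfl := (Equiv.swap u d).injective h
    exact hT.disj i j _ hy hy'
  · obtain ⟨i, hi⟩ := hT.supp x hx
    exact ⟨i, List.mem_map.2 ⟨x, hi, hfix x hx⟩⟩

lemma diagram_renameVertex (hd : ∀ i, d ∉ T i) (hud : lab u = lab d) :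
    diagram (renameVertex T u d) lab pos = diagram T lab (Function.update pos u (pos d)) := by
  funext i
  simp only [diagram, renameVertex, List.map_map]
  refine List.map_congr_left fun x hx => ?_
  by_cases hxu : x = u
  · subst hxu
    simp [hud]
  · have : Equiv.swap u d x = x := Equiv.swap_apply_of_ne_of_ne hxu fun h => hd i (h ▸ hx)
    simp [this, Function.update_of_ne hxu]

/-- The edges after renaming the middle vertex `u` of `s u w`. -/
lemma edge_of_renameVertex (hT : Shape T lab) (hsu : (s, u) ∈ edgeSet T) (huw : (u, w) ∈ edgeSet T)
    (hs : s ≠ u) (hw : w ≠ u) (hd : ∀ i, d ∉ T i) {f : VertexName × VertexName}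
    (hf : f ∈ edgeSet (renameVertex T u d)) :
    f = (s, d) ∨ f = (d, w) ∨ (f ∈ edgeSet T ∧ f.1 ≠ u ∧ f.2 ≠ u) := by
  obtain ⟨i, hi⟩ := hf
  rw [renameVertex, cyclicPairs_map] at hi
  obtain ⟨g, hg, rfl⟩ := List.mem_map.1 hi
  have hgT : g ∈ edgeSet T := ⟨i, hg⟩
  have hfix : ∀ x, (∃ i, x ∈ T i) → x ≠ u → Equiv.swap u d x = x := fun x ⟨j, hj⟩ hx =>
    Equiv.swap_apply_of_ne_of_ne hx fun h => hd j (h ▸ hj)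
  obtain ⟨g1, g2⟩ := g
  have m1 := fst_mem_of_mem_edgeSet hgT
  have m2 := snd_mem_of_mem_edgeSet hgT
  by_cases h1 : g1 = u
  · subst h1
    obtain rfl := hT.next_eq hgT huw
    right; left
    simp [hfix g2 m2 hw]
  by_cases h2 : g2 = u
  · subst h2
    obtain rfl := hT.prev_eq hgT hsu
    left
    simp [hfix g1 m1 hs]
  · right; right
    simp only [Prod.map_apply, hfix g1 m1 h1, hfix g2 m2 h2]
    exact ⟨hgT, h1, h2⟩

/-- The strand `s u w` may be changed to `s d w` by way of `s u d w`. -/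
lemma exists_slide (hT : Shape T lab) (hsu : (s, u) ∈ edgeSet T) (huw : (u, w) ∈ edgeSet T)
    (hs : s ≠ u) (hsw : s ≠ w) (hd : ∀ i, d ∉ T i) :
    ∃ T₂, IsInsertion 1 T T₂ u d w ∧ IsInsertion 1 (renameVertex T u d) T₂ s u d := by
  obtain ⟨i, hi⟩ := hsu
  obtain ⟨j, hj⟩ := huw
  obtain rfl := hT.disj i j u (snd_mem_of_mem_cyclicPairs hi) (fst_mem_of_mem_cyclicPairs hj)
  obtain ⟨t, ht⟩ := exists_isRotated_cons_cons_cons (hT.nodup i) hs hsw hi hj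
  have hn := ht.nodup_iff.1 (hT.nodup i)
  have hfix : ∀ x ∈ T i, x ≠ u → Equiv.swap u d x = x := fun x hx hxu =>
    Equiv.swap_apply_of_ne_of_ne hxu fun h => hd i (h ▸ hx)
  have hmem : ∀ x ∈ s :: u :: w :: t, x ∈ T i := fun x hx => ht.mem_iff.2 hx
  simp only [List.nodup_cons, List.mem_cons, not_or] at hn
  have hwu : w ≠ u := fun h => hn.2.1.1 h.symm
  have ht' : renameVertex T u d i ~r (s :: d :: w :: t) := by
    have := ht.map (Equiv.swap u d)
    have hmt : t.map (Equiv.swap u d) = t := by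
      conv_rhs => rw [← List.map_id t]
      refine List.map_congr_left fun x hx => hfix x (hmem x (by simp [hx])) ?_
      rintro rfl
      exact hn.2.1.2 hx
    simpa [renameVertex, hfix s (hmem s (by simp)) hs, hfix w (hmem w (by simp)) hwu, hmt] using this
  refine ⟨Function.update T i (s :: u :: d :: w :: t), ⟨i, t ++ [s], ?_, ?_, fun k hk => ?_⟩,
    ⟨i, w :: t, ht', by simp [List.IsRotated.refl], fun k hk => ?_⟩⟩
  · exact ht.trans (List.isRotated_append (l := [s]) (l' := u :: w :: t))
  · simpa using List.isRotated_append (l := [s]) (l' := u :: d :: w :: t)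
  · simp [hk, List.IsRotated.refl]
  · have : (T k).map (Equiv.swap u d) = T k := by
      conv_rhs => rw [← List.map_id (T k)]
      refine List.map_congr_left fun x hx => Equiv.swap_apply_of_ne_of_ne ?_ fun h => hd k (h ▸ hx)
      rintro rfl
      exact hk (hT.disj k i x hx (hmem x (by simp)))
    simp [hk, renameVertex, this, List.IsRotated.refl]

/-- Any two vectors lie in a plane through `0`. -/
lemma exists_form_vanishing (x y : Fin 3 → ℝ) :
    ∃ ψ : (Fin 3 → ℝ) →L[ℝ] ℝ, ψ ≠ 0 ∧ ψ x = 0 ∧ ψ y = 0 := by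
  have hlt : Submodule.span ℝ ({x, y} : Set (Fin 3 → ℝ)) < ⊤ := by
    refine lt_top_iff_ne_top.2 fun h => ?_
    classical
    have h1 := finrank_span_finset_le_card (R := ℝ) ({x, y} : Finset (Fin 3 → ℝ))
    rw [Finset.coe_pair, Set.finrank, h, finrank_top, Module.finrank_fin_fun] at h1
    have h2 := Finset.card_le_two (a := x) (b := y)
    omega
  obtain ⟨f, hf, hle⟩ := Submodule.exists_le_ker_of_lt_top _ hlt
  refine ⟨LinearMap.toContinuousLinearMap f, fun h => hf ?_, ?_, ?_⟩
  · ext1 i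
    exact LinearMap.ext fun z => by
      have := congrArg (fun g : (Fin 3 → ℝ) →L[ℝ] ℝ => g (Pi.single i z)) h
      simpa using this
  · exact hle (Submodule.subset_span (by simp))
  · exact hle (Submodule.subset_span (by simp))

/-- Moving one vertex of a link slightly, off the plane of its neighbours. -/
lemma Good.eventually_slide (hv : IsVassilievInvariant v) (hT : Shape T lab)
    (hlab : ∀ u, lab u = none) (hG : Good (edgeSet T) lab pos₀) (hsu : (s, u) ∈ edgeSet T)
    (huw : (u, w) ∈ edgeSet T) :
    ∀ᶠ p : (VertexName → Fin 3 → ℝ) × (Fin 3 → ℝ) in 𝓝 (pos₀, pos₀ u),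
      ∀ ψ : (Fin 3 → ℝ) →L[ℝ] ℝ, ψ (p.1 s - p.1 u) = 0 → ψ (p.1 w - p.1 u) = 0 →
        ψ (p.2 - p.1 u) ≠ 0 →
        valueOf v (diagram T lab p.1) = valueOf v (diagram T lab (Function.update p.1 u p.2)) := by
  have hE := edgeSet_finite T
  have hsu' : s ≠ u := fun h => hG.nondeg _ hsu (by simp [h])
  have hwu : w ≠ u := fun h => hG.nondeg _ huw (by simp [h])
  have hsw : s ≠ w := hG.prev_ne_next hsu huw
  have hev : ∀ᶠ pos in 𝓝 pos₀, Good (edgeSet T) lab pos := by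
    filter_upwards [hG.eventually hE] with pos hp
    exact hp (fun u b w _ _ h => absurd (hlab b) h) (fun u w h _ => absurd (hlab u) h)
  have hc1 : Tendsto (fun p : (VertexName → Fin 3 → ℝ) × (Fin 3 → ℝ) => p.1)
      (𝓝 (pos₀, pos₀ u)) (𝓝 pos₀) := continuous_fst.tendsto (pos₀, pos₀ u)
  have hc2 : Tendsto (fun p : (VertexName → Fin 3 → ℝ) × (Fin 3 → ℝ) => Function.update p.1 u p.2)
      (𝓝 (pos₀, pos₀ u)) (𝓝 pos₀) := by
    have : Continuous fun p : (VertexName → Fin 3 → ℝ) × (Fin 3 → ℝ) =>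
        Function.update p.1 u p.2 := continuous_fst.update u continuous_snd
    simpa using this.tendsto (pos₀, pos₀ u)
  obtain ⟨d, hd, -⟩ := exists_fresh T ∅
  have huT := snd_mem_of_mem_edgeSet hsu
  have hdT : ∀ x, (∃ i, x ∈ T i) → x ≠ d := fun x ⟨i, hi⟩ h => hd i (h ▸ hi)
  have hud := hdT u huT
  obtain ⟨T₂, h₂, h₁⟩ := exists_slide hT hsu huw hsu' hsw hd
  filter_upwards [hc1.eventually hev, hc2.eventually hev,
    hG.eventually_thin hlab hE huw (Or.inl rfl), hG.eventually_thin hlab hE hsu (Or.inr rfl)]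
    with p hG1 hG2 ht1 ht2 ψ hψs hψw hψd
  obtain ⟨pos, D⟩ := p
  simp only at *
  set ps := Function.update pos d D with hps
  have hk : ∀ x, x ≠ d → ps x = pos x := fun x hx => by rw [hps, Function.update_of_ne hx]
  have hdk : ps d = D := Function.update_self ..
  have hkT : ∀ x, (∃ i, x ∈ T i) → ps x = pos x := fun x hx => hk x (hdT x hx)
  have hsk := hkT s (fst_mem_of_mem_edgeSet hsu)
  have huk := hkT u huT
  have hwk := hkT w (snd_mem_of_mem_edgeSet huw)
  have hseg : ∀ f ∈ edgeSet T, edgeSegment ps f = edgeSegment pos f := fun f hf => by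
    rw [edgeSegment, hkT _ (fst_mem_of_mem_edgeSet hf), hkT _ (snd_mem_of_mem_edgeSet hf)]
  have hGs : Good (edgeSet T) lab ps := hG1.congr
    (fun e he => ⟨hkT _ (fst_mem_of_mem_edgeSet he), hkT _ (snd_mem_of_mem_edgeSet he)⟩)
    (fun x hx => absurd (hlab x) hx)
  have hψ : ∀ x y α β : ℝ, x • (pos s - pos u) + y • (pos w - pos u) =
      α • (pos s - pos u) + β • (D - pos u) → β = 0 := by
    intro x y α β h
    have := congrArg ψ h
    simp only [map_add, map_smul, hψs, hψw, mul_zero, add_zero, zero_add, smul_eq_mul] at this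
    exact (mul_eq_zero.1 this.symm).resolve_right hψd
  have hψ' : ∀ x α β : ℝ, x • (pos s - pos u) =
      α • (pos w - pos u) + β • (D - pos u) → β = 0 := by
    intro x α β h
    have := congrArg ψ h
    simp only [map_add, map_smul, hψs, hψw, mul_zero, zero_add, smul_eq_mul] at this
    exact (mul_eq_zero.1 this.symm).resolve_right hψd
  have hWU : pos w - pos u ≠ 0 := sub_ne_zero.2 (hG1.nondeg _ huw).symm
  have hSU : pos s - pos u ≠ 0 := sub_ne_zero.2 (hG1.nondeg _ hsu)
  -- from `s u w` to `s u d w`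
  have e1 := (hv.insert_apex hT h₂ hd hGs (hlab u) (hlab w) (by
    rw [huk, hwk, hdk, LinearIndependent.pair_iff]
    intro α β h
    have hβ : β = 0 := hψ' 0 α β (by rw [h, zero_smul])
    subst hβ
    rw [zero_smul, add_zero, smul_eq_zero] at h
    exact ⟨h.resolve_right hWU, rfl⟩) (by
    intro f hf hfu z hz hzt
    rw [huk, hwk] at hzt ⊢
    rw [hdk] at hzt
    rw [hseg f hf] at hz
    by_cases hf2 : f.2 = u
    · obtain ⟨f1, f2⟩ := f
      simp only at hf2
      subst hf2
      obtain rfl := hT.prev_eq hf hsu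
      obtain ⟨α, β, hα, hβ, hαβ, rfl⟩ := hzt
      rw [edgeSegment, segment_symm] at hz
      obtain ⟨t, ht0, ht1, ht⟩ := mem_segment_iff_exists.1 hz
      rw [add_assoc, add_right_inj] at ht
      have hβ0 := hψ' t α β ht.symm
      exact mem_segment_iff_exists.2 ⟨α, hα, by linarith, by simp [hβ0]⟩
    · have hf1 : f.1 ≠ u := by
        rintro h1
        obtain ⟨f1, f2⟩ := f
        simp only at h1
        subst h1
        exact hfu (by rw [hT.next_eq hf huw])
      rw [ht1 f hf hf1 hf2 z hz hzt]
      exact right_mem_segment _ _ _)).2.2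
  -- from `s d w` to `s u d w`
  have hT₁ := hT.renameVertex hd (hlab u)
  have hdiag : diagram (renameVertex T u d) lab ps = diagram T lab (Function.update pos u D) := by
    rw [diagram_renameVertex hd ((hlab u).trans (hlab d).symm), hdk]
    refine diagram_congr fun x hx => ?_
    by_cases hxu : x = u
    · subst hxu; simp
    · rw [Function.update_of_ne hxu, Function.update_of_ne hxu, hkT x hx]
  have hG₁ : Good (edgeSet (renameVertex T u d)) lab ps := by
    obtain ⟨G, hGc⟩ := exists_embeddedGraph hT hG2
    exact good_of_embeddedGraph hT₁ G (hGc.trans hdiag.symm)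
  have huT₁ : ∀ i, u ∉ renameVertex T u d i := by
    intro i hi
    obtain ⟨x, hx, h⟩ := List.mem_map.1 hi
    rw [Equiv.swap_apply_eq_iff, Equiv.swap_apply_left] at h
    exact hd i (h ▸ hx)
  have e2 := (hv.insert_apex hT₁ h₁ huT₁ hG₁ (hlab s) (hlab d) (by
    rw [huk, hsk, hdk, LinearIndependent.pair_iff]
    intro α β h
    have hα : α = 0 := hψ 0 0 (-α - β) α (by
      rw [zero_smul, zero_smul, add_zero, ← h]; module)
    subst hα
    rw [zero_smul, zero_add, smul_eq_zero] at h
    exact ⟨rfl, h.resolve_right (by rw [← neg_sub]; exact neg_ne_zero.2 hSU)⟩) (by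
    intro f hf hfs z hz hzt
    rw [huk, hsk, hdk] at hzt
    rw [hsk, hdk]
    rcases edge_of_renameVertex hT hsu huw hsu' hwu hd hf with rfl | rfl | ⟨hf, hf1, hf2⟩
    · exact absurd rfl hfs
    · simp only [edgeSegment, hdk, hwk] at hz
      obtain ⟨t, ht0, ht1, rfl⟩ := mem_segment_iff_exists.1 hz
      obtain ⟨α, β, hα, hβ, hαβ, h⟩ := hzt
      have h' : (1 - α - β) • (pos s - pos u) + (α - (1 - t)) • (D - pos u) =
          t • (pos w - pos u) := by
        have : (1 - t) • (D - pos u) + t • (pos w - pos u) =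
            (1 - α - β) • (pos s - pos u) + α • (D - pos u) := by
          calc _ = D + t • (pos w - D) - pos u := by module
            _ = _ := by rw [h]; module
        rw [← sub_eq_zero] at this ⊢
        rw [← neg_eq_zero, ← this]; module
      have h0 := hψ 0 t (1 - α - β) (α - (1 - t)) (by rw [h', zero_smul, zero_add])
      have hα' : α = 1 - t := by linarith
      rw [h0, zero_smul, add_zero] at h'
      rcases ht0.lt_or_eq with ht0 | rfl
      · exfalso
        have hwp : pos w - pos u = (t⁻¹ * (1 - α - β)) • (pos s - pos u) := by
          rw [mul_smul, h', smul_smul, inv_mul_cancel₀ ht0.ne', one_smul]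
        rcases (show 0 ≤ 1 - α - β by linarith).lt_or_eq with hp | hp
        · refine hG1.not_same_direction huw hsu ?_ (Or.inl ⟨rfl, rfl⟩) (Or.inr ⟨rfl, rfl⟩)
            (mul_pos (inv_pos.2 ht0) hp) hwp
          intro h
          simp only [Prod.mk.injEq] at h
          exact hsu' h.1.symm
        · rw [← hp, mul_zero, zero_smul] at hwp
          exact hWU hwp
      · simpa using right_mem_segment ℝ (pos s) D
    · rw [hseg f hf] at hz
      have hzt' : z ∈ triangle (pos u) (pos s) D := by
        rw [triangle_swap (pos u), triangle_comm]; exact hzt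
      rw [ht2 f hf hf1 hf2 z hz hzt']
      exact left_mem_segment _ _ _)).2.2
  rw [diagram_congr (fun x hx => (hkT x hx).symm), e1, ← e2, hdiag]

end LocallyConstant

section LocallyConstantGraph

variable {n : ℕ} {R : Type*} [CommRing R] {v : EmbeddedGraph n → R}

/-- An embedded link has a neighbourhood within which moving a single vertex does not change the
value. -/
lemma Good.exists_nhds_move {T : Fin n → List VertexName} {lab : VertexName → Option ℕ}
    {pos₀ : VertexName → Fin 3 → ℝ} (hv : IsVassilievInvariant v) (hT : Shape T lab)
    (hlab : ∀ u, lab u = none) (hG : Good (edgeSet T) lab pos₀) (u : VertexName) :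
    ∃ A ∈ 𝓝 pos₀, ∀ pos ∈ A, ∀ P, Function.update pos u P ∈ A →
      valueOf v (diagram T lab pos) = valueOf v (diagram T lab (Function.update pos u P)) := by
  by_cases hu : ∃ i, u ∈ T i
  swap
  · refine ⟨Set.univ, univ_mem, fun pos _ P _ => congrArg _ (diagram_congr fun x hx => ?_)⟩
    rw [Function.update_of_ne]
    rintro rfl
    exact hu hx
  obtain ⟨s, hs⟩ := exists_prev_edge hu
  obtain ⟨w, hw⟩ := exists_next_edge hu
  obtain ⟨A, hA, B, hB, hAB⟩ := mem_nhds_prod_iff.1 (hG.eventually_slide hv hT hlab hs hw)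
  refine ⟨A, hA, fun pos hpos P hP => ?_⟩
  have hsu : s ≠ u := fun h => hG.nondeg _ hs (by simp [h])
  have hwu : w ≠ u := fun h => hG.nondeg _ hw (by simp [h])
  obtain ⟨ψ₁, h1, h1s, h1w⟩ := exists_form_vanishing (pos s - pos u) (pos w - pos u)
  obtain ⟨ψ₂, h2, h2s, h2w⟩ := exists_form_vanishing (pos s - P) (pos w - P)
  obtain ⟨D, hD, hDF⟩ := exists_mem_nhds_avoiding
    (F := {((ψ₁, ψ₁ (pos u)) : ((Fin 3 → ℝ) →L[ℝ] ℝ) × ℝ), (ψ₂, ψ₂ P)}) (by simp)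
    (by rintro p (rfl | rfl); exacts [h1, h2]) hB
  have e1 := hAB (show (pos, D) ∈ A ×ˢ B from ⟨hpos, hD⟩) ψ₁ h1s h1w (by
    rw [map_sub, sub_ne_zero]; exact hDF _ (Or.inl rfl))
  have e2 := hAB (show (Function.update pos u P, D) ∈ A ×ˢ B from ⟨hP, hD⟩) ψ₂
    (by simpa [Function.update_of_ne hsu] using h2s)
    (by simpa [Function.update_of_ne hwu] using h2w) (by
    simp only [Function.update_self, map_sub, sub_ne_zero]; exact hDF _ (Or.inr rfl))
  rw [e1, e2, Function.update_idem]

/-- The value of a Vassiliev invariant does not change if the vertices of a link are moved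
slightly. -/
lemma Good.eventually_valueOf_link {T : Fin n → List VertexName} {lab : VertexName → Option ℕ}
    {pos₀ : VertexName → Fin 3 → ℝ} (hv : IsVassilievInvariant v) (hT : Shape T lab)
    (hlab : ∀ u, lab u = none) (hG : Good (edgeSet T) lab pos₀) :
    ∀ᶠ pos in 𝓝 pos₀, valueOf v (diagram T lab pos) = valueOf v (diagram T lab pos₀) := by
  classical
  choose A hA hmove using hG.exists_nhds_move hv hT hlab
  set N := (nameList T).toFinset with hN
  have hAN : (⋂ u ∈ N, A u) ∈ 𝓝 pos₀ := (biInter_finset_mem N).2 fun u _ => hA u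
  rw [nhds_pi, Filter.mem_pi] at hAN
  obtain ⟨I, hI, t, ht, hsub⟩ := hAN
  filter_upwards [set_pi_mem_nhds hI fun i _ => ht i] with pos hpos
  -- the vertices are moved one at a time
  have key : ∀ S : Finset VertexName, S ⊆ N → valueOf v (diagram T lab pos) =
      valueOf v (diagram T lab fun u => if u ∈ S then pos₀ u else pos u) := by
    intro S
    induction S using Finset.induction_on with
    | empty => intro _; simp
    | insert u S huS ih =>
      intro hS
      have huN := hS (Finset.mem_insert_self u S)
      have hbox : ∀ S : Finset VertexName,
          (fun u => if u ∈ S then pos₀ u else pos u) ∈ ⋂ u ∈ N, A u := by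
        refine fun S => hsub fun x hx => ?_
        simp only
        split
        exacts [mem_of_mem_nhds (ht x), hpos x hx]
      have hupd : Function.update (fun x => if x ∈ S then pos₀ x else pos x) u (pos₀ u) =
          fun x => if x ∈ Insert.insert u S then pos₀ x else pos x := by
        funext x
        by_cases hxu : x = u
        · subst hxu; simp
        · simp [hxu]
      rw [ih fun x hx => hS (Finset.mem_insert_of_mem hx), ← hupd]
      refine hmove u _ (Set.mem_iInter₂.1 (hbox S) u huN) _ ?_
      rw [hupd]
      exact Set.mem_iInter₂.1 (hbox _) u huN
  rw [key N subset_rfl]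
  refine congrArg _ (diagram_congr fun u hu => ?_)
  simp [hN, mem_nameList.2 hu]

/-- The value of a Vassiliev invariant does not change if the vertices of an embedded graph are
moved slightly, provided that the strands still pass straight through the nodes. -/
theorem Good.eventually_valueOf (hv : IsVassilievInvariant v) (m : ℕ) :
    ∀ {T : Fin n → List VertexName} {lab : VertexName → Option ℕ}
      {pos₀ : VertexName → Fin 3 → ℝ}, {l | ∃ u, lab u = some l}.ncard = m → Shape T lab →
      Good (edgeSet T) lab pos₀ → ∀ᶠ pos in 𝓝 pos₀,
      (∀ u b w, (u, b) ∈ edgeSet T → (b, w) ∈ edgeSet T → lab b ≠ none →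
        pos b ∈ openSegment ℝ (pos u) (pos w)) →
      (∀ u w, lab u ≠ none → lab u = lab w → pos u = pos w) →
      Good (edgeSet T) lab pos ∧
        valueOf v (diagram T lab pos) = valueOf v (diagram T lab pos₀) := by
  induction m with
  | zero =>
    intro T lab pos₀ hm hT hG
    have hlab : ∀ u, lab u = none := by
      intro u
      by_contra h
      obtain ⟨a, ha⟩ := Option.ne_none_iff_exists'.1 h
      rw [Set.ncard_eq_zero (labels_finite hT)] at hm
      exact Set.eq_empty_iff_forall_notMem.1 hm a ⟨u, ha⟩
    filter_upwards [hG.eventually (edgeSet_finite T), hG.eventually_valueOf_link hv hT hlab]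
      with pos h1 h2 h3 h4
    exact ⟨h1 h3 h4, h2⟩
  | succ m ih =>
    intro T lab pos₀ hm hT hG
    obtain ⟨a, b, hb⟩ : {l | ∃ u, lab u = some l}.Nonempty := by
      rw [← Set.ncard_pos (labels_finite hT)]; omega
    have hbn : lab b ≠ none := by simp [hb]
    obtain ⟨b', hne, hbb, -⟩ := hT.two b hbn
    have hb' : lab b' = some a := hbb.trans hb
    obtain ⟨p, hp⟩ := exists_prev_edge (hT.supp b hbn)
    obtain ⟨q, hq⟩ := exists_next_edge (hT.supp b hbn)
    obtain ⟨p', hp'⟩ := exists_prev_edge (hT.supp b' (by simp [hb']))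
    obtain ⟨q', hq'⟩ := exists_next_edge (hT.supp b' (by simp [hb']))
    obtain ⟨x, hx, -⟩ := exists_fresh T ∅
    obtain ⟨y, hy, hyx⟩ := exists_fresh T {x}
    rw [Finset.mem_singleton] at hyx
    obtain ⟨T₂, h₂⟩ := exists_isBypass (hT.supp b hbn) x y
    obtain ⟨e, he⟩ := exists_det_pos
      (hG.linearIndependent_strands hbn hbb.symm hne.symm hp hq hp' hq')
    have hxT : ∀ s, (∃ i, s ∈ T i) → s ≠ x := fun s ⟨i, hi⟩ h => hx i (h ▸ hi)
    have hyT : ∀ s, (∃ i, s ∈ T i) → s ≠ y := fun s ⟨i, hi⟩ h => hy i (h ▸ hi)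
    have hbT := hT.supp b hbn
    -- A single size `τ` of the resolution serves all positions near `pos₀`, so that the resolved
    -- graphs depend continuously on the positions.
    have hτ : ∀ e : Fin 3 → ℝ, ∀ᶠ τ in 𝓝[>] (0 : ℝ), ∀ f ∈ edgeSet T, pos₀ b ∉ edgeSegment pos₀ f →
        ∀ z ∈ edgeSegment pos₀ f, z ∉ triangle (pos₀ b + τ • (pos₀ p - pos₀ b))
          (pos₀ b + τ • (pos₀ q - pos₀ b)) (pos₀ b + τ • e) := by
      intro e
      refine (eventually_all_finite (edgeSet_finite T)).2 fun f hf => ?_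
      by_cases hbf : pos₀ b ∈ edgeSegment pos₀ f
      · exact Eventually.of_forall fun _ h => absurd hbf h
      · filter_upwards [eventually_triangle_disjoint (tendsto_add_smul (pos₀ b) (pos₀ p - pos₀ b))
          (tendsto_add_smul (pos₀ b) (pos₀ q - pos₀ b)) (tendsto_add_smul (pos₀ b) e)
          (isCompact_segment _ _).isClosed hbf] with τ h _ using h
    have hτ1 : ∀ᶠ τ in 𝓝[>] (0 : ℝ), 0 < τ ∧ τ < 1 := Ioo_mem_nhdsGT one_pos
    obtain ⟨τ, ⟨hτ0, hτ1⟩, hdis, hdis'⟩ := (hτ1.and ((hτ e).and (hτ (-e)))).exists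
    let X : (VertexName → Fin 3 → ℝ) → VertexName → Fin 3 → ℝ := fun pos =>
      Function.update (Function.update pos x (pos b + τ • (pos p - pos b)))
        y (pos b + τ • (pos q - pos b))
    have hXT : ∀ pos s, (∃ i, s ∈ T i) → X pos s = pos s := fun pos s hs => by
      simp only [X]
      rw [Function.update_of_ne (hyT s hs), Function.update_of_ne (hxT s hs)]
    have hXx : ∀ pos, X pos x = pos b + τ • (pos p - pos b) := fun pos => by
      simp only [X]
      rw [Function.update_of_ne (Ne.symm hyx), Function.update_self]
    have hXy : ∀ pos, X pos y = pos b + τ • (pos q - pos b) := fun pos => Function.update_self ..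
    have hpT := fst_mem_of_mem_edgeSet hp
    have hqT := snd_mem_of_mem_edgeSet hq
    have hpT' := fst_mem_of_mem_edgeSet hp'
    have hqT' := snd_mem_of_mem_edgeSet hq'
    -- the exchange identity at any good position for which the triangles of size `τ` are free
    have key : ∀ pos, Good (edgeSet T) lab pos →
        0 < Matrix.det (Matrix.of ![pos q - pos p, pos q' - pos p', e]) →
        (∀ e' : Fin 3 → ℝ, e' = e ∨ e' = -e → ∀ f ∈ edgeSet T, pos b ∉ edgeSegment pos f →
          ∀ z ∈ edgeSegment pos f, z ∉ triangle (pos b + τ • (pos p - pos b))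
            (pos b + τ • (pos q - pos b)) (pos b + τ • e')) →
        Shape T₂ (eraseLabel a lab) ∧
        Good (edgeSet T₂) (eraseLabel a lab) (Function.update (X pos) b (pos b + τ • e)) ∧
        Good (edgeSet T₂) (eraseLabel a lab) (Function.update (X pos) b (pos b + τ • (-e))) ∧
        valueOf v (diagram T lab pos) =
          valueOf v (diagram T₂ (eraseLabel a lab) (Function.update (X pos) b (pos b + τ • e))) -
          valueOf v (diagram T₂ (eraseLabel a lab)
            (Function.update (X pos) b (pos b + τ • (-e)))) := by
      intro pos hGp hdet hd
      obtain ⟨l, hl0, hl1, hl⟩ := mem_openSegment_iff_exists.1 (hGp.straight p b q hp hq hbn)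
      have htri : ∀ e' : Fin 3 → ℝ, e' = e ∨ e' = -e → ∀ f ∈ edgeSet T, ∀ z ∈ edgeSegment pos f,
          z ∈ triangle (pos b + τ • (pos p - pos b)) (pos b + τ • (pos q - pos b))
            (pos b + τ • e') →
          z ∈ segment ℝ (pos b + τ • (pos p - pos b)) (pos b + τ • (pos q - pos b)) := by
        intro e' he'
        refine hGp.triangle_inter_subset hT hbn hbb.symm hne.symm hp hq hp' hq'
          (r := -(τ * l)) (s := τ * (1 - l)) (by rw [hl]; module) (by rw [hl]; module) ?_ (hd e' he')
        have h1 : Matrix.det (Matrix.of ![pos q - pos p, pos q' - pos p',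
            pos b + τ • e' - pos b]) =
            τ * Matrix.det (Matrix.of ![pos q - pos p, pos q' - pos p', e']) := by
          have := det_smul_smul (d := pos q - pos p) (d' := pos q' - pos p') (e := e') (r := 1)
            (s := 1) (t := τ)
          simpa using this
        rw [h1]
        refine mul_ne_zero hτ0.ne' ?_
        rcases he' with rfl | rfl
        · exact hdet.ne'
        · have := det_smul_smul (d := pos q - pos p) (d' := pos q' - pos p') (e := e) (r := 1)
            (s := 1) (t := -1)
          simp only [one_smul, neg_smul] at this
          rw [this]
          intro h0; linarith
      have hseg : ∀ f ∈ edgeSet T, edgeSegment (X pos) f = edgeSegment pos f := fun f hf => by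
        rw [edgeSegment, hXT _ _ (fst_mem_of_mem_edgeSet hf), hXT _ _ (snd_mem_of_mem_edgeSet hf)]
      have hGX : Good (edgeSet T) lab (X pos) := hGp.congr
        (fun e he => ⟨hXT _ _ (fst_mem_of_mem_edgeSet he), hXT _ _ (snd_mem_of_mem_edgeSet he)⟩)
        (fun s hs => hXT _ s (hT.supp s hs))
      have hbX := hXT pos b hbT
      have := hv.exchange_of_triangle hGX hT hb hb' hp hq hp' hq' h₂ hx hy (Ne.symm hyx) hτ0 hτ1
        (by rw [hXx, hbX, hXT _ p hpT]) (by rw [hXy, hbX, hXT _ q hqT]) (e := e)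
        (by rwa [hXT _ p hpT, hXT _ q hqT, hXT _ p' hpT', hXT _ q' hqT'])
        (fun f hf z hz hzt => by
          rw [hseg f hf] at hz
          rw [hXx, hXy, hbX] at hzt
          rw [hXx, hXy]
          exact htri e (Or.inl rfl) f hf z hz hzt)
        (fun f hf z hz hzt => by
          rw [hseg f hf] at hz
          rw [hXx, hXy, hbX] at hzt
          rw [hXx, hXy]
          exact htri (-e) (Or.inr rfl) f hf z hz hzt)
      rw [hbX, diagram_congr fun s hs => hXT pos s hs] at this
      exact this
    obtain ⟨hT₂, hGp₀, hGm₀, hval₀⟩ := key pos₀ hG he (by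
      rintro e' (rfl | rfl)
      exacts [hdis, hdis'])
    have hcard : {l | ∃ u, eraseLabel a lab u = some l}.ncard = m := by
      rw [setOf_eraseLabel, Set.ncard_sdiff_singleton_of_mem
        (show a ∈ {l | ∃ u, lab u = some l} from ⟨b, hb⟩), hm]
      rfl
    have hc : ∀ s : VertexName, Continuous (fun pos : VertexName → Fin 3 → ℝ => pos s) :=
      continuous_apply
    have hXc : ∀ e' : Fin 3 → ℝ, Continuous fun pos : VertexName → Fin 3 → ℝ =>
        Function.update (X pos) b (pos b + τ • e') := fun e' =>
      ((continuous_id.update x ((hc b).add (((hc p).sub (hc b)).const_smul τ))).update y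
        ((hc b).add (((hc q).sub (hc b)).const_smul τ))).update b ((hc b).add continuous_const)
    have hdisj : ∀ e' : Fin 3 → ℝ, e' = e ∨ e' = -e → ∀ᶠ pos in 𝓝 pos₀, ∀ f ∈ edgeSet T,
        pos₀ b ∉ edgeSegment pos₀ f → ∀ z ∈ edgeSegment pos f,
        z ∉ triangle (pos b + τ • (pos p - pos b)) (pos b + τ • (pos q - pos b)) (pos b + τ • e') := by
      intro e' he'
      refine (eventually_all_finite (edgeSet_finite T)).2 fun f hf => ?_
      by_cases hbf : pos₀ b ∈ edgeSegment pos₀ f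
      · exact Eventually.of_forall fun _ h => absurd hbf h
      have hd0 : ∀ z ∈ segment ℝ (pos₀ f.1) (pos₀ f.2), z ∉ triangle
          (pos₀ b + τ • (pos₀ p - pos₀ b)) (pos₀ b + τ • (pos₀ q - pos₀ b)) (pos₀ b + τ • e') := by
        rcases he' with rfl | rfl
        exacts [hdis f hf hbf, hdis' f hf hbf]
      filter_upwards [eventually_triangle_segment_disjoint
        (((hc b).add (((hc p).sub (hc b)).const_smul τ)).tendsto pos₀)
        (((hc b).add (((hc q).sub (hc b)).const_smul τ)).tendsto pos₀)
        (((hc b).add continuous_const).tendsto pos₀) ((hc f.1).tendsto pos₀)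
        ((hc f.2).tendsto pos₀) hd0] with pos h _ using h
    have hdetc : ∀ᶠ pos in 𝓝 pos₀,
        0 < Matrix.det (Matrix.of ![pos q - pos p, pos q' - pos p', e]) := by
      have : Continuous fun pos : VertexName → Fin 3 → ℝ =>
          Matrix.det (Matrix.of ![pos q - pos p, pos q' - pos p', e]) := by
        simp only [Matrix.det_fin_three, Matrix.of_apply]
        have := fun s i => (continuous_apply i).comp (hc s)
        simp only [Function.comp_def] at this
        simp [Fin.isValue]
        fun_prop
      exact (this.tendsto pos₀).eventually (lt_mem_nhds he)
    filter_upwards [hG.eventually (edgeSet_finite T), hdetc, hdisj e (Or.inl rfl),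
      hdisj (-e) (Or.inr rfl), (hXc e).continuousAt.eventually (ih hcard hT₂ hGp₀),
      (hXc (-e)).continuousAt.eventually (ih hcard hT₂ hGm₀)] with pos g1 g2 g3 g4 g5 g6 hs hn
    have hGp := g1 hs hn
    refine ⟨hGp, ?_⟩
    have hmem : ∀ f ∈ edgeSet T, pos b ∉ edgeSegment pos f → pos₀ b ∉ edgeSegment pos₀ f := by
      intro f hf hbf h0
      refine hbf ?_
      have hpos := hGp.nodepos b b' hbn hbb.symm
      rcases hG.edge_of_node_mem hT hbn hbb.symm hne.symm hp hq hp' hq' hf h0 with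
        rfl | rfl | rfl | rfl
      · exact right_mem_segment _ _ _
      · exact left_mem_segment _ _ _
      · rw [hpos]; exact right_mem_segment _ _ _
      · rw [hpos]; exact left_mem_segment _ _ _
    obtain ⟨-, hGp₁, hGm₁, hval₁⟩ := key pos hGp g2 (by
      rintro e' (rfl | rfl) f hf hbf
      exacts [g3 f hf (hmem f hf hbf), g4 f hf (hmem f hf hbf)])
    rw [hval₁, hval₀, (g5 hGp₁.straight hGp₁.nodepos).2, (g6 hGm₁.straight hGm₁.nodepos).2]

end LocallyConstantGraph

/-! ### Moving free vertices to generic points -/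

section Generic

variable {n : ℕ} {T : Fin n → List VertexName} {lab : VertexName → Option ℕ}
  {pos : VertexName → Fin 3 → ℝ}

/-- The point `g` lies on no plane through a point of `P` that is spanned by two differences of
points of `P`. -/
def AvoidsPlanes (P : Set (Fin 3 → ℝ)) (g : Fin 3 → ℝ) : Prop :=
  ∀ O ∈ P, ∀ X ∈ P, ∀ X' ∈ P, ∀ Y ∈ P, ∀ Y' ∈ P, ∀ α β : ℝ,
    g ≠ O + α • (X - X') + β • (Y - Y')

lemma AvoidsPlanes.mono {P Q : Set (Fin 3 → ℝ)} {g : Fin 3 → ℝ} (h : AvoidsPlanes Q g)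
    (hPQ : P ⊆ Q) : AvoidsPlanes P g :=
  fun O hO X hX X' hX' Y hY Y' hY' => h O (hPQ hO) X (hPQ hX) X' (hPQ hX') Y (hPQ hY) Y' (hPQ hY')

/-- Finitely many planes do not cover the space. -/
lemma exists_avoidsPlanes {P : Set (Fin 3 → ℝ)} (hP : P.Finite) : ∃ g, AvoidsPlanes P g := by
  choose ψ h0 h1 h2 using exists_form_vanishing
  have hF : ((fun q : (Fin 3 → ℝ) × ((Fin 3 → ℝ) × (Fin 3 → ℝ)) × ((Fin 3 → ℝ) × (Fin 3 → ℝ)) =>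
      (ψ (q.2.1.1 - q.2.1.2) (q.2.2.1 - q.2.2.2),
        ψ (q.2.1.1 - q.2.1.2) (q.2.2.1 - q.2.2.2) q.1)) ''
      (P ×ˢ (P ×ˢ P) ×ˢ (P ×ˢ P))).Finite :=
    (hP.prod ((hP.prod hP).prod (hP.prod hP))).image _
  obtain ⟨g, -, hg⟩ := exists_mem_nhds_avoiding hF (by
    rintro _ ⟨q, -, rfl⟩
    exact h0 _ _) (x₀ := 0) univ_mem
  refine ⟨g, fun O hO X hX X' hX' Y hY Y' hY' α β h => ?_⟩
  refine hg _ ⟨(O, (X, X'), (Y, Y')), ⟨hO, ⟨hX, hX'⟩, hY, hY'⟩, rfl⟩ ?_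
  simp only
  rw [h, map_add, map_add, map_smul, map_smul, h1, h2]
  simp

lemma AvoidsPlanes.eq_zero {P : Set (Fin 3 → ℝ)} {g : Fin 3 → ℝ} (h : AvoidsPlanes P g)
    {O X X' Y Y' : Fin 3 → ℝ} (hO : O ∈ P) (hX : X ∈ P) (hX' : X' ∈ P) (hY : Y ∈ P) (hY' : Y' ∈ P)
    {t α β : ℝ} (he : t • (g - O) = α • (X - X') + β • (Y - Y')) : t = 0 := by
  by_contra ht
  refine h O hO X hX X' hX' Y hY Y' hY' (t⁻¹ * α) (t⁻¹ * β) ?_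
  have := congrArg (fun z => t⁻¹ • z) he
  simp only [smul_smul, inv_mul_cancel₀ ht, one_smul, smul_add] at this
  rw [add_assoc, ← this]
  module

lemma AvoidsPlanes.ne {P : Set (Fin 3 → ℝ)} {g O : Fin 3 → ℝ} (h : AvoidsPlanes P g) (hO : O ∈ P) :
    g ≠ O := by
  simpa using h O hO O hO O hO O hO O hO 0 0

lemma AvoidsPlanes.linearIndependent {P : Set (Fin 3 → ℝ)} {g X Y : Fin 3 → ℝ}
    (h : AvoidsPlanes P g) (hX : X ∈ P) (hY : Y ∈ P) (hXY : X ≠ Y) :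
    LinearIndependent ℝ ![Y - X, g - X] := by
  rw [LinearIndependent.pair_iff]
  intro α β he
  have hβ : β = 0 := h.eq_zero hX hY hX hX hX (t := β) (α := -α) (β := 0)
    (by linear_combination (norm := module) he)
  subst hβ
  rw [zero_smul, add_zero, smul_eq_zero] at he
  exact ⟨he.resolve_right (sub_ne_zero.2 hXY.symm), rfl⟩

/-- A point of the segment from `X` to a generic point that lies in a plane through `X` is `X`. -/
lemma AvoidsPlanes.eq_of_mem_segment {P : Set (Fin 3 → ℝ)} {g X F G z : Fin 3 → ℝ}
    (h : AvoidsPlanes P g) (hX : X ∈ P) (hF : F ∈ P) (hG : G ∈ P) (hz : z ∈ segment ℝ X g)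
    (hz' : z ∈ segment ℝ F G) : z = X := by
  obtain ⟨t, -, -, rfl⟩ := mem_segment_iff_exists.1 hz
  obtain ⟨r, -, -, hr⟩ := mem_segment_iff_exists.1 hz'
  have ht := h.eq_zero hX hF hX hG hF (t := t) (α := 1) (β := r)
    (by linear_combination (norm := module) hr)
  simp [ht]

lemma AvoidsPlanes.notMem_segment {P : Set (Fin 3 → ℝ)} {g F G : Fin 3 → ℝ}
    (h : AvoidsPlanes P g) (hF : F ∈ P) (hG : G ∈ P) : g ∉ segment ℝ F G :=
  fun hz => h.ne hF (h.eq_of_mem_segment hF hF hG (right_mem_segment _ _ _) hz)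

/-- The vertices in `V`, with the edges among them, are well placed: the edges meet properly, and
an unlabelled vertex lies on no other vertex and on no edge that does not end there. -/
structure Placed (T : Fin n → List VertexName) (lab : VertexName → Option ℕ)
    (pos : VertexName → Fin 3 → ℝ) (V : Set VertexName) : Prop where
  good : Good {e | e ∈ edgeSet T ∧ e.1 ∈ V ∧ e.2 ∈ V} lab pos
  end_of_mem : ∀ s ∈ V, lab s = none → ∀ f ∈ edgeSet T, f.1 ∈ V → f.2 ∈ V →
    pos s ∈ edgeSegment pos f → s = f.1 ∨ s = f.2
  ne : ∀ s ∈ V, lab s = none → ∀ s' ∈ V, s' ≠ s → pos s' ≠ pos s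

/-- Forgetting the edges with an end outside `V`. -/
lemma Good.placed (hG : Good (edgeSet T) lab pos) {V : Set VertexName}
    (hV : ∀ s ∈ V, ∃ i, s ∈ T i) : Placed T lab pos V where
  good := hG.mono fun _ h => h.1
  end_of_mem s hs hls f hf _ _ h := by
    obtain ⟨w, hw⟩ := exists_next_edge (hV s hs)
    exact hG.end_of_mem hw hf (Or.inl rfl) hls h
  ne s hs hls s' hs' hne h := by
    obtain ⟨w, hw⟩ := exists_next_edge (hV s hs)
    obtain ⟨w', hw'⟩ := exists_next_edge (hV s' hs')
    rcases hG.end_of_mem hw hw' (Or.inl rfl) hls (h ▸ left_mem_segment _ _ _) with rfl | rfl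
    · exact hne rfl
    · exact hG.nondeg _ hw' h

/-- A vertex can be added to a well placed set at any generic point. -/
lemma Placed.insert {V : Set VertexName} (h : Placed T lab pos V) {u : VertexName} (hu : u ∉ V)
    (hlu : lab u = none) (hn : ∀ x, (u, x) ∈ edgeSet T ∨ (x, u) ∈ edgeSet T → lab x = none)
    (hne : ∀ x y z, (x, y) ∈ edgeSet T → (y, z) ∈ edgeSet T → x ≠ z)
    {P : Set (Fin 3 → ℝ)} (hP : ∀ x ∈ V, pos x ∈ P) {g : Fin 3 → ℝ} (hg : AvoidsPlanes P g) :
    Placed T lab (Function.update pos u g) (Insert.insert u V) := by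
  set ps := Function.update pos u g with hps
  have hpu : ps u = g := by simp [hps]
  have hpV : ∀ x ∈ V, ps x = pos x := fun x hx => by
    rw [hps, Function.update_of_ne (by rintro rfl; exact hu hx)]
  have hseg : ∀ f : VertexName × VertexName, f.1 ∈ V → f.2 ∈ V →
      edgeSegment ps f = edgeSegment pos f := fun f h1 h2 => by
    rw [edgeSegment, edgeSegment, hpV _ h1, hpV _ h2]
  -- an edge is old, or it joins `u` to a neighbour
  have hcase : ∀ f ∈ edgeSet T, f.1 ∈ Insert.insert u V → f.2 ∈ Insert.insert u V →
      (f.1 ∈ V ∧ f.2 ∈ V) ∨ ∃ x ∈ V, lab x = none ∧ (f = (u, x) ∨ f = (x, u)) := by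
    rintro ⟨f1, f2⟩ hf h1 h2
    simp only [Set.mem_insert_iff] at h1 h2
    rcases h1 with rfl | h1 <;> rcases h2 with rfl | h2
    · exact absurd rfl (hne _ _ _ hf hf)
    · exact Or.inr ⟨f2, h2, hn _ (Or.inl hf), Or.inl rfl⟩
    · exact Or.inr ⟨f1, h1, hn _ (Or.inr hf), Or.inr rfl⟩
    · exact Or.inl ⟨h1, h2⟩
  have hsegn : ∀ f : VertexName × VertexName, ∀ x ∈ V, (f = (u, x) ∨ f = (x, u)) →
      edgeSegment ps f = segment ℝ (pos x) g := by
    rintro f x hx (rfl | rfl)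
    · rw [edgeSegment, hpu, hpV x hx, segment_symm]
    · rw [edgeSegment, hpu, hpV x hx]
  have hmix : ∀ e f : VertexName × VertexName, f ∈ edgeSet T → f.1 ∈ V → f.2 ∈ V →
      ∀ x ∈ V, lab x = none → (e = (u, x) ∨ e = (x, u)) → MeetProperly lab ps e f := by
    intro e f hf h1 h2 x hx hlx he z hze hzf
    rw [hsegn e x hx he] at hze
    rw [hseg f h1 h2] at hzf
    have hzx := hg.eq_of_mem_segment (hP x hx) (hP _ h1) (hP _ h2) hze hzf
    rw [hzx] at hzf
    refine ⟨x, x, ?_, h.end_of_mem x hx hlx f hf h1 h2 hzf, by rw [hzx, hpV x hx],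
      by rw [hzx, hpV x hx], Or.inl rfl⟩
    rcases he with rfl | rfl
    exacts [Or.inr rfl, Or.inl rfl]
  refine ⟨⟨?_, ?_, ?_, ?_⟩, ?_, ?_⟩
  · rintro e ⟨he, h1, h2⟩
    rcases hcase e he h1 h2 with ⟨h1, h2⟩ | ⟨x, hx, -, rfl | rfl⟩
    · rw [hpV _ h1, hpV _ h2]
      exact h.good.nondeg e ⟨he, h1, h2⟩
    · rw [hpu, hpV x hx]
      exact hg.ne (hP x hx)
    · rw [hpu, hpV x hx]
      exact (hg.ne (hP x hx)).symm
  · rintro e ⟨he, he1, he2⟩ f ⟨hf, hf1, hf2⟩ hef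
    rcases hcase e he he1 he2 with ⟨h1, h2⟩ | ⟨x, hx, hlx, hex⟩
    · rcases hcase f hf hf1 hf2 with ⟨h3, h4⟩ | ⟨y, hy, hly, hfy⟩
      · intro z hze hzf
        rw [hseg e h1 h2] at hze
        rw [hseg f h3 h4] at hzf
        obtain ⟨p, q, hp, hq, hzp, hzq, hpq⟩ :=
          h.good.inter e ⟨he, h1, h2⟩ f ⟨hf, h3, h4⟩ hef z hze hzf
        have hpV' : p ∈ V := by rcases hp with rfl | rfl <;> assumption
        have hqV' : q ∈ V := by rcases hq with rfl | rfl <;> assumption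
        exact ⟨p, q, hp, hq, by rw [hzp, hpV p hpV'], by rw [hzq, hpV q hqV'], hpq⟩
      · exact (hmix f e he h1 h2 y hy hly hfy).symm
    · rcases hcase f hf hf1 hf2 with ⟨h3, h4⟩ | ⟨y, hy, hly, hfy⟩
      · exact hmix e f hf h3 h4 x hx hlx hex
      · intro z hze hzf
        rw [hsegn e x hx hex] at hze
        rw [hsegn f y hy hfy] at hzf
        have hxy : y ≠ x := by
          rintro rfl
          rcases hex with rfl | rfl <;> rcases hfy with rfl | rfl
          · exact hef rfl
          · exact hne _ _ _ he hf rfl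
          · exact hne _ _ _ hf he rfl
          · exact hef rfl
        obtain ⟨t, -, -, rfl⟩ := mem_segment_iff_exists.1 hze
        obtain ⟨t', -, -, ht'⟩ := mem_segment_iff_exists.1 hzf
        have htt := hg.eq_zero (hP x hx) (hP y hy) (hP x hx) (hP x hx) (hP x hx) (t := t - t')
          (α := 1 - t') (β := 0) (by linear_combination (norm := module) ht')
        obtain rfl : t = t' := by linarith
        have h0 : (1 - t) • (pos y - pos x) = 0 := by linear_combination (norm := module) -ht'
        rw [smul_eq_zero] at h0
        have ht1 : 1 - t = 0 := h0.resolve_right (sub_ne_zero.2 (h.ne x hx hlx y hy hxy))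
        obtain rfl : t = 1 := by linarith
        refine ⟨u, u, ?_, ?_, by rw [hpu]; module, by rw [hpu]; module, Or.inl rfl⟩
        · rcases hex with rfl | rfl
          exacts [Or.inl rfl, Or.inr rfl]
        · rcases hfy with rfl | rfl
          exacts [Or.inl rfl, Or.inr rfl]
  · rintro p b q ⟨hpb, hp, hb⟩ ⟨hbq, -, hq⟩ hlb
    have hbu : b ≠ u := fun h => hlb (h ▸ hlu)
    have hpu : p ≠ u := fun h => hlb (hn _ (Or.inl (h ▸ hpb)))
    have hqu : q ≠ u := fun h => hlb (hn _ (Or.inr (h ▸ hbq)))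
    have hp := Set.mem_of_mem_insert_of_ne hp hpu
    have hq := Set.mem_of_mem_insert_of_ne hq hqu
    have hb := Set.mem_of_mem_insert_of_ne hb hbu
    rw [hpV _ hp, hpV _ hq, hpV _ hb]
    exact h.good.straight p b q ⟨hpb, hp, hb⟩ ⟨hbq, hb, hq⟩ hlb
  · intro x y hx hxy
    have hxu : x ≠ u := fun h => hx (h ▸ hlu)
    have hyu : y ≠ u := fun h => hx (hxy.trans (h ▸ hlu))
    rw [hps, Function.update_of_ne hxu, Function.update_of_ne hyu]
    exact h.good.nodepos x y hx hxy
  · intro s hs hls f hf hf1 hf2 hz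
    rcases hcase f hf hf1 hf2 with ⟨h1, h2⟩ | ⟨x, hx, hlx, hfx⟩
    · rw [hseg f h1 h2] at hz
      rcases hs with rfl | hs
      · rw [hpu] at hz
        exact absurd hz (hg.notMem_segment (hP _ h1) (hP _ h2))
      · rw [hpV s hs] at hz
        exact h.end_of_mem s hs hls f hf h1 h2 hz
    · rcases hs with rfl | hs
      · rcases hfx with rfl | rfl
        exacts [Or.inl rfl, Or.inr rfl]
      · rw [hsegn f x hx hfx, hpV s hs] at hz
        have hsx := hg.eq_of_mem_segment (hP x hx) (hP s hs) (hP s hs) hz (left_mem_segment _ _ _)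
        obtain rfl : s = x := by
          by_contra hne'
          exact h.ne x hx hlx s hs hne' hsx
        rcases hfx with rfl | rfl
        exacts [Or.inr rfl, Or.inl rfl]
  · intro s hs hls s' hs' hne'
    rcases hs with rfl | hs <;> rcases hs' with rfl | hs'
    · exact absurd rfl hne'
    · rw [hpu, hpV _ hs']
      exact (hg.ne (hP _ hs')).symm
    · rw [hpu, hpV _ hs]
      exact hg.ne (hP _ hs)
    · rw [hpV _ hs, hpV _ hs']
      exact h.ne s hs hls s' hs' hne'

lemma det_swap_rows {x y z : Fin 3 → ℝ} :
    Matrix.det (Matrix.of ![x, y, z]) = -Matrix.det (Matrix.of ![y, x, z]) := by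
  simp [Matrix.det_fin_three]
  ring

/-- The triangle spanned by an edge with unlabelled ends and a generic point meets every other edge
transversally in the interior, or only in the ends of its base. -/
lemma Good.generic_triangle (hG : Good (edgeSet T) lab pos) {x y : VertexName}
    (hxy : (x, y) ∈ edgeSet T) (hlx : lab x = none) (hly : lab y = none) {g : Fin 3 → ℝ}
    (hg : AvoidsPlanes (pos '' {s | ∃ i, s ∈ T i}) g) {f : VertexName × VertexName}
    (hf : f ∈ edgeSet T) (hfxy : f ≠ (x, y)) {z : Fin 3 → ℝ} (hz : z ∈ edgeSegment pos f)
    (hzt : z ∈ triangle (pos x) (pos y) g) :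
    (z = pos x ∧ (x = f.1 ∨ x = f.2)) ∨ (z = pos y ∧ (y = f.1 ∨ y = f.2)) ∨
      (z ∉ segment ℝ (pos x) (pos y) ∧ z ∉ segment ℝ (pos x) g ∧ z ∉ segment ℝ (pos y) g ∧
        z ∈ openSegment ℝ (pos f.1) (pos f.2) ∧
        Matrix.det (Matrix.of ![pos y - pos x, g - pos x, pos f.2 - pos f.1]) ≠ 0) := by
  have hP : ∀ s, (∃ i, s ∈ T i) → pos s ∈ pos '' {s | ∃ i, s ∈ T i} := fun s hs => ⟨s, hs, rfl⟩
  have hX := hP x (fst_mem_of_mem_edgeSet hxy)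
  have hY := hP y (snd_mem_of_mem_edgeSet hxy)
  have hF1 := hP _ (fst_mem_of_mem_edgeSet hf)
  have hF2 := hP _ (snd_mem_of_mem_edgeSet hf)
  have hx : z = pos x → (x = f.1 ∨ x = f.2) := fun h =>
    hG.end_of_mem hxy hf (Or.inl rfl) hlx (h ▸ hz)
  have hy : z = pos y → (y = f.1 ∨ y = f.2) := fun h =>
    hG.end_of_mem hxy hf (Or.inr rfl) hly (h ▸ hz)
  by_cases hzx : z = pos x
  · exact Or.inl ⟨hzx, hx hzx⟩
  by_cases hzy : z = pos y
  · exact Or.inr (Or.inl ⟨hzy, hy hzy⟩)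
  have hbase : z ∉ segment ℝ (pos x) (pos y) := by
    intro hzb
    obtain ⟨p, -, hp, -, hzp, -⟩ := hG.inter _ hxy f hf hfxy.symm z hzb hz
    rcases hp with rfl | rfl
    exacts [hzx hzp, hzy hzp]
  obtain ⟨α, β, hα, hβ, hαβ, hzc⟩ := hzt
  have hβ0 : β ≠ 0 := by
    rintro rfl
    exact hbase (mem_segment_iff_exists.2 ⟨α, hα, by linarith, by rw [hzc]; module⟩)
  obtain ⟨r, hr0, hr1, hr⟩ := mem_segment_iff_exists.1 hz
  refine Or.inr (Or.inr ⟨hbase, fun h => hzx (hg.eq_of_mem_segment hX hF1 hF2 h hz),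
    fun h => hzy (hg.eq_of_mem_segment hY hF1 hF2 h hz), ?_, ?_⟩)
  · have hzf : ∀ F ∈ pos '' {s | ∃ i, s ∈ T i}, z ≠ F := fun F hF h =>
      hβ0 (hg.eq_zero hX hF hX hX hY (t := β) (α := 1) (β := α)
        (by rw [← h, hzc]; module))
    refine mem_openSegment_iff_exists.2 ⟨r, hr0.lt_of_ne ?_, hr1.lt_of_ne ?_, hr⟩
    · rintro rfl
      exact hzf _ hF1 (by rw [hr]; module)
    · rintro rfl
      exact hzf _ hF2 (by rw [hr]; module)
  · intro hdet
    have hnli : ¬ LinearIndependent ℝ ![pos y - pos x, g - pos x, pos f.2 - pos f.1] := by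
      intro hli
      have := (Matrix.linearIndependent_rows_iff_isUnit (A := Matrix.of
        ![pos y - pos x, g - pos x, pos f.2 - pos f.1])).1 hli
      rw [Matrix.isUnit_iff_isUnit_det, hdet] at this
      exact not_isUnit_zero this
    rw [Fintype.linearIndependent_iff] at hnli
    push Not at hnli
    obtain ⟨γ, hsum, i, hi⟩ := hnli
    rw [Fin.sum_univ_three] at hsum
    change γ 0 • (pos y - pos x) + γ 1 • (g - pos x) + γ 2 • (pos f.2 - pos f.1) = 0 at hsum
    have h1 : γ 1 = 0 := hg.eq_zero hX hX hY hF1 hF2 (t := γ 1) (α := γ 0) (β := γ 2)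
      (by linear_combination (norm := module) hsum)
    rw [h1, zero_smul, add_zero] at hsum
    have h2 : γ 2 ≠ 0 := by
      intro h2
      rw [h2, zero_smul, add_zero, smul_eq_zero] at hsum
      have h0 := hsum.resolve_right (sub_ne_zero.2 (hG.nondeg _ hxy).symm)
      fin_cases i
      exacts [hi h0, hi h1, hi h2]
    have hpar : pos f.2 - pos f.1 = (-((γ 2)⁻¹ * γ 0)) • (pos y - pos x) := by
      have := congrArg (fun z => (γ 2)⁻¹ • z) hsum
      simp only [smul_add, smul_smul, inv_mul_cancel₀ h2, one_smul, smul_zero] at this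
      linear_combination (norm := module) this
    refine hβ0 (hg.eq_zero hX hF1 hX hY hX (t := β) (α := 1)
      (β := r * (-((γ 2)⁻¹ * γ 0)) - α) ?_)
    rw [hpar] at hr
    linear_combination (norm := module) hr - hzc

/-- Moving a vertex with unlabelled neighbours to a generic point keeps the diagram embedded and
its value: the new vertex is inserted by one push and the old one removed by another. -/
lemma IsVassilievInvariant.valueOf_update {R : Type*} [CommRing R] {v : EmbeddedGraph n → R} {k : ℕ}
    (hv : IsVassilievInvariant v) (hk : IsOfFiniteType k v)
    (hcard : {l | ∃ u, lab u = some l}.ncard = k) (hT : Shape T lab)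
    (hG : Good (edgeSet T) lab pos) {s u w : VertexName} (hsu : (s, u) ∈ edgeSet T)
    (huw : (u, w) ∈ edgeSet T) (hls : lab s = none) (hlu : lab u = none) (hlw : lab w = none)
    {g : Fin 3 → ℝ} (hg : AvoidsPlanes (pos '' {s | ∃ i, s ∈ T i}) g) :
    Good (edgeSet T) lab (Function.update pos u g) ∧
      valueOf v (diagram T lab pos) = valueOf v (diagram T lab (Function.update pos u g)) := by
  have hsw : s ≠ w := hG.prev_ne_next hsu huw
  have hsu' : s ≠ u := fun h => hG.nondeg _ hsu (by rw [h])
  have hwu : w ≠ u := fun h => hG.nondeg _ huw (by rw [h])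
  have hsT := fst_mem_of_mem_edgeSet hsu
  have huT := fst_mem_of_mem_edgeSet huw
  have hwT := snd_mem_of_mem_edgeSet huw
  have hP : ∀ s, (∃ i, s ∈ T i) → pos s ∈ pos '' {s | ∃ i, s ∈ T i} := fun s hs => ⟨s, hs, rfl⟩
  have hG2 : Good (edgeSet T) lab (Function.update pos u g) := by
    have hpl := (hG.placed (V := {x | (∃ i, x ∈ T i) ∧ x ≠ u}) fun x hx => hx.1).insert
      (u := u) (fun h => h.2 rfl) hlu (by
        rintro x (hx | hx)
        · rw [hT.next_eq hx huw, hlw]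
        · rw [hT.prev_eq hx hsu, hls])
      (fun x y z hxy hyz => hG.prev_ne_next hxy hyz) (fun x hx => hP x hx.1) hg
    have hmem : ∀ x, (∃ i, x ∈ T i) →
        x ∈ Insert.insert u {x | (∃ i, x ∈ T i) ∧ x ≠ u} := fun x hx => by
      by_cases hxu : x = u
      · exact Or.inl hxu
      · exact Or.inr ⟨hx, hxu⟩
    exact hpl.good.mono fun e he =>
      ⟨he, hmem _ (fst_mem_of_mem_edgeSet he), hmem _ (snd_mem_of_mem_edgeSet he)⟩
  refine ⟨hG2, ?_⟩
  obtain ⟨d, hd, -⟩ := exists_fresh T ∅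
  obtain ⟨T₂, h₂, h₁⟩ := exists_slide hT hsu huw hsu' hsw hd
  have hld := hT.lab_fresh hd
  set ps := Function.update pos d g with hps
  have hpd : ps d = g := by simp [hps]
  have hpT : ∀ x, (∃ i, x ∈ T i) → ps x = pos x := fun x hx => by
    rw [hps, Function.update_of_ne]
    rintro rfl
    exact hx.elim hd
  have hdiag₀ : diagram T lab pos = diagram T lab ps := diagram_congr fun x hx => (hpT x hx).symm
  have hGs : Good (edgeSet T) lab ps :=
    hG.congr (fun e he => ⟨hpT _ (fst_mem_of_mem_edgeSet he), hpT _ (snd_mem_of_mem_edgeSet he)⟩)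
      fun x hx => hpT x (hT.supp x hx)
  have himg : ps '' {s | ∃ i, s ∈ T i} = pos '' {s | ∃ i, s ∈ T i} :=
    Set.image_congr fun x hx => hpT x hx
  rw [← himg] at hg hP
  have hPs : ∀ s, (∃ i, s ∈ T i) → ps s ∈ ps '' {s | ∃ i, s ∈ T i} := fun s hs => ⟨s, hs, rfl⟩
  have e1 := hv.push hk hcard _ rfl hT hGs h₂ hd hlu hlw (by
    rw [hpd]
    exact hg.linearIndependent (hPs u huT) (hPs w hwT) (hGs.nondeg _ huw)) (by
    intro f hf hne z hz hzt
    rw [hpd] at hzt ⊢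
    rcases hGs.generic_triangle huw hlu hlw hg hf hne hz hzt with h | h | ⟨h1, h2, h3, h4, h5⟩
    · exact Or.inl h.1
    · exact Or.inr (Or.inl h.1)
    · exact Or.inr (Or.inr ⟨h1, h2, by rwa [segment_symm], h4, h5⟩))
  have hT₁ := hT.renameVertex hd hlu
  have hdiag : diagram (renameVertex T u d) lab ps = diagram T lab (Function.update pos u g) := by
    rw [diagram_renameVertex hd (hlu.trans hld.symm), hpd]
    refine diagram_congr fun x hx => ?_
    by_cases hxu : x = u
    · subst hxu; simp
    · rw [Function.update_of_ne hxu, Function.update_of_ne hxu, hpT x hx]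
  have hG₁ : Good (edgeSet (renameVertex T u d)) lab ps := by
    obtain ⟨G, hGc⟩ := exists_embeddedGraph hT hG2
    exact good_of_embeddedGraph hT₁ G (hGc.trans hdiag.symm)
  have huT₁ : ∀ i, u ∉ renameVertex T u d i := by
    intro i hi
    obtain ⟨x, hx, h⟩ := List.mem_map.1 hi
    rw [Equiv.swap_apply_eq_iff, Equiv.swap_apply_left] at h
    exact hd i (h ▸ hx)
  have hli := hg.linearIndependent (hPs s hsT) (hPs u huT) (hGs.nondeg _ hsu)
  have e2 := hv.push hk hcard _ rfl hT₁ hG₁ h₁ huT₁ hls hld (by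
    rw [hpd]
    exact LinearIndependent.pair_symm_iff.1 hli) (by
    intro f hf hne z hz hzt
    rw [hpd] at hzt ⊢
    have hzt' : z ∈ triangle (ps s) (ps u) g := by rwa [triangle_comm]
    rcases edge_of_renameVertex hT hsu huw hsu' hwu hd hf with rfl | rfl | ⟨hf, hf1, hf2⟩
    · exact absurd rfl hne
    · refine Or.inr (Or.inl ?_)
      -- a common point other than `g` would put `w` on the edge from `s` to `u`
      simp only [edgeSegment, hpd] at hz
      obtain ⟨r, hr0, -, hr⟩ := mem_segment_iff_exists.1 hz
      obtain ⟨α, β, hα, hβ, hαβ, hzc⟩ := hzt'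
      have h0 := hg.eq_zero (hPs s hsT) (hPs u huT) (hPs s hsT) (hPs w hwT) (hPs s hsT)
        (t := 1 - r - β) (α := α) (β := -r) (by linear_combination (norm := module) hzc - hr)
      rcases hr0.lt_or_eq with hr0 | rfl
      · exfalso
        have hrw : r • (ps w - ps s) = α • (ps u - ps s) := by
          have hβr : β = 1 - r := by linarith
          rw [hβr] at hzc
          linear_combination (norm := module) hzc - hr
        have hw : ps w = ps s + (r⁻¹ * α) • (ps u - ps s) := by
          have := congrArg (fun z => r⁻¹ • z) hrw
          simp only [smul_smul, inv_mul_cancel₀ hr0.ne', one_smul] at this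
          rw [← this]; module
        rcases hGs.end_of_mem huw hsu (Or.inr rfl) hlw (mem_segment_iff_exists.2
          ⟨r⁻¹ * α, by positivity, by rw [inv_mul_le_iff₀ hr0]; linarith, hw⟩) with h | h
        exacts [hsw h.symm, hwu h]
      · rw [hr]; module
    · rcases hGs.generic_triangle hsu hls hlu hg hf (fun h => hf2 (by rw [h])) hz hzt' with
        h | h | ⟨h1, h2, h3, h4, h5⟩
      · exact Or.inl h.1
      · rcases h.2 with h | h
        exacts [absurd h.symm hf1, absurd h.symm hf2]
      · refine Or.inr (Or.inr ⟨h2, h1, h3, h4, fun h => h5 ?_⟩)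
        rw [det_swap_rows, h, neg_zero])
  rw [hdiag₀, e1, ← e2, hdiag]

/-- The vertex `x` has no label, nor have its neighbours. -/
def IsFree (T : Fin n → List VertexName) (lab : VertexName → Option ℕ) (x : VertexName) : Prop :=
  lab x = none ∧ ∀ y, (x, y) ∈ edgeSet T ∨ (y, x) ∈ edgeSet T → lab y = none

lemma names_finite (T : Fin n → List VertexName) : {x | ∃ i, x ∈ T i}.Finite := by
  refine (nameList T).toFinset.finite_toSet.subset fun x hx => ?_
  simpa [mem_nameList] using hx

lemma exists_finset_isFree (T : Fin n → List VertexName) (lab : VertexName → Option ℕ) :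
    ∃ F : Finset VertexName, ∀ x, x ∈ F ↔ (∃ i, x ∈ T i) ∧ IsFree T lab x := by
  have h : {x | (∃ i, x ∈ T i) ∧ IsFree T lab x}.Finite :=
    (names_finite T).subset fun x hx => hx.1
  exact ⟨h.toFinset, fun x => by rw [Set.Finite.mem_toFinset]; rfl⟩

/-- The positions of the free vertices do not influence the value: one by one, they are moved in
both diagrams to a common generic point. -/
lemma IsVassilievInvariant.valueOf_eq_of_agree {R : Type*} [CommRing R] {v : EmbeddedGraph n → R}
    {k : ℕ} (hv : IsVassilievInvariant v) (hk : IsOfFiniteType k v)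
    (hcard : {l | ∃ u, lab u = some l}.ncard = k) (hT : Shape T lab)
    {pos pos' : VertexName → Fin 3 → ℝ} (hG : Good (edgeSet T) lab pos)
    (hG' : Good (edgeSet T) lab pos')
    (h : ∀ x, (∃ i, x ∈ T i) → ¬ IsFree T lab x → pos x = pos' x) :
    valueOf v (diagram T lab pos) = valueOf v (diagram T lab pos') := by
  have hfin := names_finite T
  obtain ⟨F, hF⟩ := exists_finset_isFree T lab
  suffices H : ∀ N : Finset VertexName, (∀ x ∈ N, (∃ i, x ∈ T i) ∧ IsFree T lab x) →
      ∀ pos pos' : VertexName → Fin 3 → ℝ, Good (edgeSet T) lab pos → Good (edgeSet T) lab pos' →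
      (∀ x, (∃ i, x ∈ T i) → x ∉ N → pos x = pos' x) →
      valueOf v (diagram T lab pos) = valueOf v (diagram T lab pos') by
    exact H F (fun x hx => (hF x).1 hx) pos pos' hG hG' fun x hx hxN =>
      h x hx fun hfree => hxN ((hF x).2 ⟨hx, hfree⟩)
  intro N
  induction N using Finset.induction_on with
  | empty =>
    intro _ pos pos' _ _ h
    rw [diagram_congr fun x hx => h x hx (Finset.notMem_empty x)]
  | insert u N huN ih =>
    intro hN pos pos' hG hG' h
    obtain ⟨huT, hlu, hun⟩ := hN u (Finset.mem_insert_self u N)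
    obtain ⟨w, huw⟩ := exists_next_edge huT
    obtain ⟨s, hsu⟩ := exists_prev_edge huT
    obtain ⟨g, hg⟩ := exists_avoidsPlanes ((hfin.image pos).union (hfin.image pos'))
    have hls := hun s (Or.inr hsu)
    have hlw := hun w (Or.inl huw)
    obtain ⟨h1, e1⟩ := hv.valueOf_update hk hcard hT hG hsu huw hls hlu hlw
      (hg.mono Set.subset_union_left)
    obtain ⟨h2, e2⟩ := hv.valueOf_update hk hcard hT hG' hsu huw hls hlu hlw
      (hg.mono Set.subset_union_right)
    rw [e1, e2]
    refine ih (fun x hx => hN x (Finset.mem_insert_of_mem hx)) _ _ h1 h2 fun x hx hxN => ?_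
    by_cases hxu : x = u
    · subst hxu; simp
    · rw [Function.update_of_ne hxu, Function.update_of_ne hxu]
      exact h x hx (by simp [hxu, hxN])

/-- Well placed vertices that include all but the free ones extend to an embedded diagram. -/
lemma Placed.exists_good (h : Placed T lab pos {x | (∃ i, x ∈ T i) ∧ ¬ IsFree T lab x})
    (hne : ∀ x y z, (x, y) ∈ edgeSet T → (y, z) ∈ edgeSet T → x ≠ z) :
    ∃ pos', Good (edgeSet T) lab pos' ∧ ∀ x, ¬ IsFree T lab x → pos' x = pos x := by
  have hfin := names_finite T
  obtain ⟨F, hF⟩ := exists_finset_isFree T lab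
  set V := {x | (∃ i, x ∈ T i) ∧ ¬ IsFree T lab x} with hV
  have H : ∀ N : Finset VertexName, (∀ x ∈ N, (∃ i, x ∈ T i) ∧ IsFree T lab x) →
      ∃ pos', Placed T lab pos' (V ∪ N) ∧ ∀ x, ¬ IsFree T lab x → pos' x = pos x := by
    intro N
    induction N using Finset.induction_on with
    | empty => exact fun _ => ⟨pos, by simpa using h, fun _ _ => rfl⟩
    | insert u N huN ih =>
      intro hN
      obtain ⟨pos', hpl, hpos'⟩ := ih fun x hx => hN x (Finset.mem_insert_of_mem hx)
      obtain ⟨huT, hfree⟩ := hN u (Finset.mem_insert_self u N)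
      obtain ⟨g, hg⟩ := exists_avoidsPlanes (hfin.image pos')
      refine ⟨Function.update pos' u g, ?_, fun x hx => ?_⟩
      · rw [Finset.coe_insert, Set.union_insert]
        refine hpl.insert (P := pos' '' {x | ∃ i, x ∈ T i}) (fun hu => ?_) hfree.1 hfree.2 hne
          (fun x hx => ⟨x, ?_, rfl⟩) hg
        · rcases hu with hu | hu
          exacts [hu.2 hfree, huN hu]
        · rcases hx with hx | hx
          exacts [hx.1, (hN x (Finset.mem_insert_of_mem hx)).1]
      · rw [Function.update_of_ne (by rintro rfl; exact hx hfree), hpos' x hx]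
  obtain ⟨pos', hpl, hpos'⟩ := H F fun x hx => (hF x).1 hx
  have hmem : ∀ x, (∃ i, x ∈ T i) → x ∈ V ∪ (F : Set VertexName) := by
    intro x hx
    by_cases hfree : IsFree T lab x
    · exact Or.inr ((hF x).2 ⟨hx, hfree⟩)
    · exact Or.inl ⟨hx, hfree⟩
  exact ⟨pos', hpl.good.mono fun e he =>
    ⟨he, hmem _ (fst_mem_of_mem_edgeSet he), hmem _ (snd_mem_of_mem_edgeSet he)⟩, hpos'⟩

end Generic

/-! ### Configurations of nodes -/

section Configuration

variable {n : ℕ} {T : Fin n → List VertexName} {lab : VertexName → Option ℕ}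
  {pos : VertexName → Fin 3 → ℝ}

/-- Passages through nodes are at least four edges apart along each strand. -/
structure Spread (T : Fin n → List VertexName) (lab : VertexName → Option ℕ) : Prop where
  ne : ∀ x y z, (x, y) ∈ edgeSet T → (y, z) ∈ edgeSet T → x ≠ z
  one : ∀ b x, (b, x) ∈ edgeSet T → lab b ≠ none → lab x = none
  two : ∀ b x y, (b, x) ∈ edgeSet T → (x, y) ∈ edgeSet T → lab b ≠ none → lab y = none
  three : ∀ b x y z, (b, x) ∈ edgeSet T → (x, y) ∈ edgeSet T → (y, z) ∈ edgeSet T →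
    lab b ≠ none → lab z = none

/-- The edge between `b` and `x` is one of the two edges at the passage `b` through a node. -/
def IsArm (T : Fin n → List VertexName) (lab : VertexName → Option ℕ) (b x : VertexName) : Prop :=
  lab b ≠ none ∧ ((x, b) ∈ edgeSet T ∨ (b, x) ∈ edgeSet T)

lemma Spread.arm_end (hS : Spread T lab) {b x : VertexName} (h : IsArm T lab b x) :
    lab x = none := by
  rcases h with ⟨hb, h | h⟩
  · by_contra hx
    exact hb (hS.one _ _ h hx)
  · exact hS.one _ _ h hb

lemma Spread.arm_unique (hS : Spread T lab) (hT : Shape T lab) {b b' x : VertexName}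
    (h : IsArm T lab b x) (h' : IsArm T lab b' x) : b = b' := by
  rcases h with ⟨hb, h | h⟩ <;> rcases h' with ⟨hb', h' | h'⟩
  · exact hT.next_eq h h'
  · exact absurd (hS.two _ _ _ h' h hb') hb
  · exact absurd (hS.two _ _ _ h h' hb) hb'
  · exact hT.prev_eq h h'

/-- The arms at the passages are nondegenerate, and different arms have at most their node in
common. -/
structure ArmsApart (T : Fin n → List VertexName) (lab : VertexName → Option ℕ)
    (pos : VertexName → Fin 3 → ℝ) : Prop where
  ne : ∀ b x, IsArm T lab b x → pos x ≠ pos b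
  apart : ∀ b x b' x', IsArm T lab b x → IsArm T lab b' x' → x ≠ x' →
    ∀ z ∈ segment ℝ (pos b) (pos x), z ∈ segment ℝ (pos b') (pos x') →
    z = pos b ∧ z = pos b' ∧ lab b = lab b'
  straight : ∀ u b w, (u, b) ∈ edgeSet T → (b, w) ∈ edgeSet T → lab b ≠ none →
    pos b ∈ openSegment ℝ (pos u) (pos w)
  nodepos : ∀ u w, lab u ≠ none → lab u = lab w → pos u = pos w

lemma IsArm.exists_edge {b x : VertexName} (h : IsArm T lab b x) :
    ∃ e ∈ edgeSet T, (e = (b, x) ∨ e = (x, b)) ∧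
      ∀ pos : VertexName → Fin 3 → ℝ, edgeSegment pos e = segment ℝ (pos b) (pos x) := by
  rcases h.2 with h | h
  · exact ⟨_, h, Or.inr rfl, fun pos => segment_symm ℝ (pos x) (pos b)⟩
  · exact ⟨_, h, Or.inl rfl, fun pos => rfl⟩

/-- Different arms in a good diagram have at most their node in common: that they end at the same
free vertex is excluded since passages are spread. -/
lemma Good.armsApart (hG : Good (edgeSet T) lab pos) (hS : Spread T lab) :
    ArmsApart T lab pos where
  ne b x h := by
    rcases h.2 with h | h
    exacts [hG.nondeg _ h, (hG.nondeg _ h).symm]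
  apart b x b' x' h h' hne z hz hz' := by
    obtain ⟨e, he, hbx, hseg⟩ := h.exists_edge
    obtain ⟨f, hf, hbx', hseg'⟩ := h'.exists_edge
    have hlx := hS.arm_end h
    have hlx' := hS.arm_end h'
    have hb := h.1
    have hb' := h'.1
    have hxb' : x ≠ b' := fun h => hb' (h ▸ hlx)
    have hbx₀ : b ≠ x' := fun h => hb (h ▸ hlx')
    have hxb : x ≠ b := fun h => hb (h ▸ hlx)
    have hef : e ≠ f := by
      rintro rfl
      rcases hbx with rfl | rfl <;> rcases hbx' with h | h <;> simp only [Prod.mk.injEq] at h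
      exacts [hne h.2, hxb' h.2, hxb' h.1, hne h.1]
    obtain ⟨p, q, hp, hq, hzp, hzq, hpq⟩ := hG.inter e he f hf hef z (by rwa [hseg]) (by rwa [hseg'])
    have hp : p = b ∨ p = x := by
      rcases hbx with rfl | rfl
      exacts [hp, hp.symm]
    have hq : q = b' ∨ q = x' := by
      rcases hbx' with rfl | rfl
      exacts [hq, hq.symm]
    rcases hpq with rfl | ⟨hpq, hlp⟩
    · rcases hp with rfl | rfl
      · rcases hq with rfl | rfl
        exacts [⟨hzp, hzp, rfl⟩, absurd rfl hbx₀]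
      · rcases hq with rfl | rfl
        exacts [absurd rfl hxb', absurd rfl hne]
    · rcases hp with rfl | rfl
      · rcases hq with rfl | rfl
        exacts [⟨hzp, hzq, hpq⟩, absurd (hpq.trans hlx') hlp]
      · exact absurd hlx hlp
  straight := hG.straight
  nodepos := hG.nodepos

lemma exists_isArm_of_not_isFree {x : VertexName} (hx : ¬ IsFree T lab x) :
    lab x ≠ none ∨ ∃ b, IsArm T lab b x := by
  by_cases hl : lab x = none
  · unfold IsFree at hx
    push Not at hx
    obtain ⟨b, hb, hlb⟩ := hx hl
    exact Or.inr ⟨b, hlb, hb⟩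
  · exact Or.inl hl

/-- The vertices that are not free, that is, the nodes and the ends of their arms, form a good
diagram as soon as the arms do. -/
lemma ArmsApart.placed (hA : ArmsApart T lab pos) (hT : Shape T lab) (hS : Spread T lab) :
    Placed T lab pos {x | (∃ i, x ∈ T i) ∧ ¬ IsFree T lab x} := by
  -- an edge between vertices that are not free is an arm
  have harm : ∀ e ∈ edgeSet T, ¬ IsFree T lab e.1 → ¬ IsFree T lab e.2 →
      ∃ b x, IsArm T lab b x ∧ (e = (b, x) ∨ e = (x, b)) := by
    rintro ⟨x, y⟩ he hx hy
    rcases exists_isArm_of_not_isFree hx with hx | ⟨b, hb⟩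
    · exact ⟨x, y, ⟨hx, Or.inr he⟩, Or.inl rfl⟩
    rcases exists_isArm_of_not_isFree hy with hy | ⟨b', hb'⟩
    · exact ⟨y, x, ⟨hy, Or.inl he⟩, Or.inr rfl⟩
    simp only at hb hb'
    rcases hb.2 with h | h
    · exact absurd (hT.next_eq h he ▸ hS.arm_end hb') hb.1
    · rcases hb'.2 with h' | h'
      · exact absurd (hS.three _ _ _ _ h he h' hb.1) hb'.1
      · exact absurd (hT.prev_eq h' he ▸ hS.arm_end hb) hb'.1
  have hseg : ∀ (e : VertexName × VertexName) b x, (e = (b, x) ∨ e = (x, b)) →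
      edgeSegment pos e = segment ℝ (pos b) (pos x) := by
    rintro e b x (rfl | rfl)
    exacts [rfl, segment_symm ℝ (pos x) (pos b)]
  have hsome : ∀ b : VertexName, (∃ i, b ∈ T i) → lab b ≠ none → ∃ x, IsArm T lab b x :=
    fun b hb hl => (exists_next_edge hb).imp fun x hx => ⟨hl, Or.inr hx⟩
  refine ⟨⟨?_, ?_, fun u b w h1 h2 => hA.straight u b w h1.1 h2.1, hA.nodepos⟩, ?_, ?_⟩
  · rintro e ⟨he, h1, h2⟩
    obtain ⟨b, x, hbx, rfl | rfl⟩ := harm e he h1.2 h2.2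
    exacts [(hA.ne b x hbx).symm, hA.ne b x hbx]
  · rintro e ⟨he, he1, he2⟩ f ⟨hf, hf1, hf2⟩ hef z hze hzf
    obtain ⟨b, x, hbx, hex⟩ := harm e he he1.2 he2.2
    obtain ⟨b', x', hbx', hfx⟩ := harm f hf hf1.2 hf2.2
    rw [hseg e b x hex] at hze
    rw [hseg f b' x' hfx] at hzf
    have hxx : x ≠ x' := by
      rintro rfl
      obtain rfl := hS.arm_unique hT hbx hbx'
      rcases hex with rfl | rfl <;> rcases hfx with rfl | rfl
      · exact hef rfl
      · exact hS.ne _ _ _ he hf rfl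
      · exact hS.ne _ _ _ hf he rfl
      · exact hef rfl
    obtain ⟨h1, h2, h3⟩ := hA.apart b x b' x' hbx hbx' hxx z hze hzf
    refine ⟨b, b', ?_, ?_, h1, h2, Or.inr ⟨h3, hbx.1⟩⟩
    · rcases hex with rfl | rfl
      exacts [Or.inl rfl, Or.inr rfl]
    · rcases hfx with rfl | rfl
      exacts [Or.inl rfl, Or.inr rfl]
  · rintro s ⟨-, hs⟩ hls f hf hf1 hf2 hz
    obtain ⟨b, hbs⟩ := (exists_isArm_of_not_isFree hs).resolve_left (not_not.2 hls)
    obtain ⟨b', x, hbx, hfx⟩ := harm f hf hf1.2 hf2.2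
    have hsx : s = x := by
      by_contra hsx
      rw [hseg f b' x hfx] at hz
      exact hA.ne b s hbs (hA.apart b s b' x hbs hbx hsx _ (right_mem_segment _ _ _) hz).1
    subst hsx
    rcases hfx with rfl | rfl
    exacts [Or.inr rfl, Or.inl rfl]
  · rintro s ⟨-, hs⟩ hls s' ⟨hsT, hs'⟩ hne h
    obtain ⟨b, hbs⟩ := (exists_isArm_of_not_isFree hs).resolve_left (not_not.2 hls)
    rcases exists_isArm_of_not_isFree hs' with hl | ⟨b', hbs'⟩
    · obtain ⟨x, hx⟩ := hsome s' hsT hl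
      by_cases hsx : s = x
      · subst hsx
        exact hA.ne _ _ hx h.symm
      · exact hA.ne b s hbs (hA.apart b s s' x hbs hx hsx _ (right_mem_segment _ _ _)
          (h ▸ left_mem_segment _ _ _)).1
    · exact hA.ne b s hbs (hA.apart b s b' s' hbs hbs' hne.symm _ (right_mem_segment _ _ _)
        (h ▸ right_mem_segment _ _ _)).1

/-- Positions `c` of the nodes, directions `d` of the passages, and for each passage the ratio `μ`
of the lengths of the two arms. The arms at a passage `b` of the node `l` end at `c l - d b` and at
`c l + μ b • d b`. -/
abbrev Configuration : Type := (ℕ → Fin 3 → ℝ) × (VertexName → Fin 3 → ℝ) × (VertexName → ℝ)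

/-- The nodes of a diagram with the arms at them are those of the configuration. -/
def Realizes (T : Fin n → List VertexName) (lab : VertexName → Option ℕ) (p : Configuration)
    (pos : VertexName → Fin 3 → ℝ) : Prop :=
  ∀ u b w l, (u, b) ∈ edgeSet T → (b, w) ∈ edgeSet T → lab b = some l →
    pos b = p.1 l ∧ pos u = p.1 l - p.2.1 b ∧ pos w = p.1 l + p.2.2 b • p.2.1 b

lemma Realizes.at_passage {p : Configuration} (h : Realizes T lab p pos) (hT : Shape T lab)
    {b : VertexName} {l : ℕ} (hb : lab b = some l) : pos b = p.1 l := by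
  have hbT := hT.supp b (by simp [hb])
  obtain ⟨w, hw⟩ := exists_next_edge hbT
  obtain ⟨u, hu⟩ := exists_prev_edge hbT
  exact (h u b w l hu hw hb).1

/-- The position of the end of an arm relative to its node. -/
lemma IsArm.exists_factor {b x : VertexName} (h : IsArm T lab b x) :
    ∃ σ : ℝ → ℝ, (∀ μ, 0 < μ → σ μ ≠ 0) ∧ ∀ (p : Configuration) pos, Realizes T lab p pos →
      ∀ l, lab b = some l → pos b = p.1 l ∧ pos x = p.1 l + σ (p.2.2 b) • p.2.1 b := by
  rcases h with ⟨-, h | h⟩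
  · obtain ⟨w, hw⟩ := exists_next_edge (snd_mem_of_mem_edgeSet h)
    refine ⟨fun _ => -1, fun _ _ => by norm_num, fun p pos hp l hl => ?_⟩
    obtain ⟨h1, h2, -⟩ := hp x b w l h hw hl
    exact ⟨h1, by rw [h2]; module⟩
  · obtain ⟨u, hu⟩ := exists_prev_edge (fst_mem_of_mem_edgeSet h)
    refine ⟨fun μ => μ, fun _ h => h.ne', fun p pos hp l hl => ?_⟩
    obtain ⟨h1, -, h2⟩ := hp u b x l hu h hl
    exact ⟨h1, h2⟩

lemma Realizes.eq (hT : Shape T lab) {p : Configuration} {pos' : VertexName → Fin 3 → ℝ}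
    (h : Realizes T lab p pos) (h' : Realizes T lab p pos') {x : VertexName}
    (hx : ¬ IsFree T lab x) : pos x = pos' x := by
  rcases exists_isArm_of_not_isFree hx with hl | ⟨b, hb⟩
  · obtain ⟨l, hl⟩ := Option.ne_none_iff_exists'.1 hl
    rw [h.at_passage hT hl, h'.at_passage hT hl]
  · obtain ⟨l, hl⟩ := Option.ne_none_iff_exists'.1 hb.1
    obtain ⟨σ, -, hσ⟩ := hb.exists_factor
    rw [(hσ p pos h l hl).2, (hσ p pos' h' l hl).2]

/-- Configurations are realized by positions that depend continuously on them, starting from any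
given positions. -/
lemma exists_realization (hT : Shape T lab) (hS : Spread T lab) (base : VertexName → Fin 3 → ℝ) :
    ∃ F : Configuration → VertexName → Fin 3 → ℝ, Continuous F ∧
      (∀ p, Realizes T lab p (F p)) ∧ ∀ p, Realizes T lab p base → F p = base := by
  have key : ∀ x, ∃ f : Configuration → Fin 3 → ℝ, Continuous f ∧
      (∀ p, Realizes T lab p base → f p = base x) ∧
      ∀ p u b w l, (u, b) ∈ edgeSet T → (b, w) ∈ edgeSet T → lab b = some l →
        (x = b → f p = p.1 l) ∧ (x = u → f p = p.1 l - p.2.1 b) ∧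
        (x = w → f p = p.1 l + p.2.2 b • p.2.1 b) := by
    intro x
    by_cases h1 : lab x = none
    · by_cases h2 : ∃ b, IsArm T lab b x
      · obtain ⟨b, hb⟩ := h2
        obtain ⟨l, hl⟩ := Option.ne_none_iff_exists'.1 hb.1
        have hu : ∀ b' l', IsArm T lab b' x → lab b' = some l' → b' = b ∧ l' = l := by
          intro b' l' hb' hl'
          obtain rfl := hS.arm_unique hT hb' hb
          exact ⟨rfl, Option.some_inj.1 (hl'.symm.trans hl)⟩
        rcases hb.2 with h | h
        · refine ⟨fun p => p.1 l - p.2.1 b, by fun_prop, fun p hp => ?_, ?_⟩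
          · obtain ⟨w, hw⟩ := exists_next_edge (snd_mem_of_mem_edgeSet h)
            exact (hp x b w l h hw hl).2.1.symm
          · intro p u b' w l' hub hbw hl'
            refine ⟨?_, ?_, ?_⟩
            · rintro rfl
              simp [h1] at hl'
            · rintro rfl
              obtain ⟨rfl, rfl⟩ := hu b' l' ⟨by simp [hl'], Or.inl hub⟩ hl'
              rfl
            · rintro rfl
              exact absurd (hS.two _ _ _ hbw h (by simp [hl'])) hb.1
        · refine ⟨fun p => p.1 l + p.2.2 b • p.2.1 b, by fun_prop, fun p hp => ?_, ?_⟩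
          · obtain ⟨u, hu⟩ := exists_prev_edge (fst_mem_of_mem_edgeSet h)
            exact (hp u b x l hu h hl).2.2.symm
          · intro p u b' w l' hub hbw hl'
            refine ⟨?_, ?_, ?_⟩
            · rintro rfl
              simp [h1] at hl'
            · rintro rfl
              exact absurd (hS.two _ _ _ h hub hb.1) (by simp [hl'])
            · rintro rfl
              obtain ⟨rfl, rfl⟩ := hu b' l' ⟨by simp [hl'], Or.inr hbw⟩ hl'
              rfl
      · refine ⟨fun _ => base x, continuous_const, fun _ _ => rfl, ?_⟩
        intro p u b w l hub hbw hl
        have hb : lab b ≠ none := by simp [hl]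
        refine ⟨?_, ?_, ?_⟩
        · rintro rfl
          exact absurd h1 hb
        · rintro rfl
          exact absurd ⟨b, hb, Or.inl hub⟩ h2
        · rintro rfl
          exact absurd ⟨b, hb, Or.inr hbw⟩ h2
    · obtain ⟨l, hl⟩ := Option.ne_none_iff_exists'.1 h1
      refine ⟨fun p => p.1 l, by fun_prop, fun p hp => (hp.at_passage hT hl).symm, ?_⟩
      intro p u b w l' hub hbw hl'
      have hb : lab b ≠ none := by simp [hl']
      refine ⟨?_, ?_, ?_⟩
      · rintro rfl
        rw [Option.some_inj.1 (hl.symm.trans hl')]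
      · rintro rfl
        exact absurd (hS.arm_end ⟨hb, Or.inl hub⟩) h1
      · rintro rfl
        exact absurd (hS.arm_end ⟨hb, Or.inr hbw⟩) h1
  choose f hf hbase hreal using key
  refine ⟨fun p x => f x p, continuous_pi fun x => hf x, fun p u b w l hub hbw hl => ?_,
    fun p hp => funext fun x => hbase x p hp⟩
  exact ⟨(hreal b p u b w l hub hbw hl).1 rfl, (hreal u p u b w l hub hbw hl).2.1 rfl,
    (hreal w p u b w l hub hbw hl).2.2 rfl⟩

lemma Realizes.straight {p : Configuration} (h : Realizes T lab p pos)
    (hμ : ∀ b, lab b ≠ none → 0 < p.2.2 b) : ∀ u b w, (u, b) ∈ edgeSet T → (b, w) ∈ edgeSet T →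
      lab b ≠ none → pos b ∈ openSegment ℝ (pos u) (pos w) := by
  intro u b w hub hbw hb
  have h0 := hμ b hb
  obtain ⟨l, hl⟩ := Option.ne_none_iff_exists'.1 hb
  obtain ⟨h1, h2, h3⟩ := h u b w l hub hbw hl
  refine mem_openSegment_iff_exists.2 ⟨(1 + p.2.2 b)⁻¹, by positivity,
    inv_lt_one_of_one_lt₀ (by linarith), ?_⟩
  rw [h1, h2, h3, show p.1 l + p.2.2 b • p.2.1 b - (p.1 l - p.2.1 b) =
    (1 + p.2.2 b) • p.2.1 b by module, smul_smul, inv_mul_cancel₀ (by positivity)]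
  module

lemma Realizes.nodepos {p : Configuration} (h : Realizes T lab p pos) (hT : Shape T lab) :
    ∀ u w, lab u ≠ none → lab u = lab w → pos u = pos w := by
  intro u w hu huw
  obtain ⟨l, hl⟩ := Option.ne_none_iff_exists'.1 hu
  rw [h.at_passage hT hl, h.at_passage hT (huw ▸ hl)]

end Configuration

/-! ### Values of configurations -/

section ConfigurationValue

variable {n : ℕ} {T : Fin n → List VertexName} {lab : VertexName → Option ℕ}
  {pos : VertexName → Fin 3 → ℝ} {R : Type*} {v : EmbeddedGraph n → R}

/-- A relation that locally is a constant function is constant on preconnected sets. -/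
lemma IsPreconnected.constant_of_rel {X Y : Type*} [TopologicalSpace X] {Val : X → Y → Prop}
    {S : Set X} (hS : IsPreconnected S) (hex : ∀ x ∈ S, ∃ y, Val x y)
    (huniq : ∀ x ∈ S, ∀ y y', Val x y → Val x y' → y = y')
    (hloc : ∀ x ∈ S, ∀ y, Val x y → ∀ᶠ x' in 𝓝[S] x, Val x' y) {x x' : X} (hx : x ∈ S)
    (hx' : x' ∈ S) {y : Y} (h : Val x y) : Val x' y := by
  let _ : TopologicalSpace Y := ⊥
  have : DiscreteTopology Y := ⟨rfl⟩
  have hne : Nonempty Y := ⟨y⟩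
  choose! f hf using hex
  have hc : ContinuousOn f S := by
    intro z hz
    rw [ContinuousWithinAt, nhds_discrete, tendsto_pure]
    filter_upwards [hloc z hz _ (hf z hz), self_mem_nhdsWithin] with z' h1 h2
    exact huniq z' h2 _ _ (hf z' h2) h1
  rw [huniq x hx _ _ h (hf x hx), hS.constant hc hx hx']
  exact hf x' hx'

/-- The configuration `p` is realized by a diagram of value `r`. -/
def RealizedValue (v : EmbeddedGraph n → R) [CommRing R] (T : Fin n → List VertexName)
    (lab : VertexName → Option ℕ) (p : Configuration) (r : R) : Prop :=
  ∃ pos, Good (edgeSet T) lab pos ∧ Realizes T lab p pos ∧ valueOf v (diagram T lab pos) = r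

/-- The arms of `p` shortened by the factor `s`. -/
def Configuration.scale (s : ℝ) (p : Configuration) : Configuration := (p.1, s • p.2.1, p.2.2)

/-- The diagrams with the nodes of `p` and short arms have the value `r`. -/
def ShortArmValue (v : EmbeddedGraph n → R) [CommRing R] (T : Fin n → List VertexName)
    (lab : VertexName → Option ℕ) (p : Configuration) (r : R) : Prop :=
  ∃ s > 0, RealizedValue v T lab (p.scale s) r

/-- Different nodes have different positions, the strands at each node have different directions,
and all arms have positive lengths. -/
structure IsAdmissible (lab : VertexName → Option ℕ) (p : Configuration) : Prop where
  inj : ∀ b b' l l', lab b = some l → lab b' = some l' → l ≠ l' → p.1 l ≠ p.1 l'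
  indep : ∀ b b', lab b ≠ none → lab b = lab b' → b ≠ b' →
    LinearIndependent ℝ ![p.2.1 b, p.2.1 b']
  pos : ∀ b, lab b ≠ none → 0 < p.2.2 b

/-- Given the arms, the free vertices can be placed so that the diagram becomes good. -/
lemma ArmsApart.exists_realizedValue [CommRing R] (hT : Shape T lab) (hS : Spread T lab)
    (hA : ArmsApart T lab pos) {p : Configuration} (hp : Realizes T lab p pos) :
    ∃ r, RealizedValue v T lab p r := by
  obtain ⟨pos', hG, h⟩ := (hA.placed hT hS).exists_good hS.ne
  refine ⟨_, pos', hG, fun u b w l hub hbw hl => ?_, rfl⟩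
  have hb : lab b ≠ none := by simp [hl]
  rw [h b fun hf => hb hf.1, h u fun hf => hb (hf.2 b (Or.inl hub)),
    h w fun hf => hb (hf.2 b (Or.inr hbw))]
  exact hp u b w l hub hbw hl

/-- The value is locally constant: if the node positions, directions and arm lengths of a good
diagram are changed slightly and its free vertices are kept, then it remains good with the same
value. -/
lemma RealizedValue.eventually [CommRing R] (hv : IsVassilievInvariant v) (hT : Shape T lab)
    (hS : Spread T lab) {p : Configuration} {r : R} (h : RealizedValue v T lab p r) :
    ∀ᶠ p' in 𝓝 p, (∀ b, lab b ≠ none → 0 < p'.2.2 b) → RealizedValue v T lab p' r := by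
  obtain ⟨base, hG, hp, rfl⟩ := h
  obtain ⟨F, hF, hreal, hbase⟩ := exists_realization hT hS base
  have hlim : Tendsto F (𝓝 p) (𝓝 base) := by
    rw [← hbase p hp]
    exact hF.tendsto p
  filter_upwards [hlim.eventually (hG.eventually_valueOf hv _ rfl hT)] with p' h hμ
  obtain ⟨h1, h2⟩ := h ((hreal p').straight hμ) ((hreal p').nodepos hT)
  exact ⟨F p', h1, hreal p', h2⟩

lemma Configuration.scale_scale (s s' : ℝ) (p : Configuration) :
    (p.scale s).scale s' = p.scale (s' * s) := by
  simp [Configuration.scale, mul_smul]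

lemma Configuration.continuous_scale :
    Continuous fun q : ℝ × Configuration => q.2.scale q.1 := by
  unfold Configuration.scale
  fun_prop

/-- Shortening the arms keeps them apart. -/
lemma ArmsApart.scale (hT : Shape T lab) (hA : ArmsApart T lab pos) {p : Configuration}
    (hp : Realizes T lab p pos) (hμ : ∀ b, lab b ≠ none → 0 < p.2.2 b) {s : ℝ} (hs : 0 < s)
    (hs1 : s ≤ 1) {pos' : VertexName → Fin 3 → ℝ} (hp' : Realizes T lab (p.scale s) pos') :
    ArmsApart T lab pos' := by
  have key : ∀ b x, IsArm T lab b x →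
      pos' b = pos b ∧ pos' x = pos b + s • (pos x - pos b) := by
    intro b x h
    obtain ⟨l, hl⟩ := Option.ne_none_iff_exists'.1 h.1
    obtain ⟨σ, -, hσ⟩ := h.exists_factor
    obtain ⟨h1, h2⟩ := hσ p pos hp l hl
    obtain ⟨h3, h4⟩ := hσ _ pos' hp' l hl
    refine ⟨h3.trans h1.symm, h4.trans ?_⟩
    rw [h2, h1]
    simp only [Configuration.scale, Pi.smul_apply]
    module
  have hsub : ∀ b x, IsArm T lab b x →
      segment ℝ (pos' b) (pos' x) ⊆ segment ℝ (pos b) (pos x) := by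
    intro b x h
    obtain ⟨h1, h2⟩ := key b x h
    refine (convex_segment _ _).segment_subset (h1 ▸ left_mem_segment _ _ _) ?_
    exact mem_segment_iff_exists.2 ⟨s, hs.le, hs1, h2⟩
  refine ⟨fun b x h h' => ?_, fun b x b' x' h h' hne z hz hz' => ?_, hp'.straight hμ,
    hp'.nodepos hT⟩
  · obtain ⟨h1, h2⟩ := key b x h
    rw [h1, h2, add_eq_left, smul_eq_zero] at h'
    exact hA.ne b x h (sub_eq_zero.1 (h'.resolve_left hs.ne'))
  · rw [(key b x h).1, (key b' x' h').1]
    exact hA.apart b x b' x' h h' hne z (hsub b x h hz) (hsub b' x' h' hz')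

/-- Short arms of an admissible configuration are apart: arms of one node point in different
directions, and different nodes have a positive distance. -/
lemma Realizes.eventually_armsApart (hT : Shape T lab) {p : Configuration}
    (hp : IsAdmissible lab p) {F : ℝ → VertexName → Fin 3 → ℝ}
    (hF : ∀ s, Realizes T lab (p.scale s) (F s)) :
    ∀ᶠ s in 𝓝[>] (0 : ℝ), ArmsApart T lab (F s) := by
  have hd0 : ∀ b, lab b ≠ none → p.2.1 b ≠ 0 := by
    intro b hb
    obtain ⟨b', hne, hbb, -⟩ := hT.two b hb
    exact (hp.indep b b' hb hbb.symm hne.symm).ne_zero 0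
  have hfin : {q : VertexName × VertexName | IsArm T lab q.1 q.2}.Finite := by
    refine ((edgeSet_finite T).union ((edgeSet_finite T).image Prod.swap)).subset ?_
    rintro ⟨b, x⟩ ⟨-, h | h⟩
    exacts [Or.inr ⟨_, h, rfl⟩, Or.inl h]
  have hfar : ∀ᶠ s in 𝓝[>] (0 : ℝ), ∀ q ∈ {q : VertexName × VertexName | IsArm T lab q.1 q.2},
      ∀ q' ∈ {q : VertexName × VertexName | IsArm T lab q.1 q.2}, lab q.1 ≠ lab q'.1 →
      ∀ z ∈ segment ℝ (F s q'.1) (F s q'.2), z ∉ segment ℝ (F s q.1) (F s q.2) := by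
    rw [eventually_all_finite hfin]
    intro q hq
    rw [eventually_all_finite hfin]
    intro q' hq'
    by_cases hne : lab q.1 = lab q'.1
    · exact Eventually.of_forall fun s h => absurd hne h
    have hlim : ∀ b x l, IsArm T lab b x → lab b = some l →
        Tendsto (fun s => F s b) (𝓝[>] (0 : ℝ)) (𝓝 (p.1 l)) ∧
        Tendsto (fun s => F s x) (𝓝[>] (0 : ℝ)) (𝓝 (p.1 l)) := by
      intro b x l h hl
      obtain ⟨σ, -, hσ⟩ := h.exists_factor
      constructor
      · exact tendsto_const_nhds.congr fun s => (hσ _ _ (hF s) l hl).1.symm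
      · refine (tendsto_add_smul (p.1 l) (σ (p.2.2 b) • p.2.1 b)).congr fun s => ?_
        rw [(hσ _ _ (hF s) l hl).2]
        simp only [Configuration.scale, Pi.smul_apply]
        module
    obtain ⟨l, hl⟩ := Option.ne_none_iff_exists'.1 hq.1
    obtain ⟨l', hl'⟩ := Option.ne_none_iff_exists'.1 hq'.1
    have h1 := hlim _ _ l hq hl
    have h2 := hlim _ _ l' hq' hl'
    have hc := hp.inj q.1 q'.1 l l' hl hl' fun h => hne (by rw [hl, hl', h])
    refine (eventually_triangle_segment_disjoint h1.1 h1.2 h1.2 h2.1 h2.2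
      fun z hz hzt => ?_).mono fun s h _ z hz hz' =>
        h z hz (segment_subset_triangle_base _ _ _ hz')
    have hzt := triangle_subset_segment_of_mem (left_mem_segment ℝ _ _) hzt
    rw [segment_same, Set.mem_singleton_iff] at hz hzt
    exact hc (hzt.symm.trans hz)
  filter_upwards [hfar, self_mem_nhdsWithin] with s hs hs0
  have hs0 : s ≠ 0 := (Set.mem_Ioi.1 hs0).ne'
  refine ⟨fun b x h hbx => ?_, fun b x b' x' h h' hne z hz hz' => ?_, (hF s).straight hp.pos,
    (hF s).nodepos hT⟩
  · obtain ⟨l, hl⟩ := Option.ne_none_iff_exists'.1 h.1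
    obtain ⟨σ, hσ0, hσ⟩ := h.exists_factor
    obtain ⟨h1, h2⟩ := hσ _ _ (hF s) l hl
    rw [h1, h2, add_eq_left, smul_eq_zero] at hbx
    rcases hbx with hbx | hbx
    · exact hσ0 _ (hp.pos b h.1) hbx
    · exact hd0 b h.1 ((smul_eq_zero.1 hbx).resolve_left hs0)
  · have hll : lab b = lab b' := by
      by_contra hll
      exact hs (b, x) h (b', x') h' hll z hz' hz
    obtain ⟨l, hl⟩ := Option.ne_none_iff_exists'.1 h.1
    have hl' : lab b' = some l := hll ▸ hl
    have hbb : F s b = F s b' := (hF s).nodepos hT b b' h.1 hll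
    suffices hzb : z = F s b from ⟨hzb, hzb.trans hbb, hll⟩
    obtain ⟨t, ht0, -, ht⟩ := mem_segment_iff_exists.1 hz
    obtain ⟨t', ht0', -, ht'⟩ := mem_segment_iff_exists.1 hz'
    by_cases hb : b = b'
    · subst hb
      -- the two arms at one passage point in opposite directions
      have hopp : ∀ u w (r r' : ℝ), (u, b) ∈ edgeSet T → (b, w) ∈ edgeSet T → 0 ≤ r → 0 ≤ r' →
          z = F s b + r • (F s u - F s b) → z = F s b + r' • (F s w - F s b) → z = F s b := by
        intro u w r r' hu hw hr hr' h1 h2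
        obtain ⟨e1, e2, e3⟩ := hF s u b w l hu hw hl
        have hμ := hp.pos b h.1
        rw [h1] at h2
        rw [e1, e2, e3] at h2
        simp only [Configuration.scale, Pi.smul_apply] at h2
        have h0 : ((r + r' * p.2.2 b) * s) • p.2.1 b = 0 := by
          linear_combination (norm := module) -h2
        have h3 : r + r' * p.2.2 b = 0 := by
          simpa [hs0, hd0 b h.1] using h0
        have : 0 ≤ r' * p.2.2 b := by positivity
        rw [h1, show r = 0 by linarith, zero_smul, add_zero]
      rcases h.2 with hx | hx <;> rcases h'.2 with hx' | hx'
      · exact absurd (hT.prev_eq hx hx') hne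
      · exact hopp x x' t t' hx hx' ht0 ht0' ht ht'
      · exact hopp x' x t' t hx' hx ht0' ht0 ht' ht
      · exact absurd (hT.next_eq hx hx') hne
    · obtain ⟨σ, hσ0, hσ⟩ := h.exists_factor
      obtain ⟨σ', -, hσ'⟩ := h'.exists_factor
      obtain ⟨h1, h2⟩ := hσ _ _ (hF s) l hl
      obtain ⟨h3, h4⟩ := hσ' _ _ (hF s) l hl'
      have heq := ht.symm.trans ht'
      rw [h1, h2, h3, h4] at heq
      simp only [Configuration.scale, Pi.smul_apply] at heq
      have := (LinearIndependent.pair_iff.1 (hp.indep b b' h.1 hll hb))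
        (t * σ (p.2.2 b) * s) (-(t' * σ' (p.2.2 b') * s))
        (by linear_combination (norm := module) heq)
      have ht0 : t = 0 := by
        simpa [hs0, hσ0 _ (hp.pos b h.1)] using this.1
      rw [ht, ht0, zero_smul, add_zero]

lemma Configuration.scale_one (p : Configuration) : p.scale 1 = p := by
  simp [Configuration.scale]

variable [CommRing R] {k : ℕ}

lemma RealizedValue.unique (hv : IsVassilievInvariant v) (hk : IsOfFiniteType k v)
    (hcard : {l | ∃ u, lab u = some l}.ncard = k) (hT : Shape T lab) {p : Configuration} {r r' : R}
    (h : RealizedValue v T lab p r) (h' : RealizedValue v T lab p r') : r = r' := by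
  obtain ⟨pos, hG, hp, rfl⟩ := h
  obtain ⟨pos', hG', hp', rfl⟩ := h'
  exact hv.valueOf_eq_of_agree hk hcard hT hG hG' fun x _ hx => hp.eq hT hp' hx

/-- Shortening the arms does not change the value. -/
lemma RealizedValue.scale (hv : IsVassilievInvariant v) (hk : IsOfFiniteType k v)
    (hcard : {l | ∃ u, lab u = some l}.ncard = k) (hT : Shape T lab) (hS : Spread T lab)
    {p : Configuration} (hμ : ∀ b, lab b ≠ none → 0 < p.2.2 b) {r : R}
    (h : RealizedValue v T lab p r) {s : ℝ} (hs : 0 < s) (hs1 : s ≤ 1) :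
    RealizedValue v T lab (p.scale s) r := by
  obtain ⟨pos, hG, hp, hr⟩ := h
  obtain ⟨F, -, hF, -⟩ := exists_realization hT hS pos
  have hc : Continuous fun s : ℝ => p.scale s :=
    Configuration.continuous_scale.comp (by fun_prop : Continuous fun s : ℝ => (s, p))
  have h1 : RealizedValue v T lab (p.scale 1) r := by
    rw [p.scale_one]
    exact ⟨pos, hG, hp, hr⟩
  refine IsPreconnected.constant_of_rel (Val := RealizedValue v T lab)
    (isPreconnected_Ioc.image _ hc.continuousOn) ?_ (fun x _ y y' => ?_) ?_
    ⟨1, ⟨one_pos, le_rfl⟩, rfl⟩ ⟨s, ⟨hs, hs1⟩, rfl⟩ h1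
  · rintro _ ⟨s, ⟨hs, hs1⟩, rfl⟩
    exact ((hG.armsApart hS).scale hT hp hμ hs hs1 (hF (p.scale s))).exists_realizedValue hT hS
      (hF _)
  · exact RealizedValue.unique hv hk hcard hT
  · rintro _ ⟨s, -, rfl⟩ y hy
    rw [eventually_nhdsWithin_iff]
    filter_upwards [hy.eventually hv hT hS] with p' hp'
    rintro ⟨s', -, rfl⟩
    exact hp' hμ

/-- The value depends neither on the arm length, since arms can be shortened, nor on the free
vertices. -/
lemma ShortArmValue.unique (hv : IsVassilievInvariant v) (hk : IsOfFiniteType k v)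
    (hcard : {l | ∃ u, lab u = some l}.ncard = k) (hT : Shape T lab) (hS : Spread T lab)
    {p : Configuration} (hμ : ∀ b, lab b ≠ none → 0 < p.2.2 b) {r r' : R}
    (h : ShortArmValue v T lab p r) (h' : ShortArmValue v T lab p r') : r = r' := by
  obtain ⟨s, hs, h⟩ := h
  obtain ⟨s', hs', h'⟩ := h'
  have key : ∀ t t' : ℝ, 0 < t → 0 < t' → t ≤ t' → ∀ y, RealizedValue v T lab (p.scale t') y →
      RealizedValue v T lab (p.scale t) y := by
    intro t t' ht ht' htt y hy
    have := RealizedValue.scale (p := p.scale t') hv hk hcard hT hS hμ hy (s := t / t')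
      (by positivity) ((div_le_one ht').2 htt)
    rwa [Configuration.scale_scale, div_mul_cancel₀ _ ht'.ne'] at this
  rcases le_total s s' with hss | hss
  · exact h.unique hv hk hcard hT (key s s' hs hs' hss r' h')
  · exact (key s' s hs' hs hss r h).unique hv hk hcard hT h'

/-- The value does not change along a connected set of admissible configurations. -/
lemma ShortArmValue.of_isPreconnected (hv : IsVassilievInvariant v) (hk : IsOfFiniteType k v)
    (hcard : {l | ∃ u, lab u = some l}.ncard = k) (hT : Shape T lab) (hS : Spread T lab)
    {C : Set Configuration} (hC : IsPreconnected C) (hadm : ∀ p ∈ C, IsAdmissible lab p)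
    {p p' : Configuration} (hp : p ∈ C) (hp' : p' ∈ C) {r : R} (h : ShortArmValue v T lab p r) :
    ShortArmValue v T lab p' r := by
  refine hC.constant_of_rel (fun q hq => ?_)
    (fun q hq y y' => ShortArmValue.unique hv hk hcard hT hS (hadm q hq).pos) ?_ hp hp' h
  · obtain ⟨F, -, hF, -⟩ := exists_realization hT hS fun _ => 0
    have := Realizes.eventually_armsApart hT (hadm q hq) fun s => hF (q.scale s)
    obtain ⟨s, hA, hs⟩ := (this.and self_mem_nhdsWithin).exists
    obtain ⟨y, hy⟩ := hA.exists_realizedValue (v := v) hT hS (hF _)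
    exact ⟨y, s, hs, hy⟩
  · rintro q - y ⟨s, hs, hy⟩
    have hc : Continuous fun q : Configuration => q.scale s :=
      Configuration.continuous_scale.comp (by fun_prop : Continuous fun q : Configuration => (s, q))
    rw [eventually_nhdsWithin_iff]
    filter_upwards [(hc.tendsto q).eventually (hy.eventually hv hT hS)] with q' hq' hqC
    exact ⟨s, hs, hq' (hadm q' hqC).pos⟩

lemma ShortArmValue.congr {p p' : Configuration}
    (h : ∀ b l, lab b = some l → p.1 l = p'.1 l ∧ p.2.1 b = p'.2.1 b ∧ p.2.2 b = p'.2.2 b) {r : R}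
    (hr : ShortArmValue v T lab p r) : ShortArmValue v T lab p' r := by
  obtain ⟨s, hs, pos, hG, hp, hval⟩ := hr
  refine ⟨s, hs, pos, hG, fun u b w l hu hw hl => ?_, hval⟩
  obtain ⟨h1, h2, h3⟩ := h b l hl
  have := hp u b w l hu hw hl
  simpa only [Configuration.scale, Pi.smul_apply, h1, h2, h3] using this

lemma exists_injective_avoiding {α : Type*} [Countable α] {S : Set ℝ} (hS : S.Finite) :
    ∃ s : α → ℝ, Function.Injective s ∧ ∀ a, s a ∉ S := by
  obtain ⟨e, he⟩ := exists_injective_nat α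
  refine ⟨fun a => hS.infinite_compl.natEmbedding _ (e a), fun a b h => ?_,
    fun a => (hS.infinite_compl.natEmbedding _ (e a)).2⟩
  exact he ((hS.infinite_compl.natEmbedding _).injective (Subtype.ext h))

/-- The nodes can be moved to other positions, one after the other, in the complement of the
finitely many other nodes. -/
lemma ShortArmValue.move_nodes (hv : IsVassilievInvariant v) (hk : IsOfFiniteType k v)
    (hcard : {l | ∃ u, lab u = some l}.ncard = k) (hT : Shape T lab) (hS : Spread T lab)
    {p : Configuration} (hp : IsAdmissible lab p) {c : ℕ → Fin 3 → ℝ}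
    (hc : ∀ l l', (∃ b, lab b = some l) → (∃ b, lab b = some l') → c l ≠ p.1 l')
    (hc' : IsAdmissible lab (c, p.2)) {r : R} (h : ShortArmValue v T lab p r) :
    ShortArmValue v T lab (c, p.2) r := by
  have hfin := labels_finite hT
  suffices H : ∀ A : Finset ℕ, (∀ l ∈ A, ∃ b, lab b = some l) →
      ShortArmValue v T lab (fun l => if l ∈ A then c l else p.1 l, p.2) r by
    have hH := H hfin.toFinset fun l hl => by simpa using hl
    refine hH.congr ?_
    refine fun b l hl => ⟨?_, rfl, rfl⟩
    exact if_pos ((Set.Finite.mem_toFinset hfin).2 ⟨b, hl⟩)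
  have hadm : ∀ A : Finset ℕ, ∀ l₀ y, (∀ b' l', lab b' = some l' → l' ≠ l₀ →
      (if l' ∈ A then c l' else p.1 l') ≠ y) → (∀ l ∈ A, ∃ b, lab b = some l) →
      IsAdmissible lab (Function.update (fun l => if l ∈ A then c l else p.1 l) l₀ y, p.2) := by
    intro A l₀ y hy hA
    refine ⟨fun b b' l l' hl hl' hne => ?_, hp.indep, hp.pos⟩
    simp only
    by_cases h1 : l = l₀
    · subst h1
      rw [Function.update_self, Function.update_of_ne (Ne.symm hne)]
      exact (hy b' l' hl' (Ne.symm hne)).symm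
    by_cases h2 : l' = l₀
    · subst h2
      rw [Function.update_self, Function.update_of_ne hne]
      exact hy b l hl hne
    rw [Function.update_of_ne h1, Function.update_of_ne h2]
    split_ifs
    · exact hc'.inj b b' l l' hl hl' hne
    · exact hc l l' ⟨b, hl⟩ ⟨b', hl'⟩
    · exact (hc l' l ⟨b', hl'⟩ ⟨b, hl⟩).symm
    · exact hp.inj b b' l l' hl hl' hne
  intro A
  induction A using Finset.induction_on with
  | empty => exact fun _ => by simpa using h
  | insert l₀ A hl₀ ih =>
    intro hA
    have hA' : ∀ l ∈ A, ∃ b, lab b = some l := fun l hl => hA l (Finset.mem_insert_of_mem hl)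
    obtain ⟨b₀, hb₀⟩ := hA l₀ (Finset.mem_insert_self _ _)
    set q : ℕ → Fin 3 → ℝ := fun l => if l ∈ A then c l else p.1 l with hq
    have hupd : (fun l => if l ∈ Insert.insert l₀ A then c l else p.1 l) =
        Function.update q l₀ (c l₀) := by
      funext l
      by_cases hl : l = l₀
      · subst hl; simp
      · simp [hl, hq]
    have hself : q = Function.update q l₀ (p.1 l₀) := by
      rw [show p.1 l₀ = q l₀ by simp [hq, hl₀], Function.update_eq_self]
    set Z : Set (Fin 3 → ℝ) := q '' ({l | ∃ b, lab b = some l} \ {l₀}) with hZ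
    have hZ' : IsPreconnected Zᶜ :=
      (Set.Countable.isConnected_compl_of_one_lt_rank (by simp)
        ((hfin.sdiff.image q).countable)).isPreconnected
    have hmem : ∀ y, y ∈ Zᶜ ↔ ∀ b' l', lab b' = some l' → l' ≠ l₀ → q l' ≠ y := by
      intro y
      constructor
      · exact fun hy b' l' hl' hne h => hy ⟨l', ⟨⟨b', hl'⟩, hne⟩, h⟩
      · rintro hy ⟨l', ⟨⟨b', hl'⟩, hne⟩, h⟩
        exact hy b' l' hl' hne h
    rw [hupd]
    have hcu : Continuous fun y : Fin 3 → ℝ => Function.update q l₀ y :=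
      continuous_const.update l₀ continuous_id
    have hcont : Continuous fun y : Fin 3 → ℝ => ((Function.update q l₀ y, p.2) : Configuration) :=
      hcu.prodMk continuous_const
    refine ShortArmValue.of_isPreconnected hv hk hcard hT hS (hZ'.image _ hcont.continuousOn) ?_
      ⟨p.1 l₀, (hmem _).2 ?_, rfl⟩ ⟨c l₀, (hmem _).2 ?_, rfl⟩ (by
        have := ih hA'
        rw [hself] at this
        exact this)
    · rintro _ ⟨y, hy, rfl⟩
      exact hadm A l₀ y ((hmem y).1 hy) hA'
    · intro b' l' hl' hne
      simp only [hq]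
      split_ifs
      exacts [hc l' l₀ ⟨b', hl'⟩ ⟨b₀, hb₀⟩, hp.inj b' b₀ l' l₀ hl' hb₀ hne]
    · intro b' l' hl' hne
      simp only [hq]
      split_ifs
      exacts [hc'.inj b' b₀ l' l₀ hl' hb₀ hne, (hc l₀ l' ⟨b₀, hb₀⟩ ⟨b', hl'⟩).symm]

lemma isPreconnected_setOf_linearIndependent {w : Fin 3 → ℝ} (hw : w ≠ 0) :
    IsPreconnected {y : Fin 3 → ℝ | LinearIndependent ℝ ![y, w]} := by
  have h : {y : Fin 3 → ℝ | LinearIndependent ℝ ![y, w]} = (Submodule.span ℝ {w} : Set _)ᶜ := by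
    ext y
    simp only [Set.mem_ofPred_eq, Set.mem_compl_iff, SetLike.mem_coe, Submodule.mem_span_singleton]
    rw [LinearIndependent.pair_symm_iff, LinearIndependent.pair_iff' hw]
    push Not
    rfl
  rw [h]
  refine (isConnected_compl_of_one_lt_codim ?_).isPreconnected
  rw [← Module.finrank_eq_rank, Nat.one_lt_cast]
  have := Submodule.finrank_quotient_add_finrank (Submodule.span ℝ {w})
  rw [finrank_span_singleton hw, Module.finrank_fin_fun] at this
  omega

/-- The strands at the nodes can be turned to other directions, one after the other, in the
complement of the line of the other strand. -/
lemma ShortArmValue.turn_strands (hv : IsVassilievInvariant v) (hk : IsOfFiniteType k v)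
    (hcard : {l | ∃ u, lab u = some l}.ncard = k) (hT : Shape T lab) (hS : Spread T lab)
    {p : Configuration} (hp : IsAdmissible lab p) {d : VertexName → Fin 3 → ℝ}
    (hd : ∀ b b', lab b ≠ none → lab b = lab b' → b ≠ b' → LinearIndependent ℝ ![d b, p.2.1 b'])
    (hd' : IsAdmissible lab (p.1, d, p.2.2)) {r : R} (h : ShortArmValue v T lab p r) :
    ShortArmValue v T lab (p.1, d, p.2.2) r := by
  have hfin : {b | lab b ≠ none}.Finite := (names_finite T).subset fun b hb => hT.supp b hb
  suffices H : ∀ A : Finset VertexName, (∀ b ∈ A, lab b ≠ none) →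
      ShortArmValue v T lab (p.1, fun b => if b ∈ A then d b else p.2.1 b, p.2.2) r by
    have hH := H hfin.toFinset fun l hl => by simpa using hl
    refine hH.congr ?_
    refine fun b l hl => ⟨rfl, ?_, rfl⟩
    exact if_pos ((Set.Finite.mem_toFinset _).2 (by rw [Set.mem_ofPred_eq, hl]; simp))
  intro A
  induction A using Finset.induction_on with
  | empty => exact fun _ => by simpa using h
  | insert b₀ A hb₀ ih =>
    intro hA
    have hl₀ := hA b₀ (Finset.mem_insert_self _ _)
    obtain ⟨b₁, hne, hl₁, huniq⟩ := hT.two b₀ hl₀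
    set q : VertexName → Fin 3 → ℝ := fun b => if b ∈ A then d b else p.2.1 b with hq
    have hupd : (fun b => if b ∈ Insert.insert b₀ A then d b else p.2.1 b) =
        Function.update q b₀ (d b₀) := by
      funext b
      by_cases hb : b = b₀
      · subst hb; simp
      · simp [hb, hq]
    have hself : q = Function.update q b₀ (p.2.1 b₀) := by
      rw [show p.2.1 b₀ = q b₀ by simp [hq, hb₀], Function.update_eq_self]
    have hind : ∀ b b', lab b ≠ none → lab b = lab b' → b ≠ b' →
        LinearIndependent ℝ ![q b, q b'] := by
      intro b b' hb hbb hne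
      simp only [hq]
      split_ifs
      · exact hd'.indep b b' hb hbb hne
      · exact hd b b' hb hbb hne
      · exact LinearIndependent.pair_symm_iff.1 (hd b' b (hbb ▸ hb) hbb.symm hne.symm)
      · exact hp.indep b b' hb hbb hne
    have h0 : q b₁ ≠ 0 := (hind b₀ b₁ hl₀ hl₁.symm hne.symm).ne_zero 1
    rw [hupd]
    have hcu : Continuous fun y : Fin 3 → ℝ => Function.update q b₀ y :=
      continuous_const.update b₀ continuous_id
    have hcont : Continuous fun y : Fin 3 → ℝ =>
        ((p.1, Function.update q b₀ y, p.2.2) : Configuration) :=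
      continuous_const.prodMk (hcu.prodMk continuous_const)
    refine ShortArmValue.of_isPreconnected hv hk hcard hT hS
      ((isPreconnected_setOf_linearIndependent h0).image _ hcont.continuousOn) ?_
      ⟨p.2.1 b₀, ?_, rfl⟩ ⟨d b₀, ?_, rfl⟩ (by
        have := ih fun b hb => hA b (Finset.mem_insert_of_mem hb)
        rw [hself] at this
        exact this)
    · rintro _ ⟨y, hy, rfl⟩
      refine ⟨hp.inj, fun b b' hb hbb hbne => ?_, hp.pos⟩
      simp only
      by_cases h1 : b = b₀
      · subst h1
        obtain rfl := (huniq b' hbb.symm).resolve_left hbne.symm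
        rw [Function.update_self, Function.update_of_ne hne]
        exact hy
      by_cases h2 : b' = b₀
      · subst h2
        obtain rfl := (huniq b hbb).resolve_left hbne
        rw [Function.update_self, Function.update_of_ne hne]
        exact LinearIndependent.pair_symm_iff.1 hy
      rw [Function.update_of_ne h1, Function.update_of_ne h2]
      exact hind b b' hb hbb hbne
    · have := hind b₀ b₁ hl₀ hl₁.symm hne.symm
      rwa [show q b₀ = p.2.1 b₀ by simp [hq, hb₀]] at this
    · show LinearIndependent ℝ ![d b₀, q b₁]
      simp only [hq]
      split_ifs
      exacts [hd'.indep b₀ b₁ hl₀ hl₁.symm hne.symm, hd b₀ b₁ hl₀ hl₁.symm hne.symm]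

/-- All admissible configurations have the same value. They are connected through nodes on one
line and directions in one plane that are generic with respect to both. -/
lemma ShortArmValue.of_isAdmissible (hv : IsVassilievInvariant v) (hk : IsOfFiniteType k v)
    (hcard : {l | ∃ u, lab u = some l}.ncard = k) (hT : Shape T lab) (hS : Spread T lab)
    {p p' : Configuration} (hp : IsAdmissible lab p) (hp' : IsAdmissible lab p') {r : R}
    (h : ShortArmValue v T lab p r) : ShortArmValue v T lab p' r := by
  have hfin := labels_finite hT
  have hfinb : {b | lab b ≠ none}.Finite := (names_finite T).subset fun b hb => hT.supp b hb
  obtain ⟨s, hs, hsav⟩ := exists_injective_avoiding (α := ℕ)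
    ((hfin.image fun l => p.1 l 0).union (hfin.image fun l => p'.1 l 0))
  obtain ⟨t, ht, htav⟩ := exists_injective_avoiding (α := VertexName)
    ((hfinb.image fun b => p.2.1 b 1 / p.2.1 b 0).union
      (hfinb.image fun b => p'.2.1 b 1 / p'.2.1 b 0))
  set c : ℕ → Fin 3 → ℝ := fun l => ![s l, 0, 0] with hc
  set d : VertexName → Fin 3 → ℝ := fun b => ![1, t b, 0] with hd
  have hcc : ∀ l l', l ≠ l' → c l ≠ c l' := fun l l' hne h =>
    hne (hs (by simpa [hc] using congrFun h 0))
  have hli : ∀ (x : ℝ) (w : Fin 3 → ℝ), w ≠ 0 → x ≠ w 1 / w 0 →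
      LinearIndependent ℝ ![![1, x, 0], w] := by
    intro x w hw hx
    rw [LinearIndependent.pair_iff]
    intro α β h
    have e0 := congrFun h 0
    have e1 := congrFun h 1
    have e2 := congrFun h 2
    simp at e0 e1 e2
    have hβ : β = 0 := by
      by_contra hβ
      have hw2 : w 2 = 0 := e2.resolve_left hβ
      have hw1 : w 1 = x * w 0 := mul_left_cancel₀ hβ (by linear_combination e1 - x * e0)
      by_cases hw0 : w 0 = 0
      · refine hw (funext fun i => ?_)
        fin_cases i
        exacts [hw0, by simpa [hw0] using hw1, hw2]
      · exact hx (by rw [hw1, mul_div_cancel_right₀ _ hw0])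
    subst hβ
    exact ⟨by simpa using e0, rfl⟩
  have hdd : ∀ b b', b ≠ b' → LinearIndependent ℝ ![d b, d b'] := by
    intro b b' hne
    refine hli _ _ (fun h => by simpa [hd] using congrFun h 0) ?_
    simpa [hd] using fun h => hne (ht h)
  have hdir : ∀ q : Configuration, IsAdmissible lab q →
      (∀ b, lab b ≠ none → ∀ a, t a ≠ q.2.1 b 1 / q.2.1 b 0) →
      ∀ b b', lab b ≠ none → lab b = lab b' → b ≠ b' →
        LinearIndependent ℝ ![d b, q.2.1 b'] := by
    intro q hq hav b b' hb hbb hne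
    exact hli _ _ ((hq.indep b b' hb hbb hne).ne_zero 1) (hav b' (hbb ▸ hb) b)
  have hd₁ := hdir p hp fun b hb a h => htav a (Or.inl ⟨b, hb, h.symm⟩)
  have hd₂ := hdir p' hp' fun b hb a h => htav a (Or.inr ⟨b, hb, h.symm⟩)
  have hc₁ : ∀ l l', (∃ b, lab b = some l) → (∃ b, lab b = some l') → c l ≠ p.1 l' :=
    fun l l' _ hl' h => hsav l (Or.inl ⟨l', hl', (congrFun h 0).symm⟩)
  have hc₂ : ∀ l l', (∃ b, lab b = some l) → (∃ b, lab b = some l') → p'.1 l ≠ c l' :=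
    fun l l' hl _ h => hsav l' (Or.inr ⟨l, hl, congrFun h 0⟩)
  have a₁ : IsAdmissible lab (c, p.2) := ⟨fun _ _ l l' _ _ => hcc l l', hp.indep, hp.pos⟩
  have a₂ : IsAdmissible lab (c, d, p.2.2) :=
    ⟨a₁.inj, fun b b' _ _ => hdd b b', hp.pos⟩
  have a₃ : IsAdmissible lab (c, d, p'.2.2) := ⟨a₁.inj, a₂.indep, hp'.pos⟩
  have a₄ : IsAdmissible lab (c, p'.2) := ⟨a₁.inj, hp'.indep, hp'.pos⟩
  have h₁ := h.move_nodes hv hk hcard hT hS hp hc₁ a₁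
  have h₂ := h₁.turn_strands hv hk hcard hT hS a₁ hd₁ a₂
  have h₃ : ShortArmValue v T lab (c, d, p'.2.2) r := by
    have hconv : IsPreconnected {μ : VertexName → ℝ | ∀ b, lab b ≠ none → 0 < μ b} := by
      refine Convex.isPreconnected fun μ hμ μ' hμ' α β hα hβ hαβ b hb => ?_
      exact (convex_Ioi (0 : ℝ)) (hμ b hb) (hμ' b hb) hα hβ hαβ
    have hcont : Continuous fun μ : VertexName → ℝ => ((c, d, μ) : Configuration) := by fun_prop
    refine ShortArmValue.of_isPreconnected hv hk hcard hT hS (hconv.image _ hcont.continuousOn) ?_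
      ⟨p.2.2, hp.pos, rfl⟩ ⟨p'.2.2, hp'.pos, rfl⟩ h₂
    rintro _ ⟨μ, hμ, rfl⟩
    exact ⟨a₁.inj, a₂.indep, hμ⟩
  have h₄ : ShortArmValue v T lab (c, p'.2) r :=
    ShortArmValue.turn_strands (p := (c, d, p'.2.2)) (d := p'.2.1) hv hk hcard hT hS a₃
      (fun b b' hb hbb hne => LinearIndependent.pair_symm_iff.1
        (hd₂ b' b (hbb ▸ hb) hbb.symm hne.symm)) a₄ h₃
  exact ShortArmValue.move_nodes (p := (c, p'.2)) (c := p'.1) hv hk hcard hT hS a₄ hc₂ hp' h₄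

/-- Every good diagram realizes an admissible configuration. -/
lemma Good.exists_configuration (hT : Shape T lab) (hS : Spread T lab)
    (hG : Good (edgeSet T) lab pos) :
    ∃ p, IsAdmissible lab p ∧ Realizes T lab p pos := by
  have hc : ∀ l, ∃ C : Fin 3 → ℝ, ∀ b, lab b = some l → pos b = C := by
    intro l
    by_cases h : ∃ b, lab b = some l
    · obtain ⟨b, hb⟩ := h
      exact ⟨pos b, fun b' hb' => hG.nodepos b' b (by simp [hb']) (by rw [hb, hb'])⟩
    · exact ⟨0, fun b hb => absurd ⟨b, hb⟩ h⟩
  have hd : ∀ b, ∃ (D : Fin 3 → ℝ) (μ : ℝ), 0 < μ ∧ (lab b ≠ none →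
      ∀ u w, (u, b) ∈ edgeSet T → (b, w) ∈ edgeSet T →
      pos u = pos b - D ∧ pos w = pos b + μ • D) := by
    intro b
    by_cases hb : lab b = none
    · exact ⟨0, 1, one_pos, fun h => absurd hb h⟩
    obtain ⟨w, hw⟩ := exists_next_edge (hT.supp b hb)
    obtain ⟨u, hu⟩ := exists_prev_edge (hT.supp b hb)
    obtain ⟨t, ht0, ht1, ht⟩ := mem_openSegment_iff_exists.1 (hG.straight u b w hu hw hb)
    refine ⟨pos b - pos u, (1 - t) / t, div_pos (by linarith) ht0, fun _ u' w' hu' hw' => ?_⟩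
    obtain rfl := hT.prev_eq hu hu'
    obtain rfl := hT.next_eq hw hw'
    refine ⟨by module, ?_⟩
    rw [ht, add_sub_cancel_left, smul_smul, div_mul_cancel₀ _ ht0.ne']
    module
  choose c hc using hc
  choose d μ hμ hd using hd
  refine ⟨(c, d, μ), ⟨?_, ?_, fun b _ => hμ b⟩, ?_⟩
  · intro b b' l l' hl hl' hne h
    simp only at h
    obtain ⟨x, hx⟩ := exists_next_edge (hT.supp b (by simp [hl]))
    obtain ⟨x', hx'⟩ := exists_next_edge (hT.supp b' (by simp [hl']))
    have hb : IsArm T lab b x := ⟨by simp [hl], Or.inr hx⟩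
    have hb' : IsArm T lab b' x' := ⟨by simp [hl'], Or.inr hx'⟩
    have hxx : x ≠ x' := by
      rintro rfl
      obtain rfl := hS.arm_unique hT hb hb'
      exact hne (Option.some_inj.1 (hl.symm.trans hl'))
    have := ((hG.armsApart hS).apart b x b' x' hb hb' hxx (pos b) (left_mem_segment _ _ _)
      (by rw [hc l b hl, h, ← hc l' b' hl']; exact left_mem_segment _ _ _)).2.2
    exact hne (Option.some_inj.1 (hl.symm.trans (this.trans hl')))
  · intro b b' hb hbb hne
    obtain ⟨w, hw⟩ := exists_next_edge (hT.supp b hb)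
    obtain ⟨u, hu⟩ := exists_prev_edge (hT.supp b hb)
    obtain ⟨w', hw'⟩ := exists_next_edge (hT.supp b' (hbb ▸ hb))
    obtain ⟨u', hu'⟩ := exists_prev_edge (hT.supp b' (hbb ▸ hb))
    have hli := hG.linearIndependent_strands hb hbb hne hu hw hu' hw'
    obtain ⟨h1, h2⟩ := hd b hb u w hu hw
    obtain ⟨h3, h4⟩ := hd b' (hbb ▸ hb) u' w' hu' hw'
    rw [LinearIndependent.pair_iff] at hli ⊢
    intro α β h
    have hμb := hμ b
    have hμb' := hμ b'
    have := hli (α / (1 + μ b)) (β / (1 + μ b')) (by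
      rw [h1, h2, h3, h4, show pos b + μ b • d b - (pos b - d b) = (1 + μ b) • d b by module,
        show pos b' + μ b' • d b' - (pos b' - d b') = (1 + μ b') • d b' by module, smul_smul,
        smul_smul, div_mul_cancel₀ _ (by positivity), div_mul_cancel₀ _ (by positivity)]
      exact h)
    simpa [(by positivity : (1 + μ b) ≠ 0), (by positivity : (1 + μ b') ≠ 0)] using this
  · intro u b w l hu hw hl
    have := hd b (by simp [hl]) u w hu hw
    simp only [← hc l b hl]
    exact ⟨trivial, this⟩

/-- Two positions of the same diagram have the same value. -/
theorem IsVassilievInvariant.valueOf_eq_of_spread (hv : IsVassilievInvariant v)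
    (hk : IsOfFiniteType k v) (hcard : {l | ∃ u, lab u = some l}.ncard = k) (hT : Shape T lab)
    (hS : Spread T lab) {pos' : VertexName → Fin 3 → ℝ} (hG : Good (edgeSet T) lab pos)
    (hG' : Good (edgeSet T) lab pos') :
    valueOf v (diagram T lab pos) = valueOf v (diagram T lab pos') := by
  obtain ⟨p, hp, hreal⟩ := hG.exists_configuration hT hS
  obtain ⟨p', hp', hreal'⟩ := hG'.exists_configuration hT hS
  have h : ShortArmValue v T lab p (valueOf v (diagram T lab pos)) :=
    ⟨1, one_pos, pos, hG, by rwa [p.scale_one], rfl⟩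
  have h' : ShortArmValue v T lab p' (valueOf v (diagram T lab pos')) :=
    ⟨1, one_pos, pos', hG', by rwa [p'.scale_one], rfl⟩
  exact ShortArmValue.unique hv hk hcard hT hS hp'.pos
    (h.of_isAdmissible hv hk hcard hT hS hp hp') h'

end ConfigurationValue

/-! ### Normal form of the strands -/

section NormalForm

variable {n : ℕ}

/-- Names for the vertices of strands with the given lists of labels: the `j`-th vertex of the
`i`-th strand is named `(i, j)`. -/
def standardNames (L : Fin n → List (Option ℕ)) (i : Fin n) : List VertexName :=
  (List.range (L i).length).map fun j => ((i : ℕ), j)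

/-- The labels of the vertices with standard names. -/
def standardLabel (L : Fin n → List (Option ℕ)) (u : VertexName) : Option ℕ :=
  if h : u.1 < n then ((L ⟨u.1, h⟩)[u.2]?).join else none

lemma mem_standardNames {L : Fin n → List (Option ℕ)} {i : Fin n} {u : VertexName} :
    u ∈ standardNames L i ↔ u.1 = i ∧ u.2 < (L i).length := by
  obtain ⟨u1, u2⟩ := u
  simp only [standardNames, List.mem_map, List.mem_range, Prod.mk.injEq]
  constructor
  · rintro ⟨j, hj, rfl, rfl⟩
    exact ⟨rfl, hj⟩
  · rintro ⟨rfl, h⟩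
    exact ⟨u2, h, rfl, rfl⟩

lemma standardLabel_eq_some {L : Fin n → List (Option ℕ)} {u : VertexName} {a : ℕ} :
    standardLabel L u = some a ↔ ∃ i : Fin n, u.1 = i ∧ (L i)[u.2]? = some (some a) := by
  unfold standardLabel
  split_ifs with h
  · rw [Option.join_eq_some_iff]
    constructor
    · exact fun h' => ⟨⟨u.1, h⟩, rfl, h'⟩
    · rintro ⟨i, hi, h'⟩
      rwa [show (⟨u.1, h⟩ : Fin n) = i from Fin.ext hi]
  · simp only [false_iff, not_exists, not_and]
    exact fun i hi => absurd (hi ▸ i.2) h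

/-- Any embedded graph is a diagram with standard names. -/
lemma EmbeddedGraph.exists_standard_diagram (H : EmbeddedGraph n) {L : Fin n → List (Option ℕ)}
    (hL : ∀ i, (H.comp i).map Prod.snd = L i) :
    Shape (standardNames L) (standardLabel L) ∧
      ∃ pos, H.comp = diagram (standardNames L) (standardLabel L) pos := by
  have hlen : ∀ i, (L i).length = (H.comp i).length := fun i => by rw [← hL i, List.length_map]
  have hcomp : H.comp = diagram (standardNames L) (standardLabel L) fun u =>
      if h : u.1 < n then (((H.comp ⟨u.1, h⟩)[u.2]?).map Prod.fst).getD 0 else 0 := by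
    funext i
    refine List.ext_getElem (by simp [diagram, standardNames, hlen]) fun j h1 h2 => ?_
    simp [diagram, standardNames, standardLabel, ← hL, List.getElem?_eq_getElem h1]
  have hnodup : ∀ i, (standardNames L i).Nodup := fun i =>
    List.nodup_range.map fun a b h => (Prod.mk.inj h).2
  have hdisj : ∀ i j u, u ∈ standardNames L i → u ∈ standardNames L j → i = j := fun i j u hi hj =>
    Fin.ext ((mem_standardNames.1 hi).1.symm.trans (mem_standardNames.1 hj).1)
  have hsupp : ∀ u, standardLabel L u ≠ none → ∃ i, u ∈ standardNames L i := by
    intro u hu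
    obtain ⟨a, ha⟩ := Option.ne_none_iff_exists'.1 hu
    obtain ⟨i, hi, h⟩ := standardLabel_eq_some.1 ha
    exact ⟨i, mem_standardNames.2 ⟨hi, (List.getElem?_eq_some_iff.1 h).1⟩⟩
  refine ⟨⟨fun i h => H.comp_ne_nil i ?_, hnodup, hdisj, hsupp, fun u hu => ?_⟩, _, hcomp⟩
  · rw [hcomp, diagram, h, List.map_nil]
  · obtain ⟨a, ha⟩ := Option.ne_none_iff_exists'.1 hu
    have hlab := allLabels_diagram (standardNames L) (standardLabel L) fun u =>
      if h : u.1 < n then (((H.comp ⟨u.1, h⟩)[u.2]?).map Prod.fst).getD 0 else 0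
    rw [← hcomp] at hlab
    have h2 := H.node_twice a (by
      rw [hlab, List.mem_filterMap]
      exact ⟨u, mem_nameList.2 (hsupp u hu), ha⟩)
    rw [hlab, List.count_filterMap, List.countP_eq_length_filter, List.length_eq_two] at h2
    obtain ⟨x, y, hxy⟩ := h2
    have hmem : ∀ w, standardLabel L w = some a ↔ w = x ∨ w = y := by
      intro w
      have : w ∈ (nameList (standardNames L)).filter (fun w => standardLabel L w == some a) ↔
          w = x ∨ w = y := by rw [hxy]; simp
      rw [← this, List.mem_filter, mem_nameList, beq_iff_eq]
      exact ⟨fun h => ⟨hsupp w (by simp [h]), h⟩, fun h => h.2⟩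
    have hne : x ≠ y := by
      have := (nodup_nameList hnodup hdisj).filter fun w => standardLabel L w == some a
      rw [hxy] at this
      simpa using this
    rcases (hmem u).1 ha with rfl | rfl
    · exact ⟨y, hne.symm, by rw [ha, (hmem y).2 (Or.inr rfl)], fun w hw => (hmem w).1 (hw.trans ha)⟩
    · exact ⟨x, hne, by rw [ha, (hmem x).2 (Or.inl rfl)],
        fun w hw => ((hmem w).1 (hw.trans ha)).symm⟩

variable {R : Type*} [CommRing R] {v : EmbeddedGraph n → R}

/-- The value `r` is taken on a graph whose strands have the cyclic lists of labels `L`. -/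
def HasLabels (v : EmbeddedGraph n → R) (L : Fin n → List (Option ℕ)) (r : R) : Prop :=
  ∃ T lab pos, Shape T lab ∧ Good (edgeSet T) lab pos ∧ (∀ i, (T i).map lab ~r L i) ∧
    valueOf v (diagram T lab pos) = r

lemma List.IsRotated.exists_of_map {α β : Type*} {f : α → β} {l : List α} {m : List β}
    (h : l.map f ~r m) : ∃ l', l ~r l' ∧ l'.map f = m := by
  obtain ⟨k, rfl⟩ := h
  exact ⟨l.rotate k, ⟨k, rfl⟩, List.map_rotate f l k⟩

/-- The value of a graph is also taken on the graph with permuted strands and renamed nodes. -/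
lemma EmbeddedGraph.hasLabels (hv : IsVassilievInvariant v) (G : EmbeddedGraph n)
    (π : Equiv.Perm (Fin n)) (σ : Equiv.Perm ℕ) :
    HasLabels v (fun i => ((G.comp (π i)).map Prod.snd).map (Option.map σ)) (v G) := by
  obtain ⟨hT, pos, hpos⟩ := G.exists_standard_diagram fun i => rfl
  have hG := good_of_embeddedGraph hT G hpos
  set T := standardNames fun i => (G.comp i).map Prod.snd
  set lab := standardLabel fun i => (G.comp i).map Prod.snd
  have hrot : ∀ j, (fun i => T (π i)) (π⁻¹ j) ~r T j := fun j => by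
    have : π (π⁻¹ j) = j := by simp
    beta_reduce
    rw [this]
  refine ⟨fun i => T (π i), relabel σ lab, pos, (hT.of_isRotated hrot).relabel σ, ?_, fun i => ?_, ?_⟩
  · rw [edgeSet_eq_of_isRotated hrot]
    exact hG.relabel σ
  · have : ((G.comp (π i)).map Prod.snd) = (T (π i)).map lab := by
      rw [hpos, diagram, List.map_map]
      rfl
    beta_reduce
    rw [this, List.map_map]
    exact List.IsRotated.refl _
  · rw [← hv.valueOf_isRotated π⁻¹ σ hT hrot hG, valueOf_eq v G hpos]

/-- An unlabelled vertex can be inserted into a strand. -/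
lemma HasLabels.pad (hv : IsVassilievInvariant v) {L : Fin n → List (Option ℕ)} {r : R}
    (h : HasLabels v L r) {i : Fin n} {x : Option ℕ} {t : List (Option ℕ)} (hi : L i ~r x :: t) :
    HasLabels v (Function.update L i (x :: none :: t)) r := by
  obtain ⟨T, lab, pos, hT, hG, hL, rfl⟩ := h
  obtain ⟨l, hl, hlm⟩ := ((hL i).trans hi).exists_of_map
  obtain ⟨a, s, rfl, rfl, rfl⟩ := List.map_eq_cons_iff.1 hlm
  obtain ⟨c, hc, -⟩ := exists_fresh T ∅
  have hlc := hT.lab_fresh hc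
  rcases s with _ | ⟨b, s⟩
  · have : (a, a) ∈ edgeSet T := ⟨i, hl.mem_cyclicPairs.2 (by simp [cyclicPairs])⟩
    exact absurd rfl (hG.nondeg _ this)
  have hab : (a, b) ∈ edgeSet T := ⟨i, hl.mem_cyclicPairs.2 (by simp [cyclicPairs_cons])⟩
  set T' := Function.update T i (a :: c :: b :: s) with hT'
  have hins : IsInsertion 1 T T' a c b := by
    refine ⟨i, s, hl, ?_, fun j hj => ?_⟩
    · rw [hT', Equiv.Perm.one_apply, Function.update_self]
    · rw [hT', Equiv.Perm.one_apply, Function.update_of_ne hj]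
  set ps := Function.update pos c (midpoint ℝ (pos a) (pos b)) with hps
  have hpT : ∀ x, (∃ i, x ∈ T i) → ps x = pos x := fun x hx => by
    rw [hps, Function.update_of_ne]
    rintro rfl
    exact hx.elim hc
  have hGs : Good (edgeSet T) lab ps :=
    hG.congr (fun e he => ⟨hpT _ (fst_mem_of_mem_edgeSet he), hpT _ (snd_mem_of_mem_edgeSet he)⟩)
      fun x hx => hpT x (hT.supp x hx)
  obtain ⟨h1, h2, h3⟩ := hv.subdivide hT hins hc hGs (by
    rw [hpT a (fst_mem_of_mem_edgeSet hab), hpT b (snd_mem_of_mem_edgeSet hab), hps,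
      Function.update_self]
    exact mem_openSegment_iff_exists.2 ⟨1 / 2, by norm_num, by norm_num, by
      rw [midpoint_eq_smul_add, invOf_eq_inv]; module⟩)
  refine ⟨T', lab, ps, h1, h2, fun j => ?_, ?_⟩
  · by_cases hj : j = i
    · subst hj
      rw [hT', Function.update_self, Function.update_self, List.map_cons, List.map_cons, hlc]
    · rw [hT', Function.update_of_ne hj, Function.update_of_ne hj]
      exact hL j
  · rw [← h3, diagram_congr hpT]

/-- The second list arises from the first one by inserting `none` at some places. -/
inductive Pads : List (Option ℕ) → List (Option ℕ) → Prop
  | nil : Pads [] []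
  | cons (x : Option ℕ) {l l' : List (Option ℕ)} : Pads l l' → Pads (x :: l) (x :: l')
  | pad {l l' : List (Option ℕ)} : Pads l l' → Pads l (none :: l')

/-- Subdividing edges of a strand does not change the value. The part `pre` of the strand is already
padded; it is not empty, as every new vertex is inserted behind an old one. -/
lemma HasLabels.of_pads (hv : IsVassilievInvariant v) {i : Fin n} {l l' : List (Option ℕ)}
    (hl : Pads l l') : ∀ {L : Fin n → List (Option ℕ)} {r : R} {pre : List (Option ℕ)}, pre ≠ [] →
      HasLabels v L r → L i ~r pre ++ l → HasLabels v (Function.update L i (pre ++ l')) r := by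
  have hcongr : ∀ {L L' : Fin n → List (Option ℕ)} {r : R}, HasLabels v L r →
      (∀ j, L j ~r L' j) → HasLabels v L' r := by
    rintro L L' r ⟨T, lab, pos, hT, hG, hL, hr⟩ h
    exact ⟨T, lab, pos, hT, hG, fun j => (hL j).trans (h j), hr⟩
  induction hl with
  | nil =>
    intro L r pre _ h hi
    refine hcongr h fun j => ?_
    by_cases hj : j = i
    · subst hj; simpa using hi
    · rw [Function.update_of_ne hj]
  | cons x _ ih =>
    intro L r pre _ h hi
    simpa using ih (pre := pre ++ [x]) (by simp) h (by simpa using hi)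
  | @pad l l' _ ih =>
    intro L r pre hpre h hi
    obtain ⟨pre', x, rfl⟩ := (List.eq_nil_or_concat pre).resolve_left hpre
    have h' := h.pad hv (i := i) (x := x) (t := l ++ pre') (hi.trans (by
      rw [List.concat_append]
      exact ⟨pre'.length, by rw [List.rotate_append_length_eq]; rfl⟩))
    have := ih (L := Function.update L i (x :: none :: (l ++ pre')))
      (pre := pre'.concat x ++ [none]) (by simp) h' (by
        rw [Function.update_self]
        refine List.IsRotated.symm ⟨pre'.length, ?_⟩
        rw [List.concat_eq_append, List.append_assoc, List.append_assoc,
          List.rotate_append_length_eq]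
        simp)
    simpa using this

/-- Each node of the word is followed by `M` unlabelled vertices. -/
def spreadWord (M : ℕ) (w : List ℕ) : List (Option ℕ) :=
  w.flatMap fun a => some a :: List.replicate M none

lemma pads_replicate_append {l l' : List (Option ℕ)} (h : Pads l l') (j : ℕ) :
    Pads l (List.replicate j none ++ l') := by
  induction j with
  | zero => exact h
  | succ j ih => exact ih.pad

/-- A list of labels with at most `M` entries becomes the spread list by padding. In the induction
`j` is the number of unlabelled vertices that are still to be inserted before the next node. -/
lemma pads_spreadWord {M : ℕ} : ∀ (m : List (Option ℕ)) (j : ℕ), m.length ≤ j → j ≤ M →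
    Pads m (List.replicate j none ++ spreadWord M (m.filterMap id))
  | [], j, _, _ => by simpa [spreadWord] using pads_replicate_append Pads.nil j
  | none :: m, 0, h, _ => by simp at h
  | none :: m, j + 1, h, hj => by
    have := (pads_spreadWord (M := M) m j (by simpa using h) (by omega)).cons none
    simpa [List.replicate_succ] using this
  | some a :: m, j, h, hj => by
    have := (pads_spreadWord (M := M) m M (by simp at h; omega) le_rfl).cons (some a)
    simpa [spreadWord] using pads_replicate_append this j

/-- The cyclic list of labels of a strand with the given cyclic sequence of nodes. -/
def standardList (M : ℕ) (w : List ℕ) : List (Option ℕ) :=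
  if w = [] then List.replicate (M + 1) none else spreadWord M w

/-- Rotating and padding brings the labels of a strand to the standard form, which depends only on
the cyclic sequence of its nodes. -/
lemma exists_pads_standardList {M : ℕ} {l : List (Option ℕ)} {w : List ℕ} (hl : l ≠ [])
    (hM : l.length ≤ M) (h : l.filterMap id ~r w) :
    ∃ x m m', l ~r x :: m ∧ Pads m m' ∧ standardList M w = x :: m' := by
  rcases w with _ | ⟨a, w⟩
  · have h0 := List.isRotated_nil_iff.1 h
    obtain ⟨x, m, rfl⟩ := List.exists_cons_of_ne_nil hl
    rcases x with _ | x
    · refine ⟨none, m, List.replicate M none, List.IsRotated.refl _, ?_, by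
        simp [standardList, List.replicate_succ]⟩
      have hm : m.filterMap id = [] := by simpa using h0
      have := pads_spreadWord (M := M) m M (by simp at hM; omega) le_rfl
      rwa [hm, spreadWord, List.flatMap_nil, List.append_nil] at this
    · simp at h0
  · -- cut the strand in front of the first node of the word
    obtain ⟨k, hk, hkw⟩ := List.isRotated_iff_mod.1 h
    have hsplit := (List.take_append_drop k (l.filterMap id)).symm
    rw [List.rotate_eq_drop_append_take hk] at hkw
    obtain ⟨l₁, l₂, hl12, h1, h2⟩ := List.filterMap_eq_append_iff.1 hsplit
    have h21 : (l₂ ++ l₁).filterMap id = a :: w := by rw [List.filterMap_append, h1, h2, hkw]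
    obtain ⟨p, x, q, hpq, hp, hx, hq⟩ := List.filterMap_eq_cons_iff.1 h21
    obtain rfl : x = some a := hx
    have hrot : l ~r some a :: (q ++ p) := by
      rw [hl12]
      refine List.isRotated_append.trans ?_
      rw [hpq]
      simpa using List.isRotated_append (l := p) (l' := some a :: q)
    refine ⟨some a, q ++ p, List.replicate M none ++ spreadWord M w, hrot, ?_, by
      simp [standardList, spreadWord]⟩
    have hw : (q ++ p).filterMap id = w := by
      rw [List.filterMap_append, hq, List.filterMap_eq_nil_iff.2 fun y hy => hp y hy,
        List.append_nil]
    rw [← hw]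
    refine pads_spreadWord _ M ?_ le_rfl
    have := hrot.perm.length_eq
    simp only [List.length_cons] at this
    omega

/-- The value of a graph is also taken on a graph in standard form, with `M` unlabelled vertices
behind each node; the strands are brought to this form one after the other. -/
lemma HasLabels.standardize (hv : IsVassilievInvariant v) {L : Fin n → List (Option ℕ)} {r : R}
    (h : HasLabels v L r) {M : ℕ} {w : Fin n → List ℕ} (hM : ∀ i, (L i).length ≤ M)
    (hw : ∀ i, (L i).filterMap id ~r w i) : HasLabels v (fun i => standardList M (w i)) r := by
  have hne : ∀ i, L i ≠ [] := by
    obtain ⟨T, lab, pos, hT, -, hL, -⟩ := h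
    intro i hi
    have := hL i
    rw [hi, List.isRotated_nil_iff, List.map_eq_nil_iff] at this
    exact hT.ne_nil i this
  suffices H : ∀ A : Finset (Fin n),
      HasLabels v (fun i => if i ∈ A then standardList M (w i) else L i) r by
    simpa using H Finset.univ
  intro A
  induction A using Finset.induction_on with
  | empty => simpa using h
  | insert i A hi ih =>
    obtain ⟨x, m, m', h1, h2, h3⟩ := exists_pads_standardList (hne i) (hM i) (hw i)
    have := ih.of_pads hv (i := i) h2 (pre := [x]) (by simp) (by simpa [hi] using h1)
    convert this using 1
    funext j
    by_cases hj : j = i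
    · subst hj; simp [h3]
    · simp [hj]

/-- The names of the vertices may be taken to be the standard ones. -/
lemma HasLabels.exists_standard_pos (hv : IsVassilievInvariant v) {L : Fin n → List (Option ℕ)}
    {r : R} (h : HasLabels v L r) :
    Shape (standardNames L) (standardLabel L) ∧ ∃ pos,
      Good (edgeSet (standardNames L)) (standardLabel L) pos ∧
      valueOf v (diagram (standardNames L) (standardLabel L) pos) = r := by
  obtain ⟨T, lab, pos, hT, hG, hL, rfl⟩ := h
  choose T' hTT' hT' using fun i => (hL i).exists_of_map
  have hrot : ∀ j, T' ((1 : Equiv.Perm (Fin n)) j) ~r T j := fun j => (hTT' j).symm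
  obtain ⟨H, hH⟩ := exists_embeddedGraph (hT.of_isRotated hrot) (edgeSet_eq_of_isRotated hrot ▸ hG)
  obtain ⟨hS, pos', hpos'⟩ := H.exists_standard_diagram (L := L) fun i => by
    rw [hH, diagram, List.map_map, ← hT' i]
    rfl
  refine ⟨hS, pos', good_of_embeddedGraph hS H hpos', ?_⟩
  rw [hv.valueOf_isRotated 1 1 hT hrot hG, relabel_one, ← hH, ← hpos']

lemma length_spreadWord_mod {K : ℕ} (w : List ℕ) : (spreadWord (4 * K + 3) w).length % 4 = 0 := by
  induction w with
  | nil => rfl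
  | cons a w ih =>
    simp only [spreadWord, List.flatMap_cons, List.length_append, List.length_cons,
      List.length_replicate] at ih ⊢
    omega

lemma mod_of_getElem_spreadWord {K a : ℕ} : ∀ (w : List ℕ) (j : ℕ),
    (spreadWord (4 * K + 3) w)[j]? = some (some a) → j % 4 = 0
  | [], j, h => by simp [spreadWord] at h
  | b :: w, j, h => by
    rw [spreadWord, List.flatMap_cons, List.getElem?_append] at h
    split_ifs at h with hj
    · rcases j with _ | j
      · rfl
      · rw [List.getElem?_cons_succ, List.getElem?_replicate] at h
        split_ifs at h
        simp at h
    · have := mod_of_getElem_spreadWord w _ h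
      simp only [List.length_cons, List.length_replicate] at this hj
      omega

/-- Along each strand the position modulo four increases by one with each edge, and it vanishes at
the labelled vertices. -/
lemma spread_standard {K : ℕ} (w : Fin n → List ℕ) :
    Spread (standardNames fun i => standardList (4 * K + 3) (w i))
      (standardLabel fun i => standardList (4 * K + 3) (w i)) := by
  set L := fun i => standardList (4 * K + 3) (w i) with hL
  have hlen : ∀ i, (L i).length % 4 = 0 := by
    intro i
    simp only [hL, standardList]
    split_ifs
    · rw [List.length_replicate]; omega
    · exact length_spreadWord_mod _
  have hlab : ∀ u, standardLabel L u ≠ none → u.2 % 4 = 0 := by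
    intro u hu
    obtain ⟨a, ha⟩ := Option.ne_none_iff_exists'.1 hu
    obtain ⟨i, -, h⟩ := standardLabel_eq_some.1 ha
    simp only [hL, standardList] at h
    split_ifs at h
    · rw [List.getElem?_replicate] at h
      split_ifs at h
      simp at h
    · exact mod_of_getElem_spreadWord _ _ h
  have hedge : ∀ x y, (x, y) ∈ edgeSet (standardNames L) → y.2 % 4 = (x.2 + 1) % 4 := by
    rintro x y ⟨i, h⟩
    obtain ⟨j, hj, h⟩ := List.mem_iff_getElem.1 h
    simp only [cyclicPairs, List.getElem_zip, List.getElem_rotate, standardNames,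
      List.getElem_map, List.getElem_range, List.length_map, List.length_range,
      Prod.mk.injEq] at h
    obtain ⟨rfl, rfl⟩ := h
    exact Nat.mod_mod_of_dvd _ (Nat.dvd_of_mod_eq_zero (hlen i))
  have hnone : ∀ u, u.2 % 4 ≠ 0 → standardLabel L u = none := fun u hu => by
    by_contra h
    exact hu (hlab u h)
  refine ⟨fun x y z h1 h2 h => ?_, fun b x h1 hb => hnone _ ?_, fun b x y h1 h2 hb => hnone _ ?_,
    fun b x y z h1 h2 h3 hb => hnone _ ?_⟩
  · have := hedge _ _ h1
    have := hedge _ _ h2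
    rw [h] at *
    omega
  · have := hedge _ _ h1
    have := hlab _ hb
    omega
  · have := hedge _ _ h1
    have := hedge _ _ h2
    have := hlab _ hb
    omega
  · have := hedge _ _ h1
    have := hedge _ _ h2
    have := hedge _ _ h3
    have := hlab _ hb
    omega

lemma exists_standardLabel_iff {M : ℕ} {w : Fin n → List ℕ} {a : ℕ} :
    (∃ u, standardLabel (fun i => standardList M (w i)) u = some a) ↔ ∃ i, a ∈ w i := by
  have hmem : ∀ i, some a ∈ standardList M (w i) ↔ a ∈ w i := by
    intro i
    unfold standardList
    split_ifs with h
    · simp [h]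
    · simp [spreadWord]
  constructor
  · rintro ⟨u, hu⟩
    obtain ⟨i, -, h⟩ := standardLabel_eq_some.1 hu
    exact ⟨i, (hmem i).1 (List.mem_of_getElem? h)⟩
  · rintro ⟨i, h⟩
    obtain ⟨j, hj⟩ := List.mem_iff_getElem?.1 ((hmem i).2 h)
    exact ⟨((i : ℕ), j), standardLabel_eq_some.2 ⟨i, rfl, hj⟩⟩

end NormalForm

theorem mainTheorem3 {n : ℕ} {R : Type*} [CommRing R] (k : ℕ) (v : EmbeddedGraph n → R)
    (hv : IsVassilievInvariant v) (hk : IsOfFiniteType k v)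
    (Γ : AbstractGraph n) (hΓ : Γ.nodes.card = k)
    (G G' : EmbeddedGraph n) (hG : G.IsEmbeddingOf Γ) (hG' : G'.IsEmbeddingOf Γ) :
    v G = v G' := by
  obtain ⟨σ, π, hσ⟩ := hG
  obtain ⟨σ', π', hσ'⟩ := hG'
  -- a common number of unlabelled vertices between nodes that suffices for both graphs
  obtain ⟨K, hK⟩ : ∃ K, ∀ i, (G.comp i).length ≤ K ∧ (G'.comp i).length ≤ K :=
    ⟨∑ i, ((G.comp i).length + (G'.comp i).length), fun i => by
      have := Finset.single_le_sum (f := fun i => (G.comp i).length + (G'.comp i).length)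
        (fun _ _ => Nat.zero_le _) (Finset.mem_univ i)
      omega⟩
  have hfilter : ∀ (l : List MarkedPoint) (σ : Equiv.Perm ℕ),
      ((l.map Prod.snd).map (Option.map σ)).filterMap id = (l.filterMap Prod.snd).map σ := by
    intro l σ
    rw [List.map_map, List.filterMap_map, List.map_filterMap]
    rfl
  have h := (G.hasLabels hv π σ).standardize hv (M := 4 * K + 3) (w := Γ.word)
    (fun i => by have := hK (π i); simp only [List.length_map]; omega)
    (fun i => by rw [hfilter]; exact hσ i)
  have h' := (G'.hasLabels hv π' σ').standardize hv (M := 4 * K + 3) (w := Γ.word)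
    (fun i => by have := hK (π' i); simp only [List.length_map]; omega)
    (fun i => by rw [hfilter]; exact hσ' i)
  obtain ⟨hT, pos, hgood, hval⟩ := h.exists_standard_pos hv
  obtain ⟨-, pos', hgood', hval'⟩ := h'.exists_standard_pos hv
  rw [← hval, ← hval']
  refine hv.valueOf_eq_of_spread hk ?_ hT (spread_standard _) hgood hgood'
  rw [← hΓ, ← Set.ncard_coe_finset]
  congr 1
  ext a
  simp only [Set.mem_ofPred_eq, exists_standardLabel_iff, AbstractGraph.nodes, List.coe_toFinset,
    List.mem_flatMap, List.mem_finRange, true_and]
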